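/- Let $k$ be a number field, $\mathcal B$ a quaternion algebra over $k$ (central simple of dimension $4$), and $v$ a finite place of $k$, possibly dyadic, such that $\mathcal B_v=\mathcal B\otimes_k k_v$ is a division algebra. Let $\mathcal O_v$ be the ring of integers of $k_v$, $q_v$ the order of its residue field, $|\cdot|_v$ the normalized absolute value, $N$ the reduced norm of $\mathcal B_v$, and $\mathcal O_{\mathcal B_v}$ the ring of elements of $\mathcal B_v$ integral over $\mathcal O_v$. Let $G_{k_v}=\mathcal B_v^\times\times(\mathcal B_v^{\rm op})^\times\times \mathrm{GL}(2)_{k_v}$ act on $V_{k_v}=\mathcal B_v\oplus\mathcal B_v$ by $(gx)(t)=g_{11}\,x(tg_2)\,g_{12}$, where $x(t)=t_1x_1+t_2x_2$ for $x=(x_1,x_2)$ and $t=(t_1,t_2)$. Let $F_x(t)=N(x(t))$, a binary quadratic form, let $P(x)$ be its discriminant, and let $k_v(x)$ be the splitting field of $F_x$ over $k_v$. Normalize the Haar measures $dg$ on $G_{k_v}$ and $dy$ on $V_{k_v}$ so that $\mathcal O_{\mathcal B_v}^\times\times\mathcal O_{\mathcal B_v}^\times\times \mathrm{GL}(2)_{\mathcal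 O_v}$ and $\mathcal O_{\mathcal B_v}\oplus\mathcal O_{\mathcal B_v}$ have volume $1$. Let $x=(1,u)$ with $u\in\mathcal B_v$ and $P(x)\neq 0$. Let $G_{x\,k_v}^\circ$ be the group of $k_v$-rational points of the identity component of the stabilizer $G_x$. For $s\in k_v[u]^\times$ let $g_s\in\mathrm{GL}(2)_{k_v}$ be the unique element with $g_s\,{}^t(s,su)={}^t(1,u)$; then $(s_1,s_2)\mapsto(s_1,s_2,g_{s_1s_2})$ is an isomorphism $(k_v[u]^\times)^2\to G_{x\,k_v}^\circ$. Let $dg''$ be the Haar measure on $G_{x\,k_v}^\circ$ that corresponds under it to the product measure, where $k_v[u]^\times$ has the Haar measure giving the unit group of the ring of integers of $k_v[u]$ volume $1$. Let $dg'$ be the left invariant measure on $G_{k_v}/G_{x\,k_v}^\circ$ with $dg=dg'\,dg''$. Then there is a unique constant $b_{x,v}>0$ such that $$\int_{G_{k_v}/G_{x\,k_v}^\circ}f(g'x)\,dg'=b_{x,v}\int_{G_{k_v}x}f(y)\,|P(y)|_v^{-2}\,dy$$ for every $f$ on the orbit $G_{k_v}x$ that is integrable with respect to $|P(y)|_v^{-2}dy$,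 and one puts $\varepsilon_v(x)=|P(x)|_v^2/b_{x,v}$. Suppose that $x=(1,u)$ is a standard orbital representative, that is, $P(x)\ne0$ and $\mathcal O_v[u]$ is the ring of integers of $k_v[u]$, and that $k_v(x)/k_v$ is a ramified quadratic extension. Let $\Delta_{k_v(x)/k_v}\subset\mathcal O_v$ be its relative discriminant and write $|\Delta_{k_v(x)/k_v}|_v=\#(\mathcal O_v/\Delta_{k_v(x)/k_v})$, so that $|\Delta_{k_v(x)/k_v}|_v=q_v^{\delta}$ if $\Delta_{k_v(x)/k_v}=\mathfrak p_v^{\delta}$. Then $$\varepsilon_v(x)=2^{-1}\,|\Delta_{k_v(x)/k_v}|_v^{-1}\,(1+q_v^{-1})\,(1-q_v^{-2})^2 .$$ -/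

import Mathlib

open MeasureTheory NumberField IsDedekindDomain
open scoped TensorProduct

noncomputable section

namespace PairQuat

/-! ### The space of pairs of quaternion algebras -/

section Algebra

set_option linter.unusedSectionVars false

variable (K : Type*) [Field K] (D : Type*) [Ring D] [Algebra K D]

/-- The group of rational points `G_K = D^× × (D^op)^× × GL(2)_K`. -/
def PairGroup : Type _ := Dˣ × (Dᵐᵒᵖ)ˣ × GL (Fin 2) K

instance : Group (PairGroup K D) := inferInstanceAs (Group (Dˣ × (Dᵐᵒᵖ)ˣ × GL (Fin 2) K))

instance [TopologicalSpace K] [TopologicalSpace D] : TopologicalSpace (PairGroup K D) :=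
  inferInstanceAs (TopologicalSpace (Dˣ × (Dᵐᵒᵖ)ˣ × GL (Fin 2) K))

instance [TopologicalSpace K] [TopologicalSpace D] : MeasurableSpace (PairGroup K D) :=
  borel _

instance [TopologicalSpace K] [TopologicalSpace D] : BorelSpace (PairGroup K D) := ⟨rfl⟩

/-- The vector space `V_K = D ⊗ K² = D ⊕ D` of pairs `x = (x 0, x 1)`. -/
def PairSpace (D : Type*) : Type _ := Fin 2 → D

instance : AddCommGroup (PairSpace D) := inferInstanceAs (AddCommGroup (Fin 2 → D))

instance {D : Type*} [TopologicalSpace D] : TopologicalSpace (PairSpace D) :=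
  inferInstanceAs (TopologicalSpace (Fin 2 → D))

instance {D : Type*} [TopologicalSpace D] : MeasurableSpace (PairSpace D) := borel _

instance {D : Type*} [TopologicalSpace D] : BorelSpace (PairSpace D) := ⟨rfl⟩

variable {K D}

namespace PairGroup

/-- The first component `g₁₁`, as an element of `D`. -/
def fst (g : PairGroup K D) : D := (g.1 : D)

/-- The second component `g₁₂`, as an element of `D`. -/
def snd (g : PairGroup K D) : D := (g.2.1 : Dᵐᵒᵖ).unop

/-- The third component `g₂`, as a matrix. -/
def mat (g : PairGroup K D) : Matrix (Fin 2) (Fin 2) K := (g.2.2 : Matrix (Fin 2) (Fin 2) K)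

@[simp] lemma fst_one : (1 : PairGroup K D).fst = 1 := rfl
@[simp] lemma snd_one : (1 : PairGroup K D).snd = 1 := rfl
@[simp] lemma mat_one : (1 : PairGroup K D).mat = 1 := rfl
@[simp] lemma fst_mul (g h : PairGroup K D) : (g * h).fst = g.fst * h.fst := rfl
@[simp] lemma snd_mul (g h : PairGroup K D) : (g * h).snd = h.snd * g.snd := rfl
@[simp] lemma mat_mul (g h : PairGroup K D) : (g * h).mat = g.mat * h.mat := rfl

end PairGroup

/-- The action `(g x)(v) = g₁₁ x(v g₂) g₁₂`, where `x(v) = v₁ x₁ + v₂ x₂`. -/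
instance : MulAction (PairGroup K D) (PairSpace D) where
  smul g x := fun i => ∑ j, g.mat i j • (g.fst * x j * g.snd)
  one_smul x := by
    funext i
    change ∑ j, (1 : Matrix (Fin 2) (Fin 2) K) i j • (1 * x j * 1) = x i
    fin_cases i <;> simp [Matrix.one_apply]
  mul_smul g h x := by
    funext i
    change ∑ j, (g.mat * h.mat) i j • (g.fst * h.fst * x j * (h.snd * g.snd)) =
      ∑ j, g.mat i j • (g.fst * (∑ l, h.mat j l • (h.fst * x l * h.snd)) * g.snd)
    simp only [Matrix.mul_apply, Fin.sum_univ_two, mul_add, add_mul, smul_add, add_smul,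
      mul_smul_comm, smul_mul_assoc, smul_smul, mul_assoc]
    abel

variable (K)

open Classical in
/-- The reduced norm of a quaternion algebra `D` over `K`: the reduced characteristic polynomial
of `a` is `(X - c)²` if `a = c` is a scalar, and the minimal polynomial of `a` otherwise. -/
def reducedNorm (a : D) : K :=
  if h : ∃ c : K, algebraMap K D c = a then h.choose ^ 2 else (minpoly K a).coeff 0

/-- The coefficients of the binary quadratic form
`F_x(v) = N(v₁ x₁ + v₂ x₂) = a₀ v₁² + a₁ v₁ v₂ + a₂ v₂²`. -/
def formCoeff (x : PairSpace D) : Fin 3 → K :=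
  ![reducedNorm K (x 0),
    reducedNorm K (x 0 + x 1) - reducedNorm K (x 0) - reducedNorm K (x 1),
    reducedNorm K (x 1)]

/-- The discriminant `P(x) = a₁² - 4 a₀ a₂` of `F_x`. -/
def disc (x : PairSpace D) : K :=
  formCoeff K x 1 ^ 2 - 4 * formCoeff K x 0 * formCoeff K x 2

/-- The polynomial `F_x(X, 1)`. -/
def formPoly (x : PairSpace D) : Polynomial K :=
  Polynomial.C (formCoeff K x 0) * Polynomial.X ^ 2 +
    Polynomial.C (formCoeff K x 1) * Polynomial.X + Polynomial.C (formCoeff K x 2)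

/-- The splitting field `K(x)` of `F_x`. -/
abbrev orbitField (x : PairSpace D) : Type _ := (formPoly K x).SplittingField

/-- The element `w_u = (1, u)` of `V_K`. -/
def pairOf (u : D) : PairSpace D := ![1, u]

end Algebra

/-! ### The identity component of the stabilizer

`G_x` is an algebraic group over `K`. The group of `K`-rational points of its identity component
consists of the `g ∈ G_K` whose image over an algebraic closure lies in the connected component
of `1` in the stabilizer, for the Zariski topology. -/

section Zariski

variable (F : Type*) [Field F]

/-- The polynomial functions on an `F`-vector space. -/
def polyFun (W : Type*) [AddCommGroup W] [Module F W] : Subalgebra F (W → F) :=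
  Algebra.adjoin F (Set.range fun l : Module.Dual F W => (l : W → F))

/-- The Zariski topology on the points of an `F`-vector space. -/
@[reducible] def zariskiTopology (W : Type*) [AddCommGroup W] [Module F W] : TopologicalSpace W :=
  TopologicalSpace.generateFrom {U | ∃ p ∈ polyFun F W, U = {w | p w ≠ 0}}

lemma continuous_zariski_of_linear {W : Type*} [AddCommGroup W] [Module F W] (L : W →ₗ[F] W) :
    @Continuous W W (zariskiTopology F W) (zariskiTopology F W) L := by
  let := zariskiTopology F W
  refine continuous_generateFrom_iff.2 ?_
  rintro _ ⟨p, hp, rfl⟩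
  refine TopologicalSpace.isOpen_generateFrom_of_mem ⟨fun w => p (L w), ?_, rfl⟩
  refine Algebra.adjoin_induction (p := fun q _ => (fun w => q (L w)) ∈ polyFun F W)
    ?_ ?_ ?_ ?_ hp
  · rintro _ ⟨l, rfl⟩
    exact Algebra.subset_adjoin ⟨l.comp L, rfl⟩
  · intro r
    exact (polyFun F W).algebraMap_mem r
  · intro f g _ _ hf hg
    exact (polyFun F W).add_mem hf hg
  · intro f g _ _ hf hg
    exact (polyFun F W).mul_mem hf hg

variable {F} {D : Type*} [Ring D] [Algebra F D]

/-- The embedding of `G_F` as a principal open subset of the affine space `D × D × M(2,2)`. -/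
def toAffine (g : PairGroup F D) : D × D × Matrix (Fin 2) (Fin 2) F := (g.fst, g.snd, g.mat)

variable (F D) in
/-- The Zariski topology on `G_F`. -/
@[reducible] def zariskiGroup : TopologicalSpace (PairGroup F D) :=
  TopologicalSpace.induced toAffine (zariskiTopology F (D × D × Matrix (Fin 2) (Fin 2) F))

lemma continuous_zariski_mul_left (a : PairGroup F D) :
    @Continuous _ _ (zariskiGroup F D) (zariskiGroup F D) (fun g => a * g) := by
  let t := zariskiTopology F (D × D × Matrix (Fin 2) (Fin 2) F)
  let := zariskiGroup F D
  refine continuous_induced_rng.2 ?_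
  let L : (D × D × Matrix (Fin 2) (Fin 2) F) →ₗ[F] (D × D × Matrix (Fin 2) (Fin 2) F) :=
    (LinearMap.mulLeft F a.fst).prodMap
      ((LinearMap.mulRight F a.snd).prodMap (LinearMap.mulLeft F a.mat))
  have h : (toAffine ∘ fun g => a * g) = L ∘ (toAffine : PairGroup F D → _) := by
    funext g
    rfl
  rw [h]
  exact (continuous_zariski_of_linear F L).comp continuous_induced_dom

/-- The connected component of `1` in the stabilizer of `x` in `G_F`, for the Zariski topology. -/
def zariskiComponent (x : PairSpace D) : Subgroup (PairGroup F D) :=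
  letI := zariskiGroup F D
  let S : Set (PairGroup F D) := MulAction.stabilizer (PairGroup F D) x
  have h1 : (1 : PairGroup F D) ∈ S := one_mem (MulAction.stabilizer (PairGroup F D) x)
  have hS : connectedComponentIn S 1 ⊆ S := connectedComponentIn_subset S 1
  have key : ∀ g ∈ connectedComponentIn S 1, ∀ h ∈ connectedComponentIn S 1,
      g⁻¹ * h ∈ connectedComponentIn S 1 := by
    intro g hg h hh
    have hsub : (fun a => g⁻¹ * a) '' connectedComponentIn S 1 ⊆ connectedComponentIn S 1 := by
      refine IsPreconnected.subset_connectedComponentIn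
        (isPreconnected_connectedComponentIn.image _
          (continuous_zariski_mul_left g⁻¹).continuousOn)
        ⟨g, hg, inv_mul_cancel g⟩ ?_
      rintro _ ⟨a, ha, rfl⟩
      exact mul_mem (inv_mem (show g ∈ MulAction.stabilizer (PairGroup F D) x from hS hg))
        (show a ∈ MulAction.stabilizer (PairGroup F D) x from hS ha)
    exact hsub ⟨h, hh, rfl⟩
  have hone : (1 : PairGroup F D) ∈ connectedComponentIn S 1 := mem_connectedComponentIn h1
  have hinv : ∀ g ∈ connectedComponentIn S 1, g⁻¹ ∈ connectedComponentIn S 1 := fun g hg => by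
    simpa using key g hg 1 hone
  { carrier := connectedComponentIn S 1
    one_mem' := hone
    inv_mem' := fun {g} hg => hinv g hg
    mul_mem' := fun {g h} hg hh => by simpa using key g⁻¹ (hinv g hg) h hh }

end Zariski

section Component

variable (K : Type*) [Field K] {D : Type*} [Ring D] [Algebra K D]

variable (D) in
/-- Extension of scalars `G_K → G_F` to an algebraic closure `F` of `K`. -/
def groupBaseChange :
    PairGroup K D →* PairGroup (AlgebraicClosure K) (AlgebraicClosure K ⊗[K] D) :=
  let ι : D →* AlgebraicClosure K ⊗[K] D :=
    (Algebra.TensorProduct.includeRight : D →ₐ[K] AlgebraicClosure K ⊗[K] D)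
  MonoidHom.prodMap (Units.map ι)
    (MonoidHom.prodMap (Units.map (MonoidHom.op ι))
      (Matrix.GeneralLinearGroup.map (algebraMap K (AlgebraicClosure K))))

/-- Extension of scalars `V_K → V_F` to an algebraic closure `F` of `K`. -/
def spaceBaseChange (x : PairSpace D) : PairSpace (AlgebraicClosure K ⊗[K] D) :=
  fun i => 1 ⊗ₜ[K] x i

/-- The group of rational points `G_{x K}°` of the identity component of the stabilizer `G_x`. -/
def stabComponent (x : PairSpace D) : Subgroup (PairGroup K D) :=
  (zariskiComponent (F := AlgebraicClosure K) (spaceBaseChange K x)).comap (groupBaseChange K D)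

end Component

/-! ### Invariant measures -/

section Measures

/-- The (regular) Haar measure on a locally compact group for which `A` has volume `1`. -/
def haarOf {G : Type*} [Group G] [TopologicalSpace G] [MeasurableSpace G] (A : Set G) :
    Measure G :=
  Classical.epsilon fun μ : Measure G => μ.IsHaarMeasure ∧ μ.Regular ∧ μ A = 1

/-- The (regular) additive Haar measure on a locally compact group for which `A` has
volume `1`. -/
def addHaarOf {V : Type*} [AddGroup V] [TopologicalSpace V] [MeasurableSpace V] (A : Set V) :
    Measure V :=
  Classical.epsilon fun μ : Measure V => μ.IsAddHaarMeasure ∧ μ.Regular ∧ μ A = 1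

variable (O : Type*) [CommRing O] (K : Type*) [NormedField K] [Algebra O K]
  (D : Type*) [Ring D] [Algebra K D] [Algebra O D] [TopologicalSpace D]

/-- The compact open subgroup `V_O = O_D ⊕ O_D`, where `O_D` is the ring of elements of `D` that
are integral over `O`. -/
def integralPairs : Set (PairSpace D) := {x | ∀ i, IsIntegral O (x i)}

/-- The compact open subgroup `𝒦 = O_D^× × O_D^× × GL(2)_O` of `G_K`. -/
def integralGroup : Set (PairGroup K D) :=
  {g | IsIntegral O g.fst ∧ IsIntegral O g⁻¹.fst ∧ IsIntegral O g.snd ∧ IsIntegral O g⁻¹.snd ∧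
    ∀ i j, g.mat i j ∈ (algebraMap O K).range ∧ g⁻¹.mat i j ∈ (algebraMap O K).range}

/-- The measure `dx` on `V_K`. -/
def spaceMeasure : Measure (PairSpace D) := addHaarOf (integralPairs O D)

/-- The measure `dg` on `G_K`. -/
def groupMeasure : Measure (PairGroup K D) := haarOf (integralGroup O K D)

variable {D}

/-- The group `K[u]^×`. -/
def QuadUnits (u : D) : Type _ := (Algebra.adjoin K ({u} : Set D))ˣ

instance (u : D) : Group (QuadUnits K u) :=
  inferInstanceAs (Group (Algebra.adjoin K ({u} : Set D))ˣ)

instance (u : D) : TopologicalSpace (QuadUnits K u) :=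
  inferInstanceAs (TopologicalSpace (Algebra.adjoin K ({u} : Set D))ˣ)

instance (u : D) : MeasurableSpace (QuadUnits K u) := borel _

instance (u : D) : BorelSpace (QuadUnits K u) := ⟨rfl⟩

variable {K}

/-- The inclusion `K[u]^× → D^×`. -/
def QuadUnits.toUnits {u : D} : QuadUnits K u →* Dˣ :=
  Units.map ((Algebra.adjoin K ({u} : Set D)).val : _ →* D)

variable (K)

/-- The measure on `K[u]^×` for which the unit group of the ring of integers of `K[u]` has
volume `1`. -/
def quadMeasure (u : D) : Measure (QuadUnits K u) :=
  haarOf {s | IsIntegral O (s.toUnits : D) ∧ IsIntegral O ((s.toUnits⁻¹ : Dˣ) : D)}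

/-- The unique element `g_s` of `GL(2)_K` with `g_s ᵗ(s, s u) = ᵗ(1, u)`, for `s ∈ K[u]^×`. -/
def quadMatrix (u s : D) : GL (Fin 2) K :=
  Classical.epsilon fun g : GL (Fin 2) K =>
    g 0 0 • s + g 0 1 • (s * u) = 1 ∧ g 1 0 • s + g 1 1 • (s * u) = u

/-- The map `ψ_u : (s₁, s₂) ↦ (s₁, s₂, g_{s₁ s₂})`, an isomorphism of `(K[u]^×)²` onto the
rational points of the identity component of the stabilizer of `w_u = (1, u)`. -/
def quadEmbed (u : D) (s : QuadUnits K u × QuadUnits K u) : PairGroup K D :=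
  (s.1.toUnits, Units.opEquiv.symm (MulOpposite.op s.2.toUnits),
    quadMatrix K u ((s.1 * s.2).toUnits : D))

/-- The measure `dg''` on `G_{x K}°` for `x = w_u`: the product measure on `(K[u]^×)²`
transported by `ψ_u`. -/
def stabMeasure (u : D) : Measure (stabComponent K (pairOf u)) :=
  (((quadMeasure O K u).prod (quadMeasure O K u)).map (quadEmbed K u)).comap Subtype.val

/-- `μ` is the left invariant (Radon) measure `dg'` on `G_K / G_{x K}°`, `x = w_u`, such that
`dg = dg' dg''`. -/
structure IsQuotientMeasure (u : D)
    (μ : Measure (PairGroup K D ⧸ stabComponent K (pairOf u))) : Prop where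
  regular : μ.Regular
  invariant : SMulInvariantMeasure (PairGroup K D) _ μ
  integral_eq : ∀ φ : PairGroup K D → ℝ, Continuous φ → HasCompactSupport φ →
    ∫ g, φ g ∂(groupMeasure O K D) =
      ∫ q, (∫ h : stabComponent K (pairOf u), φ (q.out * (h : PairGroup K D))
        ∂(stabMeasure O K u)) ∂μ

/-- `b` is the constant `b_x`, `x = w_u`: it is positive and
`∫_{G_K / G_{x K}°} f(g' x) dg' = b ∫_{G_K x} f(y) |P(y)|^{-2} dy`
for every `f` on the orbit `G_K x` that is integrable with respect to `|P(y)|^{-2} dy`. -/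
structure IsOrbitConstant (u : D) (b : ℝ) : Prop where
  pos : 0 < b
  integral_eq : ∃ μ : Measure (PairGroup K D ⧸ stabComponent K (pairOf u)),
    IsQuotientMeasure O K u μ ∧
    ∀ f : PairSpace D → ℂ,
      IntegrableOn (fun y => (‖disc K y‖ ^ 2)⁻¹ • f y)
        (MulAction.orbit (PairGroup K D) (pairOf u)) (spaceMeasure O D) →
      Integrable (fun q => f (q.out • pairOf u)) μ ∧
      ∫ q, f (q.out • pairOf u) ∂μ =
        b * ∫ y in MulAction.orbit (PairGroup K D) (pairOf u),
          (‖disc K y‖ ^ 2)⁻¹ • f y ∂(spaceMeasure O D)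

/-- The constant `b_x` for `x = w_u`. -/
def orbitConstant (u : D) : ℝ := Classical.epsilon (IsOrbitConstant O K u)

/-- The local density `ε(x) = |P(x)|² / b_x` for `x = w_u`. -/
def localDensity (u : D) : ℝ := ‖disc K (pairOf u)‖ ^ 2 / orbitConstant O K u

end Measures

/-! ### Standard representatives, ramification, discriminants -/

section Arithmetic

variable (O : Type*) [CommRing O] (K : Type*) [Field K] [Algebra O K]

/-- `x = w_u` is a standard orbital representative: it is semi-stable and `u` generates the ring
of integers of `K[u]` over `O`. -/
structure IsStandard {D : Type*} [Ring D] [Algebra K D] [Algebra O D] (u : D) : Prop where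
  semistable : disc K (pairOf u) ≠ 0
  generates : {a : D | a ∈ Algebra.adjoin K ({u} : Set D) ∧ IsIntegral O a} =
    (Algebra.adjoin O ({u} : Set D) : Set D)

variable (L : Type*) [Field L] [Algebra K L] [Algebra O L]

/-- `L / K` is a ramified quadratic extension (of local fields, `O` being the valuation ring of
`K`): the maximal ideal of `O` does not generate a prime ideal of the ring of integers of `L`. -/
structure IsRamifiedQuadratic [IsLocalRing O] : Prop where
  finrank_eq : Module.finrank K L = 2
  ramified : ¬ ((IsLocalRing.maximalIdeal O).map
    (algebraMap O (integralClosure O L))).IsPrime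

/-- The relative discriminant of `L / K`, an ideal of `O`: it is generated by the discriminants
of the bases of `L / K` that consist of integral elements. -/
def relDiscr : Ideal O :=
  Ideal.span {d | ∃ b : Module.Basis (Fin (Module.finrank K L)) K L,
    (∀ i, IsIntegral O (b i)) ∧ algebraMap O K d = Algebra.discr K b}

end Arithmetic

end PairQuat

end

/-! Write `K` for `k_v`, `D` for the quaternion division algebra, `L = K[u]`, `t = q⁻¹`, `U₀` for
the compact open subgroup `O_D^× × O_D^× × GL(2)_O`, `H` for the identity component of the
stabilizer of `x = (1, u)`, `λ` for its measure `dg''`, and `ν` for `|P(y)|⁻² dy` on the orbit.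

An element `g` scales `dy` by `|N(g₁₁) N(g₁₂) det g₂|⁴` (`distribHaarChar_pair`) and `P` by the
square of `N(g₁₁) N(g₁₂) det g₂` (`NormConj.disc_smul`), so `ν` is invariant
(`measurePreserving_orbitMeasure`). The torus `H` is `(L^×)²` (`mem_stabComponent_iff`), of index
two in the rational points of the stabilizer. The other coset consists of elements that conjugate
`u` to `ū`. Because `L/K` is ramified, it has a representative `τ` in `U₀`
(`exists_halfStabilizer`). Hence `G/H` covers the orbit two to one.

Pull `ν` back to `G/H` by summing over the two points of each fibre, and spread every point over its
coset by `λ`. The result is a left Haar measure on `G` whose value at `U₀` is `2 ν(U₀ x)`, so it is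
`2 ν(U₀ x) dg` (`liftMeasure_eq`). Dividing by this constant gives `dg'`, whose image on the orbit
is `ν / ν(U₀ x)`. Therefore `b_x = ν(U₀ x)⁻¹`, and integrating the indicator function of `U₀ x`
shows that no other constant is possible.

To compute `ν(U₀ x)`, evaluate the same Haar measure at the congruence subgroup `U_n` of level `ϖⁿ`.
For large `n` it misses `τ H`, and `measure_orbit_mul` reads `λ(H ∩ U_n) ν(U_n x) = 2 ν(U₀ x)
dg(U_n)`. Three volumes remain. First, `dg(U_n) = t^(12n) / ((1 - t²)³ (1 - t))`
(`measure_congruenceSubgroup`). Second, `λ(H ∩ U_n) = (t^(2n) / (1 - t))²`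
(`stabMeasure_congruenceSubgroup`, `measure_quadCongruence`). Third, `U_n x` is a translate of an
explicit lattice: the action is linearized at `x`, and the quadratic error is removed by successive
approximation (`orbit_congruenceSubgroup`). The lattice has volume `t^(8n) |P(x)|`
(`measure_orbitLattice`). The factor `|P(x)|` comes from `δ = u - ū`: writing `O_D = O_L ⊕ O_L w`
with `[u, w]` as large as possible, the tangent directions only reach `O_L ⊕ δ O_L w` in one of the
two coordinates, and `|N(δ)| = |P(x)|`.

Solving gives `ν(U₀ x) = 2⁻¹ |P(x)|⁻¹ (1 + t)(1 - t²)²`. Finally, standardness makes `P(x)` a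
generator of the relative discriminant (`relDiscr_orbitField`). Dyadic places need no separate
treatment, because the generator `u` is kept throughout and no square is completed. -/

noncomputable section

namespace PairQuat

/-! ### The canonical involution of a quaternion algebra -/

section NormConj

/-- The canonical involution of a quaternion algebra, with its reduced trace. -/
structure NormConj (K D : Type*) [Field K] [Ring D] [Algebra K D] where
  conj : D →ₗ[K] D
  tr : D → K
  conj_mul : ∀ a b, conj (a * b) = conj b * conj a
  conj_conj : ∀ a, conj (conj a) = a
  add_conj : ∀ a, a + conj a = algebraMap K D (tr a)
  mul_conj : ∀ a, a * conj a = algebraMap K D (reducedNorm K a)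

variable {K D : Type*} [Field K] [Ring D] [Algebra K D]

theorem reducedNorm_algebraMap [Nontrivial D] (c : K) :
    reducedNorm K (algebraMap K D c) = c ^ 2 := by
  have h : ∃ c' : K, algebraMap K D c' = algebraMap K D c := ⟨c, rfl⟩
  rw [reducedNorm, dif_pos h, (algebraMap K D).injective h.choose_spec]

/-- The minimal polynomial of a non-scalar has degree at least two, so an annihilating monic
quadratic is the minimal polynomial and the norm is its constant coefficient. -/
theorem reducedNorm_eq_of_quadratic [Nontrivial D] {a : D} (ha : a ∉ (algebraMap K D).range)
    {t n : K} (h : a * a = t • a - algebraMap K D n) : reducedNorm K a = n := by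
  have h' : ¬ ∃ c : K, algebraMap K D c = a := fun ⟨c, hc⟩ => ha ⟨c, hc⟩
  rw [reducedNorm, dif_neg h']
  have hp : (Polynomial.X ^ 2 - Polynomial.C t * Polynomial.X + Polynomial.C n).natDegree = 2 := by
    compute_degree!
  have hm : (Polynomial.X ^ 2 - Polynomial.C t * Polynomial.X + Polynomial.C n).Monic := by
    monicity!
  have hr : Polynomial.aeval a
      (Polynomial.X ^ 2 - Polynomial.C t * Polynomial.X + Polynomial.C n) = 0 := by
    simp [pow_two, h, Algebra.smul_def]
  have hint : IsIntegral K a := ⟨_, hm, hr⟩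
  have h2 : 2 ≤ (minpoly K a).natDegree := (minpoly.two_le_natDegree_iff hint).2 ha
  have heq : minpoly K a = Polynomial.X ^ 2 - Polynomial.C t * Polynomial.X + Polynomial.C n := by
    refine (Polynomial.eq_of_monic_of_dvd_of_natDegree_le (minpoly.monic hint) hm
      (minpoly.dvd K a hr) ?_).symm
    omega
  rw [heq]
  simp

/-- A pair `(u, τ)` of elements with `u² = a u - b`, `τ u = (a - u) τ`, `τ² = β` whose products
form a basis defines the canonical involution. -/
theorem nonempty_normConj_of_basis [Nontrivial D] {a b β : K} (B : QuaternionAlgebra.Basis D (-b) a β)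
    (hB : Function.Bijective B.liftHom) : Nonempty (NormConj K D) := by
  let e : QuaternionAlgebra K (-b) a β ≃ₐ[K] D := AlgEquiv.ofBijective B.liftHom hB
  have hcoe : ∀ c : K, e (c : QuaternionAlgebra K (-b) a β) = algebraMap K D c := fun c =>
    e.commutes c
  let cj : D → D := fun d => e (star (e.symm d))
  have hadd : ∀ d, d + cj d = algebraMap K D (2 * (e.symm d).re + a * (e.symm d).imI) := by
    intro d
    rw [← hcoe, ← QuaternionAlgebra.self_add_star', map_add, e.apply_symm_apply]
  have hmul : ∀ d, d * cj d = algebraMap K D (e.symm d * star (e.symm d)).re := by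
    intro d
    rw [← hcoe, ← QuaternionAlgebra.mul_star_eq_coe, map_mul, e.apply_symm_apply]
  refine ⟨⟨⟨⟨cj, fun x y => by simp [cj]⟩, fun c x => ?_⟩,
    fun d => 2 * (e.symm d).re + a * (e.symm d).imI, fun x y => by simp [cj],
    fun x => by simp [cj], hadd, fun d => ?_⟩⟩
  · change e (star (e.symm (c • x))) = c • e (star (e.symm x))
    rw [map_smul e.symm, ← map_smul e]
    congr 1
    ext <;> simp only [QuaternionAlgebra.re_star, QuaternionAlgebra.imI_star,
      QuaternionAlgebra.imJ_star, QuaternionAlgebra.imK_star, QuaternionAlgebra.re_smul,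
      QuaternionAlgebra.imI_smul, QuaternionAlgebra.imJ_smul, QuaternionAlgebra.imK_smul,
      smul_eq_mul] <;> ring
  · change d * cj d = _
    rw [hmul]
    by_cases hd : d ∈ (algebraMap K D).range
    · obtain ⟨c, rfl⟩ := hd
      rw [reducedNorm_algebraMap]
      congr 1
      rw [← hcoe, e.symm_apply_apply]
      simp [pow_two]
    · congr 1
      refine (reducedNorm_eq_of_quadratic hd
        (t := 2 * (e.symm d).re + a * (e.symm d).imI) ?_).symm
      rw [← hmul, Algebra.smul_def, ← hadd]
      -- The sum `d + cj d` is a scalar, so the two summands commute; this is what turns the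
      -- formulas for trace and norm into the quadratic equation of `d`.
      have hc : Commute d (cj d) := by
        have : cj d = algebraMap K D (2 * (e.symm d).re + a * (e.symm d).imI) - d := by
          rw [← hadd]; abel
        rw [this]
        exact Commute.sub_right (Algebra.commutes _ _).symm (Commute.refl d)
      rw [add_mul, hc.eq, add_sub_cancel_right]

end NormConj

/-! ### Cyclic presentation of a quaternion division algebra -/

section Structure

variable {K D : Type*} [Field K] [Ring D] [Algebra K D]

/-- An element of a quaternion division algebra which is not a scalar is quadratic. -/
theorem exists_quadratic [Algebra.IsCentral K D] (hfin : Module.finrank K D = 4)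
    (hdiv : ∀ a : D, a ≠ 0 → IsUnit a) {u : D} (hu : u ∉ (algebraMap K D).range) :
    ∃ a b : K, u * u = a • u - algebraMap K D b := by
  have hft : FiniteDimensional K D := Module.finite_of_finrank_pos (by omega)
  have : Nontrivial D := Module.nontrivial_of_finrank_pos (R := K) (by omega)
  have : NoZeroDivisors D := ⟨fun {x y} h => by
    by_contra! hc
    exact hc.2 (((hdiv x hc.1).mul_right_eq_zero).1 h)⟩
  have : IsDomain D := NoZeroDivisors.to_isDomain D
  let L := Algebra.adjoin K ({u} : Set D)
  have huL : u ∈ L := Algebra.self_mem_adjoin_singleton K u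
  -- As a finite-dimensional domain `K[u]` is a division ring, so `D` is free over it and the
  -- dimensions multiply.
  have hdvd : Module.finrank K L ∣ 4 := by
    let : DivisionRing L := divisionRingOfFiniteDimensional K L
    exact ⟨_, hfin.symm.trans (Module.finrank_mul_finrank K L D).symm⟩
  -- If `u` generated `D`, it would commute with everything and be a scalar.
  have hlt : Module.finrank K L ≠ 4 := by
    intro h4
    have htop : L = ⊤ := by
      have : Subalgebra.toSubmodule L = ⊤ :=
        Submodule.eq_top_of_finrank_eq (by rw [hfin]; exact h4)
      exact Algebra.toSubmodule_eq_top.1 this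
    have hcen : u ∈ Subalgebra.center K D := by
      rw [Subalgebra.mem_center_iff]
      intro d
      have hd : d ∈ Algebra.adjoin K ({u} : Set D) := by
        change d ∈ L
        rw [htop]; trivial
      exact Algebra.commute_of_mem_adjoin_self hd |>.eq.symm
    obtain ⟨c, hc⟩ := (Algebra.IsCentral.mem_center_iff K).1 hcen
    exact hu ⟨c, hc.symm⟩
  have hle : Module.finrank K L ≤ 2 := by
    have := Nat.le_of_dvd (by norm_num) hdvd
    interval_cases h : Module.finrank K L <;> omega
  have hli : ¬ LinearIndependent K ![(1 : L), ⟨u, huL⟩, ⟨u, huL⟩ * ⟨u, huL⟩] := by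
    intro h
    have := h.fintype_card_le_finrank
    simp at this
    omega
  rw [Fintype.not_linearIndependent_iff] at hli
  obtain ⟨g, hg, hne⟩ := hli
  simp only [Fin.sum_univ_three, Matrix.cons_val_zero, Matrix.cons_val_one,
    Matrix.cons_val] at hg
  have hg' : g 0 • (1 : D) + g 1 • u + g 2 • (u * u) = 0 := by
    have h := congrArg L.val hg
    simp only [map_add, map_smul, map_mul, map_one, map_zero] at h
    exact h
  have hu0 : ∀ c d : K, c • (1 : D) + d • u = 0 → c = 0 ∧ d = 0 := by
    intro c d hcd
    have hd : d = 0 := by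
      by_contra hd
      refine hu ⟨-(d⁻¹ * c), ?_⟩
      have : u = d⁻¹ • (d • u) := by rw [smul_smul, inv_mul_cancel₀ hd, one_smul]
      rw [this, eq_neg_of_add_eq_zero_right hcd, Algebra.algebraMap_eq_smul_one, smul_neg,
        smul_smul, neg_smul]
    subst hd
    simpa using hcd
  have h2 : g 2 ≠ 0 := by
    intro h2
    rw [h2, zero_smul, add_zero] at hg'
    obtain ⟨h0, h1⟩ := hu0 _ _ hg'
    obtain ⟨i, hi⟩ := hne
    fin_cases i
    exacts [hi h0, hi h1, hi h2]
  refine ⟨-((g 2)⁻¹ * g 1), (g 2)⁻¹ * g 0, ?_⟩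
  have : u * u = (g 2)⁻¹ • (g 2 • (u * u)) := by rw [smul_smul, inv_mul_cancel₀ h2, one_smul]
  rw [this, eq_neg_of_add_eq_zero_right hg', Algebra.algebraMap_eq_smul_one]
  simp only [smul_neg, smul_add, smul_smul, neg_smul]
  abel

/-- Coordinates with respect to `1, u, τ, uτ`. -/
def cyclicMap (K : Type*) {D : Type*} [Field K] [Ring D] [Algebra K D] (u τ : D) :
    (Fin 4 → K) →ₗ[K] D :=
  Fintype.linearCombination K ![1, u, τ, u * τ]

theorem cyclicMap_apply (u τ : D) (c : Fin 4 → K) :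
    cyclicMap K u τ c = (c 0 • 1 + c 1 • u) + (c 2 • 1 + c 3 • u) * τ := by
  simp only [cyclicMap, Fintype.linearCombination_apply, Fin.sum_univ_four, Matrix.cons_val_zero,
    Matrix.cons_val_one, Matrix.cons_val, add_mul, smul_mul_assoc, one_mul]
  abel

theorem noZeroDivisors_of_isUnit (hdiv : ∀ a : D, a ≠ 0 → IsUnit a) : NoZeroDivisors D :=
  ⟨fun {x y} h => by
    by_contra! hc
    exact hc.2 (((hdiv x hc.1).mul_right_eq_zero).1 h)⟩

theorem smul_one_add_smul_eq_zero [Nontrivial D] {u : D} (hu : u ∉ (algebraMap K D).range)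
    {c d : K} (hcd : c • (1 : D) + d • u = 0) : c = 0 ∧ d = 0 := by
  have hd : d = 0 := by
    by_contra hd
    refine hu ⟨-(d⁻¹ * c), ?_⟩
    have : u = d⁻¹ • (d • u) := by rw [smul_smul, inv_mul_cancel₀ hd, one_smul]
    rw [this, eq_neg_of_add_eq_zero_right hcd, Algebra.algebraMap_eq_smul_one, smul_neg,
      smul_smul, neg_smul]
  subst hd
  simpa using hcd

theorem smul_one_sub_two_ne_zero [CharZero K] [Nontrivial D] {u : D}
    (hu : u ∉ (algebraMap K D).range) (a : K) : a • (1 : D) - u - u ≠ 0 := by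
  intro h
  have := (smul_one_add_smul_eq_zero hu (c := a) (d := -2) (by
    rw [← h, neg_smul, two_smul]; abel)).2
  norm_num at this

section Cyclic

variable [CharZero K] [Nontrivial D] [NoZeroDivisors D] {u τ : D} {a : K}

/-- The commutator with `u` multiplies the `τ`-part by `a - 2u` up to sign. This factor is nonzero
because `u` is not a scalar and the characteristic is zero, and there are no zero divisors. -/
theorem cyclicMap_commute (hu : u ∉ (algebraMap K D).range) (hτ : τ ≠ 0)
    (hτu : τ * u = (a • 1 - u) * τ) {c : Fin 4 → K}
    (h : cyclicMap K u τ c * u = u * cyclicMap K u τ c) : c 2 = 0 ∧ c 3 = 0 := by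
  have hc : (c 2 • 1 + c 3 • u) * u = u * (c 2 • 1 + c 3 • u) := by
    simp [add_mul, mul_add]
  have key : (c 2 • 1 + c 3 • u) * ((a • 1 - u - u) * τ) = 0 := by
    rw [cyclicMap_apply, add_mul, mul_add, mul_assoc _ τ, hτu, ← mul_assoc u, ← hc] at h
    have h1 : (c 0 • 1 + c 1 • u) * u = u * (c 0 • 1 + c 1 • u) := by simp [add_mul, mul_add]
    rw [h1, add_right_inj, mul_assoc _ u τ] at h
    rw [sub_mul _ u τ, mul_sub, h, sub_self]
  rcases mul_eq_zero.1 key with h | h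
  · exact smul_one_add_smul_eq_zero hu h
  · rcases mul_eq_zero.1 h with h | h
    · exact absurd h (smul_one_sub_two_ne_zero hu a)
    · exact absurd h hτ

theorem cyclicMap_injective (hu : u ∉ (algebraMap K D).range) (hτ : τ ≠ 0)
    (hτu : τ * u = (a • 1 - u) * τ) : Function.Injective (cyclicMap K u τ) := by
  rw [← LinearMap.ker_eq_bot, LinearMap.ker_eq_bot']
  intro c hc
  obtain ⟨h2, h3⟩ := cyclicMap_commute hu hτ hτu (c := c) (by rw [hc]; simp)
  rw [cyclicMap_apply, h2, h3] at hc
  obtain ⟨h0, h1⟩ := smul_one_add_smul_eq_zero hu (by simpa using hc)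
  ext i
  fin_cases i
  exacts [h0, h1, h2, h3]

theorem cyclicMap_surjective (hfin : Module.finrank K D = 4) (hu : u ∉ (algebraMap K D).range)
    (hτ : τ ≠ 0) (hτu : τ * u = (a • 1 - u) * τ) : Function.Surjective (cyclicMap K u τ) := by
  have : FiniteDimensional K D := Module.finite_of_finrank_pos (by omega)
  exact (LinearMap.injective_iff_surjective_of_finrank_eq_finrank (by simp [hfin])).1
    (cyclicMap_injective hu hτ hτu)

theorem exists_centralizer (hfin : Module.finrank K D = 4) (hu : u ∉ (algebraMap K D).range)
    (hτ : τ ≠ 0) (hτu : τ * u = (a • 1 - u) * τ) {d : D} (hd : d * u = u * d) :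
    ∃ c₀ c₁ : K, d = c₀ • 1 + c₁ • u := by
  obtain ⟨c, rfl⟩ := cyclicMap_surjective hfin hu hτ hτu d
  obtain ⟨h2, h3⟩ := cyclicMap_commute hu hτ hτu hd
  exact ⟨c 0, c 1, by rw [cyclicMap_apply, h2, h3]; simp⟩

/-- The square of `τ` commutes with `u`, hence lies in `K[u]`; it also commutes with `τ`, which acts
on `K[u]` by the nontrivial conjugation, so its coefficient at `u` vanishes. -/
theorem exists_sq_eq (hfin : Module.finrank K D = 4) (hu : u ∉ (algebraMap K D).range)
    (hτ : τ ≠ 0) (hτu : τ * u = (a • 1 - u) * τ) : ∃ β : K, τ * τ = β • 1 := by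
  have h1 : τ * τ * u = u * (τ * τ) := by
    have : τ * (a • 1 - u) = u * τ := by
      rw [mul_sub, hτu, sub_mul]; simp
    rw [mul_assoc, hτu, ← mul_assoc, this, mul_assoc]
  obtain ⟨c₀, c₁, hc⟩ := exists_centralizer hfin hu hτ hτu h1
  have h2 : c₁ • ((a • 1 - u - u) * τ) = 0 := by
    have h3 : τ * (c₀ • 1 + c₁ • u) = (c₀ • 1 + c₁ • u) * τ := by rw [← hc, mul_assoc]
    simp only [mul_add, add_mul, mul_smul_comm, smul_mul_assoc, mul_one, one_mul] at h3
    rw [add_right_inj, hτu] at h3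
    rw [sub_mul _ u τ, smul_sub, h3, sub_self]
  rcases smul_eq_zero.1 h2 with h | h
  · exact ⟨c₀, by rw [hc, h]; simp⟩
  · rcases mul_eq_zero.1 h with h | h
    · exact absurd h (smul_one_sub_two_ne_zero hu a)
    · exact absurd h hτ

end Cyclic

/-- Every commutator `d u - u d` satisfies the twisted relation, by the quadratic equation of `u`.
Since `D` is central and `u` is not a scalar, some commutator is nonzero. -/
theorem exists_conj_intertwiner [Algebra.IsCentral K D] {u : D}
    (hu : u ∉ (algebraMap K D).range) {a b : K} (h : u * u = a • u - algebraMap K D b) :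
    ∃ τ : D, τ ≠ 0 ∧ τ * u = (a • 1 - u) * τ := by
  have hnc : ∃ d : D, d * u ≠ u * d := by
    by_contra! hc
    obtain ⟨c, hc⟩ := (Algebra.IsCentral.mem_center_iff K).1
      (Subalgebra.mem_center_iff.2 hc : u ∈ Subalgebra.center K D)
    exact hu ⟨c, hc.symm⟩
  obtain ⟨d, hd⟩ := hnc
  refine ⟨d * u - u * d, sub_ne_zero.2 hd, ?_⟩
  have e1 : d * u * u = a • (d * u) - b • d := by
    rw [mul_assoc, h, mul_sub, mul_smul_comm, ← Algebra.commutes, ← Algebra.smul_def]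
  have e2 : u * (u * d) = a • (u * d) - b • d := by
    rw [← mul_assoc, h, sub_mul, smul_mul_assoc, ← Algebra.smul_def]
  simp only [sub_mul, mul_sub, smul_mul_assoc, one_mul, e1, e2, mul_assoc u d u]
  abel

/-- A non-scalar `u` and a twisted element `τ` present `D` as the generalized quaternion algebra
with `i² = a i - b`, `j² = β` and basis `1, u, τ, uτ`; its star is the involution sought. -/
theorem nonempty_normConj [CharZero K] [Algebra.IsCentral K D] (hfin : Module.finrank K D = 4)
    (hdiv : ∀ a : D, a ≠ 0 → IsUnit a) : Nonempty (NormConj K D) := by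
  have : Nontrivial D := Module.nontrivial_of_finrank_pos (R := K) (by omega)
  have := noZeroDivisors_of_isUnit hdiv
  have hex : ∃ u : D, u ∉ (algebraMap K D).range := by
    by_contra! hc
    have htop : (⊥ : Subalgebra K D) = ⊤ := by
      rw [eq_top_iff]
      intro d _
      obtain ⟨c, hc⟩ := hc d
      exact Algebra.mem_bot.2 ⟨c, hc⟩
    have h1 := Subalgebra.finrank_bot (F := K) (E := D)
    rw [htop, ← Subalgebra.finrank_toSubmodule, Algebra.top_toSubmodule, finrank_top, hfin] at h1
    norm_num at h1
  obtain ⟨u, hu⟩ := hex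
  obtain ⟨a, b, hab⟩ := exists_quadratic hfin hdiv hu
  obtain ⟨τ, hτ, hτu⟩ := exists_conj_intertwiner hu hab
  obtain ⟨β, hβ⟩ := exists_sq_eq hfin hu hτ hτu
  let B : QuaternionAlgebra.Basis D (-b) a β :=
    { i := u, j := τ, k := u * τ
      i_mul_i := by rw [hab, Algebra.algebraMap_eq_smul_one, neg_smul]; abel
      j_mul_j := hβ
      i_mul_j := rfl
      j_mul_i := by rw [hτu, sub_mul, smul_mul_assoc, one_mul] }
  refine nonempty_normConj_of_basis B ?_
  have hl : ∀ q : QuaternionAlgebra K (-b) a β,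
      B.liftHom q = cyclicMap K u τ ![q.re, q.imI, q.imJ, q.imK] := by
    intro q
    rw [cyclicMap_apply]
    change algebraMap K D q.re + q.imI • u + q.imJ • τ + q.imK • (u * τ) = _
    simp [add_mul, Algebra.algebraMap_eq_smul_one]
    abel
  constructor
  · intro p q hpq
    rw [hl, hl] at hpq
    have := cyclicMap_injective hu hτ hτu hpq
    ext
    exacts [congrFun this 0, congrFun this 1, congrFun this 2, congrFun this 3]
  · intro d
    obtain ⟨c, rfl⟩ := cyclicMap_surjective hfin hu hτ hτu d
    refine ⟨⟨c 0, c 1, c 2, c 3⟩, ?_⟩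
    rw [hl]
    congr 1
    ext i
    fin_cases i <;> rfl

end Structure

end PairQuat

namespace PairQuat

/-! ### Identities for the reduced norm, the reduced trace and the discriminant -/

section NormConjLemmas

set_option linter.unusedSectionVars false

variable {K D : Type*} [Field K] [Ring D] [Algebra K D]

theorem PairGroup.smul_apply (g : PairGroup K D) (x : PairSpace D) (i : Fin 2) :
    (g • x) i = g.mat i 0 • (g.fst * x 0 * g.snd) + g.mat i 1 • (g.fst * x 1 * g.snd) :=
  Fin.sum_univ_two _

theorem PairGroup.fst_mul_fst_inv (g : PairGroup K D) : g.fst * g⁻¹.fst = 1 := by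
  rw [← fst_mul, mul_inv_cancel, fst_one]

theorem PairGroup.fst_inv_mul_fst (g : PairGroup K D) : g⁻¹.fst * g.fst = 1 := by
  rw [← fst_mul, inv_mul_cancel, fst_one]

theorem PairGroup.snd_mul_snd_inv (g : PairGroup K D) : g.snd * g⁻¹.snd = 1 := by
  rw [← snd_mul, inv_mul_cancel, snd_one]

theorem PairGroup.snd_inv_mul_snd (g : PairGroup K D) : g⁻¹.snd * g.snd = 1 := by
  rw [← snd_mul, mul_inv_cancel, snd_one]

theorem PairGroup.mat_mul_mat_inv (g : PairGroup K D) : g.mat * g⁻¹.mat = 1 := by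
  rw [← mat_mul, mul_inv_cancel, mat_one]

theorem PairGroup.mat_inv_mul_mat (g : PairGroup K D) : g⁻¹.mat * g.mat = 1 := by
  rw [← mat_mul, inv_mul_cancel, mat_one]

theorem PairGroup.ext' {g h : PairGroup K D} (h1 : g.fst = h.fst) (h2 : g.snd = h.snd)
    (h3 : g.mat = h.mat) : g = h :=
  Prod.ext (Units.ext h1) (Prod.ext (Units.ext (MulOpposite.unop_injective h2)) (Units.ext h3))

theorem PairGroup.det_ne_zero (g : PairGroup K D) : g.mat.det ≠ 0 := by
  have h := congrArg Matrix.det g.mat_mul_mat_inv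
  rw [Matrix.det_mul, Matrix.det_one] at h
  exact left_ne_zero_of_mul_eq_one h

/-- The element of `G_K` with given components and given inverse components. -/
def PairGroup.mk' (a a' b b' : D) (m m' : Matrix (Fin 2) (Fin 2) K) (h1 : a * a' = 1)
    (h2 : a' * a = 1) (h3 : b * b' = 1) (h4 : b' * b = 1) (h5 : m * m' = 1) (h6 : m' * m = 1) :
    PairGroup K D :=
  (⟨a, a', h1, h2⟩, ⟨MulOpposite.op b, MulOpposite.op b', congrArg MulOpposite.op h4,
    congrArg MulOpposite.op h3⟩, ⟨m, m', h5, h6⟩)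

section

variable {a a' b b' : D} {m m' : Matrix (Fin 2) (Fin 2) K} (h1 : a * a' = 1)
    (h2 : a' * a = 1) (h3 : b * b' = 1) (h4 : b' * b = 1) (h5 : m * m' = 1) (h6 : m' * m = 1)

@[simp] theorem PairGroup.fst_mk' : (mk' a a' b b' m m' h1 h2 h3 h4 h5 h6).fst = a := rfl
@[simp] theorem PairGroup.snd_mk' : (mk' a a' b b' m m' h1 h2 h3 h4 h5 h6).snd = b := rfl
@[simp] theorem PairGroup.mat_mk' : (mk' a a' b b' m m' h1 h2 h3 h4 h5 h6).mat = m := rfl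
@[simp] theorem PairGroup.fst_inv_mk' : (mk' a a' b b' m m' h1 h2 h3 h4 h5 h6)⁻¹.fst = a' := rfl
@[simp] theorem PairGroup.snd_inv_mk' : (mk' a a' b b' m m' h1 h2 h3 h4 h5 h6)⁻¹.snd = b' := rfl
@[simp] theorem PairGroup.mat_inv_mk' : (mk' a a' b b' m m' h1 h2 h3 h4 h5 h6)⁻¹.mat = m' := rfl

end

variable [Nontrivial D]

namespace NormConj

variable (Q : NormConj K D)
include Q

local notation "N" => reducedNorm K (D := D)

theorem conj_one : Q.conj 1 = 1 := by
  have h := Q.conj_mul (Q.conj 1) 1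
  rw [mul_one, Q.conj_conj, mul_one] at h
  exact h.symm

theorem conj_algebraMap (c : K) : Q.conj (algebraMap K D c) = algebraMap K D c := by
  rw [Algebra.algebraMap_eq_smul_one, map_smul, Q.conj_one]

theorem conj_eq (a : D) : Q.conj a = Q.tr a • 1 - a := by
  rw [← Algebra.algebraMap_eq_smul_one, ← Q.add_conj, add_sub_cancel_left]

theorem conj_mul_self (a : D) : Q.conj a * a = algebraMap K D (N a) := by
  rw [← Q.mul_conj, Q.conj_eq]
  simp [sub_mul, mul_sub]

theorem mul_self (a : D) : a * a = Q.tr a • a - algebraMap K D (N a) := by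
  have h := Q.mul_conj a
  rw [Q.conj_eq, mul_sub, mul_smul_comm, mul_one] at h
  rw [← h, sub_sub_cancel]

/-- In `a b b̄ ā` the middle factor `b b̄` is central and can be pulled out. -/
theorem nrd_mul (a b : D) : N (a * b) = N a * N b := by
  apply (algebraMap K D).injective
  rw [← Q.mul_conj, Q.conj_mul, mul_assoc, ← mul_assoc b, Q.mul_conj, ← mul_assoc,
    ← Algebra.commutes, mul_assoc, Q.mul_conj, ← map_mul, mul_comm]

omit Q in
theorem nrd_one : N 1 = 1 := by
  rw [← map_one (algebraMap K D), reducedNorm_algebraMap, one_pow]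

theorem nrd_smul (c : K) (a : D) : N (c • a) = c ^ 2 * N a := by
  rw [Algebra.smul_def, Q.nrd_mul, reducedNorm_algebraMap]

theorem nrd_zero : N 0 = 0 := by
  rw [← map_zero (algebraMap K D), reducedNorm_algebraMap]; simp

theorem nrd_conj (a : D) : N (Q.conj a) = N a := by
  apply (algebraMap K D).injective
  rw [← Q.mul_conj, Q.conj_conj, Q.conj_mul_self]

theorem nrd_neg (a : D) : N (-a) = N a := by
  rw [← neg_one_smul K, Q.nrd_smul]; simp

theorem nrd_pow (a : D) (k : ℕ) : N (a ^ k) = N a ^ k := by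
  induction k with
  | zero => simpa using nrd_one
  | succ k ih => rw [pow_succ, Q.nrd_mul, ih, pow_succ]

theorem nrd_eq_zero [NoZeroDivisors D] {a : D} : N a = 0 ↔ a = 0 := by
  refine ⟨fun h => ?_, fun h => by rw [h, Q.nrd_zero]⟩
  have h1 := Q.mul_conj a
  rw [h, map_zero, mul_eq_zero] at h1
  rcases h1 with h1 | h1
  · exact h1
  · rw [← Q.conj_conj a, h1, map_zero]

theorem nrd_add (a b : D) :
    algebraMap K D (N (a + b) - N a - N b) = a * Q.conj b + b * Q.conj a := by
  rw [map_sub, map_sub, ← Q.mul_conj, ← Q.mul_conj, ← Q.mul_conj, map_add, add_mul, mul_add,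
    mul_add]
  abel

theorem nrd_one_add (a : D) : N (1 + a) = 1 + Q.tr a + N a := by
  have h := Q.nrd_add 1 a
  rw [one_mul, Q.conj_one, mul_one, add_comm (Q.conj a), Q.add_conj, nrd_one] at h
  have := (algebraMap K D).injective h
  rw [← this]; ring

theorem nrd_combination (c d : K) (a b : D) :
    N (c • a + d • b) = c ^ 2 * N a + c * d * (N (a + b) - N a - N b) + d ^ 2 * N b := by
  have h : N (c • a + d • b) - N (c • a) - N (d • b) = c * d * (N (a + b) - N a - N b) := by
    apply (algebraMap K D).injective
    rw [Q.nrd_add, map_mul, Q.nrd_add, ← Algebra.smul_def, smul_add, map_smul, map_smul,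
      smul_mul_smul_comm, smul_mul_smul_comm, mul_comm d c]
  rw [Q.nrd_smul, Q.nrd_smul] at h
  linear_combination h

theorem tr_add (a b : D) : Q.tr (a + b) = Q.tr a + Q.tr b := by
  apply (algebraMap K D).injective
  rw [map_add, ← Q.add_conj, ← Q.add_conj, ← Q.add_conj, map_add]; abel

theorem tr_smul (c : K) (a : D) : Q.tr (c • a) = c * Q.tr a := by
  apply (algebraMap K D).injective
  rw [map_mul, ← Q.add_conj, ← Q.add_conj, map_smul, ← Algebra.smul_def, smul_add]

/-- The reduced trace as a linear form. -/
def trace : D →ₗ[K] K where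
  toFun := Q.tr
  map_add' := Q.tr_add
  map_smul' := Q.tr_smul

theorem tr_one : Q.tr 1 = 2 := by
  apply (algebraMap K D).injective
  rw [← Q.add_conj, Q.conj_one, one_add_one_eq_two, map_ofNat]

theorem nrd_fst_ne_zero (g : PairGroup K D) : N g.fst ≠ 0 := by
  have h := congrArg N g.fst_mul_fst_inv
  rw [Q.nrd_mul, nrd_one] at h
  exact left_ne_zero_of_mul_eq_one h

theorem nrd_snd_ne_zero (g : PairGroup K D) : N g.snd ≠ 0 := by
  have h := congrArg N g.snd_mul_snd_inv
  rw [Q.nrd_mul, nrd_one] at h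
  exact left_ne_zero_of_mul_eq_one h

/-- The first two components multiply the form `F_x` by their norms and the matrix substitutes the
variables; the discriminant has degree two in the coefficients and is multiplied by the square of
the determinant of a substitution. -/
theorem disc_smul (g : PairGroup K D) (x : PairSpace D) :
    disc K (g • x) = (N g.fst * N g.snd * g.mat.det) ^ 2 * disc K x := by
  have h0 : N (g.fst * x 0 * g.snd) = N g.fst * N g.snd * N (x 0) := by
    rw [Q.nrd_mul, Q.nrd_mul]; ring
  have h1 : N (g.fst * x 1 * g.snd) = N g.fst * N g.snd * N (x 1) := by
    rw [Q.nrd_mul, Q.nrd_mul]; ring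
  have h2 : N (g.fst * x 0 * g.snd + g.fst * x 1 * g.snd) =
      N g.fst * N g.snd * N (x 0 + x 1) := by
    rw [← add_mul, ← mul_add, Q.nrd_mul, Q.nrd_mul]; ring
  have h3 : (g • x) 0 + (g • x) 1 = (g.mat 0 0 + g.mat 1 0) • (g.fst * x 0 * g.snd) +
      (g.mat 0 1 + g.mat 1 1) • (g.fst * x 1 * g.snd) := by
    rw [PairGroup.smul_apply, PairGroup.smul_apply, add_smul, add_smul]; abel
  simp only [disc, formCoeff, Matrix.cons_val_zero, Matrix.cons_val_one, Matrix.cons_val]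
  rw [h3, PairGroup.smul_apply, PairGroup.smul_apply]
  simp only [Q.nrd_combination, h0, h1, h2, Matrix.det_fin_two]
  ring

theorem disc_pairOf (u : D) : disc K (pairOf u) = Q.tr u ^ 2 - 4 * N u := by
  have h0 : (pairOf u) 0 = 1 := rfl
  have h1 : (pairOf u) 1 = u := rfl
  simp only [disc, formCoeff, Matrix.cons_val_zero, Matrix.cons_val_one, Matrix.cons_val, h0, h1,
    Q.nrd_one_add, nrd_one]
  ring

/-- This is how the discriminant enters all later estimates: `u - ū` is the factor by which the
commutator with `u` acts on twisted elements, and its norm has the size of `P(x)`. -/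
theorem nrd_conj_sub (u : D) : N (Q.conj u - u) = - disc K (pairOf u) := by
  have h := Q.nrd_combination (Q.tr u) (-2) 1 u
  have e : Q.conj u - u = Q.tr u • 1 + (-2 : K) • u := by
    rw [Q.conj_eq, neg_smul, two_smul]; abel
  rw [e, h, Q.disc_pairOf, Q.nrd_one_add, nrd_one]
  ring

theorem notMem_range_of_disc_ne_zero {u : D} (h : disc K (pairOf u) ≠ 0) :
    u ∉ (algebraMap K D).range := by
  rintro ⟨c, rfl⟩
  apply h
  rw [← neg_eq_zero, ← Q.nrd_conj_sub, Q.conj_algebraMap, sub_self, Q.nrd_zero]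

theorem mul_inv_smul_conj [NoZeroDivisors D] {a : D} (ha : a ≠ 0) :
    a * ((N a)⁻¹ • Q.conj a) = 1 ∧ ((N a)⁻¹ • Q.conj a) * a = 1 := by
  have h : N a ≠ 0 := fun h => ha (Q.nrd_eq_zero.1 h)
  constructor
  · rw [mul_smul_comm, Q.mul_conj, Algebra.smul_def, ← map_mul, inv_mul_cancel₀ h, map_one]
  · rw [smul_mul_assoc, Q.conj_mul_self, Algebra.smul_def, ← map_mul, inv_mul_cancel₀ h, map_one]

end NormConj

end NormConjLemmas

end PairQuat

namespace PairQuat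

/-! ### Invariant measures on a homogeneous space and on a twofold cover -/

section Homogeneous

set_option linter.unusedSectionVars false

open scoped ENNReal

variable {G V : Type*} [Group G] [TopologicalSpace G] [IsTopologicalGroup G] [PolishSpace G]
  [LocallyCompactSpace G] [MeasurableSpace G] [BorelSpace G]
  [TopologicalSpace V] [T2Space V] [SecondCountableTopology V] [MeasurableSpace V] [BorelSpace V]
  [MulAction G V] [ContinuousSMul G V]

/-- `H` has index two in the stabilizer of `x`, the other coset being `τ H`. -/
structure IsHalfStabilizer (H : Subgroup G) (x : V) (τ : G) : Prop where
  smul_eq_iff : ∀ g : G, g • x = x ↔ g ∈ H ∨ τ⁻¹ * g ∈ H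
  notMem : τ ∉ H
  conj_mem : ∀ h ∈ H, τ⁻¹ * h * τ ∈ H

variable {H : Subgroup G} {x : V} {τ : G}

namespace IsHalfStabilizer

variable (S : IsHalfStabilizer H x τ)
include S

theorem smul_of_mem {h : G} (hh : h ∈ H) : h • x = x := (S.smul_eq_iff h).2 (Or.inl hh)

theorem smul_self : τ • x = x := (S.smul_eq_iff τ).2 (Or.inr (by simp [one_mem]))

theorem sq_mem : τ * τ ∈ H := by
  rcases (S.smul_eq_iff (τ * τ)).1 (by rw [mul_smul, S.smul_self, S.smul_self]) with h | h
  · exact h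
  · exact absurd (by simpa using h) S.notMem

open Classical in
/-- A function on the orbit of `x` obtained from a function on `G/H` by summing over the two
points of the fibres. -/
def fibreSum (_S : IsHalfStabilizer H x τ) (F : G ⧸ H → ℝ≥0∞) (y : V) : ℝ≥0∞ :=
  if h : ∃ g : G, g • x = y then
    F (QuotientGroup.mk h.choose) + F (QuotientGroup.mk (h.choose * τ)) else 0

/-- The sum does not depend on the representative: changing `g` by an element of the stabilizer
fixes the cosets of `g` and `g τ` if the element lies in `H`, and exchanges them otherwise. -/
theorem fibreSum_smul (F : G ⧸ H → ℝ≥0∞) (g : G) :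
    S.fibreSum F (g • x) = F (QuotientGroup.mk g) + F (QuotientGroup.mk (g * τ)) := by
  have h : ∃ g' : G, g' • x = g • x := ⟨g, rfl⟩
  rw [fibreSum, dif_pos h]
  obtain ⟨s, hs, hsg⟩ : ∃ s : G, s • x = x ∧ h.choose = g * s :=
    ⟨g⁻¹ * h.choose, by rw [mul_smul, h.choose_spec, inv_smul_smul], by simp⟩
  rw [hsg]
  rcases (S.smul_eq_iff s).1 hs with hs | hs
  · congr 2
    · exact QuotientGroup.mk_mul_of_mem g hs
    · rw [QuotientGroup.eq]
      have := S.conj_mem _ (inv_mem hs)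
      simpa [mul_assoc] using this
  · rw [add_comm]
    congr 2
    · rw [QuotientGroup.eq]
      have := inv_mem (H.mul_mem S.sq_mem (S.conj_mem _ hs))
      rw [← inv_mem_iff]
      have h2 := H.mul_mem S.sq_mem (S.conj_mem _ hs)
      simpa [mul_assoc] using h2
    · rw [QuotientGroup.eq, ← inv_mem_iff]
      simpa [mul_assoc] using hs

theorem fibreSum_of_notMem (F : G ⧸ H → ℝ≥0∞) {y : V} (hy : y ∉ MulAction.orbit G x) :
    S.fibreSum F y = 0 := by
  have h : ¬ ∃ g : G, g • x = y := fun ⟨g, hg⟩ => hy ⟨g, hg⟩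
  rw [fibreSum, dif_neg h]

omit S in
-- The group is σ-compact, so the orbit is a countable union of compact sets.
theorem measurableSet_orbit (x : V) : MeasurableSet (MulAction.orbit G x) := by
  have h : IsSigmaCompact (Set.range fun g : G => g • x) :=
    isSigmaCompact_range (continuous_id.smul continuous_const)
  obtain ⟨K, hK, hU⟩ := h
  rw [MulAction.orbit, ← hU]
  exact MeasurableSet.iUnion fun n => (hK n).measurableSet

/-- On the orbit, measurability can be tested after composition with the surjection from the Polish
group `G`, where the function is explicit. -/
theorem measurable_fibreSum {F : G ⧸ H → ℝ≥0∞} (hF : Measurable F) :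
    Measurable (S.fibreSum F) := by
  have hO := measurableSet_orbit (G := G) x
  refine measurable_of_restrict_of_restrict_compl hO ?_ ?_
  · let π : G → MulAction.orbit G x := fun g => ⟨g • x, g, rfl⟩
    have hπ : Measurable π :=
      ((continuous_id.smul continuous_const : Continuous fun g : G => g • x).measurable).subtype_mk
    have hs : Function.Surjective π := fun ⟨y, g, hg⟩ => ⟨g, Subtype.ext hg⟩
    rw [← hπ.measurable_comp_iff_of_surjective hs]
    have : (MulAction.orbit G x).domRestrict (S.fibreSum F) ∘ π =
        fun g => F (QuotientGroup.mk g) + F (QuotientGroup.mk (g * τ)) :=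
      funext fun g => S.fibreSum_smul F g
    rw [this]
    exact (hF.comp QuotientGroup.measurable_coe).add
      (hF.comp (QuotientGroup.measurable_coe.comp (measurable_mul_const τ)))
  · have : (MulAction.orbit G x)ᶜ.domRestrict (S.fibreSum F) = fun _ => 0 :=
      funext fun y => S.fibreSum_of_notMem F y.2
    rw [this]
    exact measurable_const

theorem fibreSum_comp_smul (F : G ⧸ H → ℝ≥0∞) (a : G) (y : V) :
    S.fibreSum (fun q => F (a • q)) y = S.fibreSum F (a • y) := by
  by_cases hy : y ∈ MulAction.orbit G x
  · obtain ⟨g, rfl⟩ := hy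
    change S.fibreSum _ (g • x) = S.fibreSum F (a • g • x)
    rw [S.fibreSum_smul, ← mul_smul, S.fibreSum_smul, mul_assoc]
    rfl
  · rw [S.fibreSum_of_notMem _ hy, S.fibreSum_of_notMem]
    rintro ⟨g, hg⟩
    exact hy ⟨a⁻¹ * g, by change (a⁻¹ * g) • x = y; rw [mul_smul]; exact inv_smul_eq_iff.2 hg⟩

open Classical in
/-- The counting measure on the fibre over `y`. -/
def fibreMeasure (_S : IsHalfStabilizer H x τ) (y : V) : Measure (G ⧸ H) :=
  if h : ∃ g : G, g • x = y then
    Measure.dirac (QuotientGroup.mk h.choose) + Measure.dirac (QuotientGroup.mk (h.choose * τ))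
  else 0

theorem lintegral_fibreMeasure {F : G ⧸ H → ℝ≥0∞} (hF : Measurable F) (y : V) :
    ∫⁻ q, F q ∂(S.fibreMeasure y) = S.fibreSum F y := by
  rw [fibreMeasure, fibreSum]
  split_ifs with h
  · rw [lintegral_add_measure, lintegral_dirac' _ hF, lintegral_dirac' _ hF]
  · rw [lintegral_zero_measure]

theorem measurable_fibreMeasure : Measurable S.fibreMeasure := by
  refine Measure.measurable_of_measurable_coe _ fun A hA => ?_
  have : (fun y => S.fibreMeasure y A) = S.fibreSum (A.indicator 1) := by
    funext y
    rw [← S.lintegral_fibreMeasure (measurable_one.indicator hA), lintegral_indicator_one hA]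
  rw [this]
  exact S.measurable_fibreSum (measurable_one.indicator hA)

/-- The pull-back to `G/H` of a measure on `V`. -/
def coverMeasure (_S : IsHalfStabilizer H x τ) (ν : Measure V) : Measure (G ⧸ H) :=
  ν.bind _S.fibreMeasure

theorem lintegral_coverMeasure (ν : Measure V) {F : G ⧸ H → ℝ≥0∞} (hF : Measurable F) :
    ∫⁻ q, F q ∂(S.coverMeasure ν) = ∫⁻ y, S.fibreSum F y ∂ν := by
  rw [coverMeasure, Measure.lintegral_bind S.measurable_fibreMeasure.aemeasurable hF.aemeasurable]
  exact lintegral_congr fun y => S.lintegral_fibreMeasure hF y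

omit S in
theorem measurable_smul_quotient (a : G) : Measurable fun q : G ⧸ H => a • q :=
  QuotientGroup.measurable_from_quotient.2
    (QuotientGroup.measurable_coe.comp (measurable_const_mul a))

theorem lintegral_coverMeasure_smul {ν : Measure V}
    (hν : ∀ a : G, MeasurePreserving (fun y : V => a • y) ν ν) {F : G ⧸ H → ℝ≥0∞}
    (hF : Measurable F) (a : G) :
    ∫⁻ q, F (a • q) ∂(S.coverMeasure ν) = ∫⁻ q, F q ∂(S.coverMeasure ν) := by
  have h := S.lintegral_coverMeasure ν (hF.comp (measurable_smul_quotient (H := H) a))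
  simp only [Function.comp_def] at h
  rw [S.lintegral_coverMeasure ν hF, h, ← (hν a).lintegral_comp (S.measurable_fibreSum hF)]
  exact lintegral_congr fun y => S.fibreSum_comp_smul F a y

omit S in
/-- The orbit map on `G/H`. -/
theorem out_smul_mk (S : IsHalfStabilizer H x τ) (g : G) :
    (QuotientGroup.mk g : G ⧸ H).out • x = g • x := by
  obtain ⟨h, hh⟩ := QuotientGroup.mk_out_eq_mul H g
  rw [hh, mul_smul, S.smul_of_mem h.2]

theorem measurable_out_smul : Measurable fun q : G ⧸ H => q.out • x := by
  refine QuotientGroup.measurable_from_quotient.2 ?_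
  have : ((fun q : G ⧸ H => q.out • x) ∘ (QuotientGroup.mk : G → G ⧸ H)) = fun g => g • x :=
    funext fun g => S.out_smul_mk g
  rw [this]
  exact (continuous_id.smul continuous_const : Continuous fun g : G => g • x).measurable

/-- Both points of the fibre over `y` are sent to `y`, which produces the factor two. The measure
must be carried by the orbit because the other fibres are empty. -/
theorem map_coverMeasure {ν : Measure V} (hν : ν (MulAction.orbit G x)ᶜ = 0) :
    (S.coverMeasure ν).map (fun q => q.out • x) = (2 : ℝ≥0∞) • ν := by
  ext A hA
  rw [Measure.map_apply S.measurable_out_smul hA, ← lintegral_indicator_one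
    (S.measurable_out_smul hA), S.lintegral_coverMeasure ν
    (measurable_one.indicator (S.measurable_out_smul hA)), Measure.smul_apply, smul_eq_mul,
    ← lintegral_indicator_one hA, ← lintegral_const_mul _ (measurable_one.indicator hA)]
  refine lintegral_congr_ae ?_
  filter_upwards [measure_eq_zero_iff_ae_notMem.1 hν] with y hy
  rw [Set.notMem_compl_iff] at hy
  obtain ⟨g, rfl⟩ := hy
  change S.fibreSum _ (g • x) = 2 * A.indicator 1 (g • x)
  have h2 : (g * τ) • x = g • x := by rw [mul_smul, S.smul_self]
  rw [S.fibreSum_smul, two_mul]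
  have h3 : ∀ k : G, ((fun q : G ⧸ H => q.out • x) ⁻¹' A).indicator (1 : G ⧸ H → ℝ≥0∞)
      (QuotientGroup.mk k) = A.indicator 1 (k • x) := by
    intro k
    classical
    simp only [Set.indicator_apply, Pi.one_apply]
    refine if_congr ?_ rfl rfl
    rw [Set.mem_preimage, S.out_smul_mk]
  rw [h3, h3, h2]

end IsHalfStabilizer

/-! ### Haar measure on `G` from invariant measures on the orbit and on `H` -/

section Lift

variable (lam : Measure H) [SFinite lam] [lam.IsMulLeftInvariant]

/-- The translate to the coset `q` of a left invariant measure on `H`. -/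
def cosetMeasure (lam : Measure H) (q : G ⧸ H) : Measure G :=
  lam.map fun h : H => q.out * (h : G)

/-- Left invariance on `H` allows the chosen representative of the coset to be replaced by any
other. -/
theorem cosetMeasure_mk (g : G) :
    cosetMeasure lam (QuotientGroup.mk g : G ⧸ H) = lam.map fun h : H => g * (h : G) := by
  obtain ⟨h₀, h⟩ := QuotientGroup.mk_out_eq_mul H g
  rw [cosetMeasure, h]
  have e : (fun k : H => g * (h₀ : G) * (k : G)) = (fun k : H => g * (k : G)) ∘ fun k => h₀ * k := by
    funext k; simp [mul_assoc]
  have hm : Measurable fun k : H => g * (k : G) :=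
    (measurable_const_mul g).comp measurable_subtype_coe
  rw [e, ← Measure.map_map hm (measurable_const_mul h₀), map_mul_left_eq_self]

theorem cosetMeasure_mk_apply (g : G) {A : Set G} (hA : MeasurableSet A) :
    cosetMeasure lam (QuotientGroup.mk g : G ⧸ H) A = lam {h : H | g * (h : G) ∈ A} := by
  have hm : Measurable fun k : H => g * (k : G) :=
    (measurable_const_mul g).comp measurable_subtype_coe
  rw [cosetMeasure_mk, Measure.map_apply hm hA]
  rfl

theorem measurable_cosetMeasure : Measurable (cosetMeasure lam) := by
  refine Measure.measurable_of_measurable_coe _ fun A hA => ?_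
  refine QuotientGroup.measurable_from_quotient.2 ?_
  have : ((fun q : G ⧸ H => cosetMeasure lam q A) ∘ (QuotientGroup.mk : G → G ⧸ H)) =
      fun g => lam (Prod.mk g ⁻¹' {p : G × H | p.1 * (p.2 : G) ∈ A}) :=
    funext fun g => cosetMeasure_mk_apply lam g hA
  rw [this]
  exact measurable_measure_prodMk_left
    ((measurable_fst.mul (measurable_subtype_coe.comp measurable_snd)) hA)

theorem cosetMeasure_preimage (a : G) (q : G ⧸ H) {A : Set G} (hA : MeasurableSet A) :
    cosetMeasure lam q ((fun g => a * g) ⁻¹' A) = cosetMeasure lam (a • q) A := by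
  induction q using QuotientGroup.induction_on with
  | H g =>
    change _ = cosetMeasure lam (QuotientGroup.mk (a * g)) A
    rw [cosetMeasure_mk_apply lam g (measurable_const_mul a hA), cosetMeasure_mk_apply lam _ hA]
    simp [mul_assoc]

variable (S : IsHalfStabilizer H x τ) {ν : Measure V}

/-- The measure on `G` obtained from a measure on the orbit and a measure on `H`. -/
def liftMeasure (lam : Measure H) (S : IsHalfStabilizer H x τ) (ν : Measure V) : Measure G :=
  (S.coverMeasure ν).bind (cosetMeasure lam)

theorem liftMeasure_apply (ν : Measure V) {A : Set G} (hA : MeasurableSet A) :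
    liftMeasure lam S ν A = ∫⁻ y, S.fibreSum (fun q => cosetMeasure lam q A) y ∂ν := by
  have hm := (measurable_cosetMeasure lam)
  rw [liftMeasure, Measure.bind_apply hA hm.aemeasurable]
  exact S.lintegral_coverMeasure ν ((Measure.measurable_coe hA).comp hm)

theorem isMulLeftInvariant_liftMeasure
    (hν : ∀ a : G, MeasurePreserving (fun y : V => a • y) ν ν) :
    (liftMeasure lam S ν).IsMulLeftInvariant := by
  refine ⟨fun a => ?_⟩
  ext A hA
  have hm := (measurable_cosetMeasure lam)
  rw [Measure.map_apply (measurable_const_mul a) hA, liftMeasure,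
    Measure.bind_apply (measurable_const_mul a hA) hm.aemeasurable,
    Measure.bind_apply hA hm.aemeasurable]
  refine Eq.trans ?_ (S.lintegral_coverMeasure_smul hν ((Measure.measurable_coe hA).comp hm) a)
  exact lintegral_congr fun q => cosetMeasure_preimage lam a q hA

/-- A point `k x` with `k ∈ U` has the two cosets `k H` and `k τ H` above it; by translation they
meet `U` in the masses of `H ∩ U` and of `τ H ∩ U`, independently of `k`. Cosets above a point
outside `U x` do not meet `U`. -/
theorem liftMeasure_subgroup (hν : ν (MulAction.orbit G x)ᶜ = 0) (U : Subgroup G)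
    (hU : IsOpen (U : Set G)) (hUc : IsCompact (U : Set G)) :
    liftMeasure lam S ν U = (lam {h : H | (h : G) ∈ U} + lam {h : H | τ * (h : G) ∈ U}) *
      ν ((fun g : G => g • x) '' U) := by
  have hUx : MeasurableSet ((fun g : G => g • x) '' (U : Set G)) :=
    (hUc.image (continuous_id.smul continuous_const)).measurableSet
  rw [liftMeasure_apply lam S ν hU.measurableSet, ← lintegral_indicator_const hUx]
  refine lintegral_congr_ae ?_
  filter_upwards [measure_eq_zero_iff_ae_notMem.1 hν] with y hy
  rw [Set.notMem_compl_iff] at hy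
  by_cases hyU : y ∈ (fun g : G => g • x) '' (U : Set G)
  · rw [Set.indicator_of_mem hyU]
    obtain ⟨k, hk, rfl⟩ := hyU
    change S.fibreSum _ (k • x) = _
    rw [S.fibreSum_smul, cosetMeasure_mk_apply lam _ hU.measurableSet,
      cosetMeasure_mk_apply lam _ hU.measurableSet]
    congr 2
    · ext h; exact U.mul_mem_cancel_left hk
    · ext h
      change k * τ * (h : G) ∈ U ↔ _
      rw [mul_assoc]
      exact U.mul_mem_cancel_left hk
  · rw [Set.indicator_of_notMem hyU]
    obtain ⟨g, rfl⟩ := hy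
    change S.fibreSum _ (g • x) = _
    rw [S.fibreSum_smul, cosetMeasure_mk_apply lam _ hU.measurableSet,
      cosetMeasure_mk_apply lam _ hU.measurableSet]
    have h1 : {h : H | g * (h : G) ∈ (U : Set G)} = ∅ := by
      refine Set.eq_empty_of_forall_notMem fun h hh => hyU ⟨_, hh, ?_⟩
      change (g * (h : G)) • x = g • x
      rw [mul_smul, S.smul_of_mem h.2]
    have h2 : {h : H | g * τ * (h : G) ∈ (U : Set G)} = ∅ := by
      refine Set.eq_empty_of_forall_notMem fun h hh => hyU ⟨_, hh, ?_⟩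
      change (g * τ * (h : G)) • x = g • x
      rw [mul_smul, mul_smul, S.smul_of_mem h.2, S.smul_self]
    rw [h1, h2, measure_empty, add_zero]

end Lift

/-! ### Comparison with the normalized Haar measure and the constant of the orbit -/

section Compare

variable (lam : Measure H) [SFinite lam] [lam.IsMulLeftInvariant]
  (S : IsHalfStabilizer H x τ) {ν : Measure V}
  (hν : ∀ a : G, MeasurePreserving (fun y : V => a • y) ν ν)
  (hνo : ν (MulAction.orbit G x)ᶜ = 0)
  {U₀ : Subgroup G} (hU₀ : IsOpen (U₀ : Set G)) (hU₀c : IsCompact (U₀ : Set G))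
  (hτ : τ ∈ U₀) (hlam : lam {h : H | (h : G) ∈ U₀} = 1)
  {dg : Measure G} [dg.IsHaarMeasure] (hdg : dg U₀ = 1)
  (hfin : ν ((fun g : G => g • x) '' U₀) ≠ ∞) (hpos : ν ((fun g : G => g • x) '' U₀) ≠ 0)

include hνo hU₀ hU₀c hτ hlam in
theorem liftMeasure_self :
    liftMeasure lam S ν U₀ = 2 * ν ((fun g : G => g • x) '' U₀) := by
  have h : {h : H | τ * (h : G) ∈ U₀} = {h : H | (h : G) ∈ U₀} := by
    ext h; exact U₀.mul_mem_cancel_left hτ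
  rw [liftMeasure_subgroup lam S hνo U₀ hU₀ hU₀c, h, hlam, one_add_one_eq_two]

include hν hνo hU₀ hU₀c hτ hlam hdg hfin in
-- Finiteness on one nonempty open set, together with invariance, gives finiteness on compact sets;
-- then uniqueness of Haar measure applies and the constant is read off at `U₀`, where both cosets
-- contribute equally because `τ ∈ U₀`.
theorem liftMeasure_eq :
    liftMeasure lam S ν = (2 * ν ((fun g : G => g • x) '' U₀)) • dg := by
  have hinv := isMulLeftInvariant_liftMeasure lam S hν
  have hself := liftMeasure_self lam S hνo hU₀ hU₀c hτ hlam
  have hft : IsFiniteMeasureOnCompacts (liftMeasure lam S ν) := ⟨fun K hK =>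
    measure_lt_top_of_isCompact_of_isMulLeftInvariant (U₀ : Set G) hU₀ ⟨1, one_mem U₀⟩
      (by rw [hself]; exact ENNReal.mul_ne_top (by simp) hfin) hK⟩
  have h := Measure.isMulLeftInvariant_eq_smul (liftMeasure lam S ν) dg
  have h2 := hself
  rw [h, Measure.smul_apply, hdg, ENNReal.smul_def, smul_eq_mul, mul_one] at h2
  rw [h, ← h2]
  rfl

include S hν hνo hU₀ hU₀c hτ hlam hdg hfin in
-- The Haar measure is evaluated at a second subgroup `U`, one that avoids the coset of `τ`. The
-- factor two that remains on the right is the source of the factor `2⁻¹` in the local density.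
theorem measure_orbit_mul (U : Subgroup G) (hU : IsOpen (U : Set G)) (hUc : IsCompact (U : Set G))
    (hUτ : ∀ h ∈ H, τ * h ∉ U) :
    lam {h : H | (h : G) ∈ U} * ν ((fun g : G => g • x) '' U) =
      2 * ν ((fun g : G => g • x) '' U₀) * dg U := by
  have h1 := liftMeasure_subgroup lam S hνo U hU hUc
  have h2 : {h : H | τ * (h : G) ∈ U} = ∅ := Set.eq_empty_of_forall_notMem fun h => hUτ h h.2
  rw [h2, measure_empty, add_zero, liftMeasure_eq lam S hν hνo hU₀ hU₀c hτ hlam hdg hfin] at h1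
  exact h1.symm

/-- The invariant measure on `G/H` compatible with the Haar measures on `G` and `H`. -/
def quotientMeasure (S : IsHalfStabilizer H x τ) (ν : Measure V) (U₀ : Subgroup G) :
    Measure (G ⧸ H) :=
  (2 * ν ((fun g : G => g • x) '' U₀))⁻¹ • S.coverMeasure ν

include hνo hpos hfin in
theorem map_quotientMeasure :
    (quotientMeasure S ν U₀).map (fun q => q.out • x) =
      (ν ((fun g : G => g • x) '' U₀))⁻¹ • ν := by
  rw [quotientMeasure, Measure.map_smul, S.map_coverMeasure hνo, smul_smul,
    ENNReal.mul_inv (by simp) (by simp), mul_comm, ← mul_assoc,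
    ENNReal.mul_inv_cancel (by simp) (by simp), one_mul]

include hν in
theorem map_smul_coverMeasure (a : G) :
    (S.coverMeasure ν).map (fun q => a • q) = S.coverMeasure ν := by
  ext A hA
  have hm := IsHalfStabilizer.measurable_smul_quotient (H := H) a
  have h := S.lintegral_coverMeasure_smul hν (measurable_one.indicator hA) a
  rw [lintegral_indicator_one hA] at h
  rw [Measure.map_apply hm hA, ← h, ← lintegral_indicator_one (hm hA)]
  rfl

include hν in
theorem smulInvariantMeasure_quotientMeasure :
    SMulInvariantMeasure G (G ⧸ H) (quotientMeasure S ν U₀) := by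
  refine ⟨fun a A hA => ?_⟩
  have hm := IsHalfStabilizer.measurable_smul_quotient (H := H) a
  rw [quotientMeasure, Measure.smul_apply, Measure.smul_apply, ← Measure.map_apply hm hA,
    map_smul_coverMeasure S hν a]

include hν hνo hU₀ hU₀c hτ hlam hfin hpos in
theorem regular_quotientMeasure (hH : IsClosed (H : Set G)) :
    (quotientMeasure S ν U₀).Regular := by
  have : IsClosed (H : Set G) := hH
  have hinv : SMulInvariantMeasure G (G ⧸ H) (S.coverMeasure ν) := ⟨fun a A hA => by
    rw [← Measure.map_apply (IsHalfStabilizer.measurable_smul_quotient a) hA,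
      map_smul_coverMeasure S hν a]⟩
  have hopen : IsOpen ((QuotientGroup.mk : G → G ⧸ H) '' U₀) :=
    QuotientGroup.isOpenMap_coe _ hU₀
  -- A coset that meets `U₀` does so in mass `λ(H ∩ U₀) = 1`, so the image of `U₀` in `G/H` has at
  -- most the mass of `U₀` under the lifted measure. Its translates give local finiteness.
  have hle : S.coverMeasure ν ((QuotientGroup.mk : G → G ⧸ H) '' U₀) ≠ ∞ := by
    have h1 := liftMeasure_self lam S hνo hU₀ hU₀c hτ hlam
    rw [liftMeasure, Measure.bind_apply hU₀.measurableSet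
      (measurable_cosetMeasure lam).aemeasurable] at h1
    refine ne_top_of_le_ne_top (ENNReal.mul_ne_top (by simp) hfin : 2 * _ ≠ ∞) (le_trans ?_ h1.le)
    rw [← lintegral_indicator_one hopen.measurableSet]
    refine lintegral_mono fun q => ?_
    by_cases hq : q ∈ (QuotientGroup.mk : G → G ⧸ H) '' U₀
    · rw [Set.indicator_of_mem hq]
      obtain ⟨k, hk, rfl⟩ := hq
      rw [cosetMeasure_mk_apply lam k hU₀.measurableSet, Pi.one_apply, ← hlam]
      refine measure_mono fun h hh => ?_
      exact mul_mem hk hh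
    · rw [Set.indicator_of_notMem hq]; exact zero_le
  have hloc : IsLocallyFiniteMeasure (quotientMeasure S ν U₀) := by
    refine ⟨fun q => ?_⟩
    induction q using QuotientGroup.induction_on with
    | H g =>
      have ho : IsOpen ((fun q : G ⧸ H => g⁻¹ • q) ⁻¹' ((QuotientGroup.mk : G → G ⧸ H) '' U₀)) :=
        hopen.preimage (continuous_const_smul _)
      refine ⟨_, ho.mem_nhds ⟨1, one_mem U₀, ?_⟩, ?_⟩
      · change (QuotientGroup.mk 1 : G ⧸ H) = QuotientGroup.mk (g⁻¹ * g)
        rw [inv_mul_cancel]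
      · rw [quotientMeasure, Measure.smul_apply, smul_eq_mul,
          hinv.measure_preimage_smul g⁻¹ hopen.measurableSet]
        refine ENNReal.mul_lt_top ?_ (lt_top_iff_ne_top.2 hle)
        rw [lt_top_iff_ne_top, ENNReal.inv_ne_top]
        exact mul_ne_zero (by simp) hpos
  infer_instance

include hν hνo hU₀ hU₀c hτ hlam hdg hfin hpos in
-- The comparison of measures says that `dg` is the composition of the quotient measure with the
-- kernel of coset measures; Fubini for kernels then passes from sets to integrable functions.
theorem integral_quotientMeasure {φ : G → ℝ} (hφ : Continuous φ) (hφc : HasCompactSupport φ) :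
    ∫ g, φ g ∂dg = ∫ q, (∫ h : H, φ (q.out * (h : G)) ∂lam) ∂(quotientMeasure S ν U₀) := by
  have hc0 : 2 * ν ((fun g : G => g • x) '' U₀) ≠ 0 := mul_ne_zero (by simp) hpos
  have hct : 2 * ν ((fun g : G => g • x) '' U₀) ≠ ∞ := ENNReal.mul_ne_top (by simp) hfin
  have hl := liftMeasure_eq lam S hν hνo hU₀ hU₀c hτ hlam hdg hfin
  let κ : ProbabilityTheory.Kernel (G ⧸ H) G := ⟨cosetMeasure lam, measurable_cosetMeasure lam⟩
  have hdg' : dg = (κ.comp (ProbabilityTheory.Kernel.const Unit (quotientMeasure S ν U₀))) () := by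
    rw [ProbabilityTheory.Kernel.comp_apply, ProbabilityTheory.Kernel.const_apply]
    ext A hA
    rw [Measure.bind_apply hA κ.measurable.aemeasurable, quotientMeasure, lintegral_smul_measure,
      ← Measure.bind_apply hA κ.measurable.aemeasurable]
    change _ = _ • liftMeasure lam S ν A
    rw [hl, Measure.smul_apply, smul_smul, smul_eq_mul,
      ENNReal.inv_mul_cancel hc0 hct, one_mul]
  have hint : Integrable φ dg := hφ.integrable_of_hasCompactSupport hφc
  rw [hdg'] at hint
  conv_lhs => rw [hdg']
  rw [ProbabilityTheory.Kernel.integral_comp hint, ProbabilityTheory.Kernel.const_apply]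
  refine integral_congr_ae (Filter.Eventually.of_forall fun q => ?_)
  change ∫ y, φ y ∂(cosetMeasure lam q) = _
  have hm : Measurable fun k : H => q.out * (k : G) :=
    (measurable_const_mul _).comp measurable_subtype_coe
  rw [cosetMeasure, integral_map hm.aemeasurable hφ.aestronglyMeasurable]

include S hU₀ hU₀c hτ hlam hdg in
-- The indicator function of `U₀` is an admissible test function, since `U₀` is open, closed and
-- compact. Its integral over a coset is `1` or `0` according to whether the coset lies over `U₀ x`.
-- This fixes the orbit constant without any uniqueness statement for `μ`.
theorem measureReal_of_integral_eq {μ : Measure (G ⧸ H)}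
    (hμ : ∀ φ : G → ℝ, Continuous φ → HasCompactSupport φ →
      ∫ g, φ g ∂dg = ∫ q, (∫ h : H, φ (q.out * (h : G)) ∂lam) ∂μ) :
    μ.real ((fun q : G ⧸ H => q.out • x) ⁻¹' ((fun g : G => g • x) '' U₀)) = 1 := by
  have hcl : IsClopen (U₀ : Set G) := ⟨U₀.isClosed_of_isOpen hU₀, hU₀⟩
  have h := hμ ((U₀ : Set G).indicator fun _ => 1) (continuous_const.indicator
    (by rw [hcl.frontier_eq]; simp)) (HasCompactSupport.of_support_subset_isCompact hU₀c
      Set.support_indicator_subset)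
  have hm : MeasurableSet ((fun q : G ⧸ H => q.out • x) ⁻¹' ((fun g : G => g • x) '' U₀)) :=
    S.measurable_out_smul (hU₀c.image (continuous_id.smul continuous_const)).measurableSet
  rw [integral_indicator_const _ hU₀.measurableSet, measureReal_def, hdg, ENNReal.toReal_one,
    smul_eq_mul, mul_one] at h
  rw [h, ← integral_indicator_one hm]
  refine integral_congr_ae (Filter.Eventually.of_forall fun q => ?_)
  induction q using QuotientGroup.induction_on with
  | H g =>
    have hs : ∫ h : H, (U₀ : Set G).indicator (fun _ => (1 : ℝ))
        ((QuotientGroup.mk g : G ⧸ H).out * (h : G)) ∂lam =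
        (cosetMeasure lam (QuotientGroup.mk g : G ⧸ H)).real U₀ := by
      have hm' : Measurable fun k : H => (QuotientGroup.mk g : G ⧸ H).out * (k : G) :=
        (measurable_const_mul _).comp measurable_subtype_coe
      rw [cosetMeasure, measureReal_def, Measure.map_apply hm' hU₀.measurableSet,
        ← measureReal_def, ← integral_indicator_one (hm' hU₀.measurableSet)]
      rfl
    change _ = ∫ h : H, (U₀ : Set G).indicator (fun _ => (1 : ℝ))
        ((QuotientGroup.mk g : G ⧸ H).out * (h : G)) ∂lam
    rw [hs]
    classical
    rw [Set.indicator_apply, Set.mem_preimage, S.out_smul_mk]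
    split_ifs with hg
    · obtain ⟨k, hk, hkg⟩ := hg
      have hkg' : (k⁻¹ * g) • x = x := by
        rw [mul_smul, inv_smul_eq_iff]; exact hkg.symm
      -- Over a point of `U₀ x` both cosets of the fibre have representatives in `U₀`, because `τ`
      -- belongs to `U₀`.
      obtain ⟨k', hk', hkk⟩ : ∃ k' ∈ U₀, k'⁻¹ * g ∈ H := by
        rcases (S.smul_eq_iff _).1 hkg' with h | h
        · exact ⟨k, hk, h⟩
        · exact ⟨k * τ, mul_mem hk hτ, by simpa [mul_assoc] using h⟩
      have : (QuotientGroup.mk g : G ⧸ H) = QuotientGroup.mk k' := (QuotientGroup.eq.2 hkk).symm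
      rw [this, measureReal_def, cosetMeasure_mk_apply lam _ hU₀.measurableSet]
      have h2 : {h : H | k' * (h : G) ∈ (U₀ : Set G)} = {h : H | (h : G) ∈ U₀} := by
        ext h; exact U₀.mul_mem_cancel_left hk'
      rw [h2, hlam]; simp
    · rw [measureReal_def, cosetMeasure_mk_apply lam _ hU₀.measurableSet]
      have h2 : {h : H | g * (h : G) ∈ (U₀ : Set G)} = ∅ := by
        refine Set.eq_empty_of_forall_notMem fun h hh => hg ⟨_, hh, ?_⟩
        change (g * (h : G)) • x = g • x
        rw [mul_smul, S.smul_of_mem h.2]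
      rw [h2]; simp

end Compare

end Homogeneous

end PairQuat

namespace PairQuat

/-! ### Local fields and quaternion division algebras over them -/

/-- `O` is the valuation ring of `K` and `ϖ` a uniformizer; the norm of `K` is normalized. -/
structure IsNormalizedLocal (O K : Type*) [CommRing O] [IsLocalRing O] [NormedField K]
    [Algebra O K] (ϖ : K) (q : ℕ) : Prop where
  injective : Function.Injective (algebraMap O K)
  mem_range : ∀ x : K, x ∈ (algebraMap O K).range ↔ ‖x‖ ≤ 1
  exists_zpow : ∀ x : K, x ≠ 0 → ∃ n : ℤ, ‖x‖ = ‖ϖ‖ ^ n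
  norm_eq : ‖ϖ‖ = (q : ℝ)⁻¹
  one_lt : 1 < q
  card_residue : Nat.card (IsLocalRing.ResidueField O) = q

/-! ### Topology of finite-dimensional spaces over a local field -/

section Topology

set_option linter.unusedSectionVars false

variable {K : Type*} [NontriviallyNormedField K] [ProperSpace K]
  {W : Type*} [AddCommGroup W] [Module K W] [FiniteDimensional K W] [TopologicalSpace W]
  [IsModuleTopology K W]

theorem nonempty_continuousLinearEquiv_pi :
    Nonempty (W ≃L[K] (Fin (Module.finrank K W) → K)) := by
  let e := (Module.finBasis K W).equivFun
  have h1 : Continuous e := IsModuleTopology.continuous_of_linearMap e.toLinearMap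
  have h2 : Continuous e.symm := by
    have : IsModuleTopology K (Fin (Module.finrank K W) → K) := inferInstance
    have := IsModuleTopology.toContinuousAdd K W
    exact IsModuleTopology.continuous_of_linearMap e.symm.toLinearMap
  exact ⟨⟨e, h1, h2⟩⟩

variable (K W)

include K in
theorem polishSpace_of_isModuleTopology : PolishSpace W := by
  obtain ⟨e⟩ := nonempty_continuousLinearEquiv_pi (K := K) (W := W)
  exact e.toHomeomorph.isClosedEmbedding.polishSpace

include K in
theorem locallyCompactSpace_of_isModuleTopology : LocallyCompactSpace W := by
  obtain ⟨e⟩ := nonempty_continuousLinearEquiv_pi (K := K) (W := W)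
  exact e.toHomeomorph.isClosedEmbedding.locallyCompactSpace

end Topology

/-! ### Topology of unit groups and of the group `G` -/

section UnitsTopology

set_option linter.unusedSectionVars false

variable (R : Type*) [Ring R] [TopologicalSpace R] [IsTopologicalRing R]

theorem polishSpace_op [PolishSpace R] : PolishSpace Rᵐᵒᵖ :=
  (MulOpposite.opHomeomorph (M := R)).symm.isClosedEmbedding.polishSpace

theorem locallyCompactSpace_op [LocallyCompactSpace R] : LocallyCompactSpace Rᵐᵒᵖ :=
  (MulOpposite.opHomeomorph (M := R)).symm.isClosedEmbedding.locallyCompactSpace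

theorem polishSpace_units [PolishSpace R] : PolishSpace Rˣ :=
  have := polishSpace_op R
  Units.isClosedEmbedding_embedProduct.polishSpace

theorem locallyCompactSpace_units [T2Space R] [LocallyCompactSpace R] : LocallyCompactSpace Rˣ :=
  have := locallyCompactSpace_op R
  Units.isClosedEmbedding_embedProduct.locallyCompactSpace

variable (K D : Type*) [NontriviallyNormedField K] [ProperSpace K] [Ring D] [Algebra K D]
  [TopologicalSpace D] [IsTopologicalRing D] [PolishSpace D] [LocallyCompactSpace D]

instance : IsTopologicalGroup (PairGroup K D) :=
  inferInstanceAs (IsTopologicalGroup (Dˣ × (Dᵐᵒᵖ)ˣ × GL (Fin 2) K))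

instance : PolishSpace (PairGroup K D) := by
  have := polishSpace_op D
  have := polishSpace_units D
  have := polishSpace_units Dᵐᵒᵖ
  have : PolishSpace (Matrix (Fin 2) (Fin 2) K) :=
    inferInstanceAs (PolishSpace (Fin 2 → Fin 2 → K))
  have := polishSpace_units (Matrix (Fin 2) (Fin 2) K)
  exact inferInstanceAs (PolishSpace (Dˣ × (Dᵐᵒᵖ)ˣ × (Matrix (Fin 2) (Fin 2) K)ˣ))

instance : LocallyCompactSpace (PairGroup K D) := by
  have := locallyCompactSpace_op D
  have := locallyCompactSpace_units D
  have := locallyCompactSpace_units Dᵐᵒᵖ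
  have : LocallyCompactSpace (Matrix (Fin 2) (Fin 2) K) :=
    inferInstanceAs (LocallyCompactSpace (Fin 2 → Fin 2 → K))
  have := locallyCompactSpace_units (Matrix (Fin 2) (Fin 2) K)
  exact inferInstanceAs (LocallyCompactSpace (Dˣ × (Dᵐᵒᵖ)ˣ × (Matrix (Fin 2) (Fin 2) K)ˣ))

instance : PolishSpace (PairSpace D) := inferInstanceAs (PolishSpace (Fin 2 → D))

instance : LocallyCompactSpace (PairSpace D) := inferInstanceAs (LocallyCompactSpace (Fin 2 → D))

instance : IsTopologicalAddGroup (PairSpace D) :=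
  inferInstanceAs (IsTopologicalAddGroup (Fin 2 → D))

variable {K D}

theorem PairGroup.continuous_fst : Continuous (PairGroup.fst : PairGroup K D → D) :=
  Units.continuous_val.comp _root_.continuous_fst

theorem PairGroup.continuous_snd : Continuous (PairGroup.snd : PairGroup K D → D) :=
  MulOpposite.continuous_unop.comp
    (Units.continuous_val.comp (_root_.continuous_fst.comp _root_.continuous_snd))

theorem PairGroup.continuous_mat :
    Continuous (PairGroup.mat : PairGroup K D → Matrix (Fin 2) (Fin 2) K) :=
  Units.continuous_val.comp (_root_.continuous_snd.comp _root_.continuous_snd)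

instance [ContinuousSMul K D] : ContinuousSMul (PairGroup K D) (PairSpace D) := by
  refine ⟨continuous_pi fun i => ?_⟩
  have : (fun p : PairGroup K D × PairSpace D => (p.1 • p.2) i) = fun p =>
      p.1.mat i 0 • (p.1.fst * p.2 0 * p.1.snd) + p.1.mat i 1 • (p.1.fst * p.2 1 * p.1.snd) :=
    funext fun p => PairGroup.smul_apply p.1 p.2 i
  rw [this]
  have h1 := PairGroup.continuous_fst (K := K) (D := D)
  have h2 := PairGroup.continuous_snd (K := K) (D := D)
  have h3 : ∀ j, Continuous fun g : PairGroup K D => g.mat i j := fun j =>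
    (PairGroup.continuous_mat (K := K) (D := D)).matrix_elem i j
  have h4 : ∀ j, Continuous fun x : PairSpace D => x j := fun j =>
    (continuous_apply j : Continuous fun x : Fin 2 → D => x j)
  have h5 : ∀ j, Continuous fun p : PairGroup K D × PairSpace D =>
      p.1.mat i j • (p.1.fst * p.2 j * p.1.snd) := fun j =>
    ((h3 j).comp continuous_fst).smul (((h1.comp continuous_fst).mul
      ((h4 j).comp continuous_snd)).mul (h2.comp continuous_fst))
  exact (h5 0).add (h5 1)

end UnitsTopology

namespace NormConj

/-! ### The valuation of the division algebra and its ring of integers -/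

section Valuation

set_option linter.unusedSectionVars false

variable {K D : Type*} [NontriviallyNormedField K] [IsUltrametricDist K] [ProperSpace K]
  [CharZero K] [Ring D] [Nontrivial D] [NoZeroDivisors D] [Algebra K D] [FiniteDimensional K D]
  [TopologicalSpace D] [IsModuleTopology K D] [IsTopologicalRing D]
  (Q : NormConj K D)
include Q

theorem continuous_trace : Continuous Q.trace :=
  have : IsModuleTopology K K := inferInstance
  IsModuleTopology.continuous_of_linearMap Q.trace

theorem continuous_conj : Continuous Q.conj :=
  IsModuleTopology.continuous_of_linearMap Q.conj

theorem continuous_norm : Continuous (reducedNorm K : D → K) := by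
  have h : (reducedNorm K : D → K) = fun a => 2⁻¹ * Q.trace (a * Q.conj a) := by
    funext a
    rw [Q.mul_conj, Algebra.algebraMap_eq_smul_one, map_smul]
    change _ = 2⁻¹ * (_ * Q.tr 1)
    rw [Q.tr_one, mul_comm, mul_assoc, mul_inv_cancel₀ two_ne_zero, mul_one]
  rw [h]
  exact continuous_const.mul (Q.continuous_trace.comp (continuous_id.mul Q.continuous_conj))

/-- The reduced norm of a division algebra is anisotropic, hence bounded below on the compact unit
sphere. The sup norm of a vector is attained by a coordinate, so every vector can be scaled to the
sphere and homogeneity gives `|N(x)| ≥ m ‖x‖²`. -/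
theorem isCompact_norm_le (r : ℝ) : IsCompact {a : D | ‖reducedNorm K a‖ ≤ r} := by
  obtain ⟨e⟩ := nonempty_continuousLinearEquiv_pi (K := K) (W := D)
  set E := Fin (Module.finrank K D) → K
  let f : E → ℝ := fun x => ‖reducedNorm K (e.symm x)‖
  have hf : Continuous f := (Q.continuous_norm.comp e.symm.continuous).norm
  have hfs : ∀ (c : K) (x : E), f (c • x) = ‖c‖ ^ 2 * f x := by
    intro c x
    simp only [f, map_smul, Q.nrd_smul, norm_mul, norm_pow]
  have hf0 : ∀ x, f x = 0 → x = 0 := by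
    intro x hx
    have := Q.nrd_eq_zero.1 (norm_eq_zero.1 hx)
    simpa using this
  obtain ⟨m, hm, hmf⟩ : ∃ m > 0, ∀ x ∈ Metric.sphere (0 : E) 1, m ≤ f x := by
    rcases (Metric.sphere (0 : E) 1).eq_empty_or_nonempty with h | h
    · exact ⟨1, one_pos, by simp [h]⟩
    · obtain ⟨x, hx, hmin⟩ := (isCompact_sphere (0 : E) 1).exists_isMinOn h hf.continuousOn
      refine ⟨f x, lt_of_le_of_ne (norm_nonneg _) ?_, fun y hy => hmin hy⟩
      intro h0
      rw [hf0 x h0.symm] at hx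
      simp at hx
  have hfm : ∀ x, m * ‖x‖ ^ 2 ≤ f x := by
    intro x
    by_cases hx : x = 0
    · subst hx; simp [f]
    · have hne : Nonempty (Fin (Module.finrank K D)) := by
        by_contra h
        rw [not_nonempty_iff] at h
        exact hx (Subsingleton.elim _ _)
      obtain ⟨i, hi'⟩ := Finite.exists_max fun j => ‖x j‖
      have hi : ‖x i‖ = ‖x‖ := le_antisymm (norm_le_pi_norm x i)
        ((pi_norm_le_iff_of_nonneg (norm_nonneg _)).2 hi')
      have hxi : x i ≠ 0 := by
        rw [← norm_ne_zero_iff, hi]; exact norm_ne_zero_iff.2 hx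
      have h1 : (x i)⁻¹ • x ∈ Metric.sphere (0 : E) 1 := by
        rw [mem_sphere_zero_iff_norm, norm_smul, norm_inv, hi, inv_mul_cancel₀ (norm_ne_zero_iff.2 hx)]
      have h2 := hmf _ h1
      rw [hfs, norm_inv, hi, inv_pow] at h2
      have h3 : 0 < ‖x‖ ^ 2 := by positivity
      rwa [inv_mul_eq_div, le_div_iff₀ h3] at h2
  have hcl : IsClosed {x : E | f x ≤ r} := isClosed_le hf continuous_const
  have hsub : {x : E | f x ≤ r} ⊆ Metric.closedBall 0 (Real.sqrt (r / m)) := by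
    intro x hx
    rw [mem_closedBall_zero_iff]
    apply Real.le_sqrt_of_sq_le
    rw [le_div_iff₀ hm, mul_comm]
    exact (hfm x).trans hx
  have hc := (isCompact_closedBall (0 : E) _).of_isClosed_subset hcl hsub
  have : {a : D | ‖reducedNorm K a‖ ≤ r} = e.symm '' {x : E | f x ≤ r} := by
    ext a
    refine ⟨fun ha => ⟨e a, by
      change ‖reducedNorm K (e.symm (e a))‖ ≤ r
      rwa [e.symm_apply_apply], by simp⟩, ?_⟩
    rintro ⟨x, hx, rfl⟩
    exact hx
  rw [this]
  exact hc.image e.symm.continuous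

theorem isClopen_norm_le {r : ℝ} (hr : 0 < r) : IsClopen {a : D | ‖reducedNorm K a‖ ≤ r} := by
  have h := (IsUltrametricDist.isClopen_closedBall (0 : K) hr.ne').preimage Q.continuous_norm
  have e : {a : D | ‖reducedNorm K a‖ ≤ r} = reducedNorm K ⁻¹' Metric.closedBall 0 r := by
    ext a; simp
  rwa [e]

/-- If the trace exceeded one, the recursion `tr(a^(k+2)) = tr(a) tr(a^(k+1)) - N(a) tr(a^k)` would
force `|tr(a^k)| = |tr(a)|^k` for `k ≥ 1`. But the powers of `a` stay in the compact set of elements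
of norm at most one, where the trace is bounded. -/
theorem norm_tr_le_one {a : D} (ha : ‖reducedNorm K a‖ ≤ 1) : ‖Q.tr a‖ ≤ 1 := by
  by_contra! hT
  have hs : ∀ k : ℕ, Q.tr (a ^ (k + 2)) = Q.tr a * Q.tr (a ^ (k + 1)) -
      reducedNorm K a * Q.tr (a ^ k) := by
    intro k
    have : a ^ (k + 2) = Q.tr a • a ^ (k + 1) + (-reducedNorm K a) • a ^ k := by
      rw [pow_succ, pow_succ, mul_assoc, Q.mul_self, mul_sub, mul_smul_comm, ← pow_succ,
        ← Algebra.commutes, ← Algebra.smul_def, neg_smul, sub_eq_add_neg]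
    rw [this, Q.tr_add, Q.tr_smul, Q.tr_smul]; ring
  have h2 : ‖(2 : K)‖ ≤ 1 := by
    simpa using IsUltrametricDist.norm_natCast_le_one K 2
  have key : ∀ k : ℕ, ‖Q.tr (a ^ k)‖ ≤ ‖Q.tr a‖ ^ k ∧
      ‖Q.tr (a ^ (k + 1))‖ = ‖Q.tr a‖ ^ (k + 1) := by
    intro k
    induction k with
    | zero => simpa [Q.tr_one] using h2
    | succ k ih =>
      refine ⟨ih.2.le, ?_⟩
      have h1 : ‖reducedNorm K a * Q.tr (a ^ k)‖ < ‖Q.tr a * Q.tr (a ^ (k + 1))‖ := by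
        rw [norm_mul, norm_mul, ih.2]
        calc ‖reducedNorm K a‖ * ‖Q.tr (a ^ k)‖ ≤ 1 * ‖Q.tr a‖ ^ k :=
              mul_le_mul ha ih.1 (norm_nonneg _) zero_le_one
          _ < ‖Q.tr a‖ * ‖Q.tr a‖ ^ (k + 1) := by
              rw [one_mul, ← pow_succ']
              exact pow_lt_pow_right₀ hT (by omega)
      rw [hs, sub_eq_add_neg, IsUltrametricDist.norm_add_eq_max_of_norm_ne_norm
        (by rw [norm_neg]; exact h1.ne'), norm_neg, max_eq_left h1.le, norm_mul, ih.2, ← pow_succ']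
  obtain ⟨M, hM⟩ := ((Q.isCompact_norm_le 1).image Q.continuous_trace).isBounded.exists_norm_le
  obtain ⟨k, hk⟩ := pow_unbounded_of_one_lt M hT
  have h1 := hM (Q.tr (a ^ (k + 1))) ⟨a ^ (k + 1), by
    change ‖_‖ ≤ 1
    rw [Q.nrd_pow, norm_pow]
    exact pow_le_one₀ (norm_nonneg _) ha, rfl⟩
  rw [(key k).2] at h1
  have h3 := pow_le_pow_right₀ hT.le (Nat.le_succ k)
  exact absurd (hk.trans_le (h3.trans h1)) (lt_irrefl _)

/-- Divide by the larger element, so that one summand becomes `1`; then `N(1 + c) = 1 + tr(c) +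
N(c)` and the bound on the trace apply. -/
theorem nrd_add_le_max (a b : D) :
    ‖reducedNorm K (a + b)‖ ≤ max ‖reducedNorm K a‖ ‖reducedNorm K b‖ := by
  have key : ∀ a b : D, ‖reducedNorm K a‖ ≤ ‖reducedNorm K b‖ →
      ‖reducedNorm K (a + b)‖ ≤ ‖reducedNorm K b‖ := by
    intro a b hab
    by_cases hb : b = 0
    · subst hb
      rw [Q.nrd_zero, norm_zero] at hab
      rw [add_zero, Q.nrd_zero, norm_zero]; exact hab
    · have hN : reducedNorm K b ≠ 0 := fun h => hb (Q.nrd_eq_zero.1 h)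
      obtain ⟨-, hb'⟩ := Q.mul_inv_smul_conj hb
      set b' := (reducedNorm K b)⁻¹ • Q.conj b
      have e : a + b = (1 + a * b') * b := by rw [add_mul, one_mul, mul_assoc, hb', mul_one, add_comm]
      have h1 : ‖reducedNorm K (a * b')‖ ≤ 1 := by
        have h2 := congrArg (fun d => ‖reducedNorm K d‖) hb'
        simp only [Q.nrd_mul, NormConj.nrd_one, norm_mul, norm_one] at h2
        rw [Q.nrd_mul, norm_mul]
        calc _ ≤ ‖reducedNorm K b‖ * ‖reducedNorm K b'‖ := by gcongr
          _ = 1 := by rw [mul_comm]; exact h2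
      have h3 : ‖reducedNorm K (1 + a * b')‖ ≤ 1 := by
        rw [Q.nrd_one_add]
        refine (IsUltrametricDist.norm_add_le_max _ _).trans (max_le ?_ h1)
        refine (IsUltrametricDist.norm_add_le_max _ _).trans (max_le ?_ (Q.norm_tr_le_one h1))
        rw [norm_one]
      rw [e, Q.nrd_mul, norm_mul]
      exact mul_le_of_le_one_left (norm_nonneg _) h3
  rcases le_total ‖reducedNorm K a‖ ‖reducedNorm K b‖ with h | h
  · exact (key a b h).trans (le_max_right _ _)
  · rw [add_comm]; exact (key b a h).trans (le_max_left _ _)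

theorem nrd_add_le {a b : D} {r : ℝ} (ha : ‖reducedNorm K a‖ ≤ r) (hb : ‖reducedNorm K b‖ ≤ r) :
    ‖reducedNorm K (a + b)‖ ≤ r := (Q.nrd_add_le_max a b).trans (max_le ha hb)

theorem nrd_sub_le {a b : D} {r : ℝ} (ha : ‖reducedNorm K a‖ ≤ r) (hb : ‖reducedNorm K b‖ ≤ r) :
    ‖reducedNorm K (a - b)‖ ≤ r := by
  rw [sub_eq_add_neg]; exact Q.nrd_add_le ha (by rwa [Q.nrd_neg])

theorem nrd_sum_le {ι : Type*} (s : Finset ι) (f : ι → D) {r : ℝ} (hr : 0 ≤ r)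
    (h : ∀ i ∈ s, ‖reducedNorm K (f i)‖ ≤ r) : ‖reducedNorm K (∑ i ∈ s, f i)‖ ≤ r := by
  classical
  induction s using Finset.induction_on with
  | empty => rw [Finset.sum_empty, Q.nrd_zero, norm_zero]; exact hr
  | insert i s hi ih =>
    rw [Finset.sum_insert hi]
    exact Q.nrd_add_le (h i (Finset.mem_insert_self i s))
      (ih fun j hj => h j (Finset.mem_insert_of_mem hj))

variable {O : Type*} [CommRing O] [IsLocalRing O] [Algebra O K] [Algebra O D] [IsScalarTower O K D]
  {ϖ : K} {q : ℕ} (hO : IsNormalizedLocal O K ϖ q)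
include hO

/-- If `|N(a)| > 1`, the leading term of a monic integral equation dominates all others in the
ultrametric valuation. Conversely, the quadratic equation of `a` has integral coefficients once the
norm, and therefore the trace, is integral. -/
theorem isIntegral_iff {a : D} : IsIntegral O a ↔ ‖reducedNorm K a‖ ≤ 1 := by
  constructor
  · rintro ⟨p, hp, hpa⟩
    by_contra! h1
    have hd : p.natDegree ≠ 0 := by
      intro h0
      rw [hp.natDegree_eq_zero.1 h0] at hpa
      simp at hpa
    have hsum : a ^ p.natDegree = - ∑ i ∈ Finset.range p.natDegree, algebraMap O D (p.coeff i) * a ^ i := by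
      rw [← Polynomial.aeval_def, hp.as_sum] at hpa
      simp only [map_add, map_pow, Polynomial.aeval_X, map_sum, map_mul, Polynomial.aeval_C] at hpa
      exact eq_neg_of_add_eq_zero_left hpa
    have h2 : ‖reducedNorm K (a ^ p.natDegree)‖ ≤ ‖reducedNorm K a‖ ^ (p.natDegree - 1) := by
      rw [hsum, Q.nrd_neg]
      refine Q.nrd_sum_le _ _ (by positivity) fun i hi => ?_
      rw [IsScalarTower.algebraMap_apply O K D, ← Algebra.smul_def, Q.nrd_smul, Q.nrd_pow,
        norm_mul, norm_pow, norm_pow]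
      have h3 : ‖algebraMap O K (p.coeff i)‖ ≤ 1 := (hO.mem_range _).1 ⟨_, rfl⟩
      calc ‖algebraMap O K (p.coeff i)‖ ^ 2 * ‖reducedNorm K a‖ ^ i
          ≤ 1 * ‖reducedNorm K a‖ ^ (p.natDegree - 1) := by
            gcongr
            · exact pow_le_one₀ (norm_nonneg _) h3
            · exact h1.le
            · have := Finset.mem_range.1 hi; omega
        _ = _ := one_mul _
    rw [Q.nrd_pow, norm_pow] at h2
    exact absurd h2 (not_le.2 (pow_lt_pow_right₀ h1 (by omega)))
  · intro ha
    obtain ⟨t, ht⟩ := (hO.mem_range _).2 (Q.norm_tr_le_one ha)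
    obtain ⟨n, hn⟩ := (hO.mem_range _).2 ha
    refine ⟨Polynomial.X ^ 2 - Polynomial.C t * Polynomial.X + Polynomial.C n, by monicity!, ?_⟩
    rw [← Polynomial.aeval_def]
    simp only [map_add, map_sub, map_pow, map_mul, Polynomial.aeval_X, Polynomial.aeval_C]
    rw [IsScalarTower.algebraMap_apply O K D, IsScalarTower.algebraMap_apply O K D n, ht, hn,
      pow_two, Q.mul_self, Algebra.smul_def]
    abel

end Valuation

end NormConj

end PairQuat

namespace PairQuat

/-! ### Haar measures normalized by a compact open set -/

section HaarOf

set_option linter.unusedSectionVars false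

/-- The choice operator in `haarOf` has a genuine witness, namely the Haar measure normalized on the
compact set `A`. -/
theorem haarOf_spec {G : Type*} [Group G] [TopologicalSpace G] [IsTopologicalGroup G]
    [LocallyCompactSpace G] [SecondCountableTopology G] [MeasurableSpace G] [BorelSpace G]
    {A : Set G} (hA : IsCompact A) (hA' : (interior A).Nonempty) :
    (haarOf A).IsHaarMeasure ∧ (haarOf A).Regular ∧ haarOf A A = 1 := by
  refine Classical.epsilon_spec (p := fun μ : Measure G => μ.IsHaarMeasure ∧ μ.Regular ∧ μ A = 1)
    ⟨Measure.haarMeasure ⟨⟨A, hA⟩, hA'⟩, inferInstance, Measure.regular_haarMeasure,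
      Measure.haarMeasure_self (K₀ := ⟨⟨A, hA⟩, hA'⟩)⟩

theorem addHaarOf_spec {V : Type*} [AddGroup V] [TopologicalSpace V] [IsTopologicalAddGroup V]
    [LocallyCompactSpace V] [SecondCountableTopology V] [MeasurableSpace V] [BorelSpace V]
    {A : Set V} (hA : IsCompact A) (hA' : (interior A).Nonempty) :
    (addHaarOf A).IsAddHaarMeasure ∧ (addHaarOf A).Regular ∧ addHaarOf A A = 1 := by
  refine Classical.epsilon_spec
    (p := fun μ : Measure V => μ.IsAddHaarMeasure ∧ μ.Regular ∧ μ A = 1)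
    ⟨Measure.addHaarMeasure ⟨⟨A, hA⟩, hA'⟩, inferInstance, Measure.regular_addHaarMeasure,
      Measure.addHaarMeasure_self (K₀ := ⟨⟨A, hA⟩, hA'⟩)⟩

end HaarOf

/-! ### Moduli of scalars -/

section Modulus

open scoped Pointwise NNReal ENNReal

set_option linter.unusedSectionVars false

variable {O K : Type*} [CommRing O] [IsLocalRing O] [NontriviallyNormedField K]
  [IsUltrametricDist K] [ProperSpace K] [Algebra O K] {ϖ : K} {q : ℕ}
  (hO : IsNormalizedLocal O K ϖ q)

namespace IsNormalizedLocal

include hO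

theorem norm_pos : 0 < ‖ϖ‖ := by
  rw [hO.norm_eq]; have := hO.one_lt; positivity

theorem ne_zero : ϖ ≠ 0 := norm_pos_iff.1 hO.norm_pos

theorem norm_lt_one : ‖ϖ‖ < 1 := by
  rw [hO.norm_eq]
  exact inv_lt_one_of_one_lt₀ (by exact_mod_cast hO.one_lt)

theorem norm_le_of_lt_one {x : K} (hx : ‖x‖ < 1) : ‖x‖ ≤ ‖ϖ‖ := by
  by_cases h0 : x = 0
  · simp [h0]
  obtain ⟨n, hn⟩ := hO.exists_zpow x h0
  rw [hn] at hx ⊢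
  have h1 : 0 < n := by
    by_contra! h
    exact absurd hx (not_lt.2 (one_le_zpow_of_nonpos₀ hO.norm_pos hO.norm_lt_one.le h))
  calc ‖ϖ‖ ^ n ≤ ‖ϖ‖ ^ (1 : ℤ) := zpow_le_zpow_right_of_le_one₀ hO.norm_pos hO.norm_lt_one.le h1
    _ = _ := zpow_one _

theorem isUnit_iff (a : O) : IsUnit a ↔ ‖algebraMap O K a‖ = 1 := by
  have hle : ∀ b : O, ‖algebraMap O K b‖ ≤ 1 := fun b => (hO.mem_range _).1 ⟨b, rfl⟩
  constructor
  · rintro ⟨⟨a, b, hab, hba⟩, rfl⟩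
    refine le_antisymm (hle a) ?_
    have h := congrArg (fun c => ‖algebraMap O K c‖) hab
    simp only [map_mul, norm_mul, map_one, norm_one] at h
    change 1 ≤ ‖algebraMap O K a‖
    rw [← h]
    exact mul_le_of_le_one_right (norm_nonneg _) (hle b)
  · intro h
    have h0 : algebraMap O K a ≠ 0 := norm_ne_zero_iff.1 (by rw [h]; exact one_ne_zero)
    obtain ⟨b, hb⟩ := (hO.mem_range ((algebraMap O K a)⁻¹)).2 (by rw [norm_inv, h, inv_one])
    refine IsUnit.of_mul_eq_one b (hO.injective ?_)
    rw [map_mul, hb, mul_inv_cancel₀ h0, map_one]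

theorem mem_maximalIdeal_iff (a : O) :
    a ∈ IsLocalRing.maximalIdeal O ↔ ‖algebraMap O K a‖ < 1 := by
  rw [IsLocalRing.mem_maximalIdeal, mem_nonunits_iff, hO.isUnit_iff]
  exact ⟨fun h => lt_of_le_of_ne ((hO.mem_range _).1 ⟨a, rfl⟩) h, fun h => h.ne⟩

/-- The unit ball is the disjoint union of the cosets of the maximal ideal, one for each residue
class. -/
theorem measure_unitBall [MeasurableSpace K] [BorelSpace K] (μ : Measure K)
    [μ.IsAddHaarMeasure] :
    μ (Metric.closedBall 0 1) = q * μ (Metric.closedBall 0 ‖ϖ‖) := by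
  have hfin : Finite (IsLocalRing.ResidueField O) :=
    Nat.finite_of_card_ne_zero (by rw [hO.card_residue]; have := hO.one_lt; omega)
  have := Fintype.ofFinite (IsLocalRing.ResidueField O)
  choose r hr using IsLocalRing.residue_surjective (R := O)
  have hsub : ∀ a b : O, IsLocalRing.residue O a = IsLocalRing.residue O b ↔
      ‖algebraMap O K a - algebraMap O K b‖ ≤ ‖ϖ‖ := by
    intro a b
    rw [← sub_eq_zero, ← map_sub, IsLocalRing.residue_eq_zero_iff, hO.mem_maximalIdeal_iff, map_sub]
    exact ⟨hO.norm_le_of_lt_one, fun h => h.trans_lt hO.norm_lt_one⟩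
  have hU : Metric.closedBall (0 : K) 1 = ⋃ c : IsLocalRing.ResidueField O,
      Metric.closedBall (algebraMap O K (r c)) ‖ϖ‖ := by
    ext x
    simp only [Set.mem_iUnion, mem_closedBall_iff_norm, sub_zero]
    constructor
    · intro hx
      obtain ⟨a, rfl⟩ := (hO.mem_range x).2 hx
      exact ⟨IsLocalRing.residue O a, (hsub _ _).1 (hr _).symm⟩
    · rintro ⟨c, hc⟩
      have h1 : ‖algebraMap O K (r c)‖ ≤ 1 := (hO.mem_range _).1 ⟨_, rfl⟩
      have h2 := IsUltrametricDist.norm_add_le_max (x - algebraMap O K (r c)) (algebraMap O K (r c))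
      rw [sub_add_cancel] at h2
      exact h2.trans (max_le (hc.trans hO.norm_lt_one.le) h1)
  have hd : Pairwise (Function.onFun Disjoint fun c : IsLocalRing.ResidueField O =>
      Metric.closedBall (algebraMap O K (r c)) ‖ϖ‖) := by
    intro c d hcd
    refine Set.disjoint_left.2 fun x hx hx' => hcd ?_
    rw [mem_closedBall_iff_norm] at hx hx'
    rw [← hr c, ← hr d, hsub]
    have := IsUltrametricDist.norm_add_le_max (x - algebraMap O K (r d))
      (-(x - algebraMap O K (r c)))
    rw [← sub_eq_add_neg, sub_sub_sub_cancel_left, norm_neg] at this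
    exact this.trans (max_le hx' hx)
  rw [hU, measure_iUnion hd fun c => Metric.isClosed_closedBall.measurableSet, tsum_fintype]
  have h3 : ∀ c : IsLocalRing.ResidueField O, μ (Metric.closedBall (algebraMap O K (r c)) ‖ϖ‖) =
      μ (Metric.closedBall 0 ‖ϖ‖) := fun c => Measure.addHaar_closedBall_center μ _ _
  rw [Finset.sum_congr rfl fun c _ => h3 c, Finset.sum_const, Finset.card_univ,
    ← Nat.card_eq_fintype_card, hO.card_residue, nsmul_eq_mul]

omit hO in
theorem smul_closedBall (c : Kˣ) (r : ℝ) :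
    c • Metric.closedBall (0 : K) r = Metric.closedBall 0 (‖(c : K)‖ * r) := by
  ext x
  rw [Set.mem_smul_set_iff_inv_smul_mem, mem_closedBall_zero_iff, mem_closedBall_zero_iff,
    Units.smul_def, smul_eq_mul, norm_mul, Units.val_inv_eq_inv_val, norm_inv,
    inv_mul_le_iff₀ (norm_pos_iff.2 c.ne_zero)]

/-- The modulus of `ϖ` comes from counting residue classes; after division by a power of `ϖ`, every
scalar preserves the unit ball. -/
theorem distribHaarChar_base (c : Kˣ) : distribHaarChar K c = ‖(c : K)‖₊ := by
  borelize K
  let μ : Measure K := Measure.addHaar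
  have hb0 : μ (Metric.closedBall 0 1) ≠ 0 := (Metric.measure_closedBall_pos μ 0 one_pos).ne'
  have hbt : μ (Metric.closedBall 0 1) ≠ ∞ := (isCompact_closedBall (0 : K) 1).measure_lt_top.ne
  have h1 : distribHaarChar K (Units.mk0 ϖ hO.ne_zero) = ‖ϖ‖₊ := by
    refine distribHaarChar_eq_of_measure_smul_eq_mul (μ := μ) hb0 hbt ?_
    rw [smul_closedBall, mul_one, hO.measure_unitBall μ, Units.val_mk0, ← mul_assoc]
    have : (‖ϖ‖₊ : ℝ≥0∞) * q = 1 := by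
      have h : ‖ϖ‖₊ * (q : ℝ≥0) = 1 := by
        ext; push_cast; rw [hO.norm_eq, inv_mul_cancel₀]
        have := hO.one_lt; positivity
      exact_mod_cast congrArg (fun x : ℝ≥0 => (x : ℝ≥0∞)) h
    rw [this, one_mul]
  obtain ⟨n, hn⟩ := hO.exists_zpow c c.ne_zero
  have h2 : distribHaarChar K (c * (Units.mk0 ϖ hO.ne_zero ^ n)⁻¹) = 1 := by
    refine distribHaarChar_eq_of_measure_smul_eq_mul (μ := μ) hb0 hbt ?_
    rw [smul_closedBall, Units.val_mul, ← zpow_neg, Units.val_zpow_eq_zpow_val, norm_mul, norm_zpow,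
      hn, Units.val_mk0, ← zpow_add₀ hO.norm_pos.ne']
    simp
  have h3 : c = c * (Units.mk0 ϖ hO.ne_zero ^ n)⁻¹ * Units.mk0 ϖ hO.ne_zero ^ n := by group
  rw [h3, map_mul, h2, one_mul, map_zpow, h1]
  ext
  push_cast
  simp [← hn]

theorem distribHaarChar_pi (n : ℕ) (c : Kˣ) : distribHaarChar (Fin n → K) c = ‖(c : K)‖₊ ^ n := by
  borelize K
  let μ : Measure K := Measure.addHaar
  have hb0 : μ (Metric.closedBall 0 1) ≠ 0 := (Metric.measure_closedBall_pos μ 0 one_pos).ne'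
  have hbt : μ (Metric.closedBall 0 1) ≠ ∞ := (isCompact_closedBall (0 : K) 1).measure_lt_top.ne
  have hreg : (Measure.pi fun _ : Fin n => μ).Regular := inferInstance
  let s : Set (Fin n → K) := Set.univ.pi fun _ => Metric.closedBall 0 1
  have hs : (Measure.pi fun _ : Fin n => μ) s = μ (Metric.closedBall 0 1) ^ n := by
    rw [Measure.pi_pi]; simp
  refine distribHaarChar_eq_of_measure_smul_eq_mul (μ := Measure.pi fun _ : Fin n => μ) (s := s)
    (by rw [hs]; exact pow_ne_zero _ hb0) (by rw [hs]; exact ENNReal.pow_ne_top hbt) ?_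
  have h : c • s = Set.univ.pi fun _ => c • Metric.closedBall (0 : K) 1 := by
    ext x
    simp only [s, Set.mem_smul_set_iff_inv_smul_mem, Set.mem_pi, Set.mem_univ, true_imp_iff,
      Pi.smul_apply]
  rw [h, Measure.pi_pi, hs]
  simp only [← distribHaarChar_mul μ, hO.distribHaarChar_base, Finset.prod_const,
    Finset.card_univ, Fintype.card_fin, mul_pow, ENNReal.coe_pow]

theorem distribHaarChar_units (W : Type*) [AddCommGroup W] [Module K W] [FiniteDimensional K W]
    [TopologicalSpace W] [IsModuleTopology K W] [IsTopologicalAddGroup W] [ContinuousSMul K W]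
    [LocallyCompactSpace W] (c : Kˣ) :
    distribHaarChar W c = ‖(c : K)‖₊ ^ Module.finrank K W := by
  borelize K W
  obtain ⟨e⟩ := nonempty_continuousLinearEquiv_pi (K := K) (W := W)
  have := polishSpace_of_isModuleTopology K W
  set n := Module.finrank K W
  let μ : Measure (Fin n → K) := Measure.addHaar
  let s : Set (Fin n → K) := Metric.closedBall 0 1
  let ν : Measure W := μ.map e.symm
  have hν : ν.IsAddHaarMeasure := ContinuousLinearEquiv.isAddHaarMeasure_map e.symm μ
  have hνs : ∀ t : Set W, ν t = μ (e.symm ⁻¹' t) := fun t =>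
    (e.symm.toHomeomorph.toMeasurableEquiv).map_apply t
  have hi : e.symm ⁻¹' (e.symm '' s) = s := Set.preimage_image_eq _ e.symm.injective
  refine distribHaarChar_eq_of_measure_smul_eq_mul (μ := ν) (s := e.symm '' s) ?_ ?_ ?_
  · rw [hνs, hi]; exact (Metric.measure_closedBall_pos μ 0 one_pos).ne'
  · rw [hνs, hi]; exact (isCompact_closedBall (0 : Fin n → K) 1).measure_lt_top.ne
  · have h : c • (e.symm '' s) = e.symm '' (c • s) := by
      ext x
      simp only [Set.mem_smul_set, Set.mem_image, exists_exists_and_eq_and, Units.smul_def, map_smul]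
    rw [h, hνs, hνs, hi, Set.preimage_image_eq _ e.symm.injective, ← distribHaarChar_mul μ,
      hO.distribHaarChar_pi, ENNReal.coe_pow]

end IsNormalizedLocal

end Modulus

end PairQuat

namespace PairQuat

/-! ### Comparison of Haar measures along a map that respects cosets -/

section Cosets

set_option linter.unusedSectionVars false

open scoped Pointwise

/-- Both products equal `[U : U'] μ(U') ν(I)`: the cosets of `U'` have equal mass in `G`, and `j`
carries them to disjoint translates of `I` in `W`. This compares a multiplicative with an additive
Haar measure without a density formula. -/
theorem measure_mul_measure_of_cosets {G W : Type*} [Group G] [TopologicalSpace G]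
    [IsTopologicalGroup G] [MeasurableSpace G] [BorelSpace G]
    [AddGroup W] [TopologicalSpace W] [ContinuousAdd W] [MeasurableSpace W] [BorelSpace W]
    (μ : Measure G) [μ.IsMulLeftInvariant] (ν : Measure W) [ν.IsAddLeftInvariant]
    {U U' : Subgroup G} (hle : U' ≤ U) (hU : IsCompact (U : Set G)) (hU' : IsOpen (U' : Set G))
    {j : G → W} (hj : Function.Injective j) {I : Set W} (hI : MeasurableSet I)
    (hjI : ∀ u ∈ U, j '' ((fun h => u * h) '' (U' : Set G)) = (fun w => j u + w) '' I) :
    μ U * ν I = μ U' * ν (j '' U) := by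
  have : CompactSpace U := isCompact_iff_compactSpace.1 hU
  have hop : IsOpen ((U'.subgroupOf U : Subgroup U) : Set U) := hU'.preimage continuous_subtype_val
  have : Finite (U ⧸ U'.subgroupOf U) := Subgroup.quotient_finite_of_isOpen _ hop
  have := Fintype.ofFinite (U ⧸ U'.subgroupOf U)
  let r : (U ⧸ U'.subgroupOf U) → G := fun c => (c.out : U)
  have hr : ∀ c, r c ∈ U := fun c => c.out.2
  have hcov : (U : Set G) = ⋃ c, (fun h => r c * h) '' (U' : Set G) := by
    ext g
    simp only [Set.mem_iUnion]
    constructor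
    · intro hg
      refine ⟨QuotientGroup.mk ⟨g, hg⟩, (r (QuotientGroup.mk ⟨g, hg⟩))⁻¹ * g, ?_, by simp⟩
      have h := QuotientGroup.eq.1 (QuotientGroup.out_eq' (QuotientGroup.mk ⟨g, hg⟩ : U ⧸ U'.subgroupOf U))
      exact Subgroup.mem_subgroupOf.1 h
    · rintro ⟨c, h, hh, rfl⟩
      exact U.mul_mem (hr c) (hle hh)
  have hdis : ∀ c d g, g ∈ (fun h => r c * h) '' (U' : Set G) →
      g ∈ (fun h => r d * h) '' (U' : Set G) → c = d := by
    rintro c d _ ⟨h, hh, rfl⟩ ⟨h', hh', he⟩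
    rw [← QuotientGroup.out_eq' c, ← QuotientGroup.out_eq' d, QuotientGroup.eq]
    refine Subgroup.mem_subgroupOf.2 ?_
    change (r c)⁻¹ * r d ∈ U'
    have : (r c)⁻¹ * r d = h * h'⁻¹ := by
      have he' : r d * h' = r c * h := he
      rw [eq_mul_inv_iff_mul_eq, mul_assoc, he', inv_mul_cancel_left]
    rw [this]
    exact U'.mul_mem hh (U'.inv_mem hh')
  have hmeas : ∀ c, MeasurableSet ((fun h => r c * h) '' (U' : Set G)) := fun c =>
    (isOpenMap_mul_left (r c) _ hU').measurableSet
  have h1 : μ U = Fintype.card (U ⧸ U'.subgroupOf U) * μ U' := by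
    conv_lhs => rw [hcov]
    rw [measure_iUnion (fun c d hcd => Set.disjoint_left.2 fun g hg hg' => hcd (hdis c d g hg hg'))
      hmeas, tsum_fintype]
    have : ∀ c, μ ((fun h => r c * h) '' (U' : Set G)) = μ U' := fun c => measure_smul μ (r c) _
    rw [Finset.sum_congr rfl fun c _ => this c, Finset.sum_const, Finset.card_univ, nsmul_eq_mul]
  have hmeas' : ∀ c, MeasurableSet (j '' ((fun h => r c * h) '' (U' : Set G))) := fun c => by
    rw [hjI _ (hr c)]
    exact (MeasurableEquiv.addLeft (j (r c))).measurableEmbedding.measurableSet_image.2 hI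
  have h2 : ν (j '' U) = Fintype.card (U ⧸ U'.subgroupOf U) * ν I := by
    rw [hcov, Set.image_iUnion, measure_iUnion (fun c d hcd => ?_) hmeas', tsum_fintype]
    · have : ∀ c, ν (j '' ((fun h => r c * h) '' (U' : Set G))) = ν I := fun c => by
        rw [hjI _ (hr c)]
        exact measure_vadd ν (j (r c)) I
      rw [Finset.sum_congr rfl fun c _ => this c, Finset.sum_const, Finset.card_univ, nsmul_eq_mul]
    · refine Set.disjoint_left.2 ?_
      rintro _ ⟨g, hg, rfl⟩ ⟨g', hg', he⟩
      exact hcd (hdis c d g hg (hj he ▸ hg'))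
  rw [h1, h2]
  ring

end Cosets

/-! ### Quadratic norms on topological algebras -/

section QuadraticNorm

open scoped Pointwise NNReal ENNReal

set_option linter.unusedSectionVars false

/-- A multiplicative quadratic form whose unit ball is compact and open. -/
structure IsQuadraticNorm {K R : Type*} [NormedField K] [Ring R] [Algebra K R] [TopologicalSpace R]
    (N : R → K) : Prop where
  apply_mul : ∀ a b, N (a * b) = N a * N b
  apply_one : N 1 = 1
  apply_smul : ∀ (c : K) a, N (c • a) = c ^ 2 * N a
  isCompact : IsCompact {a | ‖N a‖ ≤ 1}
  isOpen : IsOpen {a | ‖N a‖ ≤ 1}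

namespace IsQuadraticNorm

variable {O K : Type*} [CommRing O] [IsLocalRing O] [NontriviallyNormedField K]
  [IsUltrametricDist K] [ProperSpace K] [Algebra O K] {ϖ : K} {q : ℕ}
  (hO : IsNormalizedLocal O K ϖ q)
  {R : Type*} [Ring R] [Algebra K R] [FiniteDimensional K R] [TopologicalSpace R]
  [IsModuleTopology K R] [IsTopologicalRing R] [ContinuousSMul K R] [LocallyCompactSpace R]
  [T2Space R] {N : R → K} (hN : IsQuadraticNorm N)
include hN

theorem zero_mem : (0 : R) ∈ {a | ‖N a‖ ≤ 1} := by
  have : N 0 = 0 := by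
    have := hN.apply_smul 0 0
    simpa using this
  simp [this]

theorem norm_unit_mul_inv (a : Rˣ) : ‖N a‖ * ‖N ((a⁻¹ : Rˣ) : R)‖ = 1 := by
  rw [← norm_mul, ← hN.apply_mul, a.mul_inv, hN.apply_one, norm_one]

theorem norm_unit_pos (a : Rˣ) : 0 < ‖N a‖ := by
  refine lt_of_le_of_ne (norm_nonneg _) fun h => ?_
  have := hN.norm_unit_mul_inv a
  rw [← h, zero_mul] at this
  exact zero_ne_one this

theorem smul_ball (a : Rˣ) (r : ℝ) : a • {b | ‖N b‖ ≤ r} = {b | ‖N b‖ ≤ ‖N a‖ * r} := by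
  ext b
  have h0 := hN.norm_unit_pos a
  have h1 : ‖N ((a⁻¹ : Rˣ) : R)‖ = ‖N a‖⁻¹ := eq_inv_of_mul_eq_one_right (hN.norm_unit_mul_inv a)
  rw [Set.mem_smul_set_iff_inv_smul_mem, Set.mem_ofPred_eq, Set.mem_ofPred_eq, Units.smul_def,
    smul_eq_mul, hN.apply_mul, norm_mul, h1, inv_mul_le_iff₀ h0]

variable [MeasurableSpace R] [BorelSpace R] (ν : Measure R) [ν.IsAddHaarMeasure] [ν.Regular]

theorem measure_ball_ne_zero : ν {a | ‖N a‖ ≤ 1} ≠ 0 :=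
  (hN.isOpen.measure_pos ν ⟨0, hN.zero_mem⟩).ne'

theorem measure_ball_ne_top : ν {a | ‖N a‖ ≤ 1} ≠ ∞ := hN.isCompact.measure_lt_top.ne

include hO in
omit [MeasurableSpace R] [BorelSpace R] in
-- The element `a² / N(a)` has norm of absolute value one and preserves the unit ball, so `a²` has
-- the modulus of the scalar `N(a)`. No determinant of the multiplication map is needed.
theorem distribHaarChar_sq (a : Rˣ) :
    distribHaarChar R a ^ 2 = ‖N a‖₊ ^ Module.finrank K R := by
  borelize R
  let ν : Measure R := Measure.addHaar
  have := polishSpace_of_isModuleTopology K R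
  have : ν.Regular := inferInstance
  let ι : Kˣ →* Rˣ := Units.map (algebraMap K R)
  have hι : ∀ (c : Kˣ) (x : R), ι c • x = c • x := fun c x => by
    rw [Units.smul_def, Units.smul_def, Algebra.smul_def]; rfl
  have h1 : ∀ c : Kˣ, distribHaarChar R (ι c) = ‖(c : K)‖₊ ^ Module.finrank K R := by
    intro c
    rw [← hO.distribHaarChar_units R c]
    refine distribHaarChar_eq_of_measure_smul_eq_mul (μ := ν) (hN.measure_ball_ne_zero ν)
      (hN.measure_ball_ne_top ν) ?_
    rw [distribHaarChar_mul ν]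
    congr 1
    exact Set.image_congr fun x _ => hι c x
  have hNa : N (a : R) ≠ 0 := norm_pos_iff.1 (hN.norm_unit_pos a)
  have hNι : ∀ c : Kˣ, N (ι c : R) = (c : K) ^ 2 := fun c => by
    have : (ι c : R) = (c : K) • 1 := Algebra.algebraMap_eq_smul_one _
    rw [this, hN.apply_smul, hN.apply_one, mul_one]
  let c : Kˣ := Units.mk0 _ hNa
  have h2 : distribHaarChar R (a * a * (ι c)⁻¹) = 1 := by
    refine distribHaarChar_eq_of_measure_smul_eq_mul (μ := ν) (hN.measure_ball_ne_zero ν)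
      (hN.measure_ball_ne_top ν) ?_
    rw [hN.smul_ball, Units.val_mul, Units.val_mul, hN.apply_mul, hN.apply_mul, ← map_inv, hNι, ← pow_two,
      ← mul_pow, Units.val_inv_eq_inv_val, Units.val_mk0, mul_inv_cancel₀ hNa]
    simp
  have h3 : a * a = a * a * (ι c)⁻¹ * ι c := by group
  rw [pow_two, ← map_mul, h3, map_mul, h2, one_mul, h1]
  rfl

include hO in
/-- The measure of the units, when there is a prime element. -/
theorem measure_norm_eq_one {m : ℕ} (hm : Module.finrank K R = 2 * m) (hν : ν {a | ‖N a‖ ≤ 1} = 1)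
    (p : Rˣ) (hp : ‖N p‖ = ‖ϖ‖) (hNc : Continuous N) :
    ν {a | ‖N a‖ = 1} = ENNReal.ofReal (1 - ‖ϖ‖ ^ m) := by
  have h1 : {a | ‖N a‖ = 1} = {a | ‖N a‖ ≤ 1} \ {a | ‖N a‖ ≤ ‖ϖ‖} := by
    ext a
    simp only [Set.mem_ofPred_eq, Set.mem_sdiff, not_le]
    refine ⟨fun h => ⟨h.le, by rw [h]; exact hO.norm_lt_one⟩, fun h => le_antisymm h.1 ?_⟩
    by_contra! h'
    exact absurd (hO.norm_le_of_lt_one h') (not_le.2 h.2)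
  have h2 : {a | ‖N a‖ ≤ ‖ϖ‖} = p • {a | ‖N a‖ ≤ 1} := by rw [hN.smul_ball, hp, mul_one]
  -- With `finrank = 2m`, the modulus of `p` is the square root of `|ϖ|^(2m)`. Thus `m = 2` for `D`
  -- and `m = 1` for a ramified quadratic field.
  have h3 : distribHaarChar R p = ‖ϖ‖₊ ^ m := by
    have h := hN.distribHaarChar_sq hO p
    have hp' : ‖N p‖₊ = ‖ϖ‖₊ := NNReal.eq hp
    rw [hm, hp', mul_comm, pow_mul] at h
    exact (pow_left_inj₀ zero_le zero_le two_ne_zero).1 h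
  have hms : MeasurableSet {a | ‖N a‖ ≤ ‖ϖ‖} := (isClosed_le hNc.norm continuous_const).measurableSet
  rw [h1, measure_sdiff (s₁ := {a | ‖N a‖ ≤ 1}) (s₂ := {a | ‖N a‖ ≤ ‖ϖ‖})
      (fun a ha => le_trans ha hO.norm_lt_one.le) hms.nullMeasurableSet, hν, h2,
    ← distribHaarChar_mul ν, hν, h3, mul_one, ENNReal.ofReal_sub _ (by positivity),
    ENNReal.ofReal_one, ENNReal.ofReal_pow (norm_nonneg _)]
  · simp [enorm_eq_nnnorm]
  · rw [h2, ← distribHaarChar_mul ν, hν]; simp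

include hO in
theorem measure_smul_ball (hν : ν {a | ‖N a‖ ≤ 1} = 1) (n : ℕ) :
    ν ((fun a => ϖ ^ n • a) '' {a | ‖N a‖ ≤ 1}) =
      ENNReal.ofReal (‖ϖ‖ ^ (n * Module.finrank K R)) := by
  have h := distribHaarChar_mul ν (Units.mk0 (ϖ ^ n) (pow_ne_zero n hO.ne_zero)) {a | ‖N a‖ ≤ 1}
  rw [hν, hO.distribHaarChar_units, mul_one] at h
  rw [pow_mul, ← norm_pow, ENNReal.ofReal_pow (norm_nonneg _)]
  refine h.symm.trans ?_
  simp [enorm_eq_nnnorm]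

end IsQuadraticNorm

end QuadraticNorm

end PairQuat

namespace PairQuat

/-! ### The modulus of the action on the space of pairs -/

section PairModulus

open scoped Pointwise NNReal ENNReal

set_option linter.unusedSectionVars false

instance {K D : Type*} [Field K] [Ring D] [Algebra K D] :
    DistribMulAction (PairGroup K D) (PairSpace D) where
  smul_zero g := by
    funext i
    rw [PairGroup.smul_apply]
    change g.mat i 0 • (g.fst * 0 * g.snd) + g.mat i 1 • (g.fst * 0 * g.snd) = 0
    simp
  smul_add g x y := by
    funext i
    change (g • (x + y)) i = (g • x) i + (g • y) i
    simp only [PairGroup.smul_apply]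
    change g.mat i 0 • (g.fst * (x 0 + y 0) * g.snd) +
      g.mat i 1 • (g.fst * (x 1 + y 1) * g.snd) = _
    simp only [mul_add, add_mul, smul_add]
    abel

instance {K D : Type*} [Field K] [Ring D] [Algebra K D] : Module K (PairSpace D) :=
  inferInstanceAs (Module K (Fin 2 → D))

instance {K D : Type*} [Field K] [Ring D] [Algebra K D] [FiniteDimensional K D] :
    FiniteDimensional K (PairSpace D) :=
  inferInstanceAs (FiniteDimensional K (Fin 2 → D))

instance {K D : Type*} [Field K] [TopologicalSpace K] [Ring D] [Algebra K D] [TopologicalSpace D]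
    [IsTopologicalRing K] [IsTopologicalRing D] [IsModuleTopology K D] :
    IsModuleTopology K (PairSpace D) :=
  inferInstanceAs (IsModuleTopology K (Fin 2 → D))

instance {K D : Type*} [Field K] [TopologicalSpace K] [Ring D] [Algebra K D] [TopologicalSpace D]
    [ContinuousSMul K D] : ContinuousSMul K (PairSpace D) :=
  inferInstanceAs (ContinuousSMul K (Fin 2 → D))

/-- The inclusion of the first factor. -/
def PairGroup.inFst (K : Type*) {D : Type*} [Field K] [Ring D] [Algebra K D] :
    Dˣ →* PairGroup K D := MonoidHom.inl _ _

/-- The inclusion of the second factor. -/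
def PairGroup.inSnd (K : Type*) {D : Type*} [Field K] [Ring D] [Algebra K D] :
    (Dᵐᵒᵖ)ˣ →* PairGroup K D := (MonoidHom.inr _ _).comp (MonoidHom.inl _ _)

/-- The inclusion of the third factor. -/
def PairGroup.inMat {K : Type*} (D : Type*) [Field K] [Ring D] [Algebra K D] :
    GL (Fin 2) K →* PairGroup K D := (MonoidHom.inr _ _).comp (MonoidHom.inr _ _)

theorem PairGroup.eq_inFst_mul {K D : Type*} [Field K] [Ring D] [Algebra K D]
    (g : PairGroup K D) : g = inFst K g.1 * inSnd K g.2.1 * inMat D g.2.2 := by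
  refine PairGroup.ext' ?_ ?_ ?_
  · change (g.1 : D) = (g.1 : D) * 1 * 1
    simp
  · change (g.2.1 : Dᵐᵒᵖ).unop = 1 * ((g.2.1 : Dᵐᵒᵖ).unop * 1)
    simp
  · change (g.2.2 : Matrix (Fin 2) (Fin 2) K) = 1 * 1 * (g.2.2 : Matrix (Fin 2) (Fin 2) K)
    rw [one_mul, one_mul]

variable {O K D : Type*} [CommRing O] [IsLocalRing O] [NontriviallyNormedField K]
  [IsUltrametricDist K] [ProperSpace K] [CharZero K] [Algebra O K]
  {ϖ : K} {q : ℕ} (hO : IsNormalizedLocal O K ϖ q)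
  [Ring D] [Nontrivial D] [NoZeroDivisors D] [Algebra K D] [FiniteDimensional K D]
  [TopologicalSpace D] [IsModuleTopology K D] [IsTopologicalRing D] [ContinuousSMul K D]
  [PolishSpace D] [LocallyCompactSpace D]
  (Q : NormConj K D)

include Q in
theorem NormConj.isQuadraticNorm : IsQuadraticNorm (reducedNorm K : D → K) where
  apply_mul := Q.nrd_mul
  apply_one := NormConj.nrd_one
  apply_smul := Q.nrd_smul
  isCompact := Q.isCompact_norm_le 1
  isOpen := (Q.isClopen_norm_le one_pos).isOpen

variable (K D) in
/-- The unit ball of the space of pairs, for the reduced norm. -/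
def pairBall : Set (PairSpace D) := {x | ∀ i, ‖reducedNorm K (x i)‖ ≤ 1}

include Q in
theorem isCompact_pairBall : IsCompact (pairBall K D) :=
  isCompact_pi_infinite fun _ : Fin 2 => Q.isCompact_norm_le 1

include Q in
theorem isOpen_pairBall : IsOpen (pairBall K D) := by
  have : pairBall K D = Set.univ.pi fun _ : Fin 2 => {a : D | ‖reducedNorm K a‖ ≤ 1} := by
    ext x
    exact ⟨fun h i _ => h i, fun h i => h i trivial⟩
  rw [this]
  exact isOpen_set_pi Set.finite_univ fun _ _ => (Q.isClopen_norm_le one_pos).isOpen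

include Q in
theorem zero_mem_pairBall : (0 : PairSpace D) ∈ pairBall K D := fun _ => by
  change ‖reducedNorm K (0 : D)‖ ≤ 1
  rw [Q.nrd_zero, norm_zero]; exact zero_le_one

include Q in
theorem distribHaarChar_eq_of_smul_pairBall {g : PairGroup K D} (h : ∀ x ∈ pairBall K D, g • x ∈ pairBall K D)
    (h' : ∀ x ∈ pairBall K D, g⁻¹ • x ∈ pairBall K D) : distribHaarChar (PairSpace D) g = 1 := by
  let μ : Measure (PairSpace D) := Measure.addHaar
  refine distribHaarChar_eq_of_measure_smul_eq_mul (μ := μ) (s := pairBall K D)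
    ((isOpen_pairBall Q).measure_pos μ ⟨0, zero_mem_pairBall Q⟩).ne'
    (isCompact_pairBall Q).measure_lt_top.ne ?_
  rw [ENNReal.coe_one, one_mul]
  congr 1
  ext x
  rw [Set.mem_smul_set_iff_inv_smul_mem]
  exact ⟨fun hx => by simpa using h _ hx, h' x⟩

include Q in
theorem smul_mem_pairBall {g : PairGroup K D} (h1 : ‖reducedNorm K g.fst‖ ≤ 1)
    (h2 : ‖reducedNorm K g.snd‖ ≤ 1) (h3 : ∀ i j, ‖g.mat i j‖ ≤ 1) {x : PairSpace D}
    (hx : x ∈ pairBall K D) : g • x ∈ pairBall K D := by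
  intro i
  rw [PairGroup.smul_apply]
  refine Q.nrd_add_le ?_ ?_
  all_goals
    rw [Q.nrd_smul, Q.nrd_mul, Q.nrd_mul, norm_mul, norm_mul, norm_mul, norm_pow]
    exact mul_le_one₀ (pow_le_one₀ (norm_nonneg _) (h3 _ _)) (by positivity)
      (mul_le_one₀ (mul_le_one₀ h1 (norm_nonneg _) (hx _)) (norm_nonneg _) h2)

include Q hO in
theorem distribHaarChar_of_scalar (hfin : Module.finrank K D = 4) {g : PairGroup K D} (c : Kˣ)
    (hg : ∀ (x : PairSpace D) i, (g • x) i = (c : K) • x i) :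
    distribHaarChar (PairSpace D) g = ‖(c : K)‖₊ ^ 8 := by
  have hrank : Module.finrank K (PairSpace D) = 8 := by
    change Module.finrank K (Fin 2 → D) = 8
    rw [Module.finrank_pi_fintype]; simp [hfin]
  let μ : Measure (PairSpace D) := Measure.addHaar
  rw [← hrank, ← hO.distribHaarChar_units]
  refine distribHaarChar_eq_of_measure_smul_eq_mul (μ := μ) (s := pairBall K D)
    ((isOpen_pairBall Q).measure_pos μ ⟨0, zero_mem_pairBall Q⟩).ne'
    (isCompact_pairBall Q).measure_lt_top.ne ?_
  rw [distribHaarChar_mul μ]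
  congr 1
  refine Set.image_congr fun x _ => ?_
  funext i
  exact hg x i

include Q in
theorem norm_reducedNorm_unit_inv {a : Dˣ} (h : ‖reducedNorm K (a : D)‖ = 1) :
    ‖reducedNorm K ((a⁻¹ : Dˣ) : D)‖ = 1 := by
  have := Q.isQuadraticNorm.norm_unit_mul_inv a
  rwa [h, one_mul] at this

include Q hO in
-- Again `a² / N(a)` preserves the unit ball of `V`. The space has dimension eight, so `a²` has
-- modulus `|N(a)|⁸` and `a` has modulus `|N(a)|⁴`.
theorem distribHaarChar_inFst (hfin : Module.finrank K D = 4) (a : Dˣ) :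
    distribHaarChar (PairSpace D) (PairGroup.inFst K a) = ‖reducedNorm K (a : D)‖₊ ^ 4 := by
  have hNa : reducedNorm K (a : D) ≠ 0 := norm_pos_iff.1 (Q.isQuadraticNorm.norm_unit_pos a)
  let c : Kˣ := Units.mk0 _ hNa
  let d : Dˣ := Units.map (algebraMap K D) c
  have hd : (d : D) = (c : K) • 1 := Algebra.algebraMap_eq_smul_one _
  have h1 : ‖reducedNorm K ((a * a * d⁻¹ : Dˣ) : D)‖ = 1 := by
    have hd' : ((d⁻¹ : Dˣ) : D) = ((c⁻¹ : Kˣ) : K) • 1 := Algebra.algebraMap_eq_smul_one _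
    rw [Units.val_mul, Units.val_mul, Q.nrd_mul, Q.nrd_mul, hd', Q.nrd_smul, NormConj.nrd_one,
      mul_one, ← pow_two, ← mul_pow, Units.val_inv_eq_inv_val, Units.val_mk0, mul_inv_cancel₀ hNa]
    simp
  have key : ∀ w : Dˣ, ‖reducedNorm K (w : D)‖ = 1 → ∀ x ∈ pairBall K D,
      PairGroup.inFst K w • x ∈ pairBall K D := fun w hw x hx =>
    smul_mem_pairBall (g := PairGroup.inFst K w) Q hw.le (by
      change ‖reducedNorm K (1 : D)‖ ≤ 1
      rw [NormConj.nrd_one, norm_one]) (fun i j => by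
      change ‖(1 : Matrix (Fin 2) (Fin 2) K) i j‖ ≤ 1
      rw [Matrix.one_apply]; split_ifs <;> simp) hx
  have h2 : distribHaarChar (PairSpace D) (PairGroup.inFst K (a * a * d⁻¹)) = 1 :=
    distribHaarChar_eq_of_smul_pairBall Q (key _ h1) (by
      rw [← map_inv]; exact key _ (norm_reducedNorm_unit_inv Q h1))
  have h3 : distribHaarChar (PairSpace D) (PairGroup.inFst K d) = ‖(c : K)‖₊ ^ 8 := by
    refine distribHaarChar_of_scalar hO Q hfin c fun x i => ?_
    rw [PairGroup.smul_apply]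
    change (1 : Matrix (Fin 2) (Fin 2) K) i 0 • ((d : D) * x 0 * 1) +
      (1 : Matrix (Fin 2) (Fin 2) K) i 1 • ((d : D) * x 1 * 1) = _
    rw [hd, Matrix.one_apply, Matrix.one_apply]
    fin_cases i <;> simp
  have h4 : distribHaarChar (PairSpace D) (PairGroup.inFst K a) ^ 2 =
      (‖reducedNorm K (a : D)‖₊ ^ 4) ^ 2 := by
    have : a * a = a * a * d⁻¹ * d := by group
    rw [pow_two, ← map_mul, ← map_mul, this, map_mul, map_mul, h2, one_mul, h3, ← pow_mul]
    rfl
  exact (pow_left_inj₀ zero_le zero_le two_ne_zero).1 h4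

include Q hO in
theorem distribHaarChar_inSnd (hfin : Module.finrank K D = 4) (a : (Dᵐᵒᵖ)ˣ) :
    distribHaarChar (PairSpace D) (PairGroup.inSnd K a) =
      ‖reducedNorm K (a : Dᵐᵒᵖ).unop‖₊ ^ 4 := by
  have hinv : ∀ a : (Dᵐᵒᵖ)ˣ, ‖reducedNorm K (a : Dᵐᵒᵖ).unop‖ *
      ‖reducedNorm K ((a⁻¹ : (Dᵐᵒᵖ)ˣ) : Dᵐᵒᵖ).unop‖ = 1 := fun a =>
    Q.isQuadraticNorm.norm_unit_mul_inv (Units.opEquiv a).unop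
  have hNa : reducedNorm K (a : Dᵐᵒᵖ).unop ≠ 0 := fun h => by
    have := hinv a
    simp [h] at this
  let c : Kˣ := Units.mk0 _ hNa
  let d : (Dᵐᵒᵖ)ˣ := Units.map (algebraMap K Dᵐᵒᵖ) c
  have hd : (d : Dᵐᵒᵖ).unop = (c : K) • 1 := Algebra.algebraMap_eq_smul_one _
  have h1 : ‖reducedNorm K ((a * a * d⁻¹ : (Dᵐᵒᵖ)ˣ) : Dᵐᵒᵖ).unop‖ = 1 := by
    have hd' : ((d⁻¹ : (Dᵐᵒᵖ)ˣ) : Dᵐᵒᵖ).unop = ((c⁻¹ : Kˣ) : K) • 1 :=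
      Algebra.algebraMap_eq_smul_one _
    rw [Units.val_mul, Units.val_mul, MulOpposite.unop_mul, MulOpposite.unop_mul, Q.nrd_mul,
      Q.nrd_mul, hd', Q.nrd_smul, NormConj.nrd_one, mul_one, ← pow_two, ← mul_pow,
      Units.val_inv_eq_inv_val, Units.val_mk0, inv_mul_cancel₀ hNa]
    simp
  have key : ∀ w : (Dᵐᵒᵖ)ˣ, ‖reducedNorm K (w : Dᵐᵒᵖ).unop‖ = 1 → ∀ x ∈ pairBall K D,
      PairGroup.inSnd K w • x ∈ pairBall K D := fun w hw x hx =>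
    smul_mem_pairBall (g := PairGroup.inSnd K w) Q (by
      change ‖reducedNorm K (1 : D)‖ ≤ 1
      rw [NormConj.nrd_one, norm_one]) hw.le (fun i j => by
      change ‖(1 : Matrix (Fin 2) (Fin 2) K) i j‖ ≤ 1
      rw [Matrix.one_apply]; split_ifs <;> simp) hx
  have h2 : distribHaarChar (PairSpace D) (PairGroup.inSnd K (a * a * d⁻¹)) = 1 :=
    distribHaarChar_eq_of_smul_pairBall Q (key _ h1) (by
      rw [← map_inv]
      refine key _ ?_
      have := hinv (a * a * d⁻¹)
      rwa [h1, one_mul] at this)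
  have h3 : distribHaarChar (PairSpace D) (PairGroup.inSnd K d) = ‖(c : K)‖₊ ^ 8 := by
    refine distribHaarChar_of_scalar hO Q hfin c fun x i => ?_
    rw [PairGroup.smul_apply]
    change (1 : Matrix (Fin 2) (Fin 2) K) i 0 • (1 * x 0 * (d : Dᵐᵒᵖ).unop) +
      (1 : Matrix (Fin 2) (Fin 2) K) i 1 • (1 * x 1 * (d : Dᵐᵒᵖ).unop) = _
    rw [hd, Matrix.one_apply, Matrix.one_apply]
    fin_cases i <;> simp
  have h4 : distribHaarChar (PairSpace D) (PairGroup.inSnd K a) ^ 2 =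
      (‖reducedNorm K (a : Dᵐᵒᵖ).unop‖₊ ^ 4) ^ 2 := by
    have : a * a = a * a * d⁻¹ * d := by group
    rw [pow_two, ← map_mul, ← map_mul, this, map_mul, map_mul, h2, one_mul, h3, ← pow_mul]
    rfl
  exact (pow_left_inj₀ zero_le zero_le two_ne_zero).1 h4

/-- A character of `GL(2)` that takes the value `χ(c)²` at the scalars `c` takes the value
`χ(det)`. -/
theorem GL_two_character {K : Type*} [Field K] [CharZero K] (F : GL (Fin 2) K →* ℝ≥0)
    (χ : K →* ℝ≥0)
    (hF : ∀ (c : Kˣ) (g : GL (Fin 2) K), (g : Matrix (Fin 2) (Fin 2) K) = (c : K) • 1 →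
      F g = χ c ^ 2) (g : GL (Fin 2) K) :
    F g = χ (g : Matrix (Fin 2) (Fin 2) K).det := by
  have hconj : ∀ a b c : GL (Fin 2) K, a * b = c * a → F b = F c := fun a b c h => by
    have h' := congrArg F h
    rw [map_mul, map_mul, mul_comm] at h'
    exact mul_right_cancel₀ ((Group.isUnit a).map F).ne_zero h'
  suffices H : ∀ M : Matrix (Fin 2) (Fin 2) K, M.det ≠ 0 →
      ∀ g : GL (Fin 2) K, (g : Matrix (Fin 2) (Fin 2) K) = M → F g = χ M.det by
    refine H _ ?_ g rfl
    exact ((Matrix.isUnit_iff_isUnit_det _).1 g.isUnit).ne_zero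
  intro M hM
  refine Matrix.diagonal_transvection_induction_of_det_ne_zero
    (fun M => ∀ g : GL (Fin 2) K, (g : Matrix (Fin 2) (Fin 2) K) = M → F g = χ M.det) M hM ?_ ?_ ?_
  · intro d hd g hg
    have hd' : (Matrix.diagonal d).det = d 0 * d 1 := by
      rw [Matrix.det_diagonal, Fin.prod_univ_two]
    have hd0 : d 0 ≠ 0 := fun h => hd (by rw [hd', h, zero_mul])
    have hd1 : d 1 ≠ 0 := fun h => hd (by rw [hd', h, mul_zero])
    let s : GL (Fin 2) K := Matrix.GeneralLinearGroup.mkOfDetNeZero !![0, 1; 1, 0] (by simp)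
    let g' : GL (Fin 2) K := Matrix.GeneralLinearGroup.mkOfDetNeZero !![d 1, 0; 0, d 0]
      (by simp [hd0, hd1])
    -- The permutation matrix conjugates `diag(d₀, d₁)` to `diag(d₁, d₀)`, and a commutative
    -- character does not see conjugation.
    have e1 : F g = F g' := by
      refine hconj s _ _ (Units.ext ?_)
      rw [Units.val_mul, Units.val_mul, hg]
      change !![0, 1; 1, 0] * _ = !![d 1, 0; 0, d 0] * !![0, 1; 1, 0]
      ext i j; fin_cases i <;> fin_cases j <;> simp [Matrix.mul_apply]
    -- The product of the two diagonal matrices is the scalar `d₀ d₁`, where the hypothesis applies;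
    -- a square root in the nonnegative reals finishes.
    have e2 : F (g * g') = χ (d 0 * d 1) ^ 2 := by
      refine hF (Units.mk0 (d 0 * d 1) (mul_ne_zero hd0 hd1)) _ ?_
      rw [Units.val_mul, hg]
      change _ * !![d 1, 0; 0, d 0] = (d 0 * d 1) • 1
      ext i j; fin_cases i <;> fin_cases j <;> simp [Matrix.mul_apply, mul_comm]
    rw [map_mul, ← e1, ← pow_two] at e2
    rw [hd']
    exact (pow_left_inj₀ zero_le zero_le two_ne_zero).1 e2
  · intro t g hg
    have hdet : t.toMatrix.det = 1 := t.det
    rw [hdet, map_one]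
    obtain ⟨i, j, hij, c⟩ := t
    have hd : (Matrix.diagonal fun k => if k = i then (2 : K) else 1).det ≠ 0 := by
      rw [Matrix.det_diagonal]
      exact Finset.prod_ne_zero_iff.2 fun k _ => by split_ifs <;> norm_num
    let s : GL (Fin 2) K := Matrix.GeneralLinearGroup.mkOfDetNeZero _ hd
    -- Conjugation by a diagonal matrix with entries `2` and `1` squares a transvection, so the
    -- character takes the value `1` there.
    have e : F g = F (g * g) := by
      refine hconj s _ _ (Units.ext ?_)
      rw [Units.val_mul, Units.val_mul, Units.val_mul, hg]
      change (Matrix.diagonal fun k => if k = i then (2 : K) else 1) * Matrix.transvection i j c =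
        Matrix.transvection i j c * Matrix.transvection i j c * Matrix.diagonal _
      rw [Matrix.transvection_mul_transvection_same _ _ hij]
      ext a b
      rw [Matrix.diagonal_mul, Matrix.mul_diagonal]
      fin_cases i <;> fin_cases j <;> fin_cases a <;> fin_cases b <;>
        simp [Matrix.transvection, Matrix.single, two_mul] at hij ⊢
    rw [map_mul] at e
    exact (mul_eq_left₀ ((Group.isUnit g).map F).ne_zero).1 e.symm
  · intro A B hA hB PA PB g hg
    have h1 : F g = F (Matrix.GeneralLinearGroup.mkOfDetNeZero A hA *
        Matrix.GeneralLinearGroup.mkOfDetNeZero B hB) := by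
      congr 1
      exact Units.ext hg
    rw [h1, map_mul, PA _ rfl, PB _ rfl, Matrix.det_mul, map_mul]

include Q hO in
theorem distribHaarChar_inMat (hfin : Module.finrank K D = 4) (m : GL (Fin 2) K) :
    distribHaarChar (PairSpace D) (PairGroup.inMat D m) =
      ‖(m : Matrix (Fin 2) (Fin 2) K).det‖₊ ^ 4 := by
  refine GL_two_character ((distribHaarChar (PairSpace D)).comp (PairGroup.inMat D))
    ((powMonoidHom 4).comp (nnnormHom : K →*₀ ℝ≥0).toMonoidHom) (fun c g hg => ?_) m
  refine (distribHaarChar_of_scalar hO Q hfin c fun x i => ?_).trans ?_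
  · rw [PairGroup.smul_apply]
    change (g : Matrix (Fin 2) (Fin 2) K) i 0 • (1 * x 0 * 1) +
      (g : Matrix (Fin 2) (Fin 2) K) i 1 • (1 * x 1 * 1) = _
    rw [hg]
    fin_cases i <;> simp
  · change _ = (‖(c : K)‖₊ ^ 4) ^ 2
    rw [← pow_mul]

include Q hO in
-- The exponent four is twice that of the square of `N(g₁₁) N(g₁₂) det g₂` in the law of `P`; so
-- `|P|⁻² dy` is invariant.
theorem distribHaarChar_pair (hfin : Module.finrank K D = 4) (g : PairGroup K D) :
    distribHaarChar (PairSpace D) g =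
      ‖reducedNorm K g.fst * reducedNorm K g.snd * g.mat.det‖₊ ^ 4 := by
  conv_lhs => rw [g.eq_inFst_mul]
  rw [map_mul, map_mul, distribHaarChar_inFst hO Q hfin, distribHaarChar_inSnd hO Q hfin,
    distribHaarChar_inMat hO Q hfin, nnnorm_mul, nnnorm_mul, mul_pow, mul_pow]
  rfl

end PairModulus

end PairQuat

namespace PairQuat

/-! ### Congruence subgroups -/

section Congruence

open scoped Pointwise NNReal ENNReal

set_option linter.unusedSectionVars false

/-- The set of matrices with entries of norm at most `r`. -/
def matBall (K : Type*) [NormedField K] (r : ℝ) : Set (Matrix (Fin 2) (Fin 2) K) :=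
  {m | ∀ i j, ‖m i j‖ ≤ r}

/-! ### Ultrametric estimates for two-by-two matrices -/

section Matrix

variable {K : Type*} [NormedField K] [IsUltrametricDist K] {r s : ℝ}

theorem add_mem_matBall {m m' : Matrix (Fin 2) (Fin 2) K} (hm : m ∈ matBall K r)
    (hm' : m' ∈ matBall K r) : m + m' ∈ matBall K r := fun i j =>
  (IsUltrametricDist.norm_add_le_max _ _).trans (max_le (hm i j) (hm' i j))

theorem neg_mem_matBall {m : Matrix (Fin 2) (Fin 2) K} (hm : m ∈ matBall K r) :
    -m ∈ matBall K r := fun i j => by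
  rw [Matrix.neg_apply, norm_neg]; exact hm i j

theorem mul_mem_matBall {m m' : Matrix (Fin 2) (Fin 2) K} (hr : 0 ≤ r) (hm : m ∈ matBall K r)
    (hm' : m' ∈ matBall K s) : m * m' ∈ matBall K (r * s) := fun i j => by
  rw [Matrix.mul_apply, Fin.sum_univ_two]
  refine (IsUltrametricDist.norm_add_le_max _ _).trans (max_le ?_ ?_) <;>
  · rw [norm_mul]
    exact mul_le_mul (hm _ _) (hm' _ _) (norm_nonneg _) hr

theorem norm_det_le {m : Matrix (Fin 2) (Fin 2) K} (hm : m ∈ matBall K 1) : ‖m.det‖ ≤ 1 := by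
  rw [Matrix.det_fin_two, sub_eq_add_neg]
  refine (IsUltrametricDist.norm_add_le_max _ _).trans (max_le ?_ ?_)
  · rw [norm_mul]; exact mul_le_one₀ (hm _ _) (norm_nonneg _) (hm _ _)
  · rw [norm_neg, norm_mul]; exact mul_le_one₀ (hm _ _) (norm_nonneg _) (hm _ _)

theorem norm_det_add {m m' : Matrix (Fin 2) (Fin 2) K} (hm : m ∈ matBall K 1)
    (hd : ‖m.det‖ = 1) (hr : r < 1) (hm' : m' ∈ matBall K r) : ‖(m + m').det‖ = 1 := by
  have h1 : m + m' ∈ matBall K 1 := add_mem_matBall hm fun i j => (hm' i j).trans hr.le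
  refine le_antisymm (norm_det_le h1) ?_
  by_contra! h
  have e : m.det = (m + m').det + (-(m' 0 0 * (m + m') 1 1) + -(m 0 0 * m' 1 1) +
      (m' 0 1 * (m + m') 1 0 + m 0 1 * m' 1 0)) := by
    simp only [Matrix.det_fin_two, Matrix.add_apply]; ring
  have h0 : 0 ≤ r := (norm_nonneg _).trans (hm' 0 0)
  have h2 : ∀ a b : K, ‖a‖ ≤ r → ‖b‖ ≤ 1 → ‖a * b‖ ≤ r := fun a b ha hb => by
    rw [norm_mul, ← mul_one r]; exact mul_le_mul ha hb (norm_nonneg _) h0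
  have h3 : ∀ a b : K, ‖a‖ ≤ r → ‖b‖ ≤ r → ‖a + b‖ ≤ r := fun a b ha hb =>
    (IsUltrametricDist.norm_add_le_max _ _).trans (max_le ha hb)
  have h4 : ‖m.det‖ < 1 := by
    rw [e]
    refine (IsUltrametricDist.norm_add_le_max _ _).trans_lt (max_lt h ((h3 _ _ (h3 _ _ ?_ ?_)
      (h3 _ _ ?_ ?_)).trans_lt hr))
    · rw [norm_neg]; exact h2 _ _ (hm' _ _) (h1 _ _)
    · rw [norm_neg, mul_comm]; exact h2 _ _ (hm' _ _) (hm _ _)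
    · exact h2 _ _ (hm' _ _) (h1 _ _)
    · rw [mul_comm]; exact h2 _ _ (hm' _ _) (hm _ _)
  exact h4.ne hd

theorem inv_mem_matBall {m m' : Matrix (Fin 2) (Fin 2) K} (hmm : m * m' = 1)
    (hm : m ∈ matBall K 1) (hd : ‖m.det‖ = 1) : m' ∈ matBall K 1 := by
  have h0 : m.det ≠ 0 := norm_ne_zero_iff.1 (by rw [hd]; exact one_ne_zero)
  have e : m' = m.det⁻¹ • m.adjugate := by
    have h := congrArg (m.adjugate * ·) hmm
    simp only [← mul_assoc, Matrix.adjugate_mul, mul_one, smul_mul_assoc, one_mul] at h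
    rw [← h, smul_smul, inv_mul_cancel₀ h0, one_smul]
  intro i j
  rw [e, Matrix.smul_apply, smul_eq_mul, norm_mul, norm_inv, hd, inv_one, one_mul,
    Matrix.adjugate_fin_two]
  fin_cases i <;> fin_cases j <;> simp [hm _ _]

end Matrix

variable {O K D : Type*} [CommRing O] [IsLocalRing O] [NontriviallyNormedField K]
  [IsUltrametricDist K] [ProperSpace K] [CharZero K] [Algebra O K]
  {ϖ : K} {q : ℕ} (hO : IsNormalizedLocal O K ϖ q)
  [Ring D] [Nontrivial D] [NoZeroDivisors D] [Algebra K D] [FiniteDimensional K D]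
  [TopologicalSpace D] [IsModuleTopology K D] [IsTopologicalRing D] [ContinuousSMul K D]
  [PolishSpace D] [LocallyCompactSpace D]
  (Q : NormConj K D)

namespace NormConj

include Q

theorem norm_nrd_add {a b : D} (ha : ‖reducedNorm K a‖ = 1) {r : ℝ} (hr : r < 1)
    (hb : ‖reducedNorm K b‖ ≤ r) : ‖reducedNorm K (a + b)‖ = 1 := by
  refine le_antisymm (Q.nrd_add_le ha.le (hb.trans hr.le)) ?_
  by_contra! h
  have h1 := Q.nrd_add_le (a := a + b) (b := -b) (le_max_left _ r)
    ((Q.nrd_neg b).symm ▸ hb.trans (le_max_right _ _))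
  rw [add_neg_cancel_right, ha] at h1
  exact absurd h1 (not_le.2 (max_lt h hr))

theorem norm_nrd_of_mul_eq_one {a b : D} (h : a * b = 1) (ha : ‖reducedNorm K a‖ = 1) :
    ‖reducedNorm K b‖ = 1 := by
  have := congrArg (fun d => ‖reducedNorm K d‖) h
  simpa only [Q.nrd_mul, norm_mul, ha, one_mul, NormConj.nrd_one, norm_one] using this

theorem norm_nrd_mul_le {a b : D} {r : ℝ} (ha : ‖reducedNorm K a‖ = 1)
    (hb : ‖reducedNorm K b‖ ≤ r) : ‖reducedNorm K (a * b)‖ ≤ r := by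
  rwa [Q.nrd_mul, norm_mul, ha, one_mul]

theorem norm_nrd_mul_le' {a b : D} {r : ℝ} (ha : ‖reducedNorm K a‖ ≤ r)
    (hb : ‖reducedNorm K b‖ = 1) : ‖reducedNorm K (a * b)‖ ≤ r := by
  rwa [Q.nrd_mul, norm_mul, hb, mul_one]

/-- The group of the elements of `𝒦` that are congruent to `1`, up to `r`. -/
def congruenceSubgroup (r : ℝ) (hr : 0 ≤ r) : Subgroup (PairGroup K D) where
  -- The bounds for the two norms are `r ^ 2` because the reduced norm is quadratic: for `r = |ϖ|ⁿ`
  -- they express congruence to `1` modulo `ϖⁿ O_D`, as the last condition does for the matrix.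
  carrier := {g | ‖reducedNorm K g.fst‖ = 1 ∧ ‖reducedNorm K g.snd‖ = 1 ∧ g.mat ∈ matBall K 1 ∧
    ‖g.mat.det‖ = 1 ∧ ‖reducedNorm K (g.fst - 1)‖ ≤ r ^ 2 ∧ ‖reducedNorm K (g.snd - 1)‖ ≤ r ^ 2 ∧
    g.mat - 1 ∈ matBall K r}
  one_mem' := by
    have hm : (1 : Matrix (Fin 2) (Fin 2) K) ∈ matBall K 1 := fun i j => by
      rw [Matrix.one_apply]; split_ifs <;> simp
    refine ⟨?_, ?_, hm, ?_, ?_, ?_, fun i j => ?_⟩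
    · rw [PairGroup.fst_one, nrd_one, norm_one]
    · rw [PairGroup.snd_one, nrd_one, norm_one]
    · rw [PairGroup.mat_one, Matrix.det_one, norm_one]
    · rw [PairGroup.fst_one, sub_self, Q.nrd_zero, norm_zero]; positivity
    · rw [PairGroup.snd_one, sub_self, Q.nrd_zero, norm_zero]; positivity
    · rw [PairGroup.mat_one, sub_self, Matrix.zero_apply, norm_zero]; exact hr
  mul_mem' := by
    rintro g h ⟨g1, g2, g3, g4, g5, g6, g7⟩ ⟨h1, h2, h3, h4, h5, h6, h7⟩
    refine ⟨?_, ?_, ?_, ?_, ?_, ?_, ?_⟩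
    · rw [PairGroup.fst_mul, Q.nrd_mul, norm_mul, g1, h1, one_mul]
    · rw [PairGroup.snd_mul, Q.nrd_mul, norm_mul, g2, h2, one_mul]
    · rw [PairGroup.mat_mul, ← one_mul (1 : ℝ)]; exact mul_mem_matBall zero_le_one g3 h3
    · rw [PairGroup.mat_mul, Matrix.det_mul, norm_mul, g4, h4, one_mul]
    · have e : (g * h).fst - 1 = (g.fst - 1) * h.fst + (h.fst - 1) := by
        rw [PairGroup.fst_mul]; noncomm_ring
      rw [e]; exact Q.nrd_add_le (Q.norm_nrd_mul_le' g5 h1) h5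
    · have e : (g * h).snd - 1 = (h.snd - 1) * g.snd + (g.snd - 1) := by
        rw [PairGroup.snd_mul]; noncomm_ring
      rw [e]; exact Q.nrd_add_le (Q.norm_nrd_mul_le' h6 g2) g6
    · have e : (g * h).mat - 1 = (g.mat - 1) * h.mat + (h.mat - 1) := by
        rw [PairGroup.mat_mul]; noncomm_ring
      rw [e]
      refine add_mem_matBall ?_ h7
      rw [← mul_one r]; exact mul_mem_matBall hr g7 h3
  inv_mem' := by
    rintro g ⟨g1, g2, g3, g4, g5, g6, g7⟩
    have i1 := Q.norm_nrd_of_mul_eq_one g.fst_mul_fst_inv g1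
    have i2 := Q.norm_nrd_of_mul_eq_one g.snd_mul_snd_inv g2
    have i3 := inv_mem_matBall g.mat_mul_mat_inv g3 g4
    refine ⟨i1, i2, i3, ?_, ?_, ?_, ?_⟩
    · have h := congrArg (fun m : Matrix (Fin 2) (Fin 2) K => ‖m.det‖) g.mat_mul_mat_inv
      simpa only [Matrix.det_mul, norm_mul, g4, one_mul, Matrix.det_one, norm_one] using h
    · have e : g⁻¹.fst - 1 = -(g⁻¹.fst * (g.fst - 1)) := by
        rw [mul_sub, mul_one, g.fst_inv_mul_fst, neg_sub]
      rw [e, Q.nrd_neg]; exact Q.norm_nrd_mul_le i1 g5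
    · have e : g⁻¹.snd - 1 = -(g⁻¹.snd * (g.snd - 1)) := by
        rw [mul_sub, mul_one, g.snd_inv_mul_snd, neg_sub]
      rw [e, Q.nrd_neg]; exact Q.norm_nrd_mul_le i2 g6
    · have e : g⁻¹.mat - 1 = -(g⁻¹.mat * (g.mat - 1)) := by
        rw [mul_sub, mul_one, g.mat_inv_mul_mat, neg_sub]
      rw [e, ← one_mul r]
      exact neg_mem_matBall (mul_mem_matBall zero_le_one i3 g7)

theorem mem_congruenceSubgroup {r : ℝ} {hr : 0 ≤ r} {g : PairGroup K D} :
    g ∈ Q.congruenceSubgroup r hr ↔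
    ‖reducedNorm K g.fst‖ = 1 ∧ ‖reducedNorm K g.snd‖ = 1 ∧ g.mat ∈ matBall K 1 ∧
    ‖g.mat.det‖ = 1 ∧ ‖reducedNorm K (g.fst - 1)‖ ≤ r ^ 2 ∧ ‖reducedNorm K (g.snd - 1)‖ ≤ r ^ 2 ∧
    g.mat - 1 ∈ matBall K r := Iff.rfl

theorem mem_congruenceSubgroup_one {g : PairGroup K D} :
    g ∈ Q.congruenceSubgroup 1 zero_le_one ↔ ‖reducedNorm K g.fst‖ = 1 ∧
      ‖reducedNorm K g.snd‖ = 1 ∧ g.mat ∈ matBall K 1 ∧ ‖g.mat.det‖ = 1 := by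
  refine ⟨fun h => ⟨h.1, h.2.1, h.2.2.1, h.2.2.2.1⟩, fun h => ⟨h.1, h.2.1, h.2.2.1, h.2.2.2, ?_⟩⟩
  have h1 : ‖reducedNorm K (1 : D)‖ = 1 := by rw [nrd_one, norm_one]
  refine ⟨?_, ?_, ?_⟩
  · rw [one_pow]; exact Q.nrd_sub_le h.1.le h1.le
  · rw [one_pow]; exact Q.nrd_sub_le h.2.1.le h1.le
  · rw [sub_eq_add_neg]
    refine add_mem_matBall h.2.2.1 (neg_mem_matBall fun i j => ?_)
    rw [Matrix.one_apply]; split_ifs <;> simp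

theorem congruenceSubgroup_le (r : ℝ) (hr : 0 ≤ r) :
    Q.congruenceSubgroup r hr ≤ Q.congruenceSubgroup 1 zero_le_one := fun _ h =>
  Q.mem_congruenceSubgroup_one.2 ⟨h.1, h.2.1, h.2.2.1, h.2.2.2.1⟩

theorem isOpen_congruenceSubgroup {r : ℝ} (hr : 0 < r) :
    IsOpen (Q.congruenceSubgroup r hr.le : Set (PairGroup K D)) := by
  have hs : IsOpen {c : K | ‖c‖ = 1} := by
    have := IsUltrametricDist.isOpen_sphere (0 : K) one_ne_zero
    convert this using 1
    ext c; simp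
  have hb : ∀ {s : ℝ}, 0 < s → IsOpen {c : K | ‖c‖ ≤ s} := fun {s} h => by
    have := IsUltrametricDist.isOpen_closedBall (0 : K) h.ne'
    convert this using 1
    ext c; simp
  have hm : ∀ {s : ℝ}, 0 < s → IsOpen (matBall K s) := fun {s} h => by
    have : matBall K s = ⋂ i, ⋂ j, (fun m : Matrix (Fin 2) (Fin 2) K => m i j) ⁻¹' {c | ‖c‖ ≤ s} := by
      ext m; simp [matBall]
    rw [this]
    exact isOpen_iInter_of_finite fun i => isOpen_iInter_of_finite fun j =>
      (hb h).preimage (continuous_id.matrix_elem i j)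
  have c1 := PairGroup.continuous_fst (K := K) (D := D)
  have c2 := PairGroup.continuous_snd (K := K) (D := D)
  have c3 := PairGroup.continuous_mat (K := K) (D := D)
  have cN := Q.continuous_norm
  exact (hs.preimage (cN.comp c1)).inter <| (hs.preimage (cN.comp c2)).inter <|
    ((hm one_pos).preimage c3).inter <| (hs.preimage c3.matrix_det).inter <|
    ((hb (by positivity)).preimage (cN.comp (c1.sub continuous_const))).inter <|
    ((hb (by positivity)).preimage (cN.comp (c2.sub continuous_const))).inter <|
    (hm hr).preimage (c3.sub continuous_const)

end NormConj

/-- The unit group is closed in the product of the ring and its opposite through `a ↦ (a, a⁻¹)`;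
bounding only `a` would not suffice. -/
theorem isCompact_units_of_isCompact {R : Type*} [Ring R] [TopologicalSpace R]
    [IsTopologicalRing R] [T2Space R] {C : Set R} (hC : IsCompact C) :
    IsCompact {a : Rˣ | (a : R) ∈ C ∧ ((a⁻¹ : Rˣ) : R) ∈ C} := by
  have h := (Units.isClosedEmbedding_embedProduct (α := R)).isCompact_preimage
    (hC.prod (hC.image MulOpposite.continuous_op))
  convert h using 1
  ext a
  simp [Units.embedProduct]

namespace NormConj

include Q

theorem isCompact_congruenceSubgroup {r : ℝ} (hr : 0 < r) :
    IsCompact (Q.congruenceSubgroup r hr.le : Set (PairGroup K D)) := by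
  have := polishSpace_op D
  have hmc : IsCompact (matBall K 1) := by
    have : matBall K 1 = {m : Fin 2 → Fin 2 → K | ∀ i, m i ∈ {f : Fin 2 → K | ∀ j, f j ∈
        Metric.closedBall (0 : K) 1}} := by
      ext m
      exact forall_congr' fun i => forall_congr' fun j => mem_closedBall_zero_iff.symm
    rw [this]
    exact isCompact_pi_infinite fun i => isCompact_pi_infinite fun j => isCompact_closedBall 0 1
  have hop : IsCompact (MulOpposite.op '' {a : D | ‖reducedNorm K a‖ ≤ 1}) :=
    (Q.isCompact_norm_le 1).image MulOpposite.continuous_op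
  have hc := (isCompact_units_of_isCompact (Q.isCompact_norm_le 1)).prod
    ((isCompact_units_of_isCompact hop).prod (isCompact_units_of_isCompact hmc))
  refine IsCompact.of_isClosed_subset (show IsCompact (X := PairGroup K D) _ from hc)
    ((Q.congruenceSubgroup r hr.le).isClosed_of_isOpen (Q.isOpen_congruenceSubgroup hr)) ?_
  intro g hg
  have hg' := (Q.congruenceSubgroup r hr.le).inv_mem hg
  exact ⟨⟨hg.1.le, hg'.1.le⟩, ⟨⟨_, hg.2.1.le, rfl⟩, ⟨_, hg'.2.1.le, rfl⟩⟩, hg.2.2.1, hg'.2.2.1⟩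

variable [Algebra O D] [IsScalarTower O K D]

include hO in
theorem integralGroup_eq :
    integralGroup O K D = (Q.congruenceSubgroup 1 zero_le_one : Set (PairGroup K D)) := by
  ext g
  rw [SetLike.mem_coe, Q.mem_congruenceSubgroup_one]
  have key : ∀ a b : D, a * b = 1 → ((IsIntegral O a ∧ IsIntegral O b) ↔ ‖reducedNorm K a‖ = 1) := by
    intro a b hab
    rw [Q.isIntegral_iff hO, Q.isIntegral_iff hO]
    have h := congrArg (fun d => ‖reducedNorm K d‖) hab
    simp only [Q.nrd_mul, norm_mul, NormConj.nrd_one, norm_one] at h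
    constructor
    · rintro ⟨h1, h2⟩
      refine le_antisymm h1 ?_
      rw [← h]; exact mul_le_of_le_one_right (norm_nonneg _) h2
    · intro h1
      exact ⟨h1.le, (Q.norm_nrd_of_mul_eq_one hab h1).le⟩
  have k1 := key _ _ g.fst_mul_fst_inv
  have k2 := key _ _ g.snd_mul_snd_inv
  constructor
  · rintro ⟨h1, h2, h3, h4, h5⟩
    have m1 : g.mat ∈ matBall K 1 := fun i j => (hO.mem_range _).1 (h5 i j).1
    have m2 : g⁻¹.mat ∈ matBall K 1 := fun i j => (hO.mem_range _).1 (h5 i j).2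
    refine ⟨k1.1 ⟨h1, h2⟩, k2.1 ⟨h3, h4⟩, m1, le_antisymm (norm_det_le m1) ?_⟩
    have h := congrArg (fun m : Matrix (Fin 2) (Fin 2) K => ‖m.det‖) g.mat_mul_mat_inv
    simp only [Matrix.det_mul, norm_mul, Matrix.det_one, norm_one] at h
    rw [← h]; exact mul_le_of_le_one_right (norm_nonneg _) (norm_det_le m2)
  · rintro ⟨h1, h2, h3, h4⟩
    obtain ⟨a1, a2⟩ := k1.2 h1
    obtain ⟨b1, b2⟩ := k2.2 h2
    have m2 := inv_mem_matBall g.mat_mul_mat_inv h3 h4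
    exact ⟨a1, a2, b1, b2, fun i j => ⟨(hO.mem_range _).2 (h3 i j), (hO.mem_range _).2 (m2 i j)⟩⟩

include hO in
theorem integralPairs_eq : integralPairs O D = pairBall K D := by
  ext x
  exact forall_congr' fun i => Q.isIntegral_iff hO

include hO in
theorem groupMeasure_spec : (groupMeasure O K D).IsHaarMeasure ∧ (groupMeasure O K D).Regular ∧
    groupMeasure O K D (Q.congruenceSubgroup 1 zero_le_one : Set (PairGroup K D)) = 1 := by
  have h := haarOf_spec (A := integralGroup O K D)
    (by rw [Q.integralGroup_eq hO]; exact Q.isCompact_congruenceSubgroup one_pos)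
    (by
      rw [Q.integralGroup_eq hO, (Q.isOpen_congruenceSubgroup one_pos).interior_eq]
      exact ⟨1, one_mem _⟩)
  rw [← Q.integralGroup_eq hO]
  exact h

include hO in
theorem spaceMeasure_spec : (spaceMeasure O D).IsAddHaarMeasure ∧ (spaceMeasure O D).Regular ∧
    spaceMeasure O D (pairBall K D) = 1 := by
  have h := addHaarOf_spec (A := integralPairs O D)
    (by rw [Q.integralPairs_eq hO]; exact isCompact_pairBall Q)
    (by
      rw [Q.integralPairs_eq hO, (isOpen_pairBall Q).interior_eq]
      exact ⟨0, zero_mem_pairBall Q⟩)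
  rw [← Q.integralPairs_eq hO]
  exact h

end NormConj

end Congruence

end PairQuat

namespace PairQuat

/-! ### Volumes of congruence subgroups -/

section Volumes

open scoped Pointwise NNReal ENNReal

set_option linter.unusedSectionVars false

/-! ### Volumes over the base field and of `GL(2)` over its valuation ring -/

section Base

variable {O K : Type*} [CommRing O] [IsLocalRing O] [NontriviallyNormedField K]
  [IsUltrametricDist K] [ProperSpace K] [Algebra O K]
  {ϖ : K} {q : ℕ} (hO : IsNormalizedLocal O K ϖ q) [MeasurableSpace K] [BorelSpace K]
  (μ : Measure K) [μ.IsAddHaarMeasure] (hμ : μ (Metric.closedBall 0 1) = 1)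

namespace IsNormalizedLocal

include hO hμ

theorem measure_closedBall_pow (n : ℕ) :
    μ (Metric.closedBall 0 (‖ϖ‖ ^ n)) = ENNReal.ofReal (‖ϖ‖ ^ n) := by
  have h := distribHaarChar_mul μ (Units.mk0 (ϖ ^ n) (pow_ne_zero n hO.ne_zero))
    (Metric.closedBall 0 1)
  rw [smul_closedBall, hμ, hO.distribHaarChar_base, Units.val_mk0, mul_one, mul_one, norm_pow] at h
  rw [← h, ← norm_pow, ofReal_norm]
  rfl

theorem measure_closedBall_norm : μ (Metric.closedBall 0 ‖ϖ‖) = ENNReal.ofReal ‖ϖ‖ := by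
  simpa using hO.measure_closedBall_pow μ hμ 1

theorem measure_sphere : μ {x | ‖x‖ = 1} = ENNReal.ofReal (1 - ‖ϖ‖) := by
  have h1 : {x : K | ‖x‖ = 1} = Metric.closedBall 0 1 \ Metric.closedBall 0 ‖ϖ‖ := by
    ext x
    simp only [Set.mem_sdiff, mem_closedBall_zero_iff, not_le]
    refine ⟨fun h => ⟨h.le, by rw [h]; exact hO.norm_lt_one⟩, fun h => le_antisymm h.1 ?_⟩
    by_contra! h'
    exact absurd (hO.norm_le_of_lt_one h') (not_le.2 h.2)
  rw [h1, measure_sdiff (Metric.closedBall_subset_closedBall hO.norm_lt_one.le)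
    Metric.isClosed_closedBall.measurableSet.nullMeasurableSet, hμ,
    hO.measure_closedBall_norm μ hμ, ENNReal.ofReal_sub _ (norm_nonneg _), ENNReal.ofReal_one]
  rw [hO.measure_closedBall_norm μ hμ]; exact ENNReal.ofReal_ne_top

/-- Since `a` is a unit, the condition says that `d` differs from the integral element `a⁻¹ z` by a
unit, so the set is a translate of the unit sphere. -/
theorem measure_unit_slice {a z : K} (ha : ‖a‖ = 1) (hz : ‖z‖ ≤ 1) :
    μ {d | ‖d‖ ≤ 1 ∧ ‖a * d - z‖ = 1} = ENNReal.ofReal (1 - ‖ϖ‖) := by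
  have ha0 : a ≠ 0 := norm_ne_zero_iff.1 (by rw [ha]; exact one_ne_zero)
  have h1 : {d | ‖d‖ ≤ 1 ∧ ‖a * d - z‖ = 1} = (fun d => d + -(a⁻¹ * z)) ⁻¹' {x | ‖x‖ = 1} := by
    ext d
    have e : a * d - z = a * (d + -(a⁻¹ * z)) := by
      rw [mul_add, mul_neg, mul_inv_cancel_left₀ ha0, sub_eq_add_neg]
    have e2 : ‖a⁻¹ * z‖ ≤ 1 := by rw [norm_mul, norm_inv, ha, inv_one, one_mul]; exact hz
    change _ ∧ _ ↔ ‖d + -(a⁻¹ * z)‖ = 1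
    rw [e, norm_mul, ha, one_mul]
    refine ⟨fun h => h.2, fun h => ⟨?_, h⟩⟩
    have := IsUltrametricDist.norm_add_le_max (d + -(a⁻¹ * z)) (a⁻¹ * z)
    rw [neg_add_cancel_right] at this
    exact this.trans (max_le h.le e2)
  rw [h1, measure_preimage_add_right, hO.measure_sphere μ hμ]

/-- The set of invertible integral matrices, as a set of pairs of rows. -/
theorem measure_rows [SigmaFinite μ] : ((μ.prod μ).prod (μ.prod μ)) {p : (K × K) × (K × K) |
    (‖p.1.1‖ ≤ 1 ∧ ‖p.1.2‖ ≤ 1) ∧ (‖p.2.1‖ ≤ 1 ∧ ‖p.2.2‖ ≤ 1) ∧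
      ‖p.1.1 * p.2.2 - p.1.2 * p.2.1‖ = 1} =
    ENNReal.ofReal ((1 - ‖ϖ‖ ^ 2) * (1 - ‖ϖ‖)) := by
  have : PolishSpace K := inferInstance
  have hsq : ∀ r : ℝ, {p : K × K | ‖p.1‖ ≤ r ∧ ‖p.2‖ ≤ r} =
      Metric.closedBall 0 r ×ˢ Metric.closedBall 0 r := fun r => by ext p; simp
  have hmeas : ∀ r : ℝ, MeasurableSet {p : K × K | ‖p.1‖ ≤ r ∧ ‖p.2‖ ≤ r} := fun r => by
    rw [hsq]
    exact Metric.isClosed_closedBall.measurableSet.prod Metric.isClosed_closedBall.measurableSet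
  have hS : MeasurableSet {p : (K × K) × (K × K) |
    (‖p.1.1‖ ≤ 1 ∧ ‖p.1.2‖ ≤ 1) ∧ (‖p.2.1‖ ≤ 1 ∧ ‖p.2.2‖ ≤ 1) ∧
      ‖p.1.1 * p.2.2 - p.1.2 * p.2.1‖ = 1} := by
    refine ((hmeas 1).preimage measurable_fst).inter (((hmeas 1).preimage measurable_snd).inter ?_)
    refine (isClosed_eq ?_ continuous_const).measurableSet
    fun_prop
  let P : Set (K × K) := {p | ‖p.1‖ ≤ 1 ∧ ‖p.2‖ ≤ 1} \ {p | ‖p.1‖ ≤ ‖ϖ‖ ∧ ‖p.2‖ ≤ ‖ϖ‖}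
  have hP : (μ.prod μ) P = ENNReal.ofReal (1 - ‖ϖ‖ ^ 2) := by
    rw [measure_sdiff (s₁ := {p : K × K | ‖p.1‖ ≤ 1 ∧ ‖p.2‖ ≤ 1})
      (s₂ := {p : K × K | ‖p.1‖ ≤ ‖ϖ‖ ∧ ‖p.2‖ ≤ ‖ϖ‖})
      (fun p hp => ⟨hp.1.trans hO.norm_lt_one.le, hp.2.trans hO.norm_lt_one.le⟩)
      (hmeas _).nullMeasurableSet, hsq, hsq, Measure.prod_prod, Measure.prod_prod, hμ,
      hO.measure_closedBall_norm μ hμ, ← ENNReal.ofReal_mul (norm_nonneg _), one_mul,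
      ENNReal.ofReal_sub _ (by positivity), ENNReal.ofReal_one, pow_two]
    rw [hsq, Measure.prod_prod, hO.measure_closedBall_norm μ hμ]
    exact ENNReal.mul_ne_top ENNReal.ofReal_ne_top ENNReal.ofReal_ne_top
  have hmul : ∀ x y : K, ‖x‖ ≤ 1 → ‖y‖ ≤ 1 → ‖x * y‖ ≤ 1 := fun x y hx hy => by
    rw [norm_mul]; exact mul_le_one₀ hx (norm_nonneg _) hy
  -- Fix the first row. If it is primitive, one of its entries is a unit, and for every integral
  -- value of the entry below it the remaining entry ranges over a translate of the units. If it is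
  -- not primitive, the determinant is never a unit.
  have slice : ∀ x : K × K, (μ.prod μ) (Prod.mk x ⁻¹' {p : (K × K) × (K × K) |
    (‖p.1.1‖ ≤ 1 ∧ ‖p.1.2‖ ≤ 1) ∧ (‖p.2.1‖ ≤ 1 ∧ ‖p.2.2‖ ≤ 1) ∧
      ‖p.1.1 * p.2.2 - p.1.2 * p.2.1‖ = 1}) =
      P.indicator (fun _ => ENNReal.ofReal (1 - ‖ϖ‖)) x := by
    rintro ⟨a, b⟩
    have hT := (hS.preimage (measurable_prodMk_left (x := (a, b))))
    by_cases hP' : (a, b) ∈ P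
    · rw [Set.indicator_of_mem hP']
      obtain ⟨⟨ha, hb⟩, hab⟩ := hP'
      by_cases ha1 : ‖a‖ = 1
      · rw [Measure.prod_apply hT]
        have : ∀ c, μ (Prod.mk c ⁻¹' (Prod.mk (a, b) ⁻¹' {p : (K × K) × (K × K) |
          (‖p.1.1‖ ≤ 1 ∧ ‖p.1.2‖ ≤ 1) ∧ (‖p.2.1‖ ≤ 1 ∧ ‖p.2.2‖ ≤ 1) ∧
            ‖p.1.1 * p.2.2 - p.1.2 * p.2.1‖ = 1})) =
            (Metric.closedBall (0 : K) 1).indicator (fun _ => ENNReal.ofReal (1 - ‖ϖ‖)) c := by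
          intro c
          by_cases hc : c ∈ Metric.closedBall (0 : K) 1
          · rw [Set.indicator_of_mem hc]
            rw [mem_closedBall_zero_iff] at hc
            rw [← hO.measure_unit_slice μ hμ ha1 (hmul b c hb hc)]
            congr 1
            ext d
            exact ⟨fun h => ⟨h.2.1.2, h.2.2⟩, fun h => ⟨⟨ha, hb⟩, ⟨hc, h.1⟩, h.2⟩⟩
          · rw [Set.indicator_of_notMem hc]
            rw [mem_closedBall_zero_iff] at hc
            convert measure_empty (μ := μ)
            exact Set.eq_empty_of_forall_notMem fun d h => hc h.2.1.1
        simp_rw [this]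
        rw [lintegral_indicator_const Metric.isClosed_closedBall.measurableSet, hμ, mul_one]
      · have hb1 : ‖b‖ = 1 := by
          by_contra h
          exact hab ⟨hO.norm_le_of_lt_one (lt_of_le_of_ne ha ha1),
            hO.norm_le_of_lt_one (lt_of_le_of_ne hb h)⟩
        rw [Measure.prod_apply_symm hT]
        have : ∀ d, μ ((fun c => (c, d)) ⁻¹' (Prod.mk (a, b) ⁻¹' {p : (K × K) × (K × K) |
          (‖p.1.1‖ ≤ 1 ∧ ‖p.1.2‖ ≤ 1) ∧ (‖p.2.1‖ ≤ 1 ∧ ‖p.2.2‖ ≤ 1) ∧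
            ‖p.1.1 * p.2.2 - p.1.2 * p.2.1‖ = 1})) =
            (Metric.closedBall (0 : K) 1).indicator (fun _ => ENNReal.ofReal (1 - ‖ϖ‖)) d := by
          intro d
          by_cases hd : d ∈ Metric.closedBall (0 : K) 1
          · rw [Set.indicator_of_mem hd]
            rw [mem_closedBall_zero_iff] at hd
            rw [← hO.measure_unit_slice μ hμ hb1 (hmul a d ha hd)]
            congr 1
            ext c
            refine ⟨fun h => ⟨h.2.1.1, ?_⟩, fun h => ⟨⟨ha, hb⟩, ⟨h.1, hd⟩, ?_⟩⟩
            · rw [norm_sub_rev]; exact h.2.2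
            · have := h.2; rw [norm_sub_rev] at this; exact this
          · rw [Set.indicator_of_notMem hd]
            rw [mem_closedBall_zero_iff] at hd
            convert measure_empty (μ := μ)
            exact Set.eq_empty_of_forall_notMem fun c h => hd h.2.1.2
        simp_rw [this]
        rw [lintegral_indicator_const Metric.isClosed_closedBall.measurableSet, hμ, mul_one]
    · rw [Set.indicator_of_notMem hP']
      convert measure_empty (μ := μ.prod μ)
      refine Set.eq_empty_of_forall_notMem ?_
      rintro ⟨c, d⟩ ⟨⟨ha, hb⟩, ⟨hc, hd⟩, h⟩
      refine hP' ⟨⟨ha, hb⟩, fun ⟨h1, h2⟩ => ?_⟩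
      have h3 : ‖a * d - b * c‖ ≤ ‖ϖ‖ := by
        rw [sub_eq_add_neg]
        refine (IsUltrametricDist.norm_add_le_max _ _).trans (max_le ?_ ?_)
        · rw [norm_mul, ← mul_one ‖ϖ‖]; exact mul_le_mul h1 hd (norm_nonneg _) (norm_nonneg _)
        · rw [norm_neg, norm_mul, ← mul_one ‖ϖ‖]
          exact mul_le_mul h2 hc (norm_nonneg _) (norm_nonneg _)
      exact absurd hO.norm_lt_one (not_lt.2 (h.symm.le.trans h3))
  have hPm : MeasurableSet P := (hmeas 1).diff (hmeas _)
  rw [Measure.prod_apply hS]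
  simp_rw [slice]
  rw [lintegral_indicator_const hPm, hP, ← ENNReal.ofReal_mul (by linarith [hO.norm_lt_one]),
    mul_comm]

end IsNormalizedLocal

end Base

variable {O K D : Type*} [CommRing O] [IsLocalRing O] [NontriviallyNormedField K]
  [IsUltrametricDist K] [ProperSpace K] [CharZero K] [Algebra O K]
  {ϖ : K} {q : ℕ} (hO : IsNormalizedLocal O K ϖ q)
  [Ring D] [Nontrivial D] [NoZeroDivisors D] [Algebra K D] [FiniteDimensional K D]
  [TopologicalSpace D] [IsModuleTopology K D] [IsTopologicalRing D] [ContinuousSMul K D]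
  [PolishSpace D] [LocallyCompactSpace D]
  (Q : NormConj K D)

/-- The coordinates of an element of `G_K`. -/
def PairGroup.coord (g : PairGroup K D) : D × D × ((K × K) × (K × K)) :=
  (g.fst, g.snd, (g.mat 0 0, g.mat 0 1), (g.mat 1 0, g.mat 1 1))

theorem PairGroup.coord_injective : Function.Injective (PairGroup.coord (K := K) (D := D)) := by
  intro g h e
  simp only [PairGroup.coord, Prod.mk.injEq] at e
  refine PairGroup.ext' e.1 e.2.1 ?_
  ext i j
  fin_cases i <;> fin_cases j <;> simp [e]

include Q in
theorem exists_pairGroup {a b : D} {m : Matrix (Fin 2) (Fin 2) K} (ha : a ≠ 0) (hb : b ≠ 0)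
    (hm : m.det ≠ 0) : ∃ g : PairGroup K D, g.fst = a ∧ g.snd = b ∧ g.mat = m := by
  obtain ⟨h1, h2⟩ := Q.mul_inv_smul_conj ha
  obtain ⟨h3, h4⟩ := Q.mul_inv_smul_conj hb
  have hu : IsUnit m.det := isUnit_iff_ne_zero.2 hm
  exact ⟨PairGroup.mk' a _ b _ m m⁻¹ h1 h2 h3 h4 (Matrix.mul_nonsing_inv m hu)
    (Matrix.nonsing_inv_mul m hu), rfl, rfl, rfl⟩

namespace NormConj

include Q

include hO in
-- In the coordinates `D × D × M(2)` the subgroup becomes the box of level `ϖⁿ` around `1`, of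
-- volume `t^(12n)` since the space has dimension twelve. The whole group becomes `O_D^× × O_D^× ×
-- GL(2)_O`, of additive volume `(1 - t²)² · (1 - t²)(1 - t)`.
theorem measure_congruenceSubgroup (dg : Measure (PairGroup K D)) [dg.IsMulLeftInvariant]
    (hdg : dg (Q.congruenceSubgroup 1 zero_le_one : Set (PairGroup K D)) = 1)
    (hfin : Module.finrank K D = 4) (p : Dˣ)
    (hp : ‖reducedNorm K (p : D)‖ = ‖ϖ‖) (n : ℕ) (hn : n ≠ 0) :
    dg (Q.congruenceSubgroup (‖ϖ‖ ^ n) (by positivity) : Set (PairGroup K D)) *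
      ENNReal.ofReal ((1 - ‖ϖ‖ ^ 2) ^ 3 * (1 - ‖ϖ‖)) = ENNReal.ofReal (‖ϖ‖ ^ (12 * n)) := by
  borelize D K
  have hϖ := hO.norm_pos
  set t := ‖ϖ‖ with ht
  have ht1 : t < 1 := hO.norm_lt_one
  have hr : t ^ n < 1 := pow_lt_one₀ hϖ.le ht1 hn
  have hr2 : (t ^ n) ^ 2 < 1 := pow_lt_one₀ (by positivity) hr two_ne_zero
  have hN := Q.isQuadraticNorm
  let μ : Measure K := addHaarOf (Metric.closedBall 0 1)
  obtain ⟨hμ1, hμ2, hμ⟩ : μ.IsAddHaarMeasure ∧ μ.Regular ∧ μ (Metric.closedBall 0 1) = 1 :=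
    addHaarOf_spec (isCompact_closedBall 0 1)
      ⟨0, Metric.ball_subset_interior_closedBall (Metric.mem_ball_self one_pos)⟩
  let ν : Measure D := addHaarOf {a | ‖reducedNorm K a‖ ≤ 1}
  obtain ⟨hν1, hν2, hν⟩ : ν.IsAddHaarMeasure ∧ ν.Regular ∧ ν {a | ‖reducedNorm K a‖ ≤ 1} = 1 :=
    addHaarOf_spec hN.isCompact (by rw [hN.isOpen.interior_eq]; exact ⟨0, hN.zero_mem⟩)
  let ball : ℝ → Set D := fun r => {a | ‖reducedNorm K a‖ ≤ r ^ 2}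
  let kball : ℝ → Set K := fun r => Metric.closedBall 0 r
  let I : Set (D × D × ((K × K) × (K × K))) := ball (t ^ n) ×ˢ ball (t ^ n) ×ˢ
    ((kball (t ^ n) ×ˢ kball (t ^ n)) ×ˢ (kball (t ^ n) ×ˢ kball (t ^ n)))
  have hball : MeasurableSet (ball (t ^ n)) :=
    (isClosed_le Q.continuous_norm.norm continuous_const).measurableSet
  have hkball : MeasurableSet (kball (t ^ n)) := Metric.isClosed_closedBall.measurableSet
  have hI : MeasurableSet I :=
    hball.prod (hball.prod ((hkball.prod hkball).prod (hkball.prod hkball)))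
  have hνI : ν (ball (t ^ n)) = ENNReal.ofReal (t ^ (4 * n)) := by
    have h := hN.measure_smul_ball hO ν hν n
    rw [hfin] at h
    rw [mul_comm 4 n, ← h]
    congr 1
    ext a
    have h0 : ϖ ^ n ≠ 0 := pow_ne_zero n hO.ne_zero
    constructor
    · intro ha
      refine ⟨(ϖ ^ n)⁻¹ • a, ?_, smul_inv_smul₀ h0 a⟩
      change ‖_‖ ≤ _
      rw [Q.nrd_smul, norm_mul, norm_pow, norm_inv, norm_pow, inv_pow,
        inv_mul_le_iff₀ (by positivity), mul_one]
      exact ha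
    · rintro ⟨b, hb, rfl⟩
      change ‖_‖ ≤ _
      rw [Q.nrd_smul, norm_mul, norm_pow, norm_pow]
      exact mul_le_of_le_one_right (by positivity) hb
  have hpol : PolishSpace K := inferInstance
  have m1 : MeasurableAdd (K × K) := ⟨fun c => (continuous_const_add c).measurable,
    fun c => (continuous_add_const c).measurable⟩
  have m2 : MeasurableAdd ((K × K) × (K × K)) := ⟨fun c => (continuous_const_add c).measurable,
    fun c => (continuous_add_const c).measurable⟩
  have m3 : MeasurableAdd (D × ((K × K) × (K × K))) := ⟨fun c => (continuous_const_add c).measurable,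
    fun c => (continuous_add_const c).measurable⟩
  have i1 : (μ.prod μ).IsAddHaarMeasure := inferInstance
  have i2 := Measure.prod.instIsAddHaarMeasure (μ.prod μ) (μ.prod μ)
  have i3 := Measure.prod.instIsAddHaarMeasure ν ((μ.prod μ).prod (μ.prod μ))
  have i4 := Measure.prod.instIsAddHaarMeasure ν (ν.prod ((μ.prod μ).prod (μ.prod μ)))
  -- For `u` in the integral group, the coset of `u` is `u` plus the box: multiplication by `u` or
  -- `u⁻¹` preserves the box, and adding an element of the box keeps the norms and the determinant
  -- units.
  have hcos := measure_mul_measure_of_cosets dg (ν.prod (ν.prod ((μ.prod μ).prod (μ.prod μ))))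
    (Q.congruenceSubgroup_le (t ^ n) (by positivity)) (Q.isCompact_congruenceSubgroup one_pos)
    (Q.isOpen_congruenceSubgroup (by positivity)) PairGroup.coord_injective hI (by
      intro u hu
      have hu1 := Q.mem_congruenceSubgroup_one.1 hu
      have hu2 := Q.mem_congruenceSubgroup_one.1 (inv_mem hu)
      ext w
      constructor
      · rintro ⟨_, ⟨g, hg, rfl⟩, rfl⟩
        obtain ⟨-, -, -, -, g5, g6, g7⟩ := hg
        have k1 : u.fst * (g.fst - 1) ∈ ball (t ^ n) := Q.norm_nrd_mul_le hu1.1 g5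
        have k2 : (g.snd - 1) * u.snd ∈ ball (t ^ n) := Q.norm_nrd_mul_le' g6 hu1.2.1
        have k3 := mul_mem_matBall zero_le_one hu1.2.2.1 g7
        rw [one_mul] at k3
        refine ⟨(u.fst * (g.fst - 1), (g.snd - 1) * u.snd,
          ((u.mat * (g.mat - 1)) 0 0, (u.mat * (g.mat - 1)) 0 1),
          ((u.mat * (g.mat - 1)) 1 0, (u.mat * (g.mat - 1)) 1 1)), ⟨k1, k2, ⟨?_, ?_⟩, ?_, ?_⟩, ?_⟩
        iterate 4 exact mem_closedBall_zero_iff.2 (k3 _ _)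
        · simp only [PairGroup.coord, PairGroup.fst_mul, PairGroup.snd_mul, PairGroup.mat_mul,
            mul_sub, sub_mul, mul_one, one_mul, Prod.mk_add_mk, Matrix.sub_apply, add_sub_cancel]
      · rintro ⟨⟨a, b, ⟨c00, c01⟩, ⟨c10, c11⟩⟩, ⟨ha, hb, ⟨h00, h01⟩, ⟨h10, h11⟩⟩, rfl⟩
        rw [mem_closedBall_zero_iff] at h00 h01 h10 h11
        let c : Matrix (Fin 2) (Fin 2) K := !![c00, c01; c10, c11]
        have hc : c ∈ matBall K (t ^ n) := fun i j => by
          fin_cases i <;> fin_cases j <;> assumption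
        have n1 : ‖reducedNorm K (u.fst + a)‖ = 1 := Q.norm_nrd_add hu1.1 hr2 ha
        have n2 : ‖reducedNorm K (u.snd + b)‖ = 1 := Q.norm_nrd_add hu1.2.1 hr2 hb
        have n3 : ‖(u.mat + c).det‖ = 1 := norm_det_add hu1.2.2.1 hu1.2.2.2 hr hc
        obtain ⟨g, g1, g2, g3⟩ := exists_pairGroup Q (a := u.fst + a) (b := u.snd + b)
          (m := u.mat + c) (fun h => by rw [h, Q.nrd_zero] at n1; simp at n1)
          (fun h => by rw [h, Q.nrd_zero] at n2; simp at n2)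
          (fun h => by rw [h] at n3; simp at n3)
        have hg : g ∈ Q.congruenceSubgroup 1 zero_le_one := Q.mem_congruenceSubgroup_one.2
          ⟨by rw [g1, n1], by rw [g2, n2], by
            rw [g3]; exact add_mem_matBall hu1.2.2.1 fun i j => (hc i j).trans hr.le, by rw [g3, n3]⟩
        refine ⟨g, ⟨u⁻¹ * g, ?_, mul_inv_cancel_left u g⟩, ?_⟩
        · have hug := Q.mem_congruenceSubgroup_one.1 (mul_mem (inv_mem hu) hg)
          refine ⟨hug.1, hug.2.1, hug.2.2.1, hug.2.2.2, ?_, ?_, ?_⟩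
          · rw [PairGroup.fst_mul, g1, mul_add, u.fst_inv_mul_fst, add_sub_cancel_left]
            exact Q.norm_nrd_mul_le hu2.1 ha
          · rw [PairGroup.snd_mul, g2, add_mul, u.snd_mul_snd_inv, add_sub_cancel_left]
            exact Q.norm_nrd_mul_le' hb hu2.2.1
          · rw [PairGroup.mat_mul, g3, mul_add, u.mat_inv_mul_mat, add_sub_cancel_left,
              ← one_mul (t ^ n)]
            exact mul_mem_matBall zero_le_one hu2.2.2.1 hc
        · simp only [PairGroup.coord, g1, g2, g3, c, Matrix.add_apply, Prod.mk_add_mk]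
          simp)
  have himg : PairGroup.coord '' (Q.congruenceSubgroup 1 zero_le_one : Set (PairGroup K D)) =
      {a : D | ‖reducedNorm K a‖ = 1} ×ˢ {a : D | ‖reducedNorm K a‖ = 1} ×ˢ
      {p : (K × K) × (K × K) |
    (‖p.1.1‖ ≤ 1 ∧ ‖p.1.2‖ ≤ 1) ∧ (‖p.2.1‖ ≤ 1 ∧ ‖p.2.2‖ ≤ 1) ∧
      ‖p.1.1 * p.2.2 - p.1.2 * p.2.1‖ = 1} := by
    ext ⟨a, b, ⟨c00, c01⟩, ⟨c10, c11⟩⟩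
    constructor
    · rintro ⟨g, hg, e⟩
      simp only [PairGroup.coord, Prod.mk.injEq] at e
      obtain ⟨rfl, rfl, ⟨rfl, rfl⟩, rfl, rfl⟩ := e
      obtain ⟨g1, g2, g3, g4⟩ := Q.mem_congruenceSubgroup_one.1 hg
      rw [Matrix.det_fin_two] at g4
      exact ⟨g1, g2, ⟨g3 0 0, g3 0 1⟩, ⟨g3 1 0, g3 1 1⟩, g4⟩
    · rintro ⟨h1, h2, ⟨h3, h4⟩, ⟨h5, h6⟩, h7⟩
      have hdet : !![c00, c01; c10, c11].det = c00 * c11 - c01 * c10 := Matrix.det_fin_two_of _ _ _ _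
      have z1 : a ≠ 0 := fun h => by
        have h1' : ‖reducedNorm K a‖ = 1 := h1
        rw [h, Q.nrd_zero] at h1'; simp at h1'
      have z2 : b ≠ 0 := fun h => by
        have h1' : ‖reducedNorm K b‖ = 1 := h2
        rw [h, Q.nrd_zero] at h1'; simp at h1'
      obtain ⟨g, rfl, rfl, g3⟩ := exists_pairGroup Q (m := !![c00, c01; c10, c11]) z1 z2
        (fun h => by
          have h7' : ‖c00 * c11 - c01 * c10‖ = 1 := h7
          rw [← hdet, h] at h7'; simp at h7')
      refine ⟨g, Q.mem_congruenceSubgroup_one.2 ⟨h1, h2, ?_, ?_⟩, ?_⟩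
      · rw [g3]
        intro i j
        fin_cases i <;> fin_cases j <;> assumption
      · rw [g3, hdet]; exact h7
      · simp [PairGroup.coord, g3]
  have hvol := hN.measure_norm_eq_one hO ν (m := 2) hfin hν p hp Q.continuous_norm
  rw [← ht] at hvol
  have hrows := hO.measure_rows μ hμ
  rw [← ht] at hrows
  have t2 : 0 ≤ 1 - t ^ 2 := sub_nonneg.2 (pow_le_one₀ hϖ.le ht1.le)
  have hk : μ (kball (t ^ n)) = ENNReal.ofReal (t ^ n) := hO.measure_closedBall_pow μ hμ n
  simp only [himg, I, Measure.prod_prod] at hcos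
  rw [hvol, hrows, hdg, one_mul, hνI, hk, ← ENNReal.ofReal_mul t2, ← ENNReal.ofReal_mul t2, ← ENNReal.ofReal_mul (by positivity),
    ← ENNReal.ofReal_mul (by positivity), ← ENNReal.ofReal_mul (by positivity),
    ← ENNReal.ofReal_mul (by positivity)] at hcos
  rw [show (1 - t ^ 2) ^ 3 * (1 - t) = (1 - t ^ 2) * ((1 - t ^ 2) * ((1 - t ^ 2) * (1 - t))) by ring,
    ← hcos]
  congr 1
  ring

end NormConj

end Volumes

end PairQuat

namespace PairQuat

/-! ### The identity component of the stabilizer of `w_u` -/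

section Torus

set_option linter.unusedSectionVars false

variable {F A : Type*} [Field F] [Ring A] [Algebra F A] {U : A} {a b : F}

/-- The norm of `x + y U`, where `U² = a U - b`. -/
def torusNorm (a b x y : F) : F := x ^ 2 + a * x * y + b * y ^ 2

/-- The matrix that takes `(w, w U)` to `(1, U)`, where `w = x + y U` and `U² = a U - b`. -/
def torusMat (a b x y : F) : Matrix (Fin 2) (Fin 2) F :=
  (torusNorm a b x y)⁻¹ • !![x + a * y, -y; b * y, x]

theorem torusMat_mul {x y : F} (h : torusNorm a b x y ≠ 0) :
    torusMat a b x y * !![x, y; -(b * y), x + a * y] = 1 := by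
  rw [torusMat, smul_mul_assoc, Matrix.mul_fin_two, Matrix.one_fin_two]
  have e : torusNorm a b x y = x ^ 2 + a * x * y + b * y ^ 2 := rfl
  ext i j
  fin_cases i <;> fin_cases j <;>
    simp only [Matrix.smul_apply, Fin.mk_one, Fin.zero_eta, Matrix.of_apply, Matrix.cons_val', Matrix.cons_val_zero,
      Matrix.cons_val_one, Matrix.cons_val_fin_one, smul_eq_mul] <;>
    field_simp <;> rw [e] <;> ring

theorem mul_torusMat {x y : F} (h : torusNorm a b x y ≠ 0) :
    !![x, y; -(b * y), x + a * y] * torusMat a b x y = 1 :=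
  mul_eq_one_comm.1 (torusMat_mul h)

theorem torus_mul_inv (hU : U * U = a • U - b • 1) {x y : F} (h : torusNorm a b x y ≠ 0) :
    (x • 1 + y • U) * ((torusNorm a b x y)⁻¹ • ((x + a * y) • 1 - y • U)) = 1 := by
  have e : (x • (1 : A) + y • U) * ((x + a * y) • 1 - y • U) = torusNorm a b x y • 1 := by
    simp only [add_mul, mul_sub, smul_mul_assoc, mul_smul_comm, one_mul, mul_one, hU, torusNorm]
    module
  rw [mul_smul_comm, e, smul_smul, inv_mul_cancel₀ h, one_smul]

theorem torus_inv_mul (hU : U * U = a • U - b • 1) {x y : F} (h : torusNorm a b x y ≠ 0) :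
    ((torusNorm a b x y)⁻¹ • ((x + a * y) • 1 - y • U)) * (x • 1 + y • U) = 1 := by
  have e : ((x + a * y) • 1 - y • U) * (x • (1 : A) + y • U) = torusNorm a b x y • 1 := by
    simp only [mul_add, sub_mul, smul_mul_assoc, mul_smul_comm, one_mul, mul_one, hU, torusNorm]
    module
  rw [smul_mul_assoc, e, smul_smul, inv_mul_cancel₀ h, one_smul]

/-- The element `(w, 1, g_w)`, where `w = x + y U`. -/
def torusLeft (hU : U * U = a • U - b • 1) (x y : F) (h : torusNorm a b x y ≠ 0) : PairGroup F A :=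
  PairGroup.mk' _ _ 1 1 _ _ (torus_mul_inv hU h) (torus_inv_mul hU h) (one_mul 1) (one_mul 1)
    (torusMat_mul h) (mul_torusMat h)

/-- The element `(1, w, g_w)`, where `w = x + y U`. -/
def torusRight (hU : U * U = a • U - b • 1) (x y : F) (h : torusNorm a b x y ≠ 0) :
    PairGroup F A :=
  PairGroup.mk' 1 1 _ _ _ _ (one_mul 1) (one_mul 1) (torus_mul_inv hU h) (torus_inv_mul hU h)
    (torusMat_mul h) (mul_torusMat h)

theorem torusMat_relation (hU : U * U = a • U - b • 1) {x y : F} (h : torusNorm a b x y ≠ 0) :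
    torusMat a b x y 0 0 • (x • 1 + y • U) + torusMat a b x y 0 1 • ((x • 1 + y • U) * U) = 1 ∧
    torusMat a b x y 1 0 • (x • 1 + y • U) + torusMat a b x y 1 1 • ((x • 1 + y • U) * U) = U := by
  have e : (x • (1 : A) + y • U) * U = x • U + y • (a • U - b • 1) := by
    rw [add_mul, smul_mul_assoc, smul_mul_assoc, one_mul, hU]
  have h1 : (torusNorm a b x y)⁻¹ * (x ^ 2 + a * x * y + b * y ^ 2) = 1 := inv_mul_cancel₀ h
  rw [e]
  simp only [torusMat, Matrix.smul_apply, Matrix.of_apply, Matrix.cons_val', Matrix.cons_val_zero,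
    Matrix.cons_val_one, Matrix.cons_val_fin_one, smul_eq_mul]
  set n := (torusNorm a b x y)⁻¹
  constructor
  · have : (n * (x + a * y)) • (x • (1 : A) + y • U) + (n * -y) • (x • U + y • (a • U - b • 1)) =
        (n * (x ^ 2 + a * x * y + b * y ^ 2)) • 1 := by module
    rw [this, h1, one_smul]
  · have : (n * (b * y)) • (x • (1 : A) + y • U) + (n * x) • (x • U + y • (a • U - b • 1)) =
        (n * (x ^ 2 + a * x * y + b * y ^ 2)) • U := by module
    rw [this, h1, one_smul]

theorem pairOf_zero (u : A) : pairOf u 0 = 1 := rfl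
theorem pairOf_one (u : A) : pairOf u 1 = u := rfl

theorem smul_pairOf_eq_iff {u : A} {g : PairGroup F A} : g • pairOf u = pairOf u ↔
    g.mat 0 0 • (g.fst * g.snd) + g.mat 0 1 • (g.fst * u * g.snd) = 1 ∧
    g.mat 1 0 • (g.fst * g.snd) + g.mat 1 1 • (g.fst * u * g.snd) = u := by
  have h : g • pairOf u = pairOf u ↔
      (g • pairOf u) 0 = pairOf u 0 ∧ (g • pairOf u) 1 = pairOf u 1 :=
    (funext_iff (f := (g • pairOf u : Fin 2 → A)) (g := pairOf u)).trans Fin.forall_fin_two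
  rw [h, PairGroup.smul_apply, PairGroup.smul_apply, pairOf_zero, pairOf_one, mul_one]

theorem torusLeft_smul (hU : U * U = a • U - b • 1) (x y : F) (h : torusNorm a b x y ≠ 0) :
    torusLeft hU x y h • pairOf U = pairOf U := by
  rw [smul_pairOf_eq_iff]
  simpa [torusLeft] using torusMat_relation hU h

theorem torusRight_smul (hU : U * U = a • U - b • 1) (x y : F) (h : torusNorm a b x y ≠ 0) :
    torusRight hU x y h • pairOf U = pairOf U := by
  rw [smul_pairOf_eq_iff]
  have e : U * (x • 1 + y • U) = (x • 1 + y • U) * U := by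
    simp only [mul_add, add_mul, mul_smul_comm, smul_mul_assoc, one_mul, mul_one]
  simpa [torusRight, e] using torusMat_relation hU h

/-- An element of the stabilizer acts on `F[U]` by the identity or by the conjugation. -/
theorem commute_or_conj_of_smul_eq (h2 : (2 : F) ≠ 0) (hU : U * U = a • U - b • 1)
    (hind : ∀ c d : F, c • (1 : A) + d • U = 0 → c = 0 ∧ d = 0) (hab : a ^ 2 - 4 * b ≠ 0)
    {g : PairGroup F A} (hg : g • pairOf U = pairOf U) :
    U * g.fst = g.fst * U ∨ U * g.fst = g.fst * (a • 1 - U) := by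
  obtain ⟨e0, e1⟩ := smul_pairOf_eq_iff.1 hg
  have hU1 : U ≠ 0 := fun h => by
    have := (hind 0 1 (by rw [h]; simp)).2
    exact one_ne_zero this
  have : Nontrivial A := ⟨U, 0, hU1⟩
  set m := g.mat
  set p : A := m 0 0 • 1 + m 0 1 • U with hp
  set r : A := m 1 0 • 1 + m 1 1 • U with hr
  have f0 : g.fst * p * g.snd = 1 := by
    rw [← e0, hp]; simp only [mul_add, add_mul, mul_smul_comm, smul_mul_assoc, mul_one]
  have f1 : g.fst * r * g.snd = U := by
    rw [← e1, hr]; simp only [mul_add, add_mul, mul_smul_comm, smul_mul_assoc, mul_one]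
  have f2 : p * g.snd = g⁻¹.fst := by
    rw [← mul_one g⁻¹.fst, ← f0, ← mul_assoc, ← mul_assoc, g.fst_inv_mul_fst, one_mul]
  have f3 : p * (g.snd * g.fst) = 1 := by rw [← mul_assoc, f2, g.fst_inv_mul_fst]
  have f4 : r * (g.snd * g.fst) = g⁻¹.fst * U * g.fst := by
    rw [← f1]
    simp only [← mul_assoc, g.fst_inv_mul_fst, one_mul]
  have f5 : g.snd * g.fst * p = 1 := by
    have : g.snd = g⁻¹.fst * (g.fst * g.snd) := by
      rw [← mul_assoc, g.fst_inv_mul_fst, one_mul]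
    have h6 : p = g⁻¹.fst * g⁻¹.snd := by
      rw [← f2, mul_assoc, g.snd_mul_snd_inv, mul_one]
    rw [h6, mul_assoc, ← mul_assoc g.fst, g.fst_mul_fst_inv, one_mul, g.snd_mul_snd_inv]
  -- The algebra may have zero divisors here, so the invertibility of `p = m₀₀ + m₀₁ U` inside
  -- `F[U]` has to be deduced from its having an inverse in `A`: if its norm vanished, its conjugate
  -- would be killed.
  set n := torusNorm a b (m 0 0) (m 0 1) with hn
  have hn0 : n ≠ 0 := by
    intro h0
    have e : p * ((m 0 0 + a * m 0 1) • 1 - m 0 1 • U) = n • 1 := by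
      rw [hp, hn]
      simp only [add_mul, mul_sub, smul_mul_assoc, mul_smul_comm, one_mul, mul_one, hU, torusNorm]
      module
    rw [h0, zero_smul] at e
    have e' := congrArg (g.snd * g.fst * ·) e
    simp only [← mul_assoc, f5, one_mul, mul_zero] at e'
    obtain ⟨z1, z2⟩ := hind (m 0 0 + a * m 0 1) (-m 0 1) (by rw [neg_smul, ← sub_eq_add_neg]; exact e')
    rw [neg_eq_zero] at z2
    rw [z2, mul_zero, add_zero] at z1
    rw [hp, z1, z2, zero_smul, zero_smul, add_zero, zero_mul] at f3
    exact zero_ne_one f3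
  have f6 : g.snd * g.fst = n⁻¹ • ((m 0 0 + a * m 0 1) • 1 - m 0 1 • U) := by
    have h7 := torus_mul_inv hU hn0
    rw [← hp, ← hn] at h7
    exact left_inv_eq_right_inv f5 h7
  -- Both `r` and `p⁻¹ = g₁₂ g₁₁` lie in `F[U]`, so conjugation by `g₁₁` maps `U` into `F[U]`. The
  -- image satisfies the quadratic equation of `U`, whose only non-scalar solutions in `F[U]` are
  -- `U` and `a - U`.
  obtain ⟨α, β, f7⟩ : ∃ α β : F, g⁻¹.fst * U * g.fst = α • 1 + β • U := by
    rw [← f4, f6, hr, mul_smul_comm]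
    refine ⟨n⁻¹ * (m 1 0 * (m 0 0 + a * m 0 1) + m 1 1 * m 0 1 * b),
      n⁻¹ * (-(m 1 0 * m 0 1) + m 1 1 * (m 0 0 + a * m 0 1) - m 1 1 * m 0 1 * a), ?_⟩
    simp only [add_mul, mul_sub, smul_mul_assoc, mul_smul_comm, one_mul, mul_one, hU]
    module
  have f8 : U * g.fst = g.fst * (α • 1 + β • U) := by
    rw [← f7, ← mul_assoc, ← mul_assoc, g.fst_mul_fst_inv, one_mul]
  have f9 : (α • 1 + β • U) * (α • 1 + β • U) = a • (α • 1 + β • U) - b • (1 : A) := by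
    rw [← f7]
    have : g⁻¹.fst * U * g.fst * (g⁻¹.fst * U * g.fst) = g⁻¹.fst * (U * U) * g.fst := by
      simp only [mul_assoc]
      rw [← mul_assoc g.fst, g.fst_mul_fst_inv, one_mul]
    rw [this, hU, mul_sub, sub_mul, mul_smul_comm, mul_smul_comm, smul_mul_assoc, smul_mul_assoc,
      mul_one, g.fst_inv_mul_fst]
  obtain ⟨g0, g1⟩ := hind (α ^ 2 - β ^ 2 * b - a * α + b) (2 * α * β + β ^ 2 * a - a * β) (by
    have h9 : (α • 1 + β • U) * (α • 1 + β • U) - (a • (α • 1 + β • U) - b • (1 : A)) = 0 :=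
      sub_eq_zero.2 f9
    rw [← h9]
    simp only [add_mul, mul_add, smul_mul_assoc, mul_smul_comm, one_mul, mul_one, hU]
    module)
  have hβ : β ≠ 0 := by
    intro h0
    have : U = α • 1 := by
      have h8 := congrArg (· * g⁻¹.fst) f8
      simp only [h0, zero_smul, add_zero, mul_smul_comm, smul_mul_assoc, mul_one, mul_assoc,
        g.fst_mul_fst_inv] at h8
      exact h8
    have := (hind (-α) 1 (by rw [one_smul, neg_smul, neg_add_eq_zero]; exact this.symm)).2
    exact one_ne_zero this
  have g2 : 2 * α = a * (1 - β) := by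
    have : β * (2 * α - a * (1 - β)) = 0 := by linear_combination g1
    exact sub_eq_zero.1 ((mul_eq_zero.1 this).resolve_left hβ)
  -- Eliminating `α` leaves `β² = 1`, because the discriminant is nonzero.
  have g3 : (β - 1) * (β + 1) * (a ^ 2 - 4 * b) = 0 := by
    linear_combination 4 * g0 - (2 * α + a * (1 - β) - 2 * a) * g2
  rcases mul_eq_zero.1 ((mul_eq_zero.1 g3).resolve_right hab) with h | h
  · left
    have hb1 : β = 1 := sub_eq_zero.1 h
    have ha0 : α = 0 := by
      rw [hb1, sub_self, mul_zero] at g2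
      exact (mul_eq_zero.1 g2).resolve_left h2
    rw [f8, hb1, ha0, zero_smul, zero_add, one_smul]
  · right
    have hb1 : β = -1 := eq_neg_of_add_eq_zero_left h
    have ha0 : α = a := by
      rw [hb1] at g2
      exact mul_left_cancel₀ h2 (by linear_combination g2)
    rw [f8, hb1, ha0, neg_smul, one_smul, sub_eq_add_neg]

/-- Linear forms separate points of `W'`, so the kernel is an intersection of zero sets of linear
functions on `W`. -/
theorem isClosed_zariski_of_linear {W W' : Type*} [AddCommGroup W] [Module F W] [AddCommGroup W']
    [Module F W'] (L : W →ₗ[F] W') : @IsClosed W (zariskiTopology F W) {w | L w = 0} := by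
  let := zariskiTopology F W
  have : {w | L w = 0} = ⋂ l : Module.Dual F W', {w | l (L w) ≠ 0}ᶜ := by
    ext w
    simp only [Set.mem_iInter, Set.mem_compl_iff, Set.mem_ofPred_eq, not_not]
    exact (Module.forall_dual_apply_eq_zero_iff F (L w)).symm
  rw [this]
  refine isClosed_iInter fun l => isClosed_compl_iff.2 ?_
  exact TopologicalSpace.isOpen_generateFrom_of_mem
    ⟨_, Algebra.subset_adjoin ⟨l.comp L, rfl⟩, rfl⟩

/-- Commuting with `U` and conjugating `U` to `a - U` are disjoint closed conditions that cover the
stabilizer; the connected component of `1` lies in the first. -/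
theorem commute_of_mem_zariskiComponent (h2 : (2 : F) ≠ 0) (hU : U * U = a • U - b • 1)
    (hind : ∀ c d : F, c • (1 : A) + d • U = 0 → c = 0 ∧ d = 0) (hab : a ^ 2 - 4 * b ≠ 0)
    {g : PairGroup F A} (hg : g ∈ zariskiComponent (F := F) (pairOf U)) :
    g • pairOf U = pairOf U ∧ U * g.fst = g.fst * U := by
  let tA := zariskiTopology F (A × A × Matrix (Fin 2) (Fin 2) F)
  let t := zariskiGroup F A
  let S : Set (PairGroup F A) := MulAction.stabilizer (PairGroup F A) (pairOf U)
  have h1 : (1 : PairGroup F A) ∈ S := one_mem (MulAction.stabilizer (PairGroup F A) (pairOf U))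
  change g ∈ connectedComponentIn S 1 at hg
  have hsub : connectedComponentIn S 1 ⊆ S := connectedComponentIn_subset S 1
  refine ⟨hsub hg, ?_⟩
  let L1 : (A × A × Matrix (Fin 2) (Fin 2) F) →ₗ[F] A :=
    (LinearMap.mulLeft F U - LinearMap.mulRight F U).comp (LinearMap.fst F _ _)
  let L2 : (A × A × Matrix (Fin 2) (Fin 2) F) →ₗ[F] A :=
    (LinearMap.mulLeft F U - LinearMap.mulRight F (a • 1 - U)).comp (LinearMap.fst F _ _)
  have c1 : IsClosed {g : PairGroup F A | U * g.fst = g.fst * U} := by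
    have := (isClosed_zariski_of_linear L1).preimage (f := toAffine) continuous_induced_dom
    convert this using 1
    ext g
    exact sub_eq_zero.symm
  have c2 : IsClosed {g : PairGroup F A | U * g.fst = g.fst * (a • 1 - U)} := by
    have := (isClosed_zariski_of_linear L2).preimage (f := toAffine) continuous_induced_dom
    convert this using 1
    ext g
    exact sub_eq_zero.symm
  have hdis : ∀ g : PairGroup F A, U * g.fst = g.fst * U → U * g.fst ≠ g.fst * (a • 1 - U) := by
    intro g e1 e2
    rw [e1] at e2
    have e3 := congrArg (g⁻¹.fst * ·) e2
    simp only [← mul_assoc, g.fst_inv_mul_fst, one_mul] at e3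
    have := (hind (-a) 2 (by
      rw [two_smul, neg_smul]
      nth_rewrite 1 [e3]
      abel)).2
    exact h2 this
  rcases isPreconnected_iff_subset_of_disjoint_closed.1
    (isPreconnected_connectedComponentIn (x := (1 : PairGroup F A)) (F := S)) _ _ c1 c2
    (fun g hg => commute_or_conj_of_smul_eq h2 hU hind hab (hsub hg))
    (Set.eq_empty_of_forall_notMem fun g hg => hdis g hg.2.1 hg.2.2) with h | h
  · exact h hg
  · have h11 := h (mem_connectedComponentIn h1)
    exact absurd h11 (hdis 1 (by simp))

/-- A rational curve in the stabilizer that passes through `1` lies in the identity component. -/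
theorem mem_zariskiComponent_of_curve [Infinite F] {x : PairSpace A} (n : Polynomial F) (f : F → PairGroup F A)
    (A₀ A₁ B₀ B₁ : A) (P : Fin 2 → Fin 2 → Polynomial F)
    (hf : ∀ t, n.eval t ≠ 0 → f t • x = x ∧ (f t).fst = A₀ + t • A₁ ∧ (f t).snd = B₀ + t • B₁ ∧
      ∀ i j, n.eval t * (f t).mat i j = (P i j).eval t)
    {t₀ t₁ : F} (h0 : n.eval t₀ ≠ 0) (hf0 : f t₀ = 1) (h1 : n.eval t₁ ≠ 0) :
    f t₁ ∈ zariskiComponent (F := F) x := by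
  classical
  let tA := zariskiTopology F (A × A × Matrix (Fin 2) (Fin 2) F)
  let t := zariskiGroup F A
  let S : Set (PairGroup F A) := MulAction.stabilizer (PairGroup F A) x
  have hn : n ≠ 0 := fun h => by simp [h] at h0
  have hfin : {t | n.eval t = 0}.Finite := by
    refine (n.roots.toFinset.finite_toSet).subset fun t ht => ?_
    simpa [hn] using ht
  -- The parameter space is the affine line minus the zeros of `n`. It is infinite, so its cofinite
  -- topology is connected.
  let X := CofiniteTopology {t // n.eval t ≠ 0}
  have : Infinite {t // n.eval t ≠ 0} :=
    Set.infinite_coe_iff.2 (Set.Finite.infinite_compl (s := {t | n.eval t = 0}) hfin)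
  let γ : X → PairGroup F A := fun t => f (CofiniteTopology.of.symm t).1
  -- Along the curve every polynomial function is a polynomial in `t` divided by a power of `n`, so
  -- its zero set is finite or everything. This is continuity from the cofinite to the Zariski
  -- topology.
  have key : ∀ p ∈ polyFun F (A × A × Matrix (Fin 2) (Fin 2) F), ∃ (R : Polynomial F) (k : ℕ),
      ∀ t, n.eval t ≠ 0 → p (toAffine (f t)) * n.eval t ^ k = R.eval t := by
    intro p hp
    refine Algebra.adjoin_induction (p := fun q _ => ∃ (R : Polynomial F) (k : ℕ),
      ∀ t, n.eval t ≠ 0 → q (toAffine (f t)) * n.eval t ^ k = R.eval t) ?_ ?_ ?_ ?_ hp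
    · rintro _ ⟨l, rfl⟩
      let lm : Fin 2 → Fin 2 → F := fun i j => l (0, 0, Matrix.single i j 1)
      refine ⟨n * (Polynomial.C (l (A₀, B₀, 0)) + Polynomial.C (l (A₁, B₁, 0)) * Polynomial.X) +
        ∑ i, ∑ j, P i j * Polynomial.C (lm i j), 1, fun t ht => ?_⟩
      obtain ⟨-, e1, e2, e3⟩ := hf t ht
      have hdec : toAffine (f t) = (A₀, B₀, 0) + t • (A₁, B₁, 0) +
          ∑ i, ∑ j, (f t).mat i j • ((0, 0, Matrix.single i j 1) :
            A × A × Matrix (Fin 2) (Fin 2) F) := by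
        refine Prod.ext ?_ (Prod.ext ?_ ?_)
        · simpa [toAffine, Fin.sum_univ_two] using e1
        · simpa [toAffine, Fin.sum_univ_two] using e2
        · conv_lhs => rw [show (toAffine (f t)).2.2 = (f t).mat from rfl,
            Matrix.matrix_eq_sum_single (f t).mat]
          simp [Fin.sum_univ_two, Matrix.smul_single]
      change l (toAffine (f t)) * _ = _
      rw [hdec]
      simp only [map_add, map_smul, smul_eq_mul, Polynomial.eval_add, Polynomial.eval_mul,
        Polynomial.eval_C, Polynomial.eval_X, ← e3, pow_one,
        Fin.sum_univ_two, lm]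
      ring
    · intro r
      exact ⟨Polynomial.C r, 0, fun t _ => by simp [Pi.algebraMap_apply]⟩
    · rintro p q - - ⟨R, k, hR⟩ ⟨R', k', hR'⟩
      refine ⟨R * n ^ k' + R' * n ^ k, k + k', fun t ht => ?_⟩
      rw [Polynomial.eval_add, Polynomial.eval_mul, Polynomial.eval_mul, ← hR t ht, ← hR' t ht,
        Polynomial.eval_pow, Polynomial.eval_pow, Pi.add_apply]
      ring
    · rintro p q - - ⟨R, k, hR⟩ ⟨R', k', hR'⟩
      refine ⟨R * R', k + k', fun t ht => ?_⟩
      rw [Polynomial.eval_mul, ← hR t ht, ← hR' t ht, Pi.mul_apply]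
      ring
  have hγ : Continuous γ := by
    refine continuous_induced_rng.2 (continuous_generateFrom_iff.2 ?_)
    rintro _ ⟨p, hp, rfl⟩
    obtain ⟨R, k, hR⟩ := key p hp
    by_cases hR0 : R = 0
    · have : toAffine ∘ γ ⁻¹' {w | p w ≠ 0} = ∅ := by
        refine Set.eq_empty_of_forall_notMem fun t ht => ht ?_
        have := hR _ (CofiniteTopology.of.symm t).2
        rw [hR0, Polynomial.eval_zero] at this
        exact (mul_eq_zero.1 this).resolve_right (pow_ne_zero _ (CofiniteTopology.of.symm t).2)
      rw [this]; exact isOpen_empty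
    · refine CofiniteTopology.isOpen_iff'.2 (Or.inr ?_)
      have hfin' : {t | R.eval t = 0}.Finite := by
        refine (R.roots.toFinset.finite_toSet).subset fun t ht => ?_
        simpa [hR0] using ht
      refine (hfin'.preimage (f := fun t : X => (CofiniteTopology.of.symm t).1) ?_).subset ?_
      · exact fun s _ t _ h => CofiniteTopology.of.symm.injective (Subtype.ext h)
      · intro t ht
        have ht' : p (toAffine (γ t)) = 0 := not_not.1 ht
        have := hR _ (CofiniteTopology.of.symm t).2
        change R.eval _ = 0
        rw [← this]
        change p (toAffine (γ t)) * _ = 0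
        rw [ht', zero_mul]
  have hpre : IsPreconnected (Set.range γ) := isPreconnected_range hγ
  refine hpre.subset_connectedComponentIn (F := S) ⟨CofiniteTopology.of ⟨t₀, h0⟩, hf0⟩ ?_
    ⟨CofiniteTopology.of ⟨t₁, h1⟩, rfl⟩
  rintro _ ⟨t, rfl⟩
  exact (hf _ (CofiniteTopology.of.symm t).2).1

/-- The line from `1` to `w = x + y U` stays in `F[U]`; on the open set where its norm does not
vanish it lifts to a rational curve in the stabilizer that joins `1` to the given element. -/
theorem torusLeft_torusRight_mem [Infinite F] (hU : U * U = a • U - b • 1) (x y : F) (h : torusNorm a b x y ≠ 0) :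
    torusLeft hU x y h ∈ zariskiComponent (F := F) (pairOf U) ∧
    torusRight hU x y h ∈ zariskiComponent (F := F) (pairOf U) := by
  classical
  let X : Polynomial F := 1 + Polynomial.X * Polynomial.C (x - 1)
  let Y : Polynomial F := Polynomial.X * Polynomial.C y
  let n : Polynomial F := X ^ 2 + Polynomial.C a * X * Y + Polynomial.C b * Y ^ 2
  have hn : ∀ t, n.eval t = torusNorm a b (X.eval t) (Y.eval t) := fun t => by simp [n, torusNorm]
  let P : Fin 2 → Fin 2 → Polynomial F := ![![X + Polynomial.C a * Y, -Y], ![Polynomial.C b * Y, X]]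
  have hP : ∀ t, n.eval t ≠ 0 → ∀ i j,
      n.eval t * torusMat a b (X.eval t) (Y.eval t) i j = (P i j).eval t := by
    intro t ht i j
    rw [hn] at ht
    rw [hn, torusMat, Matrix.smul_apply, smul_eq_mul, mul_inv_cancel_left₀ ht]
    fin_cases i <;> fin_cases j <;> simp [P]
  have hX0 : X.eval 0 = 1 := by simp [X]
  have hY0 : Y.eval 0 = 0 := by simp [Y]
  have hX1 : X.eval 1 = x := by simp [X]
  have hY1 : Y.eval 1 = y := by simp [Y]
  have h0 : n.eval 0 ≠ 0 := by rw [hn, hX0, hY0]; simp [torusNorm]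
  have h1 : n.eval 1 ≠ 0 := by rw [hn, hX1, hY1]; exact h
  have hw : ∀ t, X.eval t • (1 : A) + Y.eval t • U = 1 + t • ((x - 1) • 1 + y • U) := fun t => by
    simp only [X, Y, Polynomial.eval_add, Polynomial.eval_mul, Polynomial.eval_one,
      Polynomial.eval_X, Polynomial.eval_C]
    module
  have hm0 : torusMat a b (1 : F) 0 = 1 := by
    rw [torusMat, Matrix.one_fin_two]; simp [torusNorm]
  let f (T : (x y : F) → torusNorm a b x y ≠ 0 → PairGroup F A) : F → PairGroup F A := fun t =>
    if ht : torusNorm a b (X.eval t) (Y.eval t) ≠ 0 then T _ _ ht else 1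
  have hfe : ∀ T t, ∀ ht : n.eval t ≠ 0, f T t = T (X.eval t) (Y.eval t) ((hn t) ▸ ht) :=
    fun T t ht => dif_pos ((hn t) ▸ ht)
  have hf1 : ∀ T, f T 1 = T x y h := by
    intro T
    rw [hfe T 1 h1]
    congr 1
  constructor
  · rw [← hf1 (torusLeft hU)]
    refine mem_zariskiComponent_of_curve n (f (torusLeft hU)) 1 ((x - 1) • 1 + y • U) 1 0 P
      (fun t ht => ?_) h0 ?_ h1
    · rw [hfe _ t ht]
      exact ⟨torusLeft_smul hU _ _ _, hw t, by rw [smul_zero, add_zero]; rfl, hP t ht⟩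
    · rw [hfe _ 0 h0]
      refine PairGroup.ext' ?_ rfl ?_
      · change X.eval 0 • (1 : A) + Y.eval 0 • U = 1
        rw [hX0, hY0]; simp
      · change torusMat a b (X.eval 0) (Y.eval 0) = 1
        rw [hX0, hY0, hm0]
  · rw [← hf1 (torusRight hU)]
    refine mem_zariskiComponent_of_curve n (f (torusRight hU)) 1 0 1 ((x - 1) • 1 + y • U) P
      (fun t ht => ?_) h0 ?_ h1
    · rw [hfe _ t ht]
      exact ⟨torusRight_smul hU _ _ _, by rw [smul_zero, add_zero]; rfl, hw t, hP t ht⟩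
    · rw [hfe _ 0 h0]
      refine PairGroup.ext' rfl ?_ ?_
      · change X.eval 0 • (1 : A) + Y.eval 0 • U = 1
        rw [hX0, hY0]; simp
      · change torusMat a b (X.eval 0) (Y.eval 0) = 1
        rw [hX0, hY0, hm0]

end Torus

end PairQuat

namespace PairQuat

/-! ### Rational points of the identity component -/

section Component

set_option linter.unusedSectionVars false

variable {K D : Type*} [Field K] [Ring D] [Algebra K D]

theorem groupBaseChange_fst (g : PairGroup K D) : (groupBaseChange K D g).fst = 1 ⊗ₜ g.fst := rfl
theorem groupBaseChange_snd (g : PairGroup K D) : (groupBaseChange K D g).snd = 1 ⊗ₜ g.snd := rfl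
theorem groupBaseChange_mat (g : PairGroup K D) (i j : Fin 2) : (groupBaseChange K D g).mat i j =
    algebraMap K (AlgebraicClosure K) (g.mat i j) := rfl

theorem spaceBaseChange_pairOf (u : D) : spaceBaseChange K (pairOf u) = pairOf (1 ⊗ₜ[K] u) := by
  funext i
  fin_cases i <;> rfl

theorem one_tmul_injective : Function.Injective fun d : D => (1 : AlgebraicClosure K) ⊗ₜ[K] d :=
  Algebra.TensorProduct.includeRight_injective
    (FaithfulSMul.algebraMap_injective K (AlgebraicClosure K))

theorem spaceBaseChange_smul (g : PairGroup K D) (x : PairSpace D) :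
    spaceBaseChange K (g • x) = groupBaseChange K D g • spaceBaseChange K x := by
  funext i
  rw [PairGroup.smul_apply]
  simp only [spaceBaseChange, PairGroup.smul_apply, groupBaseChange_fst, groupBaseChange_snd,
    groupBaseChange_mat, Algebra.TensorProduct.tmul_mul_tmul, mul_one, TensorProduct.tmul_add,
    algebraMap_smul, TensorProduct.tmul_smul]

/-- An element of the stabilizer of `w_u` is determined by its first two components. -/
theorem eq_of_smul_pairOf_eq {u : D} (hu : ∀ c d : K, c • (1 : D) + d • u = 0 → c = 0 ∧ d = 0)
    {g h : PairGroup K D} (hg : g • pairOf u = pairOf u) (hh : h • pairOf u = pairOf u)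
    (h1 : g.fst = h.fst) (h2 : g.snd = h.snd) : g = h := by
  suffices H : h⁻¹ * g = 1 by rw [inv_mul_eq_one] at H; exact H.symm
  have hs : (h⁻¹ * g) • pairOf u = pairOf u := by
    rw [mul_smul, hg, inv_smul_eq_iff, hh]
  have e1 : (h⁻¹ * g).fst = 1 := by rw [PairGroup.fst_mul, h1, h.fst_inv_mul_fst]
  have e2 : (h⁻¹ * g).snd = 1 := by rw [PairGroup.snd_mul, h2, h.snd_mul_snd_inv]
  refine PairGroup.ext' e1 e2 ?_
  obtain ⟨r0, r1⟩ := smul_pairOf_eq_iff.1 hs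
  rw [e1, e2, one_mul, one_mul, mul_one] at r0 r1
  obtain ⟨a0, a1⟩ := hu ((h⁻¹ * g).mat 0 0 - 1) ((h⁻¹ * g).mat 0 1) (by
    rw [sub_smul, one_smul, sub_add_eq_add_sub, r0, sub_self])
  obtain ⟨a2, a3⟩ := hu ((h⁻¹ * g).mat 1 0) ((h⁻¹ * g).mat 1 1 - 1) (by
    rw [sub_smul, one_smul, ← add_sub_assoc, r1, sub_self])
  ext i j
  fin_cases i <;> fin_cases j
  exacts [sub_eq_zero.1 a0, a1, a2, sub_eq_zero.1 a3]

/-- The quadratic subalgebra generated by `u` is its own centralizer. -/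
structure IsSelfCentralizing (K : Type*) {D : Type*} [Field K] [Ring D] [Algebra K D] (u : D) :
    Prop where
  indep : ∀ c d : K, c • (1 : D) + d • u = 0 → c = 0 ∧ d = 0
  exists_eq : ∀ d : D, d * u = u * d → ∃ c₀ c₁ : K, d = c₀ • 1 + c₁ • u

variable [CharZero K] [NoZeroDivisors D] [Nontrivial D] (Q : NormConj K D) {u : D}
  (hu : IsSelfCentralizing K u)

theorem NormConj.torusNorm_eq (x y : K) :
    torusNorm (Q.tr u) (reducedNorm K u) x y = reducedNorm K (x • (1 : D) + y • u) := by
  rw [Q.nrd_combination, NormConj.nrd_one, torusNorm, Q.nrd_one_add]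
  ring

theorem NormConj.mul_self' : u * u = Q.tr u • u - reducedNorm K u • 1 := by
  rw [Q.mul_self u, Algebra.algebraMap_eq_smul_one]

include hu

/-- The first stabilizer equation expresses the inverse of `g₁₂` as `g₁₁` times an element of
`K[u]`. -/
theorem commute_snd {g : PairGroup K D} (hg : g • pairOf u = pairOf u)
    (hc : u * g.fst = g.fst * u) : g.snd * u = u * g.snd := by
  obtain ⟨e0, -⟩ := smul_pairOf_eq_iff.1 hg
  have f0 : (g.mat 0 0 • g.fst + g.mat 0 1 • (g.fst * u)) * g.snd = 1 := by
    rw [← e0, add_mul, smul_mul_assoc, smul_mul_assoc]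
  have f1 : g⁻¹.snd = g.mat 0 0 • g.fst + g.mat 0 1 • (g.fst * u) :=
    (left_inv_eq_right_inv f0 g.snd_mul_snd_inv).symm
  have f2 : u * g⁻¹.snd = g⁻¹.snd * u := by
    rw [f1, mul_add, add_mul, mul_smul_comm, mul_smul_comm, smul_mul_assoc, smul_mul_assoc, hc,
      ← mul_assoc, hc]
  calc g.snd * u = g.snd * (u * g⁻¹.snd) * g.snd := by
        rw [mul_assoc, mul_assoc, g.snd_inv_mul_snd, mul_one]
    _ = u * g.snd := by rw [f2, ← mul_assoc, g.snd_mul_snd_inv, one_mul]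

include Q in
-- One direction descends the connectedness argument from the algebraic closure. For the other, both
-- components of `g` lie in `K[u]`, so `g` is a product of two torus elements, and each is joined to
-- `1` by a curve after base change.
theorem mem_stabComponent_iff (hd : disc K (pairOf u) ≠ 0) {g : PairGroup K D} :
    g ∈ stabComponent K (pairOf u) ↔ g • pairOf u = pairOf u ∧ u * g.fst = g.fst * u := by
  let F := AlgebraicClosure K
  let ι := algebraMap K F
  have hι : Function.Injective ι := FaithfulSMul.algebraMap_injective K F
  have : CharZero F := charZero_of_injective_algebraMap hι
  have : Infinite F := IsAlgClosed.instInfinite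
  let U : F ⊗[K] D := 1 ⊗ₜ u
  let a := ι (Q.tr u)
  let b := ι (reducedNorm K u)
  have hs : ∀ (c : K) (d : D), (1 : F) ⊗ₜ[K] (c • d) = ι c • ((1 : F) ⊗ₜ[K] d) := fun c d => by
    rw [TensorProduct.tmul_smul]; exact (algebraMap_smul F c _).symm
  have h1 : (1 : F ⊗[K] D) = 1 ⊗ₜ 1 := rfl
  have hU : U * U = a • U - b • 1 := by
    rw [Algebra.TensorProduct.tmul_mul_tmul, one_mul, Q.mul_self', TensorProduct.tmul_sub, hs, hs]
    rfl
  have hind : ∀ c d : F, c • (1 : F ⊗[K] D) + d • U = 0 → c = 0 ∧ d = 0 := by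
    intro c d hcd
    have hli : LinearIndependent K ![(1 : D), u] := LinearIndependent.pair_iff.2 hu.indep
    have hli' := Module.Flat.linearIndependent_one_tmul (S := F) hli
    have h := Fintype.linearIndependent_iff.1 hli' ![c, d] (by
      rw [Fin.sum_univ_two]
      exact hcd)
    exact ⟨h 0, h 1⟩
  have hx : spaceBaseChange K (pairOf u) = pairOf U := spaceBaseChange_pairOf u
  constructor
  · intro hg
    have hg' : groupBaseChange K D g ∈ zariskiComponent (F := F) (pairOf U) := by rw [← hx]; exact hg
    obtain ⟨e1, e2⟩ := commute_of_mem_zariskiComponent two_ne_zero hU hind (by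
      intro h0
      refine hd (hι ?_)
      rw [Q.disc_pairOf, map_zero, ← h0, map_sub, map_pow, map_mul, map_ofNat]) hg'
    refine ⟨?_, one_tmul_injective (K := K) ?_⟩
    · rw [← hx, ← spaceBaseChange_smul] at e1
      funext i
      exact one_tmul_injective (K := K) (congrFun e1 i)
    · rw [groupBaseChange_fst, Algebra.TensorProduct.tmul_mul_tmul,
        Algebra.TensorProduct.tmul_mul_tmul, one_mul] at e2
      exact e2
  · rintro ⟨hg, hc⟩
    obtain ⟨x, y, hxy⟩ := hu.exists_eq _ hc.symm
    obtain ⟨x', y', hxy'⟩ := hu.exists_eq _ (commute_snd hu hg hc)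
    have hn : ∀ x y : K, torusNorm (Q.tr u) (reducedNorm K u) x y ≠ 0 →
        torusNorm a b (ι x) (ι y) ≠ 0 := fun x y h h0 => h (hι (by
      rw [map_zero, ← h0]; simp [torusNorm, a, b]))
    have n1 : torusNorm (Q.tr u) (reducedNorm K u) x y ≠ 0 := by
      rw [Q.torusNorm_eq, ← hxy]; exact Q.nrd_fst_ne_zero g
    have n2 : torusNorm (Q.tr u) (reducedNorm K u) x' y' ≠ 0 := by
      rw [Q.torusNorm_eq, ← hxy']; exact Q.nrd_snd_ne_zero g
    -- An element of the stabilizer is determined by its first two components, so it suffices to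
    -- compare these.
    have e : g = torusLeft Q.mul_self' x y n1 * torusRight Q.mul_self' x' y' n2 := by
      refine eq_of_smul_pairOf_eq hu.indep hg (by rw [mul_smul, torusRight_smul, torusLeft_smul]) ?_ ?_
      · rw [hxy]; simp [torusLeft, torusRight]
      · rw [hxy']; simp [torusLeft, torusRight]
    have hm : ∀ (x y : K) i j, ι (torusMat (Q.tr u) (reducedNorm K u) x y i j) =
        torusMat a b (ι x) (ι y) i j := by
      intro x y i j
      simp only [torusMat, Matrix.smul_apply, smul_eq_mul, map_mul, map_inv₀]
      congr 1
      · simp [torusNorm, a, b]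
      · fin_cases i <;> fin_cases j <;> simp [a, b]
    have hw : ∀ x y : K, (1 : F) ⊗ₜ[K] (x • (1 : D) + y • u) = ι x • 1 + ι y • U := fun x y => by
      rw [TensorProduct.tmul_add, hs, hs, h1]
    have t1 : groupBaseChange K D (torusLeft Q.mul_self' x y n1) =
        torusLeft hU (ι x) (ι y) (hn _ _ n1) := by
      refine PairGroup.ext' (hw x y) rfl ?_
      ext i j
      exact hm x y i j
    have t2 : groupBaseChange K D (torusRight Q.mul_self' x' y' n2) =
        torusRight hU (ι x') (ι y') (hn _ _ n2) := by
      refine PairGroup.ext' rfl (hw x' y') ?_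
      ext i j
      exact hm x' y' i j
    change groupBaseChange K D g ∈ zariskiComponent (F := F) (spaceBaseChange K (pairOf u))
    rw [hx, e, map_mul, t1, t2]
    exact mul_mem (torusLeft_torusRight_mem hU _ _ _).1 (torusLeft_torusRight_mem hU _ _ _).2

end Component

end PairQuat

namespace PairQuat

/-! ### The quadratic subalgebra and the measure on the stabilizer -/

section Quad

set_option linter.unusedSectionVars false

section Algebraic

variable {K D : Type*} [Field K] [Ring D] [Algebra K D] {u : D} (hu : IsSelfCentralizing K u)
include hu

theorem mem_adjoin_iff_commute {d : D} : d ∈ Algebra.adjoin K ({u} : Set D) ↔ d * u = u * d := by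
  constructor
  · intro hd
    refine Algebra.adjoin_induction (p := fun d _ => d * u = u * d) ?_ ?_ ?_ ?_ hd
    · rintro _ rfl; rfl
    · intro r; exact Algebra.commutes r u
    · intro x y _ _ hx hy; rw [add_mul, mul_add, hx, hy]
    · intro x y _ _ hx hy; rw [mul_assoc, hy, ← mul_assoc, hx, mul_assoc]
  · intro hd
    obtain ⟨c, d, rfl⟩ := hu.exists_eq d hd
    exact add_mem (Subalgebra.smul_mem _ (one_mem _) _)
      (Subalgebra.smul_mem _ (Algebra.self_mem_adjoin_singleton K u) _)

omit hu in
theorem adjoin_commute {d e : D} (hd : d ∈ Algebra.adjoin K ({u} : Set D))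
    (he : e ∈ Algebra.adjoin K ({u} : Set D)) : d * e = e * d := by
  refine Algebra.adjoin_induction (p := fun d _ => d * e = e * d) ?_ ?_ ?_ ?_ hd
  · rintro _ rfl
    refine Algebra.adjoin_induction (p := fun e _ => _ * e = e * _) ?_ ?_ ?_ ?_ he
    · rintro _ rfl; rfl
    · intro r; exact (Algebra.commutes r _).symm
    · intro x y _ _ hx hy; rw [add_mul, mul_add, hx, hy]
    · intro x y _ _ hx hy; rw [← mul_assoc, hx, mul_assoc, hy, mul_assoc]
  · intro r; exact Algebra.commutes r e
  · intro x y _ _ hx hy; rw [add_mul, mul_add, hx, hy]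
  · intro x y _ _ hx hy; rw [mul_assoc, hy, ← mul_assoc, hx, mul_assoc]

/-- The coordinates with respect to the basis `1, u` of `K[u]`. -/
def quadEquiv : (K × K) ≃ₗ[K] Algebra.adjoin K ({u} : Set D) := by
  let U : Algebra.adjoin K ({u} : Set D) := ⟨u, Algebra.self_mem_adjoin_singleton K u⟩
  refine LinearEquiv.ofBijective
    ((LinearMap.toSpanSingleton K _ 1).coprod (LinearMap.toSpanSingleton K _ U)) ⟨?_, ?_⟩
  · rw [← LinearMap.ker_eq_bot, LinearMap.ker_eq_bot']
    rintro ⟨c, d⟩ h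
    obtain ⟨rfl, rfl⟩ := hu.indep c d (congrArg Subtype.val h)
    rfl
  · rintro ⟨d, hd⟩
    obtain ⟨x, y, h⟩ := hu.exists_eq d ((mem_adjoin_iff_commute hu).1 hd)
    exact ⟨(x, y), Subtype.ext h.symm⟩

theorem finrank_adjoin : Module.finrank K (Algebra.adjoin K ({u} : Set D)) = 2 := by
  rw [← (quadEquiv hu).finrank_eq]; simp

theorem coord_unique {s : Algebra.adjoin K ({u} : Set D)} {x y : K} (h : (s : D) = x • 1 + y • u) :
    (quadEquiv hu).symm s = (x, y) := by
  rw [LinearEquiv.symm_apply_eq]; exact Subtype.ext h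

end Algebraic

/-! ### The isomorphism of the square of `K[u]^×` with the stabilizer component -/

section Embed

variable {K D : Type*} [NormedField K] [CharZero K] [Ring D] [Algebra K D] [NoZeroDivisors D]
  [Nontrivial D] (Q : NormConj K D) {u : D} (hu : IsSelfCentralizing K u)

theorem QuadUnits.val_mul_inv (s : QuadUnits K u) :
    (s.toUnits : D) * (s⁻¹.toUnits : D) = 1 := by
  rw [map_inv, Units.mul_inv]

theorem QuadUnits.mem (s : QuadUnits K u) : (s.toUnits : D) ∈ Algebra.adjoin K ({u} : Set D) :=
  ((show (Algebra.adjoin K ({u} : Set D))ˣ from s) : Algebra.adjoin K ({u} : Set D)).2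

theorem QuadUnits.commute (s : QuadUnits K u) : (s.toUnits : D) * u = u * s.toUnits :=
  adjoin_commute s.mem (Algebra.self_mem_adjoin_singleton K u)

theorem QuadUnits.ext' {s t : QuadUnits K u} (h : (s.toUnits : D) = t.toUnits) : s = t :=
  Units.ext (Subtype.ext h)

include Q hu

theorem quadMatrix_spec (s : QuadUnits K u) :
    quadMatrix K u (s.toUnits : D) 0 0 • (s.toUnits : D) +
      quadMatrix K u (s.toUnits : D) 0 1 • ((s.toUnits : D) * u) = 1 ∧
    quadMatrix K u (s.toUnits : D) 1 0 • (s.toUnits : D) +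
      quadMatrix K u (s.toUnits : D) 1 1 • ((s.toUnits : D) * u) = u := by
  obtain ⟨x, y, h⟩ := hu.exists_eq _ s.commute
  have hn : torusNorm (Q.tr u) (reducedNorm K u) x y ≠ 0 := by
    rw [Q.torusNorm_eq, ← h]
    intro h0
    exact s.toUnits.ne_zero (Q.nrd_eq_zero.1 h0)
  refine Classical.epsilon_spec (p := fun g : GL (Fin 2) K =>
    g 0 0 • (s.toUnits : D) + g 0 1 • ((s.toUnits : D) * u) = 1 ∧
    g 1 0 • (s.toUnits : D) + g 1 1 • ((s.toUnits : D) * u) = u)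
    ⟨⟨_, _, torusMat_mul hn, mul_torusMat hn⟩, ?_⟩
  rw [h]
  exact torusMat_relation Q.mul_self' hn

/-- Dividing the defining equations by `s` shows that the rows of `g_s` are the coordinates of `s⁻¹`
and `u s⁻¹` in the basis `1, u`. Continuity and integrality of `g_s` are read off from this. -/
theorem quadMatrix_eq (s : QuadUnits K u) :
    quadMatrix K u (s.toUnits : D) 0 0 • 1 + quadMatrix K u (s.toUnits : D) 0 1 • u =
      (s⁻¹.toUnits : D) ∧
    quadMatrix K u (s.toUnits : D) 1 0 • 1 + quadMatrix K u (s.toUnits : D) 1 1 • u =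
      u * (s⁻¹.toUnits : D) := by
  obtain ⟨h0, h1⟩ := quadMatrix_spec Q hu s
  have e : ∀ x y : K, (x • (s.toUnits : D) + y • ((s.toUnits : D) * u)) * (s⁻¹.toUnits : D) =
      x • 1 + y • u := by
    intro x y
    rw [add_mul, smul_mul_assoc, smul_mul_assoc, s.val_mul_inv, s.commute, mul_assoc,
      s.val_mul_inv, mul_one]
  exact ⟨by rw [← e, h0, one_mul], by rw [← e, h1]⟩

omit Q hu in
theorem quadEmbed_fst (s : QuadUnits K u × QuadUnits K u) : (quadEmbed K u s).fst = s.1.toUnits :=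
  rfl

omit Q hu in
theorem quadEmbed_snd (s : QuadUnits K u × QuadUnits K u) : (quadEmbed K u s).snd = s.2.toUnits :=
  rfl

omit Q hu in
theorem quadEmbed_mat (s : QuadUnits K u × QuadUnits K u) :
    (quadEmbed K u s).mat = quadMatrix K u ((s.1 * s.2).toUnits : D) := rfl

theorem quadEmbed_smul (s : QuadUnits K u × QuadUnits K u) :
    quadEmbed K u s • pairOf u = pairOf u := by
  rw [smul_pairOf_eq_iff, quadEmbed_fst, quadEmbed_snd, quadEmbed_mat]
  have h := quadMatrix_spec Q hu (s.1 * s.2)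
  have e : (s.1.toUnits : D) * u * s.2.toUnits = s.1.toUnits * s.2.toUnits * u := by
    rw [mul_assoc, mul_assoc, s.2.commute]
  rw [e]
  rw [show ((s.1 * s.2).toUnits : D) = s.1.toUnits * s.2.toUnits by
    rw [map_mul, Units.val_mul]] at h ⊢
  exact h

/-- The map `quadEmbed` as a homomorphism. -/
def quadHom : QuadUnits K u × QuadUnits K u →* PairGroup K D :=
  MonoidHom.mk' (quadEmbed K u) fun s t => by
    refine eq_of_smul_pairOf_eq hu.indep (quadEmbed_smul Q hu _) ?_ ?_ ?_
    · rw [mul_smul, quadEmbed_smul Q hu, quadEmbed_smul Q hu]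
    · rw [PairGroup.fst_mul, quadEmbed_fst, quadEmbed_fst, quadEmbed_fst, Prod.fst_mul, map_mul,
        Units.val_mul]
    · rw [PairGroup.snd_mul, quadEmbed_snd, quadEmbed_snd, quadEmbed_snd, Prod.snd_mul, map_mul,
        Units.val_mul]
      -- The second factor of `G` is an opposite group, so multiplicativity there uses that `K[u]`
      -- is commutative.
      exact adjoin_commute s.2.mem t.2.mem

theorem quadEmbed_mem (hd : disc K (pairOf u) ≠ 0) (s : QuadUnits K u × QuadUnits K u) :
    quadEmbed K u s ∈ stabComponent K (pairOf u) :=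
  (mem_stabComponent_iff Q hu hd).2 ⟨quadEmbed_smul Q hu s, s.1.commute.symm⟩

omit Q in
theorem exists_quadUnits {d d' : D} (h : d * d' = 1) (h' : d' * d = 1) (hd : d * u = u * d) :
    ∃ s : QuadUnits K u, (s.toUnits : D) = d := by
  have hd' : d' * u = u * d' := by
    calc d' * u = d' * (u * d) * d' := by rw [mul_assoc, mul_assoc, h, mul_one]
      _ = u * d' := by rw [← hd, ← mul_assoc, h', one_mul]
  exact ⟨(⟨⟨d, (mem_adjoin_iff_commute hu).2 hd⟩, ⟨d', (mem_adjoin_iff_commute hu).2 hd'⟩,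
    Subtype.ext h, Subtype.ext h'⟩ : (Algebra.adjoin K ({u} : Set D))ˣ), rfl⟩

theorem exists_quadEmbed (hd : disc K (pairOf u) ≠ 0) {g : PairGroup K D}
    (hg : g ∈ stabComponent K (pairOf u)) : ∃ s, quadEmbed K u s = g := by
  obtain ⟨h1, h2⟩ := (mem_stabComponent_iff Q hu hd).1 hg
  obtain ⟨s, hs⟩ := exists_quadUnits hu g.fst_mul_fst_inv g.fst_inv_mul_fst h2.symm
  obtain ⟨t, ht⟩ := exists_quadUnits hu g.snd_mul_snd_inv g.snd_inv_mul_snd (commute_snd hu h1 h2)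
  exact ⟨(s, t), eq_of_smul_pairOf_eq hu.indep (quadEmbed_smul Q hu _) h1 hs ht⟩

end Embed

variable {O K D : Type*} [CommRing O] [IsLocalRing O] [NontriviallyNormedField K]
  [IsUltrametricDist K] [ProperSpace K] [CharZero K] [Algebra O K]
  {ϖ : K} {q : ℕ} (hO : IsNormalizedLocal O K ϖ q)
  [Ring D] [Nontrivial D] [NoZeroDivisors D] [Algebra K D] [FiniteDimensional K D]
  [TopologicalSpace D] [IsModuleTopology K D] [IsTopologicalRing D] [ContinuousSMul K D]
  [PolishSpace D] [LocallyCompactSpace D]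
  (Q : NormConj K D) {u : D} (hu : IsSelfCentralizing K u)

instance : IsTopologicalRing (Algebra.adjoin K ({u} : Set D)) :=
  { continuous_neg := continuous_induced_rng.2 (continuous_neg.comp continuous_subtype_val) }

instance : IsModuleTopology K (Algebra.adjoin K ({u} : Set D)) :=
  IsModuleTopology.iso (ContinuousLinearEquiv.ofFinrankEq (𝕜 := K)
    (E := Fin (Module.finrank K (Algebra.adjoin K ({u} : Set D))) → K) (by simp))

instance : PolishSpace (Algebra.adjoin K ({u} : Set D)) := polishSpace_of_isModuleTopology K _

instance : LocallyCompactSpace (Algebra.adjoin K ({u} : Set D)) :=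
  locallyCompactSpace_of_isModuleTopology K _

instance : IsTopologicalGroup (QuadUnits K u) :=
  inferInstanceAs (IsTopologicalGroup (Algebra.adjoin K ({u} : Set D))ˣ)

instance : PolishSpace (QuadUnits K u) := polishSpace_units (Algebra.adjoin K ({u} : Set D))

instance : LocallyCompactSpace (QuadUnits K u) :=
  locallyCompactSpace_units (Algebra.adjoin K ({u} : Set D))

include hu in
theorem isClosedEmbedding_adjoin_val :
    Topology.IsClosedEmbedding (Subtype.val : Algebra.adjoin K ({u} : Set D) → D) := by
  refine IsClosed.isClosedEmbedding_subtypeVal ?_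
  have : ((Algebra.adjoin K ({u} : Set D) : Subalgebra K D) : Set D) = {d | d * u = u * d} := by
    ext d; exact mem_adjoin_iff_commute hu
  rw [this]
  exact isClosed_eq (continuous_id.mul continuous_const) (continuous_const.mul continuous_id)

include Q hu in
theorem isQuadraticNorm_adjoin :
    IsQuadraticNorm fun s : Algebra.adjoin K ({u} : Set D) => reducedNorm K (s : D) where
  apply_mul a b := Q.nrd_mul a b
  apply_one := NormConj.nrd_one
  apply_smul c a := Q.nrd_smul c a
  isCompact := (isClosedEmbedding_adjoin_val hu).isCompact_preimage (Q.isCompact_norm_le 1)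
  isOpen := (Q.isClopen_norm_le one_pos).isOpen.preimage continuous_subtype_val

include Q hu in
-- The matrix entries are linear coordinates of `s⁻¹` and `u s⁻¹`. For the topology of `GL(2)` the
-- inverse matrix must vary continuously too, and it is the matrix of the inverse argument because
-- the map is a homomorphism.
theorem continuous_quadEmbed : Continuous (quadEmbed K u) := by
  have hval : Continuous fun s : QuadUnits K u => (s.toUnits : D) :=
    continuous_subtype_val.comp (Units.continuous_val (M := Algebra.adjoin K ({u} : Set D)))
  have htu : Continuous (QuadUnits.toUnits : QuadUnits K u → Dˣ) :=
    Continuous.units_map _ continuous_subtype_val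
  have hcoord : Continuous (quadEquiv hu).symm :=
    IsModuleTopology.continuous_of_linearMap (quadEquiv hu).symm.toLinearMap
  have hsub : Continuous fun s : QuadUnits K u => (⟨_, s⁻¹.mem⟩ : Algebra.adjoin K ({u} : Set D)) :=
    (hval.comp continuous_inv).subtype_mk _
  have hsub' : Continuous fun s : QuadUnits K u =>
      (⟨_, mul_mem (Algebra.self_mem_adjoin_singleton K u) s⁻¹.mem⟩ :
        Algebra.adjoin K ({u} : Set D)) :=
    (continuous_const.mul (hval.comp continuous_inv)).subtype_mk _
  have hmat : Continuous fun s : QuadUnits K u =>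
      (quadMatrix K u (s.toUnits : D) : Matrix (Fin 2) (Fin 2) K) := by
    have h1 : ∀ s : QuadUnits K u, (quadEquiv hu).symm ⟨_, s⁻¹.mem⟩ =
        (quadMatrix K u (s.toUnits : D) 0 0, quadMatrix K u (s.toUnits : D) 0 1) := fun s =>
      coord_unique hu (quadMatrix_eq Q hu s).1.symm
    have h2 : ∀ s : QuadUnits K u, (quadEquiv hu).symm
        ⟨_, mul_mem (Algebra.self_mem_adjoin_singleton K u) s⁻¹.mem⟩ =
        (quadMatrix K u (s.toUnits : D) 1 0, quadMatrix K u (s.toUnits : D) 1 1) := fun s =>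
      coord_unique hu (quadMatrix_eq Q hu s).2.symm
    have c1 := (hcoord.comp hsub).congr h1
    have c2 := (hcoord.comp hsub').congr h2
    refine continuous_matrix fun i j => ?_
    fin_cases i <;> fin_cases j
    exacts [c1.fst, c1.snd, c2.fst, c2.snd]
  have hgl : Continuous fun s : QuadUnits K u × QuadUnits K u => (quadEmbed K u s).2.2 := by
    have hv : Continuous fun s : QuadUnits K u × QuadUnits K u =>
        ((quadEmbed K u s).2.2 : Matrix (Fin 2) (Fin 2) K) :=
      hmat.comp (continuous_fst.mul continuous_snd)
    refine Units.continuous_iff.2 ⟨hv, ?_⟩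
    refine (hv.comp continuous_inv).congr fun s => ?_
    have h : quadEmbed K u s⁻¹ = (quadEmbed K u s)⁻¹ := map_inv (quadHom Q hu) s
    change ((quadEmbed K u s⁻¹).2.2 : Matrix (Fin 2) (Fin 2) K) = _
    rw [h]
    rfl
  refine (htu.comp continuous_fst).prodMk (Continuous.prodMk ?_ hgl)
  refine Units.continuous_iff.2 ⟨?_, ?_⟩
  · exact MulOpposite.continuous_op.comp (hval.comp continuous_snd)
  · exact MulOpposite.continuous_op.comp
      (Units.continuous_val.comp (continuous_inv.comp (htu.comp continuous_snd)))

include Q hu in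
theorem isClosed_stabComponent (hd : disc K (pairOf u) ≠ 0) :
    IsClosed (stabComponent K (pairOf u) : Set (PairGroup K D)) := by
  have e : (stabComponent K (pairOf u) : Set (PairGroup K D)) =
      {g | g • pairOf u = pairOf u} ∩ {g | u * g.fst = g.fst * u} := by
    ext g; exact mem_stabComponent_iff Q hu hd
  rw [e]
  exact (isClosed_eq (continuous_id.smul continuous_const) continuous_const).inter
    (isClosed_eq (continuous_const.mul PairGroup.continuous_fst)
      (PairGroup.continuous_fst.mul continuous_const))

/-- The isomorphism of `(K[u]^×)²` onto the stabilizer component. -/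
def quadHomStab (hd : disc K (pairOf u) ≠ 0) :
    QuadUnits K u × QuadUnits K u →* stabComponent K (pairOf u) :=
  (quadHom Q hu).codRestrict _ (quadEmbed_mem Q hu hd)

include Q hu in
-- The pull-back to the closed subgroup of the measure transported to `G` is the direct transport to
-- the subgroup, since the map takes its values there.
theorem stabMeasure_eq [Algebra O D] (hd : disc K (pairOf u) ≠ 0) :
    stabMeasure O K u =
      ((quadMeasure O K u).prod (quadMeasure O K u)).map (quadHomStab Q hu hd) := by
  have hm : Measurable (quadHomStab Q hu hd) :=
    ((continuous_quadEmbed Q hu).subtype_mk _).measurable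
  have hemb : MeasurableEmbedding (Subtype.val : stabComponent K (pairOf u) → PairGroup K D) :=
    MeasurableEmbedding.subtype_coe (isClosed_stabComponent Q hu hd).measurableSet
  ext S hS
  rw [stabMeasure, hemb.comap_apply, Measure.map_apply (continuous_quadEmbed Q hu).measurable
    (hemb.measurableSet_image.2 hS), Measure.map_apply hm hS]
  congr 1
  ext s
  constructor
  · rintro ⟨h, hh, e⟩
    have : quadHomStab Q hu hd s = h := Subtype.ext e.symm
    rw [Set.mem_preimage, this]; exact hh
  · intro h
    exact ⟨_, h, rfl⟩

include Q hu in
theorem quadHomStab_surjective (hd : disc K (pairOf u) ≠ 0) :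
    Function.Surjective (quadHomStab Q hu hd) := fun h => by
  obtain ⟨s, hs⟩ := exists_quadEmbed Q hu hd h.2
  exact ⟨s, Subtype.ext hs⟩

/-- The group of units of `K[u]` that are congruent to `1`, up to `r`. -/
def quadCongruence (Q : NormConj K D) (u : D) (r : ℝ) : Subgroup (QuadUnits K u) where
  carrier := {s | ‖reducedNorm K (s.toUnits : D)‖ = 1 ∧ ‖reducedNorm K ((s.toUnits : D) - 1)‖ ≤ r ^ 2}
  one_mem' := by
    refine ⟨?_, ?_⟩
    · rw [map_one, Units.val_one, NormConj.nrd_one, norm_one]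
    · rw [map_one, Units.val_one, sub_self, Q.nrd_zero, norm_zero]; positivity
  mul_mem' := by
    rintro s t ⟨s1, s2⟩ ⟨t1, t2⟩
    refine ⟨?_, ?_⟩
    · rw [map_mul, Units.val_mul, Q.nrd_mul, norm_mul, s1, t1, one_mul]
    · have e : ((s * t).toUnits : D) - 1 = ((s.toUnits : D) - 1) * t.toUnits + (t.toUnits - 1) := by
        rw [map_mul, Units.val_mul]; noncomm_ring
      rw [e]
      exact Q.nrd_add_le (Q.norm_nrd_mul_le' s2 t1) t2
  inv_mem' := by
    rintro s ⟨s1, s2⟩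
    have i1 := Q.norm_nrd_of_mul_eq_one s.val_mul_inv s1
    refine ⟨i1, ?_⟩
    have e : (s⁻¹.toUnits : D) - 1 = -((s.toUnits - 1) * (s⁻¹.toUnits : D)) := by
      rw [sub_mul, one_mul, s.val_mul_inv, neg_sub]
    rw [e, Q.nrd_neg]
    exact Q.norm_nrd_mul_le' s2 i1

theorem mem_quadCongruence {r : ℝ} {s : QuadUnits K u} : s ∈ quadCongruence Q u r ↔
    ‖reducedNorm K (s.toUnits : D)‖ = 1 ∧ ‖reducedNorm K ((s.toUnits : D) - 1)‖ ≤ r ^ 2 := Iff.rfl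

theorem mem_quadCongruence_one {s : QuadUnits K u} : s ∈ quadCongruence Q u 1 ↔
    ‖reducedNorm K (s.toUnits : D)‖ = 1 :=
  ⟨fun h => h.1, fun h => ⟨h, by
    rw [one_pow]; exact Q.nrd_sub_le h.le (by rw [NormConj.nrd_one, norm_one])⟩⟩

theorem isOpen_quadCongruence {r : ℝ} (hr : 0 < r) :
    IsOpen (quadCongruence Q u r : Set (QuadUnits K u)) := by
  have hs : IsOpen {c : K | ‖c‖ = 1} := by
    have := IsUltrametricDist.isOpen_sphere (0 : K) one_ne_zero
    convert this using 1
    ext c; simp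
  have hval : Continuous fun s : QuadUnits K u => (s.toUnits : D) :=
    continuous_subtype_val.comp (Units.continuous_val (M := Algebra.adjoin K ({u} : Set D)))
  exact (hs.preimage (Q.continuous_norm.comp hval)).inter
    ((Q.isClopen_norm_le (by positivity)).isOpen.preimage (hval.sub continuous_const))

include hu in
theorem isCompact_quadCongruence_one :
    IsCompact (quadCongruence Q u 1 : Set (QuadUnits K u)) := by
  have h := isCompact_units_of_isCompact (isQuadraticNorm_adjoin Q hu).isCompact
  have e : (quadCongruence Q u 1 : Set (QuadUnits K u)) = {s : (Algebra.adjoin K ({u} : Set D))ˣ |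
      (s : Algebra.adjoin K ({u} : Set D)) ∈ {s : Algebra.adjoin K ({u} : Set D) | ‖reducedNorm K (s : D)‖ ≤ 1} ∧
      ((s⁻¹ : (Algebra.adjoin K ({u} : Set D))ˣ) : Algebra.adjoin K ({u} : Set D)) ∈
        {s : Algebra.adjoin K ({u} : Set D) | ‖reducedNorm K (s : D)‖ ≤ 1}} := by
    ext s
    refine (mem_quadCongruence_one Q).trans ?_
    constructor
    · intro h
      exact ⟨h.le, (Q.norm_nrd_of_mul_eq_one s.val_mul_inv h).le⟩
    · rintro ⟨h1, h2⟩
      refine le_antisymm h1 ?_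
      have h := congrArg (fun d => ‖reducedNorm K d‖) s.val_mul_inv
      simp only [Q.nrd_mul, norm_mul, NormConj.nrd_one, norm_one] at h
      rw [← h]; exact mul_le_of_le_one_right (norm_nonneg _) h2
  rw [e]
  exact h

variable [Algebra O D] [IsScalarTower O K D]

include Q hu hO in
theorem quadMeasure_spec : (quadMeasure O K u).IsHaarMeasure ∧ (quadMeasure O K u).Regular ∧
    quadMeasure O K u (quadCongruence Q u 1 : Set (QuadUnits K u)) = 1 := by
  have e : {s : QuadUnits K u | IsIntegral O (s.toUnits : D) ∧
      IsIntegral O ((s.toUnits⁻¹ : Dˣ) : D)} = (quadCongruence Q u 1 : Set (QuadUnits K u)) := by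
    ext s
    refine Iff.trans ?_ (mem_quadCongruence_one Q).symm
    rw [Set.mem_ofPred_eq, Q.isIntegral_iff hO, Q.isIntegral_iff hO]
    constructor
    · rintro ⟨h1, h2⟩
      refine le_antisymm h1 ?_
      have h := congrArg (fun d => ‖reducedNorm K d‖) s.val_mul_inv
      simp only [Q.nrd_mul, norm_mul, NormConj.nrd_one, norm_one] at h
      rw [← h]; exact mul_le_of_le_one_right (norm_nonneg _) (by rw [map_inv]; exact h2)
    · intro h
      refine ⟨h.le, ?_⟩
      have := (Q.norm_nrd_of_mul_eq_one s.val_mul_inv h).le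
      rwa [map_inv] at this
  have h := haarOf_spec (A := (quadCongruence Q u 1 : Set (QuadUnits K u)))
    (isCompact_quadCongruence_one Q hu)
    (by rw [(isOpen_quadCongruence Q one_pos).interior_eq]; exact ⟨1, one_mem _⟩)
  rw [quadMeasure, e]
  exact h

include Q hu hO in
-- The same coset comparison as for `G`, inside `K[u]`. The assumption that some `p` has norm of the
-- size of `ϖ` expresses ramification: the integral units have additive volume `1 - t` instead of `1
-- - t²`.
theorem measure_quadCongruence (p : QuadUnits K u) (hp : ‖reducedNorm K (p.toUnits : D)‖ = ‖ϖ‖)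
    (n : ℕ) (hn : n ≠ 0) :
    quadMeasure O K u (quadCongruence Q u (‖ϖ‖ ^ n) : Set (QuadUnits K u)) *
      ENNReal.ofReal (1 - ‖ϖ‖) = ENNReal.ofReal (‖ϖ‖ ^ (2 * n)) := by
  let : MeasurableSpace ↥(Algebra.adjoin K ({u} : Set D)) := borel _
  have : BorelSpace ↥(Algebra.adjoin K ({u} : Set D)) := ⟨rfl⟩
  obtain ⟨hl1, hl2, hl3⟩ := quadMeasure_spec hO Q hu
  have hϖ := hO.norm_pos
  set t := ‖ϖ‖ with ht
  have ht1 : t < 1 := hO.norm_lt_one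
  have hr2 : (t ^ n) ^ 2 < 1 := pow_lt_one₀ (by positivity) (pow_lt_one₀ hϖ.le ht1 hn) two_ne_zero
  have hN := isQuadraticNorm_adjoin Q hu
  let ν : Measure ↥(Algebra.adjoin K ({u} : Set D)) := addHaarOf {a | ‖reducedNorm K (a : D)‖ ≤ 1}
  obtain ⟨hν1, hν2, hν⟩ : ν.IsAddHaarMeasure ∧ ν.Regular ∧ ν {a | ‖reducedNorm K (a : D)‖ ≤ 1} = 1 :=
    addHaarOf_spec hN.isCompact (by rw [hN.isOpen.interior_eq]; exact ⟨0, hN.zero_mem⟩)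
  have hNc : Continuous fun a : ↥(Algebra.adjoin K ({u} : Set D)) => reducedNorm K (a : D) :=
    Q.continuous_norm.comp continuous_subtype_val
  let I : Set ↥(Algebra.adjoin K ({u} : Set D)) := {a | ‖reducedNorm K (a : D)‖ ≤ (t ^ n) ^ 2}
  have hI : MeasurableSet I := (isClosed_le hNc.norm continuous_const).measurableSet
  have hνI : ν I = ENNReal.ofReal (t ^ (2 * n)) := by
    have h := hN.measure_smul_ball hO ν hν n
    rw [finrank_adjoin hu] at h
    rw [mul_comm 2 n, ← h]
    congr 1
    ext a
    have h0 : ϖ ^ n ≠ 0 := pow_ne_zero n hO.ne_zero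
    constructor
    · intro ha
      refine ⟨(ϖ ^ n)⁻¹ • a, ?_, smul_inv_smul₀ h0 a⟩
      change ‖reducedNorm K ((ϖ ^ n)⁻¹ • (a : D))‖ ≤ _
      rw [Q.nrd_smul, norm_mul, norm_pow, norm_inv, norm_pow, inv_pow,
        inv_mul_le_iff₀ (by positivity), mul_one]
      exact ha
    · rintro ⟨b, hb, rfl⟩
      change ‖reducedNorm K (ϖ ^ n • (b : D))‖ ≤ _
      rw [Q.nrd_smul, norm_mul, norm_pow, norm_pow]
      exact mul_le_of_le_one_right (by positivity) hb
  let j : QuadUnits K u → ↥(Algebra.adjoin K ({u} : Set D)) := fun s => ⟨_, s.mem⟩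
  have hj : Function.Injective j := fun s t h => QuadUnits.ext' (congrArg Subtype.val h)
  have hex : ∀ a : ↥(Algebra.adjoin K ({u} : Set D)), ‖reducedNorm K (a : D)‖ = 1 → ∃ s : QuadUnits K u, j s = a := by
    intro a ha
    have ha0 : (a : D) ≠ 0 := fun h => by rw [h, Q.nrd_zero] at ha; simp at ha
    obtain ⟨h1, h2⟩ := Q.mul_inv_smul_conj ha0
    obtain ⟨s, hs⟩ := exists_quadUnits hu h1 h2 ((mem_adjoin_iff_commute hu).1 a.2)
    exact ⟨s, Subtype.ext hs⟩
  have hcos := measure_mul_measure_of_cosets (quadMeasure O K u) ν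
    (U := quadCongruence Q u 1) (U' := quadCongruence Q u (t ^ n))
    (fun s hs => (mem_quadCongruence_one Q).2 hs.1) (isCompact_quadCongruence_one Q hu)
    (isOpen_quadCongruence Q (by positivity)) hj hI (by
      intro s hs
      have s1 := hs.1
      have s2 := ((quadCongruence Q u 1).inv_mem hs).1
      ext w
      constructor
      · rintro ⟨_, ⟨h, hh, rfl⟩, rfl⟩
        refine ⟨j s * (j h - 1), Q.norm_nrd_mul_le s1 hh.2, ?_⟩
        change j s + j s * (j h - 1) = j s * j h
        rw [mul_sub, mul_one, add_sub_cancel]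
      · rintro ⟨a, ha, rfl⟩
        obtain ⟨g, hg⟩ := hex (j s + a) (Q.norm_nrd_add s1 hr2 ha)
        have hg' : (g.toUnits : D) = s.toUnits + a := congrArg Subtype.val hg
        refine ⟨g, ⟨s⁻¹ * g, ⟨?_, ?_⟩, mul_inv_cancel_left s g⟩, hg⟩
        · rw [map_mul, Units.val_mul, Q.nrd_mul, norm_mul, s2, one_mul, hg']
          exact Q.norm_nrd_add s1 hr2 ha
        · have e : ((s⁻¹ * g).toUnits : D) - 1 = (s⁻¹.toUnits : D) * a := by
            rw [map_mul, Units.val_mul, hg', mul_add, map_inv, Units.inv_mul, add_sub_cancel_left]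
          rw [e]
          exact Q.norm_nrd_mul_le s2 ha)
  have himg : j '' (quadCongruence Q u 1 : Set (QuadUnits K u)) =
      {a : ↥(Algebra.adjoin K ({u} : Set D)) | ‖reducedNorm K (a : D)‖ = 1} := by
    ext a
    constructor
    · rintro ⟨s, hs, rfl⟩; exact hs.1
    · intro ha
      obtain ⟨s, rfl⟩ := hex a ha
      exact ⟨s, (mem_quadCongruence_one Q).2 ha, rfl⟩
  have hvol := hN.measure_norm_eq_one hO ν (m := 1) (finrank_adjoin hu) hν
    (show (Algebra.adjoin K ({u} : Set D))ˣ from p) hp hNc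
  rw [himg, hvol, hl3, one_mul, hνI, pow_one] at hcos
  exact hcos.symm

include Q hu hO in
theorem stabMeasure_spec (hd : disc K (pairOf u) ≠ 0) :
    SFinite (stabMeasure O K u) ∧ (stabMeasure O K u).IsMulLeftInvariant := by
  obtain ⟨hl1, hl2, hl3⟩ := quadMeasure_spec hO Q hu
  have hm : Measurable (quadHomStab Q hu hd) :=
    ((continuous_quadEmbed Q hu).subtype_mk _).measurable
  rw [stabMeasure_eq Q hu hd]
  exact ⟨inferInstance, isMulLeftInvariant_map (quadHomStab Q hu hd).toMulHom hm
    (quadHomStab_surjective Q hu hd)⟩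

end Quad

end PairQuat

namespace PairQuat

/-! ### Commutators with a quadratic element -/

section Commutator

set_option linter.unusedSectionVars false

variable {K D : Type*} [Field K] [Ring D] [Algebra K D]

/-- The commutator with `u`. -/
def comm (u d : D) : D := u * d - d * u

theorem comm_add (u a b : D) : comm u (a + b) = comm u a + comm u b := by
  simp only [comm]; noncomm_ring

theorem comm_sub (u a b : D) : comm u (a - b) = comm u a - comm u b := by
  simp only [comm]; noncomm_ring

theorem comm_smul (c : K) (u a : D) : comm u (c • a) = c • comm u a := by
  simp only [comm, smul_sub, mul_smul_comm, smul_mul_assoc]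

theorem comm_eq_zero {u d : D} : comm u d = 0 ↔ d * u = u * d :=
  sub_eq_zero.trans eq_comm

theorem comm_mul_of_commute {u m : D} (hm : m * u = u * m) (d : D) :
    comm u (m * d) = m * comm u d := by
  rw [comm, comm, mul_sub, ← mul_assoc, ← hm, mul_assoc, mul_assoc]

variable [Nontrivial D] (Q : NormConj K D) (u : D)

namespace NormConj
include Q

/-- Commutators with `u` are exactly what intertwines `u` and `ū`, by the quadratic equation of `u`;
nothing has to be divided by two. -/
theorem comm_mul_self (d : D) : comm u d * u = Q.conj u * comm u d := by
  have h : u * (u * d) = Q.tr u • (u * d) - d * algebraMap K D (reducedNorm K u) := by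
    rw [← mul_assoc, Q.mul_self u, sub_mul, smul_mul_assoc, Algebra.commutes]
  rw [comm, Q.conj_eq, sub_mul, sub_mul, mul_assoc d u u, Q.mul_self u, mul_sub u, h]
  simp only [mul_sub, smul_mul_assoc, mul_smul_comm, one_mul, mul_assoc]
  abel

variable {u}

theorem comm_of_twisted {z : D} (hz : z * u = Q.conj u * z) : comm u z = (u - Q.conj u) * z := by
  rw [comm, hz, sub_mul]

theorem mul_conj_of_twisted {z : D} (hz : z * u = Q.conj u * z) : z * Q.conj u = u * z := by
  have h : Q.conj u = Q.tr u • 1 - u := Q.conj_eq u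
  rw [h] at hz ⊢
  rw [mul_sub, mul_smul_comm, mul_one, hz, sub_mul, smul_mul_assoc, one_mul, sub_sub_cancel]

theorem comm_comm (d : D) : comm u (comm u d) = (u - Q.conj u) * comm u d :=
  Q.comm_of_twisted (Q.comm_mul_self u d)

theorem conj_sub_commute : (u - Q.conj u) * u = u * (u - Q.conj u) := by
  rw [Q.conj_eq, sub_mul, mul_sub, sub_mul, mul_sub, smul_mul_assoc, mul_smul_comm, one_mul, mul_one]

/-- The quotient of two twisted elements commutes with `u`, because the inverse of a twisted element
is twisted. Twisted elements thus form a line over `K[u]`. -/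
theorem exists_mul_of_twisted [NoZeroDivisors D] {z z' : D} (hz : z * u = Q.conj u * z)
    (hz' : z' * u = Q.conj u * z') (h0 : z ≠ 0) : ∃ m, m * u = u * m ∧ z' = m * z := by
  obtain ⟨h1, h2⟩ := Q.mul_inv_smul_conj h0
  set w := (reducedNorm K z)⁻¹ • Q.conj z with hw
  refine ⟨z' * w, ?_, by rw [mul_assoc, h2, mul_one]⟩
  have e : w * u = Q.conj u * w := by
    calc w * u = w * (u * z) * w := by rw [mul_assoc, mul_assoc, h1, mul_one]
      _ = w * z * Q.conj u * w := by rw [← Q.mul_conj_of_twisted hz, mul_assoc w z]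
      _ = Q.conj u * w := by rw [h2, one_mul]
  rw [mul_assoc, e, ← mul_assoc, Q.mul_conj_of_twisted hz', mul_assoc]

end NormConj

end Commutator

/-! ### The stabilizer of a ramified representative -/

section Representative

set_option linter.unusedSectionVars false

open scoped ENNReal

/-- `u` generates the ring of integers of the quadratic algebra `K[u]`, which is ramified with a
uniformizer of norm `ϖ` up to units. -/
structure IsRamifiedGenerator {K D : Type*} [NormedField K] [Ring D] [Algebra K D] (ϖ : K) (u : D) :
    Prop where
  selfCentralizing : IsSelfCentralizing K u
  disc_ne_zero : disc K (pairOf u) ≠ 0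
  norm_le : ‖reducedNorm K u‖ ≤ 1
  coord_le : ∀ x y : K, ‖reducedNorm K (x • (1 : D) + y • u)‖ ≤ 1 → ‖x‖ ≤ 1 ∧ ‖y‖ ≤ 1
  exists_uniformizer : ∃ p : QuadUnits K u, ‖reducedNorm K (p.toUnits : D)‖ = ‖ϖ‖

variable {O K D : Type*} [CommRing O] [IsLocalRing O] [NontriviallyNormedField K]
  [IsUltrametricDist K] [ProperSpace K] [CharZero K] [Algebra O K]
  {ϖ : K} {q : ℕ} (hO : IsNormalizedLocal O K ϖ q)
  [Ring D] [Nontrivial D] [NoZeroDivisors D] [Algebra K D] [FiniteDimensional K D]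
  [TopologicalSpace D] [IsModuleTopology K D] [IsTopologicalRing D] [ContinuousSMul K D]
  [PolishSpace D] [LocallyCompactSpace D]
  (Q : NormConj K D) {u : D} (hu : IsRamifiedGenerator ϖ u)

namespace IsRamifiedGenerator

include Q hu

theorem coord_le_pow (hϖ : ϖ ≠ 0) (n : ℕ) {x y : K}
    (h : ‖reducedNorm K (x • (1 : D) + y • u)‖ ≤ (‖ϖ‖ ^ n) ^ 2) :
    ‖x‖ ≤ ‖ϖ‖ ^ n ∧ ‖y‖ ≤ ‖ϖ‖ ^ n := by
  have h0 : ϖ ^ n ≠ 0 := pow_ne_zero n hϖ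
  have h1 : ‖reducedNorm K (((ϖ ^ n)⁻¹ * x) • (1 : D) + ((ϖ ^ n)⁻¹ * y) • u)‖ ≤ 1 := by
    rw [← smul_smul, ← smul_smul, ← smul_add, Q.nrd_smul, norm_mul, norm_pow, norm_inv, norm_pow,
      inv_pow, inv_mul_le_iff₀ (by positivity), mul_one]
    exact h
  have h2 := hu.coord_le _ _ h1
  rwa [norm_mul, norm_mul, norm_inv, norm_pow, inv_mul_le_iff₀ (by positivity), mul_one,
    inv_mul_le_iff₀ (by positivity), mul_one] at h2

/-- The matrix imposes no further condition: its rows are the coordinates of `s⁻¹` and `u s⁻¹`, and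
since `1, u` is an integral basis, congruences in `K[u]` become congruences of coordinates. -/
theorem quadEmbed_mem_congruenceSubgroup (hϖ : ϖ ≠ 0) (n : ℕ) (s : QuadUnits K u × QuadUnits K u) :
    quadEmbed K u s ∈ Q.congruenceSubgroup (‖ϖ‖ ^ n) (by positivity) ↔
      s.1 ∈ quadCongruence Q u (‖ϖ‖ ^ n) ∧ s.2 ∈ quadCongruence Q u (‖ϖ‖ ^ n) := by
  rw [Q.mem_congruenceSubgroup, mem_quadCongruence, mem_quadCongruence, quadEmbed_fst,
    quadEmbed_snd]
  constructor
  · rintro ⟨h1, h2, -, -, h3, h4, -⟩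
    exact ⟨⟨h1, h3⟩, h2, h4⟩
  · rintro ⟨⟨h1, h3⟩, h2, h4⟩
    have hs : s.1 * s.2 ∈ quadCongruence Q u (‖ϖ‖ ^ n) := mul_mem ⟨h1, h3⟩ ⟨h2, h4⟩
    obtain ⟨i1, i2⟩ := inv_mem hs
    have e := quadMatrix_eq Q hu.selfCentralizing (s.1 * s.2)
    set i : D := ((s.1 * s.2)⁻¹.toUnits : D) with hi
    set m := (quadEmbed K u s).mat with hm
    have e0 : m 0 0 • (1 : D) + m 0 1 • u = i := e.1
    have e1 : m 1 0 • (1 : D) + m 1 1 • u = u * i := e.2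
    have hmul : ∀ {d : D} {r : ℝ}, ‖reducedNorm K d‖ ≤ r → ‖reducedNorm K (u * d)‖ ≤ r := by
      intro d r hd
      rw [Q.nrd_mul, norm_mul]
      exact (mul_le_of_le_one_left (norm_nonneg _) hu.norm_le).trans hd
    -- The element fixes `x`, so the multiplier of `P` is one. With both norms units, the
    -- determinant must be a unit.
    have hdisc := Q.disc_smul (quadEmbed K u s) (pairOf u)
    rw [quadEmbed_smul Q hu.selfCentralizing, eq_comm] at hdisc
    have hdet := congrArg norm (mul_right_cancel₀ hu.disc_ne_zero (hdisc.trans (one_mul _).symm))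
    rw [quadEmbed_fst, quadEmbed_snd, norm_pow, norm_mul, norm_mul, h1, h2, one_mul, one_mul,
      norm_one] at hdet
    have a0 := hu.coord_le (m 0 0) (m 0 1) (by rw [e0]; exact i1.le)
    have a1 := hu.coord_le (m 1 0) (m 1 1) (by rw [e1]; exact hmul i1.le)
    have b0 := hu.coord_le_pow Q hϖ n (x := m 0 0 - 1) (y := m 0 1) (by
      rw [sub_smul, one_smul, sub_add_eq_add_sub, e0]; exact i2)
    have b1 := hu.coord_le_pow Q hϖ n (x := m 1 0) (y := m 1 1 - 1) (by
      rw [sub_smul, one_smul, add_sub_assoc', e1, show u * i - u = u * (i - 1) by noncomm_ring]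
      exact hmul i2)
    refine ⟨h1, h2, ?_, (pow_eq_one_iff_of_nonneg (norm_nonneg _) two_ne_zero).1 hdet, h3, h4, ?_⟩
    · intro k l
      fin_cases k <;> fin_cases l
      exacts [a0.1, a0.2, a1.1, a1.2]
    · intro k l
      rw [Matrix.sub_apply, Matrix.one_apply]
      fin_cases k <;> fin_cases l
      · simpa using b0.1
      · simpa using b0.2
      · simpa using b1.1
      · simpa using b1.2

variable [Algebra O D] [IsScalarTower O K D]

include hO

theorem stabMeasure_congruenceSubgroup (n : ℕ) :
    stabMeasure O K u {h | (h : PairGroup K D) ∈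
      Q.congruenceSubgroup (‖ϖ‖ ^ n) (by positivity)} =
    quadMeasure O K u (quadCongruence Q u (‖ϖ‖ ^ n) : Set (QuadUnits K u)) ^ 2 := by
  obtain ⟨hl1, hl2, hl3⟩ := quadMeasure_spec hO Q hu.selfCentralizing
  have hm : Measurable (quadHomStab Q hu.selfCentralizing hu.disc_ne_zero) :=
    ((continuous_quadEmbed Q hu.selfCentralizing).subtype_mk _).measurable
  have hpos : 0 < ‖ϖ‖ ^ n := pow_pos hO.norm_pos n
  have hS : MeasurableSet {h : stabComponent K (pairOf u) | (h : PairGroup K D) ∈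
      Q.congruenceSubgroup (‖ϖ‖ ^ n) (by positivity)} :=
    ((Q.isOpen_congruenceSubgroup hpos).preimage continuous_subtype_val).measurableSet
  rw [stabMeasure_eq Q hu.selfCentralizing hu.disc_ne_zero, Measure.map_apply hm hS, sq,
    ← Measure.prod_prod]
  congr 1
  ext s
  exact hu.quadEmbed_mem_congruenceSubgroup Q hO.ne_zero n s

theorem stabMeasure_congruenceSubgroup_one :
    stabMeasure O K u {h | (h : PairGroup K D) ∈ Q.congruenceSubgroup 1 zero_le_one} = 1 := by
  have h := hu.stabMeasure_congruenceSubgroup hO Q 0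
  simp only [pow_zero] at h
  rw [h, (quadMeasure_spec hO Q hu.selfCentralizing).2.2, one_pow]

omit [Algebra O D] [IsScalarTower O K D]

/-- There is an element of norm one that conjugates `u` to its conjugate. -/
theorem exists_twisted (hfin : Module.finrank K D = 4) :
    ∃ z : D, ‖reducedNorm K z‖ = 1 ∧ z * u = Q.conj u * z := by
  obtain ⟨w, hw⟩ : ∃ w : D, w * u ≠ u * w := by
    by_contra! h
    have : (⊤ : Submodule K D) ≤ Subalgebra.toSubmodule (Algebra.adjoin K ({u} : Set D)) :=
      fun d _ => (mem_adjoin_iff_commute hu.selfCentralizing).2 (h d)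
    have h2 := Submodule.finrank_mono this
    rw [finrank_top, hfin] at h2
    have h3 := finrank_adjoin hu.selfCentralizing
    have : Module.finrank K (Subalgebra.toSubmodule (Algebra.adjoin K ({u} : Set D))) = 2 := h3
    omega
  have hz0 : comm u w ≠ 0 := fun h => hw (comm_eq_zero.1 h)
  have hz := Q.comm_mul_self u w
  obtain ⟨k, hk⟩ := hO.exists_zpow _ (fun h => hz0 (Q.nrd_eq_zero.1 h))
  -- Ramification enters here: the norm of a twisted element has the size of a power of `ϖ`, and it
  -- can be normalized by a power of the uniformizer of `K[u]` without losing the twisted relation.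
  obtain ⟨p, hp⟩ := hu.exists_uniformizer
  have hp' : ∀ k : ℤ, ‖reducedNorm K ((p ^ k).toUnits : D)‖ = ‖ϖ‖ ^ k := by
    let f : QuadUnits K u →* ℝ :=
      { toFun := fun s => ‖reducedNorm K (s.toUnits : D)‖
        map_one' := by rw [map_one, Units.val_one, NormConj.nrd_one, norm_one]
        map_mul' := fun s t => by rw [map_mul, Units.val_mul, Q.nrd_mul, norm_mul] }
    intro k
    have := map_zpow' f (fun s => eq_inv_of_mul_eq_one_right (by
      rw [← map_mul, mul_inv_cancel, map_one])) p k
    rw [show f p = ‖ϖ‖ from hp] at this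
    exact this
  refine ⟨((p ^ (-k)).toUnits : D) * comm u w, ?_, ?_⟩
  · rw [Q.nrd_mul, norm_mul, hp', hk, ← zpow_add₀ hO.norm_pos.ne', neg_add_cancel, zpow_zero]
  · have hc := (p ^ (-k)).commute
    rw [mul_assoc, hz, ← mul_assoc, ← mul_assoc]
    congr 1
    rw [Q.conj_eq, mul_sub, sub_mul, hc, mul_smul_comm, smul_mul_assoc, one_mul, mul_one]

/-- Take `τ = (z, z⁻¹, m)` with `z` twisted of unit norm. Its first two components send `(1, u)` to
`(1, ū)`, and since `ū = tr(u) - u` the matrix `m` with rows `(1, 0)` and `(tr(u), -1)` restores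
`(1, u)`. All components are integral units, so `τ` lies in `U₀`. -/
theorem exists_halfStabilizer (hfin : Module.finrank K D = 4) :
    ∃ τ ∈ Q.congruenceSubgroup 1 zero_le_one, IsHalfStabilizer (stabComponent K (pairOf u))
      (pairOf u) τ ∧ τ.fst * u = Q.conj u * τ.fst := by
  obtain ⟨z, hz1, hz⟩ := hu.exists_twisted hO Q hfin
  have hz0 : z ≠ 0 := fun h => by rw [h, Q.nrd_zero] at hz1; simp at hz1
  obtain ⟨h1, h2⟩ := Q.mul_inv_smul_conj hz0
  set w := (reducedNorm K z)⁻¹ • Q.conj z with hw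
  have hw1 : ‖reducedNorm K w‖ = 1 := Q.norm_nrd_of_mul_eq_one h1 hz1
  have hw0 : w ≠ 0 := fun h => by rw [h, Q.nrd_zero] at hw1; simp at hw1
  have hdet : (!![1, 0; Q.tr u, -1] : Matrix (Fin 2) (Fin 2) K).det = -1 := by
    rw [Matrix.det_fin_two_of]; ring
  obtain ⟨τ, t1, t2, t3⟩ := exists_pairGroup Q hz0 hw0 (hdet.trans_ne (by norm_num))
  have htr : ‖Q.tr u‖ ≤ 1 := Q.norm_tr_le_one hu.norm_le
  have huu := Q.mul_self' (u := u)
  have hD2 : (2 : K) ≠ 0 := two_ne_zero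
  have hmem := fun {g : PairGroup K D} =>
    mem_stabComponent_iff Q hu.selfCentralizing hu.disc_ne_zero (g := g)
  have hτx : τ • pairOf u = pairOf u := by
    rw [smul_pairOf_eq_iff, t1, t2, t3]
    refine ⟨by simp [h1], ?_⟩
    have : z * u * w = Q.conj u := by rw [hz, mul_assoc, h1, mul_one]
    rw [this, h1, Q.conj_eq]
    simp
  have hcu : Q.conj u ≠ u := by
    intro h
    have h3 := Q.nrd_conj_sub u
    rw [h, sub_self, Q.nrd_zero, eq_comm, neg_eq_zero] at h3
    exact hu.disc_ne_zero h3
  have hinv : τ⁻¹.fst = w := by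
    have := τ.fst_inv_mul_fst
    rw [t1] at this
    rw [← mul_one τ⁻¹.fst, ← h1, ← mul_assoc, this, one_mul]
  have hwu : w * Q.conj u = u * w := by
    calc w * Q.conj u = w * (Q.conj u * z) * w := by rw [mul_assoc, mul_assoc, h1, mul_one]
      _ = u * w := by rw [← hz, ← mul_assoc, h2, one_mul]
  have hwu' : w * u = Q.conj u * w := by
    calc w * u = w * (u * z) * w := by rw [mul_assoc, mul_assoc, h1, mul_one]
      _ = Q.conj u * w := by rw [← Q.mul_conj_of_twisted hz, ← mul_assoc, h2, one_mul]
  have hiff : ∀ g : PairGroup K D, g • pairOf u = pairOf u ↔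
      g ∈ stabComponent K (pairOf u) ∨ τ⁻¹ * g ∈ stabComponent K (pairOf u) := by
    intro g
    constructor
    · intro hg
      rcases commute_or_conj_of_smul_eq hD2 huu hu.selfCentralizing.indep
        (by rw [← Q.disc_pairOf]; exact hu.disc_ne_zero) hg with h | h
      · exact Or.inl (hmem.2 ⟨hg, h⟩)
      · refine Or.inr (hmem.2 ⟨?_, ?_⟩)
        · rw [mul_smul, hg, inv_smul_eq_iff, hτx]
        · rw [← Q.conj_eq] at h
          rw [PairGroup.fst_mul, hinv, ← mul_assoc, ← hwu, mul_assoc, mul_assoc]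
          congr 1
          rw [Q.conj_eq] at h ⊢
          rw [sub_mul, h, smul_mul_assoc, one_mul, mul_sub, mul_smul_comm, mul_one, sub_sub_cancel]
    · rintro (h | h)
      · exact (hmem.1 h).1
      · have := (hmem.1 h).1
        rwa [mul_smul, inv_smul_eq_iff, hτx] at this
  refine ⟨τ, Q.mem_congruenceSubgroup_one.2 ⟨by rw [t1, hz1], by rw [t2, hw1], ?_, ?_⟩,
    ⟨hiff, ?_, ?_⟩, by rw [t1, hz]⟩
  · rw [t3]
    intro i j
    fin_cases i <;> fin_cases j <;> simp [htr]
  · rw [t3, hdet, norm_neg, norm_one]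
  · intro h
    have h3 := (hmem.1 h).2
    rw [t1, hz] at h3
    have h4 : (Q.conj u - u) * z = 0 := by rw [sub_mul, ← h3, sub_self]
    rcases mul_eq_zero.1 h4 with h4 | h4
    · exact hcu (sub_eq_zero.1 h4)
    · exact hz0 h4
  · intro h hh
    obtain ⟨g1, g2⟩ := hmem.1 hh
    refine hmem.2 ⟨?_, ?_⟩
    · rw [mul_smul, mul_smul, hτx, g1, inv_smul_eq_iff, hτx]
    · rw [PairGroup.fst_mul, PairGroup.fst_mul, hinv, t1, ← mul_assoc, ← mul_assoc, ← hwu,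
        mul_assoc, mul_assoc, mul_assoc, mul_assoc, hz]
      congr 1
      rw [← mul_assoc, ← mul_assoc]
      congr 1
      rw [Q.conj_eq, sub_mul, mul_sub, g2, smul_mul_assoc, mul_smul_comm, one_mul, mul_one]

omit hO
/-- The elements of the other coset are far away from one. -/
theorem mul_notMem_congruenceSubgroup {τ : PairGroup K D} (hτ : τ.fst * u = Q.conj u * τ.fst)
    {r : ℝ} (hr : 0 ≤ r) (hr2 : r ^ 2 < ‖disc K (pairOf u)‖)
    {h : PairGroup K D} (hh : h ∈ stabComponent K (pairOf u)) :
    τ * h ∉ Q.congruenceSubgroup r hr := by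
  intro hmem
  obtain ⟨h1, -, -, -, h3, -⟩ := Q.mem_congruenceSubgroup.1 hmem
  obtain ⟨-, g2⟩ := (mem_stabComponent_iff Q hu.selfCentralizing hu.disc_ne_zero).1 hh
  have e : (τ * h).fst * u = Q.conj u * (τ * h).fst := by
    rw [PairGroup.fst_mul, mul_assoc, ← g2, ← mul_assoc, hτ, mul_assoc]
  -- The commutator with `u` kills `1`, so it is small if the first component is near `1`. On the
  -- other coset it equals `(u - ū)` times a unit, whose norm has the size of the discriminant.
  have e1 : comm u (τ * h).fst = comm u ((τ * h).fst - 1) := by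
    rw [comm_sub, show comm u (1 : D) = 0 by simp [comm], sub_zero]
  have e2 : ‖reducedNorm K (comm u (τ * h).fst)‖ = ‖disc K (pairOf u)‖ := by
    rw [Q.comm_of_twisted e, Q.nrd_mul, norm_mul, h1, mul_one, ← neg_sub, Q.nrd_neg,
      Q.nrd_conj_sub, norm_neg]
  have e3 : ‖reducedNorm K (comm u ((τ * h).fst - 1))‖ ≤ r ^ 2 := by
    refine Q.nrd_sub_le ?_ ?_
    · rw [Q.nrd_mul, norm_mul]
      exact (mul_le_of_le_one_left (norm_nonneg _) hu.norm_le).trans h3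
    · rw [Q.nrd_mul, norm_mul]
      exact (mul_le_of_le_one_right (norm_nonneg _) hu.norm_le).trans h3
  rw [← e1, e2] at e3
  exact absurd e3 (not_le.2 hr2)

end IsRamifiedGenerator

end Representative

end PairQuat

namespace PairQuat

/-! ### The orbit of a congruence subgroup -/

section CongruenceOrbit

set_option linter.unusedSectionVars false

variable {O K D : Type*} [CommRing O] [IsLocalRing O] [NontriviallyNormedField K]
  [IsUltrametricDist K] [ProperSpace K] [CharZero K] [Algebra O K]
  {ϖ : K} {q : ℕ} (hO : IsNormalizedLocal O K ϖ q)
  [Ring D] [Nontrivial D] [NoZeroDivisors D] [Algebra K D] [FiniteDimensional K D]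
  [TopologicalSpace D] [IsModuleTopology K D] [IsTopologicalRing D] [ContinuousSMul K D]
  [PolishSpace D] [LocallyCompactSpace D]
  (Q : NormConj K D) {u w : D} (hu : IsRamifiedGenerator ϖ u)

/-- `w` is an integral element whose commutator with `u` has maximal norm. -/
structure IsMaximalComm (K : Type*) {D : Type*} [NormedField K] [Ring D] [Algebra K D] (u w : D) :
    Prop where
  norm_le : ‖reducedNorm K w‖ ≤ 1
  ne_zero : comm u w ≠ 0
  le : ∀ d : D, ‖reducedNorm K d‖ ≤ 1 →
    ‖reducedNorm K (comm u d)‖ ≤ ‖reducedNorm K (comm u w)‖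

include Q hu in
-- A maximum exists because the integers of `D` are compact. It is nonzero: otherwise, after scaling
-- into the unit ball, all of `D` would commute with `u`.
theorem exists_isMaximalComm (hfin : Module.finrank K D = 4) : ∃ w : D, IsMaximalComm K u w := by
  have hc : Continuous fun d : D => ‖reducedNorm K (comm u d)‖ :=
    (Q.continuous_norm.comp ((continuous_const.mul continuous_id).sub
      (continuous_id.mul continuous_const))).norm
  obtain ⟨w, hw, hmax⟩ := (Q.isCompact_norm_le 1).exists_isMaxOn
    ⟨0, by rw [Set.mem_ofPred_eq, Q.nrd_zero, norm_zero]; exact zero_le_one⟩ hc.continuousOn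
  refine ⟨w, hw, fun h0 => ?_, hmax⟩
  have hle : (⊤ : Submodule K D) ≤ Subalgebra.toSubmodule (Algebra.adjoin K ({u} : Set D)) := by
    intro d _
    refine (mem_adjoin_iff_commute hu.selfCentralizing).2 (comm_eq_zero.1 ?_)
    obtain ⟨c, hc0, hc1⟩ : ∃ c : K, c ≠ 0 ∧ ‖reducedNorm K (c • d)‖ ≤ 1 := by
      obtain ⟨c, hc0, hc⟩ := NormedField.exists_norm_lt K
        (show 0 < (1 + ‖reducedNorm K d‖)⁻¹ by positivity)
      refine ⟨c, norm_pos_iff.1 hc0, ?_⟩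
      have h1 : (1 + ‖reducedNorm K d‖)⁻¹ ≤ 1 := inv_le_one_of_one_le₀ (by simp)
      rw [Q.nrd_smul, norm_mul, norm_pow, sq, mul_assoc]
      refine mul_le_one₀ (hc.le.trans h1) (by positivity) ?_
      calc ‖c‖ * ‖reducedNorm K d‖ ≤ (1 + ‖reducedNorm K d‖)⁻¹ * (1 + ‖reducedNorm K d‖) := by
            gcongr; simp
        _ = 1 := inv_mul_cancel₀ (by positivity)
    have h2 : ‖reducedNorm K (comm u (c • d))‖ ≤ ‖reducedNorm K (comm u w)‖ := hmax hc1
    rw [h0, Q.nrd_zero, norm_zero, comm_smul, Q.nrd_smul, norm_mul] at h2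
    rcases mul_eq_zero.1 (le_antisymm h2 (by positivity)) with h | h
    · exact absurd (norm_eq_zero.1 h) (pow_ne_zero 2 hc0)
    · exact Q.nrd_eq_zero.1 (norm_eq_zero.1 h)
  have h2 := Submodule.finrank_mono hle
  rw [finrank_top, hfin] at h2
  have h3 := finrank_adjoin hu.selfCentralizing
  have : Module.finrank K (Subalgebra.toSubmodule (Algebra.adjoin K ({u} : Set D))) = 2 := h3
  omega

variable (hw : IsMaximalComm K u w)

include Q hw in
theorem IsMaximalComm.le_of_le (hϖ : ϖ ≠ 0) (n : ℕ) {d : D}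
    (hd : ‖reducedNorm K d‖ ≤ (‖ϖ‖ ^ n) ^ 2) :
    ‖reducedNorm K (comm u d)‖ ≤ (‖ϖ‖ ^ n) ^ 2 * ‖reducedNorm K (comm u w)‖ := by
  have h0 : ϖ ^ n ≠ 0 := pow_ne_zero n hϖ
  have h1 : ‖reducedNorm K ((ϖ ^ n)⁻¹ • d)‖ ≤ 1 := by
    rw [Q.nrd_smul, norm_mul, norm_pow, norm_inv, norm_pow, inv_pow, inv_mul_le_iff₀ (by positivity),
      mul_one]
    exact hd
  have h2 := hw.le _ h1
  rwa [comm_smul, Q.nrd_smul, norm_mul, norm_pow, norm_inv, norm_pow, inv_pow,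
    inv_mul_le_iff₀ (by positivity)] at h2

include Q hw in
theorem IsMaximalComm.nrd_pos : 0 < ‖reducedNorm K (comm u w)‖ :=
  norm_pos_iff.2 fun h => hw.ne_zero (Q.nrd_eq_zero.1 h)

include Q in
theorem norm_nrd_conj_sub : ‖reducedNorm K (u - Q.conj u)‖ = ‖disc K (pairOf u)‖ := by
  rw [← neg_sub, Q.nrd_neg, Q.nrd_conj_sub, norm_neg]

/-- The elements of norm at most `r²` whose commutator with `u` is divisible by the different. -/
def commBall (K : Type*) {D : Type*} [NormedField K] [Ring D] [Algebra K D] (u w : D) (r : ℝ) :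
    Set D :=
  {d | ‖reducedNorm K d‖ ≤ r ^ 2 ∧ ‖reducedNorm K (comm u d)‖ ≤
    r ^ 2 * (‖disc K (pairOf u)‖ * ‖reducedNorm K (comm u w)‖)}

include Q in
theorem add_mem_commBall {r : ℝ} {a b : D} (ha : a ∈ commBall K u w r) (hb : b ∈ commBall K u w r) :
    a + b ∈ commBall K u w r :=
  ⟨Q.nrd_add_le ha.1 hb.1, by rw [comm_add]; exact Q.nrd_add_le ha.2 hb.2⟩

include Q in
theorem mem_commBall_of_commute {r : ℝ} {a : D} (ha : ‖reducedNorm K a‖ ≤ r ^ 2)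
    (hc : a * u = u * a) : a ∈ commBall K u w r :=
  ⟨ha, by rw [comm_eq_zero.2 hc, Q.nrd_zero, norm_zero]; positivity⟩

include Q hw in
-- Any element that is small enough, by a further factor of the size of the discriminant, lies in
-- the lattice. This is how second-order errors are absorbed.
theorem mem_commBall_of_le (hϖ : ϖ ≠ 0) (n : ℕ) {r : ℝ} (hr0 : 0 < r)
    (hn : (‖ϖ‖ ^ n) ^ 2 ≤ r ^ 2 * ‖disc K (pairOf u)‖) (hd1 : ‖disc K (pairOf u)‖ ≤ 1) {d : D}
    (hd : ‖reducedNorm K d‖ ≤ (‖ϖ‖ ^ n) ^ 2) : d ∈ commBall K u w r := by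
  refine ⟨hd.trans (hn.trans (mul_le_of_le_one_right (by positivity) hd1)), ?_⟩
  refine (hw.le_of_le Q hϖ n hd).trans ?_
  rw [← mul_assoc]
  exact mul_le_mul_of_nonneg_right hn (norm_nonneg _)

include Q hu in
theorem norm_mul_left_le {r : ℝ} {d : D} (hd : ‖reducedNorm K d‖ ≤ r) :
    ‖reducedNorm K (u * d)‖ ≤ r := by
  rw [Q.nrd_mul, norm_mul]
  exact (mul_le_of_le_one_left (norm_nonneg _) hu.norm_le).trans hd

include Q hu in
theorem norm_mul_right_le {r : ℝ} {d : D} (hd : ‖reducedNorm K d‖ ≤ r) :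
    ‖reducedNorm K (d * u)‖ ≤ r := by
  rw [Q.nrd_mul, norm_mul]
  exact (mul_le_of_le_one_right (norm_nonneg _) hu.norm_le).trans hd

include Q hu in
theorem norm_comm_le {r : ℝ} {d : D} (hd : ‖reducedNorm K d‖ ≤ r) :
    ‖reducedNorm K (comm u d)‖ ≤ r :=
  Q.nrd_sub_le (norm_mul_left_le Q hu hd) (norm_mul_right_le Q hu hd)

include Q hu hw in
-- A second commutator is multiplication of the first by `u - ū`, which supplies exactly the factor
-- `|P(x)|` demanded by `commBall`.
theorem comm_mem_commBall (hϖ : ϖ ≠ 0) (n : ℕ) {d : D}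
    (hd : ‖reducedNorm K d‖ ≤ (‖ϖ‖ ^ n) ^ 2) : comm u d ∈ commBall K u w (‖ϖ‖ ^ n) := by
  refine ⟨norm_comm_le Q hu hd, ?_⟩
  rw [Q.comm_comm, Q.nrd_mul, norm_mul, norm_nrd_conj_sub, mul_left_comm]
  exact mul_le_mul_of_nonneg_left (hw.le_of_le Q hϖ n hd) (norm_nonneg _)

include Q hu in
theorem norm_disc_le_one : ‖disc K (pairOf u)‖ ≤ 1 := by
  rw [← norm_nrd_conj_sub Q]
  exact Q.nrd_sub_le hu.norm_le (by rw [Q.nrd_conj]; exact hu.norm_le)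

include Q hu hw in
/-- Up to an element of `K[u]`, an element of the ball is a commutator. -/
theorem exists_comm_sub_commute {r : ℝ} {d : D} (hd : d ∈ commBall K u w r) :
    ∃ b : D, ‖reducedNorm K b‖ ≤ r ^ 2 ∧ (d - comm u b) * u = u * (d - comm u b) := by
  have hdisc : 0 < ‖disc K (pairOf u)‖ := norm_pos_iff.2 hu.disc_ne_zero
  obtain ⟨m, hm, hdm⟩ := Q.exists_mul_of_twisted (Q.comm_mul_self u w) (Q.comm_mul_self u d) hw.ne_zero
  have hc0 : u - Q.conj u ≠ 0 := fun h => by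
    have := norm_nrd_conj_sub (u := u) Q
    rw [h, Q.nrd_zero, norm_zero] at this
    exact hdisc.ne this
  obtain ⟨h1, h2⟩ := Q.mul_inv_smul_conj hc0
  set c := u - Q.conj u with hc
  set c' := (reducedNorm K c)⁻¹ • Q.conj c
  have hcc : c * u = u * c := Q.conj_sub_commute
  have hcc' : c' * u = u * c' := by
    calc c' * u = c' * (u * c) * c' := by rw [mul_assoc, mul_assoc, h1, mul_one]
      _ = u * c' := by rw [← hcc, ← mul_assoc, h2, one_mul]
  have hm' : (c' * m) * u = u * (c' * m) := by rw [mul_assoc, hm, ← mul_assoc, hcc', mul_assoc]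
  have hmn : ‖reducedNorm K m‖ ≤ r ^ 2 * ‖disc K (pairOf u)‖ := by
    have h3 := hd.2
    rw [hdm, Q.nrd_mul, norm_mul, ← mul_assoc] at h3
    exact le_of_mul_le_mul_right h3 (hw.nrd_pos Q)
  -- Here `[u, d] = m [u, w]` and `c' = (u - ū)⁻¹`. For `b = c' m w` the double commutator is `(u -
  -- ū) c' m [u, w] = [u, d]`, so `d - [u, b]` commutes with `u`; the bound on `[u, d]` makes `b`
  -- small enough.
  refine ⟨c' * m * w, ?_, ?_⟩
  · have h3 : ‖reducedNorm K c'‖ = ‖disc K (pairOf u)‖⁻¹ := by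
      have := congrArg (fun d => ‖reducedNorm K d‖) h1
      simp only [Q.nrd_mul, norm_mul, NormConj.nrd_one, norm_one] at this
      rw [norm_nrd_conj_sub Q] at this
      exact eq_inv_of_mul_eq_one_right this
    rw [Q.nrd_mul, Q.nrd_mul, norm_mul, norm_mul, h3]
    refine (mul_le_of_le_one_right (by positivity) hw.norm_le).trans ?_
    rw [inv_mul_le_iff₀ hdisc, mul_comm]
    exact hmn
  · rw [← comm_eq_zero, comm_sub, Q.comm_comm, comm_mul_of_commute hm', ← hc, mul_assoc c', ← hdm,
      ← mul_assoc, h1, one_mul, sub_self]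

/-- The tangent lattice of the orbit at `pairOf u`. -/
def orbitLattice (K : Type*) {D : Type*} [NormedField K] [Ring D] [Algebra K D] (u w : D) (r : ℝ) :
    Set (PairSpace D) :=
  {z | ‖reducedNorm K (z 0)‖ ≤ r ^ 2 ∧ z 1 - z 0 * u ∈ commBall K u w r}

include Q in
theorem norm_nrd_smul_le {c : K} {d : D} {r s : ℝ} (hc : ‖c‖ ≤ r)
    (hd : ‖reducedNorm K d‖ ≤ s) : ‖reducedNorm K (c • d)‖ ≤ r ^ 2 * s := by
  rw [Q.nrd_smul, norm_mul, norm_pow]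
  exact mul_le_mul (pow_le_pow_left₀ (norm_nonneg _) hc 2) hd (norm_nonneg _) (by positivity)

include Q in
theorem norm_nrd_mul_le_mul {a b : D} {r s : ℝ} (hr : 0 ≤ r) (ha : ‖reducedNorm K a‖ ≤ r)
    (hb : ‖reducedNorm K b‖ ≤ s) : ‖reducedNorm K (a * b)‖ ≤ r * s := by
  rw [Q.nrd_mul, norm_mul]
  exact mul_le_mul ha hb (norm_nonneg _) hr

include Q hu in
/-- The action of an element close to one, up to second order. -/
theorem smul_pairOf_expand {r : ℝ} (hr0 : 0 ≤ r) (hr1 : r ≤ 1) {g : PairGroup K D}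
    (ha : ‖reducedNorm K (g.fst - 1)‖ ≤ r ^ 2) (hb : ‖reducedNorm K (g.snd - 1)‖ ≤ r ^ 2)
    (hm : g.mat - 1 ∈ matBall K r) :
    ∃ e e' : D, ‖reducedNorm K e‖ ≤ r ^ 2 * r ^ 2 ∧ ‖reducedNorm K e'‖ ≤ r ^ 2 * r ^ 2 ∧
      (g • pairOf u - pairOf u) 0 = (g.mat - 1) 0 0 • 1 + (g.mat - 1) 0 1 • u + (g.fst - 1) +
        (g.snd - 1) + e ∧
      (g • pairOf u - pairOf u) 1 - (g • pairOf u - pairOf u) 0 * u =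
        ((g.mat - 1) 1 0 • 1 + (g.mat - 1) 1 1 • u - (g.mat - 1) 0 0 • u -
          (g.mat - 1) 0 1 • (u * u)) + comm u (g.snd - 1) + e' := by
  have hr2 : 0 ≤ r ^ 2 := by positivity
  have hr3 : r ^ 2 ≤ 1 := pow_le_one₀ hr0 hr1
  obtain ⟨a, hA⟩ : ∃ a, g.fst = 1 + a := ⟨g.fst - 1, by abel⟩
  obtain ⟨b, hB⟩ : ∃ b, g.snd = 1 + b := ⟨g.snd - 1, by abel⟩
  obtain ⟨m, hM⟩ : ∃ m, g.mat = 1 + m := ⟨g.mat - 1, by abel⟩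
  rw [hA, add_sub_cancel_left] at ha
  rw [hB, add_sub_cancel_left] at hb
  rw [hM, add_sub_cancel_left] at hm
  have hab := norm_nrd_mul_le_mul Q hr2 ha hb
  have hle : r ^ 2 * r ^ 2 ≤ r ^ 2 := mul_le_of_le_one_right hr2 hr3
  obtain ⟨s, hs⟩ : ∃ s, s = a + b + a * b := ⟨_, rfl⟩
  obtain ⟨s', hs'⟩ : ∃ s', s' = a * u + u * b + a * u * b := ⟨_, rfl⟩
  have hsn : ‖reducedNorm K s‖ ≤ r ^ 2 := hs ▸ Q.nrd_add_le (Q.nrd_add_le ha hb) (hab.trans hle)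
  have hau := norm_mul_right_le Q hu ha
  have hsn' : ‖reducedNorm K s'‖ ≤ r ^ 2 := hs' ▸
    Q.nrd_add_le (Q.nrd_add_le hau (norm_mul_left_le Q hu hb))
      ((norm_nrd_mul_le_mul Q hr2 hau hb).trans hle)
  have hz : ∀ i : Fin 2, (g • pairOf u - pairOf u) i =
      g.mat i 0 • (1 + s) + g.mat i 1 • (u + s') - pairOf u i := by
    intro i
    change (g • pairOf u) i - pairOf u i = _
    rw [PairGroup.smul_apply, pairOf_zero, pairOf_one, hA, hB, hs, hs']
    congr 3
    · noncomm_ring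
    · noncomm_ring
  have hz0 : (g • pairOf u - pairOf u) 0 =
      s + m 0 0 • (1 + s) + m 0 1 • (u + s') := by
    rw [hz, hM, Matrix.add_apply, Matrix.add_apply, Matrix.one_apply_eq,
      Matrix.one_apply_ne (by decide), pairOf_zero, add_smul, one_smul, zero_add]
    abel
  have hz1 : (g • pairOf u - pairOf u) 1 =
      s' + m 1 0 • (1 + s) + m 1 1 • (u + s') := by
    rw [hz, hM, Matrix.add_apply, Matrix.add_apply, Matrix.one_apply_eq,
      Matrix.one_apply_ne (by decide), pairOf_one, zero_add, add_smul (1 : K), one_smul]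
    abel
  rw [hA, hB, hM, add_sub_cancel_left, add_sub_cancel_left, add_sub_cancel_left]
  refine ⟨a * b + m 0 0 • s + m 0 1 • s', a * comm u b + m 1 0 • s + m 1 1 • s' - m 0 0 • (s * u) -
    m 0 1 • (s' * u), ?_, ?_, ?_, ?_⟩
  · exact Q.nrd_add_le (Q.nrd_add_le hab (norm_nrd_smul_le Q (hm 0 0) hsn))
      (norm_nrd_smul_le Q (hm 0 1) hsn')
  · exact Q.nrd_sub_le (Q.nrd_sub_le (Q.nrd_add_le (Q.nrd_add_le
      (norm_nrd_mul_le_mul Q hr2 ha (norm_comm_le Q hu hb))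
      (norm_nrd_smul_le Q (hm 1 0) hsn)) (norm_nrd_smul_le Q (hm 1 1) hsn'))
      (norm_nrd_smul_le Q (hm 0 0) (norm_mul_right_le Q hu hsn)))
      (norm_nrd_smul_le Q (hm 0 1) (norm_mul_right_le Q hu hsn'))
  · have h1 : a * b = s - a - b := by rw [hs]; abel
    rw [h1, hz0, smul_add, smul_add]
    abel
  · have h1 : s' - s * u = comm u b + a * comm u b := by
      rw [hs, hs', comm]; noncomm_ring
    rw [hz1, hz0, add_mul, add_mul, smul_mul_assoc, smul_mul_assoc, add_mul, add_mul, one_mul]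
    simp only [smul_add]
    rw [← sub_eq_zero] at h1 ⊢
    rw [← h1]
    abel

include Q hu hw in
-- To first order the second coordinate, corrected by the first, is an element of `K[u]` plus a
-- commutator `[u, b]`. Both lie in `commBall`, and the quadratic error does too once `ϖ^(2n)` is at
-- most of the size of the discriminant.
theorem smul_sub_mem_orbitLattice (hϖ : ϖ ≠ 0) (hϖ1 : ‖ϖ‖ ≤ 1) (n : ℕ)
    (hn : (‖ϖ‖ ^ n) ^ 2 ≤ ‖disc K (pairOf u)‖) {g : PairGroup K D}
    (hg : g ∈ Q.congruenceSubgroup (‖ϖ‖ ^ n) (by positivity)) :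
    g • pairOf u - pairOf u ∈ orbitLattice K u w (‖ϖ‖ ^ n) := by
  obtain ⟨-, -, -, -, ha, hb, hm⟩ := Q.mem_congruenceSubgroup.1 hg
  have hr : 0 < ‖ϖ‖ ^ n := by positivity
  have hr1 : ‖ϖ‖ ^ n ≤ 1 := pow_le_one₀ (norm_nonneg _) hϖ1
  set r := ‖ϖ‖ ^ n with hrr
  have hr3 : r ^ 2 ≤ 1 := pow_le_one₀ hr.le hr1
  have hle : r ^ 2 * r ^ 2 ≤ r ^ 2 := mul_le_of_le_one_right (by positivity) hr3
  obtain ⟨e, e', he, he', h0, h1⟩ := smul_pairOf_expand Q hu hr.le hr1 ha hb hm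
  have h1n : ‖reducedNorm K (1 : D)‖ ≤ 1 := by rw [NormConj.nrd_one, norm_one]
  have hs := fun (i j : Fin 2) {d : D} (hd : ‖reducedNorm K d‖ ≤ 1) =>
    (norm_nrd_smul_le Q (hm i j) hd).trans (mul_one (r ^ 2)).le
  refine ⟨?_, ?_⟩
  · rw [h0]
    exact Q.nrd_add_le (Q.nrd_add_le (Q.nrd_add_le (Q.nrd_add_le (hs 0 0 h1n) (hs 0 1 hu.norm_le))
      ha) hb) (he.trans hle)
  · rw [h1]
    refine add_mem_commBall Q (add_mem_commBall Q ?_ (comm_mem_commBall Q hu hw hϖ n hb)) ?_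
    · refine mem_commBall_of_commute Q (Q.nrd_sub_le (Q.nrd_sub_le (Q.nrd_add_le (hs 1 0 h1n)
        (hs 1 1 hu.norm_le)) (hs 0 0 hu.norm_le)) (hs 0 1 (norm_mul_left_le Q hu hu.norm_le))) ?_
      simp only [sub_mul, add_mul, mul_sub, mul_add, smul_mul_assoc, mul_smul_comm, one_mul,
        mul_one, mul_assoc]
    · refine mem_commBall_of_le Q hw hϖ (n + n) hr ?_ (norm_disc_le_one Q hu) ?_
      · rw [pow_add, mul_pow]; exact mul_le_mul_of_nonneg_left hn (by positivity)
      · rw [pow_add, mul_pow]; exact he'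

include Q hu hw in
/-- An approximation step. -/
theorem exists_smul_approx (hϖ : ϖ ≠ 0) (n : ℕ) (hn1 : ‖ϖ‖ ^ n < 1)
    {z : PairSpace D} (hz : z ∈ orbitLattice K u w (‖ϖ‖ ^ n)) :
    ∃ g ∈ Q.congruenceSubgroup (‖ϖ‖ ^ n) (by positivity), ∀ i,
      ‖reducedNorm K ((pairOf u + z - g • pairOf u) i)‖ ≤ (‖ϖ‖ ^ n) ^ 2 * (‖ϖ‖ ^ n) ^ 2 := by
  have hr : 0 < ‖ϖ‖ ^ n := by positivity
  obtain ⟨hz0, hz1⟩ := hz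
  -- Write `z₁ - z₀ u = [u, b] + x + y u`. The element with first components `1 + z₀ - b` and `1 +
  -- b`, and with the matrix changed only in its second row by `(x, y)`, has `z` as its linear part.
  obtain ⟨b, hb, hbu⟩ := exists_comm_sub_commute Q hu hw hz1
  obtain ⟨x, y, hxy⟩ := hu.selfCentralizing.exists_eq _ hbu
  obtain ⟨hx, hy⟩ := hu.coord_le_pow Q hϖ n (x := x) (y := y) (by
    rw [← hxy]; exact Q.nrd_sub_le hz1.1 (norm_comm_le Q hu hb))
  set r := ‖ϖ‖ ^ n with hrr
  have hr2 : r ^ 2 < 1 := pow_lt_one₀ hr.le hn1 two_ne_zero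
  have h1n : ‖reducedNorm K (1 : D)‖ = 1 := by rw [NormConj.nrd_one, norm_one]
  have ha : ‖reducedNorm K (z 0 - b)‖ ≤ r ^ 2 := Q.nrd_sub_le hz0 hb
  have ha1 := Q.norm_nrd_add h1n hr2 ha
  have hb1 := Q.norm_nrd_add h1n hr2 hb
  have hm : (!![0, 0; x, y] : Matrix (Fin 2) (Fin 2) K) ∈ matBall K r := by
    intro i j
    fin_cases i <;> fin_cases j <;> simp [hx, hy, hr.le]
  have h1m : (1 : Matrix (Fin 2) (Fin 2) K) ∈ matBall K 1 := by
    intro i j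
    rw [Matrix.one_apply]
    split_ifs <;> simp
  have hdet := norm_det_add h1m (by simp) hn1 hm
  have hne : ∀ {d : D}, ‖reducedNorm K d‖ = 1 → d ≠ 0 := fun h h0 => by
    rw [h0, Q.nrd_zero] at h; simp at h
  obtain ⟨g, g1, g2, g3⟩ := exists_pairGroup Q (hne ha1) (hne hb1) (norm_pos_iff.1 (by
    rw [hdet]; exact one_pos))
  have e1 : g.fst - 1 = z 0 - b := by rw [g1, add_sub_cancel_left]
  have e2 : g.snd - 1 = b := by rw [g2, add_sub_cancel_left]
  have e3 : g.mat - 1 = !![0, 0; x, y] := by rw [g3, add_sub_cancel_left]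
  have hg : g ∈ Q.congruenceSubgroup r hr.le := by
    refine Q.mem_congruenceSubgroup.2 ⟨by rw [g1, ha1], by rw [g2, hb1], ?_, by rw [g3, hdet],
      by rw [e1]; exact ha, by rw [e2]; exact hb, by rw [e3]; exact hm⟩
    rw [g3]
    exact add_mem_matBall h1m fun i j => (hm i j).trans hn1.le
  refine ⟨g, hg, ?_⟩
  obtain ⟨e, e', he, he', h0, h1⟩ := smul_pairOf_expand Q hu hr.le hn1.le (g := g)
    (by rw [e1]; exact ha) (by rw [e2]; exact hb) (by rw [e3]; exact hm)
  rw [e1, e2, e3] at h0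
  rw [e2, e3] at h1
  have k0 : (pairOf u + z - g • pairOf u) 0 = -e := by
    have : (pairOf u + z - g • pairOf u) 0 = z 0 - (g • pairOf u - pairOf u) 0 := by
      change pairOf u 0 + z 0 - (g • pairOf u) 0 = z 0 - ((g • pairOf u) 0 - pairOf u 0)
      abel
    rw [this, h0]
    simp
  have k1 : (pairOf u + z - g • pairOf u) 1 = -e' - e * u := by
    have h2 : (pairOf u + z - g • pairOf u) 1 = (z 1 - z 0 * u) - ((g • pairOf u - pairOf u) 1 -
        (g • pairOf u - pairOf u) 0 * u) + (z 0 - (g • pairOf u - pairOf u) 0) * u := by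
      change pairOf u 1 + z 1 - (g • pairOf u) 1 = z 1 - z 0 * u - (((g • pairOf u) 1 - pairOf u 1) -
        ((g • pairOf u) 0 - pairOf u 0) * u) + (z 0 - ((g • pairOf u) 0 - pairOf u 0)) * u
      noncomm_ring
    rw [h2, h1, h0, sub_eq_iff_eq_add.1 hxy]
    simp
    noncomm_ring
  intro i
  fin_cases i
  · change ‖reducedNorm K ((pairOf u + z - g • pairOf u) 0)‖ ≤ _
    rw [k0, Q.nrd_neg]; exact he
  · change ‖reducedNorm K ((pairOf u + z - g • pairOf u) 1)‖ ≤ _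
    rw [k1]
    exact Q.nrd_sub_le (by rw [Q.nrd_neg]; exact he') (norm_mul_right_le Q hu he)

include Q in
theorem norm_nrd_pair_smul_le {g : PairGroup K D} (hg : g ∈ Q.congruenceSubgroup 1 zero_le_one)
    {z : PairSpace D} {r : ℝ} (hz : ∀ i, ‖reducedNorm K (z i)‖ ≤ r) (i : Fin 2) :
    ‖reducedNorm K ((g • z) i)‖ ≤ r := by
  obtain ⟨h1, h2, h3, -⟩ := Q.mem_congruenceSubgroup_one.1 hg
  have h4 : ∀ j, ‖reducedNorm K (g.mat i j • (g.fst * z j * g.snd))‖ ≤ r := fun j =>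
    (norm_nrd_smul_le Q (h3 i j)
      (Q.norm_nrd_mul_le' (Q.norm_nrd_mul_le h1 (hz j)) h2)).trans (by rw [one_pow, one_mul])
  rw [PairGroup.smul_apply]
  exact Q.nrd_add_le (h4 0) (h4 1)

include Q in
theorem congruenceSubgroup_mono {r s : ℝ} (hr : 0 ≤ r) (hs : 0 ≤ s) (h : r ≤ s) :
    Q.congruenceSubgroup r hr ≤ Q.congruenceSubgroup s hs := by
  intro g hg
  obtain ⟨h1, h2, h3, h4, h5, h6, h7⟩ := Q.mem_congruenceSubgroup.1 hg
  have h8 := pow_le_pow_left₀ hr h 2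
  exact Q.mem_congruenceSubgroup.2
    ⟨h1, h2, h3, h4, h5.trans h8, h6.trans h8, fun i j => (h7 i j).trans h⟩

include Q hu hw in
-- One inclusion is the expansion of the action. For the other, `y` is moved towards `x` by
-- successive approximation inside the subgroup, and compactness of the subgroup replaces the limit
-- of the corrections.
theorem orbit_congruenceSubgroup (hϖ : ϖ ≠ 0) (hϖ1 : ‖ϖ‖ < 1) (n : ℕ) (hn0 : n ≠ 0)
    (hn : (‖ϖ‖ ^ n) ^ 2 ≤ ‖ϖ‖ ^ 2 * ‖disc K (pairOf u)‖) :
    (fun g : PairGroup K D => g • pairOf u) ''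
      (Q.congruenceSubgroup (‖ϖ‖ ^ n) (by positivity) : Set (PairGroup K D)) =
    {y | y - pairOf u ∈ orbitLattice K u w (‖ϖ‖ ^ n)} := by
  have hϖ0 : 0 < ‖ϖ‖ := norm_pos_iff.2 hϖ
  have hn' : (‖ϖ‖ ^ n) ^ 2 ≤ ‖disc K (pairOf u)‖ :=
    hn.trans (mul_le_of_le_one_left (norm_nonneg _) (pow_le_one₀ hϖ0.le hϖ1.le))
  ext y
  constructor
  · rintro ⟨g, hg, rfl⟩
    exact smul_sub_mem_orbitLattice Q hu hw hϖ hϖ1.le n hn' hg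
  · intro hy
    -- Each step squares the scale of the error. The hypothesis on `n` ensures that this gains at
    -- least one power of `ϖ` even after the loss of a factor of the size of the discriminant.
    have key : ∀ m : ℕ, ∃ g ∈ Q.congruenceSubgroup (‖ϖ‖ ^ n) (by positivity),
        g • y - pairOf u ∈ orbitLattice K u w (‖ϖ‖ ^ (n + m)) := by
      intro m
      induction m with
      | zero => exact ⟨1, one_mem _, by rw [one_smul]; exact hy⟩
      | succ m ih =>
        obtain ⟨g, hg, hgy⟩ := ih
        have hr : 0 < ‖ϖ‖ ^ (n + m) := by positivity
        obtain ⟨k, hk, hky⟩ := exists_smul_approx Q hu hw hϖ (n + m)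
          (pow_lt_one₀ hϖ0.le hϖ1 (by omega)) hgy
        have hk' := congruenceSubgroup_mono Q hr.le (by positivity : 0 ≤ ‖ϖ‖ ^ n)
          (pow_le_pow_of_le_one hϖ0.le hϖ1.le (Nat.le_add_right n m)) hk
        refine ⟨k⁻¹ * g, mul_mem (inv_mem hk') hg, ?_⟩
        have e : (k⁻¹ * g) • y - pairOf u =
            k⁻¹ • (pairOf u + (g • y - pairOf u) - k • pairOf u) := by
          rw [smul_sub, inv_smul_smul, mul_smul]
          congr 2
          abel
        have hs : ∀ i, ‖reducedNorm K (((k⁻¹ * g) • y - pairOf u) i)‖ ≤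
            (‖ϖ‖ ^ (n + m + (n + m))) ^ 2 := by
          rw [e, pow_add _ (n + m), mul_pow]
          exact norm_nrd_pair_smul_le Q (inv_mem (Q.congruenceSubgroup_le _ _ hk)) hky
        have hle : (‖ϖ‖ ^ (n + m + (n + m))) ^ 2 ≤
            (‖ϖ‖ ^ (n + m + 1)) ^ 2 * ‖disc K (pairOf u)‖ := by
          rw [pow_add _ (n + m), mul_pow, pow_add _ (n + m) 1, pow_one, mul_pow, mul_assoc]
          refine mul_le_mul_of_nonneg_left (le_trans ?_ hn) (by positivity)
          exact pow_le_pow_left₀ hr.le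
            (pow_le_pow_of_le_one hϖ0.le hϖ1.le (Nat.le_add_right n m)) 2
        rw [← add_assoc]
        refine ⟨(hs 0).trans (hle.trans (mul_le_of_le_one_right (by positivity)
          (norm_disc_le_one Q hu))), ?_⟩
        exact mem_commBall_of_le Q hw hϖ _ (by positivity) hle (norm_disc_le_one Q hu)
          (Q.nrd_sub_le (hs 1) (norm_mul_right_le Q hu (hs 0)))
    have hpos : 0 < ‖ϖ‖ ^ n := by positivity
    have hC : IsCompact ((fun g : PairGroup K D => g • y) ''
        (Q.congruenceSubgroup (‖ϖ‖ ^ n) (by positivity) : Set (PairGroup K D))) :=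
      (Q.isCompact_congruenceSubgroup hpos).image (continuous_id.smul continuous_const)
    have hap : ∀ i : Fin 2, Continuous fun z : PairSpace D => z i := fun i => continuous_apply i
    have hφ : Continuous fun z : PairSpace D =>
        ‖reducedNorm K (z 0 - 1)‖ + ‖reducedNorm K (z 1 - u)‖ :=
      (Q.continuous_norm.comp ((hap 0).sub continuous_const)).norm.add
        (Q.continuous_norm.comp ((hap 1).sub continuous_const)).norm
    -- The distance from `x` attains its minimum on the compact set of translates of `y`; the
    -- approximations force this minimum to be zero.
    obtain ⟨_, ⟨g, hg, rfl⟩, hmin⟩ := hC.exists_isMinOn ⟨_, ⟨1, one_mem _, rfl⟩⟩ hφ.continuousOn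
    have hbd : ∀ m : ℕ, ‖reducedNorm K ((g • y) 0 - 1)‖ + ‖reducedNorm K ((g • y) 1 - u)‖ ≤
        2 * (‖ϖ‖ ^ 2) ^ m := by
      intro m
      obtain ⟨k, hk, hky⟩ := key m
      have h1 := hmin ⟨k, hk, rfl⟩
      refine le_trans h1 ?_
      have h2 : (‖ϖ‖ ^ (n + m)) ^ 2 ≤ (‖ϖ‖ ^ 2) ^ m := by
        rw [← pow_mul, ← pow_mul]
        exact pow_le_pow_of_le_one hϖ0.le hϖ1.le (by nlinarith)
      have h3 : ‖reducedNorm K ((k • y) 0 - 1)‖ ≤ (‖ϖ‖ ^ (n + m)) ^ 2 := hky.1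
      have h4 : ‖reducedNorm K ((k • y) 1 - u)‖ ≤ (‖ϖ‖ ^ (n + m)) ^ 2 := by
        have e : (k • y) 1 - u = (((k • y) 1 - u) - ((k • y) 0 - 1) * u) + ((k • y) 0 - 1) * u := by
          abel
        rw [e]
        exact Q.nrd_add_le hky.2.1 (norm_mul_right_le Q hu h3)
      rw [two_mul]
      exact add_le_add (h3.trans h2) (h4.trans h2)
    have hlim : Filter.Tendsto (fun m : ℕ => 2 * (‖ϖ‖ ^ 2) ^ m) Filter.atTop (nhds 0) := by
      have := (tendsto_pow_atTop_nhds_zero_of_lt_one (by positivity : 0 ≤ ‖ϖ‖ ^ 2)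
        (pow_lt_one₀ hϖ0.le hϖ1 two_ne_zero)).const_mul 2
      rwa [mul_zero] at this
    have h0 := ge_of_tendsto' hlim hbd
    have h5 : (g • y) 0 - 1 = 0 := Q.nrd_eq_zero.1 (norm_eq_zero.1
      (le_antisymm (by linarith [norm_nonneg (reducedNorm K ((g • y) 1 - u))]) (norm_nonneg _)))
    have h6 : (g • y) 1 - u = 0 := Q.nrd_eq_zero.1 (norm_eq_zero.1
      (le_antisymm (by linarith [norm_nonneg (reducedNorm K ((g • y) 0 - 1))]) (norm_nonneg _)))
    have h7 : g • y = pairOf u := by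
      funext i
      fin_cases i
      · exact sub_eq_zero.1 h5
      · exact sub_eq_zero.1 h6
    exact ⟨g⁻¹, inv_mem hg, by rw [← h7]; exact inv_smul_smul g y⟩

end CongruenceOrbit

end PairQuat

namespace PairQuat

/-! ### The volume of the orbit -/

section OrbitVolume

open scoped Pointwise ENNReal NNReal

set_option linter.unusedSectionVars false

section Quadratic

variable {O K : Type*} [CommRing O] [IsLocalRing O] [NontriviallyNormedField K]
  [IsUltrametricDist K] [ProperSpace K] [Algebra O K] {ϖ : K} {q : ℕ}
  (hO : IsNormalizedLocal O K ϖ q)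
  {R : Type*} [Ring R] [Algebra K R] [FiniteDimensional K R] [TopologicalSpace R]
  [IsModuleTopology K R] [IsTopologicalRing R] [ContinuousSMul K R] [LocallyCompactSpace R]
  [T2Space R] {N : R → K} (hN : IsQuadraticNorm N)
  [MeasurableSpace R] [BorelSpace R] (ν : Measure R) [ν.IsAddHaarMeasure] [ν.Regular]

include hO hN in
theorem IsQuadraticNorm.measure_norm_le (hR : Module.finrank K R = 2) (hν : ν {a | ‖N a‖ ≤ 1} = 1)
    (a : Rˣ) : ν {b | ‖N b‖ ≤ ‖N a‖} = ENNReal.ofReal ‖N a‖ := by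
  have h := hN.smul_ball a 1
  rw [mul_one] at h
  have h2 := hN.distribHaarChar_sq hO a
  rw [hR] at h2
  have h3 : distribHaarChar R a = ‖N a‖₊ := (pow_left_inj₀ zero_le zero_le two_ne_zero).1 h2
  rw [← h, ← distribHaarChar_mul ν, hν, h3, mul_one, ofReal_norm]
  rfl

end Quadratic

variable {O K D : Type*} [CommRing O] [IsLocalRing O] [NontriviallyNormedField K]
  [IsUltrametricDist K] [ProperSpace K] [CharZero K] [Algebra O K]
  {ϖ : K} {q : ℕ} (hO : IsNormalizedLocal O K ϖ q)
  [Ring D] [Nontrivial D] [NoZeroDivisors D] [Algebra K D] [FiniteDimensional K D]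
  [TopologicalSpace D] [IsModuleTopology K D] [IsTopologicalRing D] [ContinuousSMul K D]
  [PolishSpace D] [LocallyCompactSpace D]
  (Q : NormConj K D) {u w : D} (hu : IsRamifiedGenerator ϖ u) (hw : IsMaximalComm K u w)

/-- The map `(l, m) ↦ l + m w`. -/
def quadSum (K : Type*) {D : Type*} [Field K] [Ring D] [Algebra K D] (u w : D) :
    (Algebra.adjoin K ({u} : Set D) × Algebra.adjoin K ({u} : Set D)) →ₗ[K] D :=
  (Algebra.adjoin K ({u} : Set D)).val.toLinearMap.coprod
    ((LinearMap.mulRight K w).comp (Algebra.adjoin K ({u} : Set D)).val.toLinearMap)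

theorem quadSum_apply (s : Algebra.adjoin K ({u} : Set D) × Algebra.adjoin K ({u} : Set D)) :
    quadSum K u w s = (s.1 : D) + s.2 * w := rfl

include hu in
theorem comm_quadSum (s : Algebra.adjoin K ({u} : Set D) × Algebra.adjoin K ({u} : Set D)) :
    comm u (quadSum K u w s) = s.2 * comm u w := by
  rw [quadSum_apply, comm_add, comm_eq_zero.2 ((mem_adjoin_iff_commute hu.selfCentralizing).1 s.1.2),
    zero_add, comm_mul_of_commute ((mem_adjoin_iff_commute hu.selfCentralizing).1 s.2.2)]

include hu hw Q in
-- The commutator with `u` maps `l + m w` to `m [u, w]`, so it detects `m`. Every commutator is a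
-- multiple of `[u, w]` over `K[u]`, whence surjectivity.
theorem quadSum_bijective : Function.Bijective (quadSum K u w) := by
  constructor
  · rw [← LinearMap.ker_eq_bot, LinearMap.ker_eq_bot']
    intro s hs
    have h1 := comm_quadSum (w := w) hu s
    rw [hs, show comm u (0 : D) = 0 by simp [comm], eq_comm] at h1
    have h2 : (s.2 : D) = 0 := (mul_eq_zero.1 h1).resolve_right hw.ne_zero
    have h3 : (s.1 : D) = 0 := by
      have := quadSum_apply (w := w) s
      rwa [hs, h2, zero_mul, add_zero, eq_comm] at this
    exact Prod.ext (Subtype.ext h3) (Subtype.ext h2)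
  · intro d
    obtain ⟨m, hm, hdm⟩ :=
      Q.exists_mul_of_twisted (Q.comm_mul_self u w) (Q.comm_mul_self u d) hw.ne_zero
    have h : (d - m * w) * u = u * (d - m * w) := by
      rw [← comm_eq_zero, comm_sub, comm_mul_of_commute hm, hdm, sub_self]
    exact ⟨(⟨_, (mem_adjoin_iff_commute hu.selfCentralizing).2 h⟩,
      ⟨_, (mem_adjoin_iff_commute hu.selfCentralizing).2 hm⟩), by
        rw [quadSum_apply]; exact sub_add_cancel _ _⟩

include hu hw Q in
-- This is the decomposition of the integers of `D` as `O_L ⊕ O_L w`. Maximality of `[u, w]` bounds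
-- `m` in `l + m w` by the size of the sum, and then `l` is bounded as a difference.
theorem norm_quadSum_le_iff (hϖ : ϖ ≠ 0) (n : ℕ)
    (s : Algebra.adjoin K ({u} : Set D) × Algebra.adjoin K ({u} : Set D)) :
    ‖reducedNorm K (quadSum K u w s)‖ ≤ (‖ϖ‖ ^ n) ^ 2 ↔
      ‖reducedNorm K (s.1 : D)‖ ≤ (‖ϖ‖ ^ n) ^ 2 ∧ ‖reducedNorm K (s.2 : D)‖ ≤ (‖ϖ‖ ^ n) ^ 2 := by
  have hle : ∀ {m : D}, ‖reducedNorm K m‖ ≤ (‖ϖ‖ ^ n) ^ 2 →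
      ‖reducedNorm K (m * w)‖ ≤ (‖ϖ‖ ^ n) ^ 2 := by
    intro m hm
    rw [Q.nrd_mul, norm_mul]
    exact (mul_le_of_le_one_right (norm_nonneg _) hw.norm_le).trans hm
  constructor
  · intro h
    have h1 := hw.le_of_le Q hϖ n h
    rw [comm_quadSum hu, Q.nrd_mul, norm_mul] at h1
    have h2 := le_of_mul_le_mul_right h1 (hw.nrd_pos Q)
    refine ⟨?_, h2⟩
    have h3 : (s.1 : D) = quadSum K u w s - s.2 * w := by rw [quadSum_apply, add_sub_cancel_right]
    rw [h3]
    exact Q.nrd_sub_le h (hle h2)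
  · rintro ⟨h1, h2⟩
    exact Q.nrd_add_le h1 (hle h2)

include hu hw Q in
theorem quadSum_mem_commBall_iff (hϖ : ϖ ≠ 0) (n : ℕ)
    (s : Algebra.adjoin K ({u} : Set D) × Algebra.adjoin K ({u} : Set D)) :
    quadSum K u w s ∈ commBall K u w (‖ϖ‖ ^ n) ↔ ‖reducedNorm K (s.1 : D)‖ ≤ (‖ϖ‖ ^ n) ^ 2 ∧
      ‖reducedNorm K (s.2 : D)‖ ≤ (‖ϖ‖ ^ n) ^ 2 * ‖disc K (pairOf u)‖ := by
  rw [commBall, Set.mem_ofPred_eq, norm_quadSum_le_iff Q hu hw hϖ, comm_quadSum hu, Q.nrd_mul,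
    norm_mul, ← mul_assoc, mul_le_mul_iff_left₀ (hw.nrd_pos Q)]
  refine ⟨fun h => ⟨h.1.1, h.2⟩, fun h => ⟨⟨h.1, h.2.trans ?_⟩, h.2⟩⟩
  exact mul_le_of_le_one_right (by positivity) (norm_disc_le_one Q hu)

/-- The map `(f, d) ↦ (f, f u + d)`. -/
def shear (K : Type*) {D : Type*} [Field K] [Ring D] [Algebra K D] (u : D) :
    (D × D) ≃ₗ[K] PairSpace D where
  toFun p := ![p.1, p.1 * u + p.2]
  invFun z := (z 0, z 1 - z 0 * u)
  map_add' p p' := by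
    funext i
    fin_cases i
    · rfl
    · change (p.1 + p'.1) * u + (p.2 + p'.2) = (p.1 * u + p.2) + (p'.1 * u + p'.2)
      rw [add_mul]; abel
  map_smul' c p := by
    funext i
    fin_cases i
    · rfl
    · change (c • p.1) * u + c • p.2 = c • (p.1 * u + p.2)
      rw [smul_mul_assoc, smul_add]
  left_inv p := by
    refine Prod.ext rfl ?_
    change p.1 * u + p.2 - p.1 * u = p.2
    rw [add_sub_cancel_left]
  right_inv z := by
    funext i
    fin_cases i
    · rfl
    · change z 0 * u + (z 1 - z 0 * u) = z 1
      rw [add_sub_cancel]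

variable [Algebra O D] [IsScalarTower O K D]

include hO hu hw Q in
-- In the coordinates `(f, d) ↦ (f, f u + d)` followed by `D = L ⊕ L w`, the lattice is a product of
-- four balls of `L`, and the integral pairs become the product of four unit balls. Only the last
-- ball of the lattice is smaller, by the factor `|P(x)|`.
theorem measure_orbitLattice (n : ℕ) :
    spaceMeasure O D (orbitLattice K u w (‖ϖ‖ ^ n)) =
      ENNReal.ofReal (‖ϖ‖ ^ (8 * n) * ‖disc K (pairOf u)‖) := by
  obtain ⟨hs1, hs2, hs3⟩ := Q.spaceMeasure_spec hO
  have hϖ := hO.ne_zero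
  let : MeasurableSpace ↥(Algebra.adjoin K ({u} : Set D)) := borel _
  have : BorelSpace ↥(Algebra.adjoin K ({u} : Set D)) := ⟨rfl⟩
  have hN := isQuadraticNorm_adjoin Q hu.selfCentralizing
  let ν : Measure ↥(Algebra.adjoin K ({u} : Set D)) :=
    addHaarOf {a : ↥(Algebra.adjoin K ({u} : Set D)) | ‖reducedNorm K (a : D)‖ ≤ 1}
  obtain ⟨hν1, hν2, hν⟩ : ν.IsAddHaarMeasure ∧ ν.Regular ∧
      ν {a : ↥(Algebra.adjoin K ({u} : Set D)) | ‖reducedNorm K (a : D)‖ ≤ 1} = 1 :=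
    addHaarOf_spec hN.isCompact (by rw [hN.isOpen.interior_eq]; exact ⟨0, hN.zero_mem⟩)
  let ball : ℝ → Set ↥(Algebra.adjoin K ({u} : Set D)) := fun r => {a | ‖reducedNorm K (a : D)‖ ≤ r}
  let μ₂ := ν.prod ν
  have h2 : μ₂.IsAddHaarMeasure := Measure.prod.instIsAddHaarMeasure ν ν
  let μ := μ₂.prod μ₂
  have h4 : μ.IsAddHaarMeasure := Measure.prod.instIsAddHaarMeasure μ₂ μ₂
  let e₁ := LinearEquiv.ofBijective (quadSum K u w) (quadSum_bijective Q hu hw)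
  let e₀ : ((↥(Algebra.adjoin K ({u} : Set D)) × ↥(Algebra.adjoin K ({u} : Set D))) ×
      (↥(Algebra.adjoin K ({u} : Set D)) × ↥(Algebra.adjoin K ({u} : Set D)))) ≃ₗ[K] PairSpace D :=
    (e₁.prodCongr e₁).trans (shear K u)
  let e := ContinuousLinearEquiv.mk e₀
    (IsModuleTopology.continuous_of_linearMap e₀.toLinearMap)
    (IsModuleTopology.continuous_of_linearMap e₀.symm.toLinearMap)
  have he0 : ∀ p, e p 0 = quadSum K u w p.1 := fun p => rfl
  have he1 : ∀ p, e p 1 = quadSum K u w p.1 * u + quadSum K u w p.2 := fun p => rfl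
  have hmap : (μ.map e).IsAddHaarMeasure := e.isAddHaarMeasure_map μ
  have hme : ∀ S, μ.map e S = μ (e ⁻¹' S) := fun S =>
    (e.toHomeomorph.toMeasurableEquiv.measurableEmbedding.map_apply μ S)
  have hpre : ∀ m : ℕ, e ⁻¹' orbitLattice K u w (‖ϖ‖ ^ m) =
      (ball ((‖ϖ‖ ^ m) ^ 2) ×ˢ ball ((‖ϖ‖ ^ m) ^ 2)) ×ˢ
      (ball ((‖ϖ‖ ^ m) ^ 2) ×ˢ ball ((‖ϖ‖ ^ m) ^ 2 * ‖disc K (pairOf u)‖)) := by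
    intro m
    ext p
    change ‖reducedNorm K (e p 0)‖ ≤ _ ∧ e p 1 - e p 0 * u ∈ _ ↔ _
    rw [he0, he1, add_sub_cancel_left, norm_quadSum_le_iff Q hu hw hϖ,
      quadSum_mem_commBall_iff Q hu hw hϖ]
    rfl
  have hpre1 : e ⁻¹' pairBall K D = (ball 1 ×ˢ ball 1) ×ˢ (ball 1 ×ˢ ball 1) := by
    ext p
    have h : p ∈ e ⁻¹' pairBall K D ↔ ‖reducedNorm K (quadSum K u w p.1)‖ ≤ (‖ϖ‖ ^ 0) ^ 2 ∧
        ‖reducedNorm K (quadSum K u w p.2)‖ ≤ (‖ϖ‖ ^ 0) ^ 2 := by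
      rw [pow_zero, one_pow]
      constructor
      · intro hp
        have a0 := hp 0
        have a1 := hp 1
        rw [he0] at a0
        rw [he1] at a1
        refine ⟨a0, ?_⟩
        have := Q.nrd_sub_le a1 (norm_mul_right_le Q hu a0)
        rwa [add_sub_cancel_left] at this
      · rintro ⟨a0, a1⟩ i
        fin_cases i
        · exact a0
        · exact Q.nrd_add_le (norm_mul_right_le Q hu a0) a1
    rw [h, norm_quadSum_le_iff Q hu hw hϖ, norm_quadSum_le_iff Q hu hw hϖ, pow_zero, one_pow]
    rfl
  -- The change of variables matches unit balls, so it carries the product measure to `dy` exactly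
  -- and no Jacobian appears.
  have hone : μ.map e (pairBall K D) = 1 := by
    rw [hme, hpre1, Measure.prod_prod, Measure.prod_prod, show ν (ball 1) = 1 from hν]
    simp
  have heq : μ.map e = spaceMeasure O D := by
    have h := Measure.isAddLeftInvariant_eq_smul (μ.map e) (spaceMeasure O D)
    have h1 := congrArg (fun m => m (pairBall K D)) h
    simp only [Measure.smul_apply, hone, hs3] at h1
    rw [h]
    have h5 : (μ.map e).addHaarScalarFactor (spaceMeasure O D) = 1 := by
      rw [ENNReal.smul_def, smul_eq_mul, mul_one] at h1
      exact_mod_cast h1.symm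
    rw [h5, one_smul]
  have hdisc : ‖disc K (pairOf u)‖ ≠ 0 := norm_ne_zero_iff.2 hu.disc_ne_zero
  have hunit : ∀ r : ℝ, r ≠ 0 → (∃ d : D, d * u = u * d ∧ ‖reducedNorm K d‖ = r) →
      ν (ball r) = ENNReal.ofReal r := by
    rintro r hr ⟨d, hd, rfl⟩
    obtain ⟨h1, h2⟩ := Q.mul_inv_smul_conj (a := d) fun h => hr (by rw [h, Q.nrd_zero, norm_zero])
    obtain ⟨s, rfl⟩ := exists_quadUnits hu.selfCentralizing h1 h2 hd
    exact hN.measure_norm_le hO ν (finrank_adjoin hu.selfCentralizing) hν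
      (show (Algebra.adjoin K ({u} : Set D))ˣ from s)
  have hϖn : ‖reducedNorm K (ϖ ^ n • (1 : D))‖ = (‖ϖ‖ ^ n) ^ 2 := by
    rw [Q.nrd_smul, NormConj.nrd_one, mul_one, norm_pow, norm_pow]
  have hpn : (‖ϖ‖ ^ n) ^ 2 ≠ 0 := by have := hO.norm_pos; positivity
  have hb1 := hunit ((‖ϖ‖ ^ n) ^ 2) hpn ⟨ϖ ^ n • 1, by simp, hϖn⟩
  -- The radius is realized by the norm of `ϖⁿ (u - ū)`, so this ball is a principal ideal, and its
  -- volume is the modulus of its generator.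
  have hb2 := hunit ((‖ϖ‖ ^ n) ^ 2 * ‖disc K (pairOf u)‖) (mul_ne_zero hpn hdisc)
    ⟨ϖ ^ n • 1 * (u - Q.conj u), by
      rw [smul_mul_assoc, one_mul, smul_mul_assoc, mul_smul_comm, Q.conj_sub_commute], by
      rw [Q.nrd_mul, norm_mul, hϖn, norm_nrd_conj_sub]⟩
  rw [← heq, hme, hpre, Measure.prod_prod, Measure.prod_prod, Measure.prod_prod, hb1, hb2,
    ← ENNReal.ofReal_mul (by positivity), ← ENNReal.ofReal_mul (by positivity),
    ← ENNReal.ofReal_mul (by positivity)]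
  congr 1
  ring

end OrbitVolume

end PairQuat

namespace PairQuat

/-! ### The local density -/

section Density

open scoped Pointwise ENNReal NNReal

set_option linter.unusedSectionVars false

variable {O K D : Type*} [CommRing O] [IsLocalRing O] [NontriviallyNormedField K]
  [IsUltrametricDist K] [ProperSpace K] [CharZero K] [Algebra O K]
  {ϖ : K} {q : ℕ} (hO : IsNormalizedLocal O K ϖ q)
  [Ring D] [Nontrivial D] [NoZeroDivisors D] [Algebra K D] [FiniteDimensional K D]
  [TopologicalSpace D] [IsModuleTopology K D] [IsTopologicalRing D] [ContinuousSMul K D]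
  [PolishSpace D] [LocallyCompactSpace D]
  (Q : NormConj K D) {u : D} (hu : IsRamifiedGenerator ϖ u)

include Q in
theorem continuous_disc : Continuous (disc K : PairSpace D → K) := by
  have hap : ∀ i : Fin 2, Continuous fun z : PairSpace D => z i := fun i => continuous_apply i
  have h0 := Q.continuous_norm.comp (hap 0)
  have h1 := Q.continuous_norm.comp (hap 1)
  have h2 := Q.continuous_norm.comp ((hap 0).add (hap 1))
  exact (((h2.sub h0).sub h1).pow 2).sub ((continuous_const.mul h0).mul h1)

/-- The density `|P(y)|^{-2}`. -/
def discDensity (K : Type*) {D : Type*} [NormedField K] [Ring D] [Algebra K D] (y : PairSpace D) :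
    ℝ≥0 :=
  (‖disc K y‖₊ ^ 2)⁻¹

include Q in
theorem measurable_discDensity : Measurable (discDensity K : PairSpace D → ℝ≥0) :=
  ((continuous_disc Q).nnnorm.pow 2).measurable.inv

variable [Algebra O D] [IsScalarTower O K D]

variable (O K) in
/-- The measure `|P(y)|^{-2} dy` on the orbit. -/
def orbitMeasure (u : D) : Measure (PairSpace D) :=
  ((spaceMeasure O D).restrict (MulAction.orbit (PairGroup K D) (pairOf u))).withDensity
    fun y => discDensity K y

theorem orbitMeasure_apply {A : Set (PairSpace D)} (hA : MeasurableSet A) :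
    orbitMeasure O K u A = ∫⁻ y, (A ∩ MulAction.orbit (PairGroup K D) (pairOf u)).indicator
      (fun y => (discDensity K y : ℝ≥0∞)) y ∂(spaceMeasure O D) := by
  have ho : MeasurableSet (MulAction.orbit (PairGroup K D) (pairOf u)) :=
    IsHalfStabilizer.measurableSet_orbit (G := PairGroup K D) (pairOf u)
  rw [orbitMeasure, withDensity_apply _ hA, Measure.restrict_restrict hA,
    lintegral_indicator (hA.inter ho)]

theorem orbitMeasure_compl : orbitMeasure O K u (MulAction.orbit (PairGroup K D) (pairOf u))ᶜ = 0 := by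
  have ho : MeasurableSet (MulAction.orbit (PairGroup K D) (pairOf u)) :=
    IsHalfStabilizer.measurableSet_orbit (G := PairGroup K D) (pairOf u)
  rw [orbitMeasure_apply ho.compl, Set.compl_inter_self]
  simp

include hO Q in
-- The modulus of the action on `V` is the fourth power of the norm of the multiplier whose square
-- multiplies `P`, so `|P|⁻²` compensates it.
theorem measurePreserving_orbitMeasure (hfin : Module.finrank K D = 4) (a : PairGroup K D) :
    MeasurePreserving (fun y : PairSpace D => a • y) (orbitMeasure O K u) (orbitMeasure O K u) := by
  obtain ⟨hs1, hs2, hs3⟩ := Q.spaceMeasure_spec hO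
  have hm : Measurable fun y : PairSpace D => a • y := (continuous_const_smul a).measurable
  have ho : MeasurableSet (MulAction.orbit (PairGroup K D) (pairOf u)) :=
    IsHalfStabilizer.measurableSet_orbit (G := PairGroup K D) (pairOf u)
  refine ⟨hm, ?_⟩
  set c : ℝ≥0 := ‖reducedNorm K a.fst * reducedNorm K a.snd * a.mat.det‖₊ ^ 4 with hc
  have hc0 : c ≠ 0 := pow_ne_zero 4 (nnnorm_ne_zero_iff.2 (mul_ne_zero (mul_ne_zero
    (Q.nrd_fst_ne_zero a) (Q.nrd_snd_ne_zero a)) a.det_ne_zero))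
  have hmap : (spaceMeasure O D).map (fun y => a • y) = ((c⁻¹ : ℝ≥0) : ℝ≥0∞) • spaceMeasure O D := by
    ext A hA
    have h := distribHaarChar_mul (spaceMeasure O D) a⁻¹ A
    rw [map_inv, distribHaarChar_pair hO Q hfin] at h
    rw [Measure.map_apply hm hA, Measure.smul_apply, smul_eq_mul, Set.preimage_smul]
    exact h.symm
  have hden : ∀ y : PairSpace D, discDensity K y = c * discDensity K (a • y) := by
    intro y
    rw [discDensity, discDensity, Q.disc_smul, nnnorm_mul, nnnorm_pow, mul_pow, ← pow_mul, mul_inv,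
      ← mul_assoc, show 2 * 2 = 4 from rfl, ← hc, mul_inv_cancel₀ hc0, one_mul]
  ext A hA
  have hmem : ∀ y : PairSpace D, a • y ∈ MulAction.orbit (PairGroup K D) (pairOf u) ↔
      y ∈ MulAction.orbit (PairGroup K D) (pairOf u) := fun y => by
    rw [← MulAction.orbit_eq_iff, MulAction.orbit_smul, MulAction.orbit_eq_iff]
  have hmi : Measurable ((A ∩ MulAction.orbit (PairGroup K D) (pairOf u)).indicator
      (fun y => (discDensity K y : ℝ≥0∞))) :=
    (measurable_discDensity Q).coe_nnreal_ennreal.indicator (hA.inter ho)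
  rw [Measure.map_apply hm hA, orbitMeasure_apply (hm hA), orbitMeasure_apply hA]
  calc _ = ∫⁻ y, c * (A ∩ MulAction.orbit (PairGroup K D) (pairOf u)).indicator
        (fun y => (discDensity K y : ℝ≥0∞)) (a • y) ∂(spaceMeasure O D) := by
        refine lintegral_congr fun y => ?_
        by_cases hy : a • y ∈ A ∩ MulAction.orbit (PairGroup K D) (pairOf u)
        · rw [Set.indicator_of_mem hy, Set.indicator_of_mem
            (show y ∈ (fun y => a • y) ⁻¹' A ∩ _ from ⟨hy.1, (hmem y).1 hy.2⟩), hden,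
            ENNReal.coe_mul]
        · rw [Set.indicator_of_notMem hy, Set.indicator_of_notMem
            (fun h => hy ⟨h.1, (hmem y).2 h.2⟩), mul_zero]
    _ = _ := by
        refine (lintegral_const_mul _ (hmi.comp hm)).trans ?_
        have h := lintegral_map (μ := spaceMeasure O D) hmi hm
        rw [hmap, lintegral_smul_measure, smul_eq_mul] at h
        refine (congrArg (fun t => (c : ℝ≥0∞) * t) h.symm).trans ?_
        rw [← mul_assoc, ← ENNReal.coe_mul, mul_inv_cancel₀ hc0, ENNReal.coe_one, one_mul]

include Q in
-- On the orbit of the integral group the multiplier of `P` is a unit, so the density is constant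
-- there.
theorem orbitMeasure_of_subset {A : Set (PairSpace D)} (hA : MeasurableSet A)
    (hAU : A ⊆ (fun g : PairGroup K D => g • pairOf u) ''
      (Q.congruenceSubgroup 1 zero_le_one : Set (PairGroup K D))) :
    orbitMeasure O K u A = discDensity K (pairOf u) * spaceMeasure O D A := by
  have e : A ∩ MulAction.orbit (PairGroup K D) (pairOf u) = A :=
    Set.inter_eq_left.2 fun y hy => by
      obtain ⟨g, -, rfl⟩ := hAU hy
      exact ⟨g, rfl⟩
  rw [orbitMeasure_apply hA, e, ← lintegral_indicator_const hA]
  refine lintegral_congr fun y => ?_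
  by_cases hy : y ∈ A
  · rw [Set.indicator_of_mem hy, Set.indicator_of_mem hy]
    obtain ⟨g, hg, rfl⟩ := hAU hy
    obtain ⟨h1, h2, -, h4⟩ := Q.mem_congruenceSubgroup_one.1 hg
    congr 1
    change discDensity K (g • pairOf u) = _
    rw [discDensity, discDensity, Q.disc_smul]
    congr 2
    ext
    rw [coe_nnnorm, coe_nnnorm, norm_mul, norm_pow, norm_mul, norm_mul, h1, h2, h4]
    simp
  · rw [Set.indicator_of_notMem hy, Set.indicator_of_notMem hy]

include hO hu Q

/-- The comparison of Haar measures at a deep congruence subgroup has `ν(U₀ x)` as its only unknown.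
In the solution the powers of `t` cancel, since `2·2n + 8n = 12n`. -/
theorem orbitMeasure_integral_orbit (hfin : Module.finrank K D = 4) :
    (orbitMeasure O K u).real ((fun g : PairGroup K D => g • pairOf u) ''
      (Q.congruenceSubgroup 1 zero_le_one : Set (PairGroup K D))) =
      2⁻¹ * ‖disc K (pairOf u)‖⁻¹ * (1 + ‖ϖ‖) * (1 - ‖ϖ‖ ^ 2) ^ 2 ∧
    orbitMeasure O K u ((fun g : PairGroup K D => g • pairOf u) ''
      (Q.congruenceSubgroup 1 zero_le_one : Set (PairGroup K D))) ≠ ∞ := by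
  obtain ⟨hs1, hs2, hs3⟩ := Q.spaceMeasure_spec hO
  obtain ⟨hg1, hg2, hg3⟩ := Q.groupMeasure_spec hO
  obtain ⟨hl1, hl2⟩ := stabMeasure_spec hO Q hu.selfCentralizing hu.disc_ne_zero
  obtain ⟨τ, hτ, S, hτu⟩ := hu.exists_halfStabilizer hO Q hfin
  obtain ⟨w, hw⟩ := exists_isMaximalComm Q hu hfin
  obtain ⟨p, hp⟩ := hu.exists_uniformizer
  have ht0 := hO.norm_pos
  have ht1 := hO.norm_lt_one
  have hP : 0 < ‖disc K (pairOf u)‖ := norm_pos_iff.2 hu.disc_ne_zero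
  have hcont : Continuous fun g : PairGroup K D => g • pairOf u :=
    continuous_id.smul continuous_const
  have hcpt := ((Q.isCompact_congruenceSubgroup one_pos).image hcont)
  have hfinite : orbitMeasure O K u ((fun g : PairGroup K D => g • pairOf u) ''
      (Q.congruenceSubgroup 1 zero_le_one : Set (PairGroup K D))) ≠ ∞ := by
    rw [orbitMeasure_of_subset Q hcpt.measurableSet subset_rfl]
    exact ENNReal.mul_ne_top ENNReal.coe_ne_top hcpt.measure_lt_top.ne
  refine ⟨?_, hfinite⟩
  -- The level must be so deep that the approximation argument converges and that the subgroup
  -- misses the coset of `τ`; both follow from this inequality.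
  obtain ⟨n, hn0, hn⟩ : ∃ n : ℕ, n ≠ 0 ∧ (‖ϖ‖ ^ n) ^ 2 ≤ ‖ϖ‖ ^ 2 * ‖disc K (pairOf u)‖ := by
    obtain ⟨n, hn⟩ := exists_pow_lt_of_lt_one (show 0 < ‖ϖ‖ ^ 2 * ‖disc K (pairOf u)‖ by positivity)
      ht1
    refine ⟨n + 1, by omega, le_trans ?_ hn.le⟩
    rw [← pow_mul]
    exact pow_le_pow_of_le_one ht0.le ht1.le (by omega)
  have hr : 0 < ‖ϖ‖ ^ n := by positivity
  have hlt : (‖ϖ‖ ^ n) ^ 2 < ‖disc K (pairOf u)‖ :=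
    hn.trans_lt (mul_lt_of_lt_one_left hP (pow_lt_one₀ ht0.le ht1 two_ne_zero))
  have hmul := measure_orbit_mul (stabMeasure O K u) S
    (measurePreserving_orbitMeasure (u := u) hO Q hfin) orbitMeasure_compl
    (Q.isOpen_congruenceSubgroup one_pos) (Q.isCompact_congruenceSubgroup one_pos) hτ
    (hu.stabMeasure_congruenceSubgroup_one hO Q) hg3 hfinite
    (Q.congruenceSubgroup (‖ϖ‖ ^ n) hr.le) (Q.isOpen_congruenceSubgroup hr)
    (Q.isCompact_congruenceSubgroup hr)
    (fun h hh => hu.mul_notMem_congruenceSubgroup Q hτu hr.le hlt hh)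
  have hsub := Set.image_mono (f := fun g : PairGroup K D => g • pairOf u)
    (show (Q.congruenceSubgroup (‖ϖ‖ ^ n) hr.le : Set (PairGroup K D)) ⊆ _ from
      Q.congruenceSubgroup_le _ hr.le)
  have horb := orbitMeasure_of_subset (O := O) Q
    ((Q.isCompact_congruenceSubgroup hr).image hcont).measurableSet hsub
  have hlat := measure_orbitLattice hO Q hu hw n
  have htrans : spaceMeasure O D ((fun g : PairGroup K D => g • pairOf u) ''
      (Q.congruenceSubgroup (‖ϖ‖ ^ n) hr.le : Set (PairGroup K D))) =
      ENNReal.ofReal (‖ϖ‖ ^ (8 * n) * ‖disc K (pairOf u)‖) := by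
    rw [← hlat, orbit_congruenceSubgroup Q hu hw hO.ne_zero ht1 n hn0 hn]
    simp only [sub_eq_add_neg]
    exact measure_preimage_add_right _ _ _
  rw [htrans] at horb
  have hdg := Q.measure_congruenceSubgroup hO (groupMeasure O K D) hg3 hfin p.toUnits hp n hn0
  have hquad := measure_quadCongruence hO Q hu.selfCentralizing p hp n hn0
  rw [hu.stabMeasure_congruenceSubgroup hO Q n] at hmul
  have m1 := congrArg ENNReal.toReal hmul
  have m2 := congrArg ENNReal.toReal horb
  have m3 := congrArg ENNReal.toReal hdg
  have m4 := congrArg ENNReal.toReal hquad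
  have p1 : 0 < 1 - ‖ϖ‖ := sub_pos.2 ht1
  have p2 : 0 < 1 - ‖ϖ‖ ^ 2 := sub_pos.2 (pow_lt_one₀ ht0.le ht1 two_ne_zero)
  rw [ENNReal.toReal_mul, ENNReal.toReal_mul, ENNReal.toReal_mul, ENNReal.toReal_pow,
    ENNReal.toReal_ofNat] at m1
  rw [ENNReal.toReal_mul, ENNReal.toReal_ofReal (by positivity)] at m2
  rw [ENNReal.toReal_mul, ENNReal.toReal_ofReal (by positivity),
    ENNReal.toReal_ofReal (by positivity)] at m3
  rw [ENNReal.toReal_mul, ENNReal.toReal_ofReal p1.le,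
    ENNReal.toReal_ofReal (by positivity)] at m4
  have hden : ((discDensity K (pairOf u) : ℝ≥0∞)).toReal = (‖disc K (pairOf u)‖ ^ 2)⁻¹ := by
    rw [ENNReal.coe_toReal, discDensity]; simp
  rw [hden] at m2
  rw [m2] at m1
  have q1 := eq_div_of_mul_eq p1.ne' m4
  have q2 := eq_div_of_mul_eq (by positivity) m3
  rw [q1, q2] at m1
  rw [measureReal_def]
  set X := (orbitMeasure O K u ((fun g : PairGroup K D => g • pairOf u) ''
      (Q.congruenceSubgroup 1 zero_le_one : Set (PairGroup K D)))).toReal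
  set t := ‖ϖ‖
  set P := ‖disc K (pairOf u)‖
  have p3 : 1 - t ^ 2 = (1 - t) * (1 + t) := by ring
  have h12 : t ^ (12 * n) = (t ^ (2 * n)) ^ 2 * t ^ (8 * n) := by rw [← pow_mul, ← pow_add]; ring_nf
  rw [h12] at m1
  have h8 : 0 < t ^ (8 * n) := by positivity
  have h2 : 0 < t ^ (2 * n) := by positivity
  have p4 : 0 < 1 + t := by positivity
  generalize t ^ (8 * n) = T8 at *
  generalize t ^ (2 * n) = T2 at *
  rw [p3] at m1 ⊢
  field_simp at m1 ⊢
  linarith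

/-- The density is `|P(x)|² ν(U₀ x)`, so the factor `|P(x)|⁻¹` of the volume turns into `|P(x)|`. -/
theorem existsUnique_isOrbitConstant (hfin : Module.finrank K D = 4) :
    (∃! b : ℝ, IsOrbitConstant O K u b) ∧ localDensity O K u =
      2⁻¹ * ‖disc K (pairOf u)‖ * (1 + ‖ϖ‖) * (1 - ‖ϖ‖ ^ 2) ^ 2 := by
  obtain ⟨hs1, hs2, hs3⟩ := Q.spaceMeasure_spec hO
  obtain ⟨hg1, hg2, hg3⟩ := Q.groupMeasure_spec hO
  obtain ⟨hl1, hl2⟩ := stabMeasure_spec hO Q hu.selfCentralizing hu.disc_ne_zero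
  obtain ⟨τ, hτ, S, hτu⟩ := hu.exists_halfStabilizer hO Q hfin
  obtain ⟨hval, hfinite⟩ := orbitMeasure_integral_orbit hO Q hu hfin
  have ht0 := hO.norm_pos
  have ht1 := hO.norm_lt_one
  have hP : 0 < ‖disc K (pairOf u)‖ := norm_pos_iff.2 hu.disc_ne_zero
  have hcont : Continuous fun g : PairGroup K D => g • pairOf u :=
    continuous_id.smul continuous_const
  have hcpt := ((Q.isCompact_congruenceSubgroup one_pos).image hcont)
  set ν := orbitMeasure O K u with hν
  set A := (fun g : PairGroup K D => g • pairOf u) ''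
    (Q.congruenceSubgroup 1 zero_le_one : Set (PairGroup K D)) with hA
  have p2 : 0 < 1 - ‖ϖ‖ ^ 2 := sub_pos.2 (pow_lt_one₀ ht0.le ht1 two_ne_zero)
  have hreal : 0 < ν.real A := by rw [hval]; positivity
  have hpos : ν A ≠ 0 := fun h => by rw [measureReal_def, h] at hreal; simp at hreal
  have hinv := measurePreserving_orbitMeasure (u := u) hO Q hfin
  have hcompl : ν (MulAction.orbit (PairGroup K D) (pairOf u))ᶜ = 0 := orbitMeasure_compl
  have hlam := hu.stabMeasure_congruenceSubgroup_one hO Q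
  have hopen := Q.isOpen_congruenceSubgroup one_pos
  have hcomp := Q.isCompact_congruenceSubgroup one_pos
  have hsmul : ∀ (f : PairSpace D → ℂ) y,
      discDensity K y • f y = (‖disc K y‖ ^ 2)⁻¹ • f y := fun f y => by
    rw [NNReal.smul_def, discDensity]; simp
  have hintiff : ∀ f : PairSpace D → ℂ, Integrable f ν ↔
      IntegrableOn (fun y => (‖disc K y‖ ^ 2)⁻¹ • f y)
        (MulAction.orbit (PairGroup K D) (pairOf u)) (spaceMeasure O D) := fun f => by
    rw [hν, orbitMeasure, integrable_withDensity_iff_integrable_smul (measurable_discDensity Q)]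
    simp only [hsmul]
    rfl
  have hinteq : ∀ f : PairSpace D → ℂ, ∫ y, f y ∂ν =
      ∫ y in MulAction.orbit (PairGroup K D) (pairOf u),
        (‖disc K y‖ ^ 2)⁻¹ • f y ∂(spaceMeasure O D) := fun f => by
    rw [hν, orbitMeasure, integral_withDensity_eq_integral_smul (measurable_discDensity Q)]
    simp only [hsmul]
  have hmeas : Measurable fun q : PairGroup K D ⧸ stabComponent K (pairOf u) => q.out • pairOf u :=
    S.measurable_out_smul
  have hex : IsOrbitConstant O K u (ν.real A)⁻¹ := by
    refine ⟨inv_pos.2 hreal, quotientMeasure S ν (Q.congruenceSubgroup 1 zero_le_one), ⟨?_, ?_, ?_⟩, ?_⟩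
    · exact regular_quotientMeasure (stabMeasure O K u) S hinv hcompl hopen hcomp hτ hlam hfinite hpos
        (isClosed_stabComponent Q hu.selfCentralizing hu.disc_ne_zero)
    · exact smulInvariantMeasure_quotientMeasure S hinv
    · intro φ hφ hφc
      exact integral_quotientMeasure (stabMeasure O K u) S hinv hcompl hopen hcomp hτ hlam hg3
        hfinite hpos hφ hφc
    · intro f hf
      have hmap := map_quotientMeasure S hcompl hfinite hpos
      have hf1 : Integrable f ((ν A)⁻¹ • ν) :=
        ((hintiff f).2 hf).smul_measure (ENNReal.inv_ne_top.2 hpos)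
      rw [← hmap] at hf1
      refine ⟨hf1.comp_measurable hmeas, ?_⟩
      rw [← integral_map hmeas.aemeasurable hf1.aestronglyMeasurable, hmap, integral_smul_measure,
        hinteq, ENNReal.toReal_inv, ← measureReal_def, Complex.real_smul]
  -- Testing with the indicator function of `U₀ x` gives `1 = b ν(U₀ x)`, whatever quotient measure
  -- occurs in the definition.
  have huniq : ∀ b, IsOrbitConstant O K u b → b = (ν.real A)⁻¹ := by
    rintro b ⟨hb, μ, hμ, hf⟩
    have h1 := measureReal_of_integral_eq (stabMeasure O K u) S hopen hcomp hτ hlam hg3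
      hμ.integral_eq
    have hAm : MeasurableSet A := hcpt.measurableSet
    have hind : Integrable (A.indicator fun _ => (1 : ℂ)) ν :=
      (integrable_indicator_iff hAm).2 (integrableOn_const hfinite)
    have h2 := (hf _ ((hintiff _).1 hind)).2
    rw [← hinteq, integral_indicator_const _ hAm] at h2
    have h3 : ∫ q : PairGroup K D ⧸ stabComponent K (pairOf u),
        A.indicator (fun _ => (1 : ℂ)) (q.out • pairOf u) ∂μ = 1 := by
      have : (fun q : PairGroup K D ⧸ stabComponent K (pairOf u) =>
          A.indicator (fun _ => (1 : ℂ)) (q.out • pairOf u)) =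
          ((fun q : PairGroup K D ⧸ stabComponent K (pairOf u) => q.out • pairOf u) ⁻¹' A).indicator
            fun _ => (1 : ℂ) := rfl
      rw [this, integral_indicator_const _ (hmeas hAm), h1, one_smul]
    rw [h3, Complex.real_smul, mul_one] at h2
    have h4 : 1 = b * ν.real A := by exact_mod_cast h2
    exact eq_inv_of_mul_eq_one_left h4.symm
  refine ⟨⟨_, hex, huniq⟩, ?_⟩
  have hb : orbitConstant O K u = (ν.real A)⁻¹ := huniq _ (Classical.epsilon_spec ⟨_, hex⟩)
  rw [localDensity, hb, hval]
  field_simp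

end Density

end PairQuat

namespace PairQuat

/-! ### Completions of number fields -/

section NumberField

variable (k : Type*) [Field k] [NumberField k] (v : HeightOneSpectrum (𝓞 k))

instance : CharZero (v.adicCompletion k) :=
  charZero_of_injective_algebraMap (algebraMap k (v.adicCompletion k)).injective

theorem norm_le_one_iff_valued (x : v.adicCompletion k) : ‖x‖ ≤ 1 ↔ Valued.v x ≤ 1 := by
  rw [FinitePlace.norm_def]
  exact (NNReal.coe_le_one).trans
    (WithZeroMulInt.toNNReal_le_one_iff (HeightOneSpectrum.one_lt_absNorm_nnreal v))

theorem norm_lt_one_iff_valued (x : v.adicCompletion k) : ‖x‖ < 1 ↔ Valued.v x < 1 := by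
  rw [FinitePlace.norm_def]
  exact (NNReal.coe_lt_one).trans
    (WithZeroMulInt.toNNReal_lt_one_iff (HeightOneSpectrum.one_lt_absNorm_nnreal v))

/-- Reduction of global integers. -/
def globalResidue : 𝓞 k →+* IsLocalRing.ResidueField (v.adicCompletionIntegers k) :=
  (IsLocalRing.residue _).comp (algebraMap (𝓞 k) (v.adicCompletionIntegers k))

theorem residue_eq_zero_iff_norm (x : v.adicCompletionIntegers k) :
    IsLocalRing.residue (v.adicCompletionIntegers k) x = 0 ↔ ‖(x : v.adicCompletion k)‖ < 1 := by
  rw [IsLocalRing.residue_eq_zero_iff, IsLocalRing.mem_maximalIdeal, mem_nonunits_iff,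
    HeightOneSpectrum.adicCompletionIntegers.isUnit_iff_valued_eq_one, norm_lt_one_iff_valued]
  exact ⟨fun h => lt_of_le_of_ne x.2 h, fun h => h.ne⟩

/-- An integer of the completion is approximated within the open unit ball first by an element of
`k`, which is then `v`-integral, and next by a global integer. -/
theorem globalResidue_surjective : Function.Surjective (globalResidue k v) := by
  intro y
  obtain ⟨y, rfl⟩ := IsLocalRing.residue_surjective y
  obtain ⟨a, ha⟩ := (HeightOneSpectrum.denseRange_algebraMap k v).exists_dist_lt
    (y : v.adicCompletion k) one_pos
  rw [dist_eq_norm] at ha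
  have hy : ‖(y : v.adicCompletion k)‖ ≤ 1 := (norm_le_one_iff_valued k v _).2 y.2
  have ha1 : ‖algebraMap k (v.adicCompletion k) a‖ ≤ 1 := by
    have e : algebraMap k (v.adicCompletion k) a =
      y - (y - algebraMap k (v.adicCompletion k) a) := by abel
    rw [e, sub_eq_add_neg]
    exact (IsUltrametricDist.norm_add_le_max _ _).trans
      (max_le hy (by rw [norm_neg]; exact ha.le))
  have hval : ∀ b : k, Valued.v (algebraMap k (v.adicCompletion k) b) = v.valuation k b := fun b =>
    HeightOneSpectrum.valuedAdicCompletion_eq_valuation' v b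
  have hav : v.valuation k a ≤ 1 := by rw [← hval, ← norm_le_one_iff_valued]; exact ha1
  obtain ⟨r, hr⟩ := v.exists_valuation_sub_lt_of_integer hav 1
  rw [← hval, Units.val_one, ← norm_lt_one_iff_valued, map_sub] at hr
  refine ⟨r, ?_⟩
  rw [← sub_eq_zero, globalResidue, RingHom.comp_apply, ← map_sub, residue_eq_zero_iff_norm]
  have e : ((algebraMap (𝓞 k) (v.adicCompletionIntegers k) r - y : v.adicCompletionIntegers k) :
      v.adicCompletion k) = (algebraMap k (v.adicCompletion k) (algebraMap (𝓞 k) k r) -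
        algebraMap k (v.adicCompletion k) a) + -(y - algebraMap k (v.adicCompletion k) a) := by
    rw [neg_sub, sub_add_sub_cancel]
    rfl
  rw [e]
  exact (IsUltrametricDist.norm_add_le_max _ _).trans_lt (max_lt hr (by rw [norm_neg]; exact ha))

theorem ker_globalResidue : RingHom.ker (globalResidue k v) = v.asIdeal := by
  ext r
  rw [RingHom.mem_ker, globalResidue, RingHom.comp_apply, residue_eq_zero_iff_norm]
  exact FinitePlace.norm_lt_one_iff_mem k v r

theorem card_residueField_adicCompletion :
    Nat.card (IsLocalRing.ResidueField (v.adicCompletionIntegers k)) = Ideal.absNorm v.asIdeal := by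
  rw [← ker_globalResidue, Ideal.absNorm_apply, Submodule.cardQuot_apply]
  exact (Nat.card_congr (RingHom.quotientKerEquivOfSurjective
    (globalResidue_surjective k v)).toEquiv).symm

instance : ProperSpace (v.adicCompletion k) := by
  refine Valued.integer.properSpace_iff_completeSpace_and_isDiscreteValuationRing_integer_and_finite_residueField.2
    ⟨inferInstance, (inferInstance : IsDiscreteValuationRing (v.adicCompletionIntegers k)), ?_⟩
  refine Nat.finite_of_card_ne_zero ?_
  change Nat.card (IsLocalRing.ResidueField (v.adicCompletionIntegers k)) ≠ 0
  rw [card_residueField_adicCompletion]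
  have := HeightOneSpectrum.one_lt_absNorm v
  omega

/-- The norm of the completion is the valuation exponentiated with base the absolute norm of `v`,
which is the order of the residue field; a global uniformizer serves as `ϖ`. -/
theorem exists_isNormalizedLocal : ∃ ϖ : v.adicCompletion k,
    IsNormalizedLocal (v.adicCompletionIntegers k) (v.adicCompletion k) ϖ
      (Nat.card (IsLocalRing.ResidueField (v.adicCompletionIntegers k))) := by
  have hq := HeightOneSpectrum.one_lt_absNorm v
  obtain ⟨π, hπ⟩ := v.valuation_exists_uniformizer k
  have hval : ∀ b : k, Valued.v (algebraMap k (v.adicCompletion k) b) = v.valuation k b := fun b =>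
    HeightOneSpectrum.valuedAdicCompletion_eq_valuation' v b
  have hnorm : ∀ (x : v.adicCompletion k) (n : ℤ), Valued.v x = WithZero.exp n →
      ‖x‖ = (Ideal.absNorm v.asIdeal : ℝ) ^ n := by
    intro x n hx
    rw [FinitePlace.norm_def, hx, WithZeroMulInt.toNNReal_neg_apply _ WithZero.exp_ne_zero]
    simp only [NNReal.coe_zpow, NNReal.coe_natCast]
    rfl
  have hϖ : ‖algebraMap k (v.adicCompletion k) π‖ = (Ideal.absNorm v.asIdeal : ℝ)⁻¹ := by
    rw [hnorm _ (-1) (by rw [hval, hπ]), zpow_neg_one]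
  refine ⟨algebraMap k (v.adicCompletion k) π, ⟨Subtype.val_injective, ?_, ?_, ?_, ?_, rfl⟩⟩
  · intro x
    rw [norm_le_one_iff_valued]
    exact ⟨by rintro ⟨y, rfl⟩; exact y.2, fun h => ⟨⟨x, h⟩, rfl⟩⟩
  · intro x hx
    have h0 : Valued.v x ≠ 0 := (Valuation.ne_zero_iff _).2 hx
    refine ⟨-(WithZero.log (Valued.v x)), ?_⟩
    rw [hϖ, inv_zpow, zpow_neg, inv_inv]
    exact hnorm _ _ (WithZero.exp_log h0).symm
  · rw [hϖ, card_residueField_adicCompletion]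
  · rw [card_residueField_adicCompletion]; exact hq

end NumberField

end PairQuat

namespace PairQuat

/-! ### Quadratic extensions -/

section QuadraticField

variable {K L : Type*} [Field K] [Field L] [Algebra K L] (hL : Module.finrank K L = 2)
  {β : L} {a b : K} (hβ : β * β = a • β - b • 1)
  (hind : ∀ c d : K, c • (1 : L) + d • β = 0 → c = 0 ∧ d = 0)

/-- The basis `1, β`. -/
def quadBasis : Module.Basis (Fin 2) K L :=
  basisOfLinearIndependentOfCardEqFinrank (b := ![1, β]) (LinearIndependent.pair_iff.2 hind)
    (by rw [hL]; simp)

theorem quadBasis_zero : quadBasis hL hind 0 = 1 := by simp [quadBasis]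

theorem quadBasis_one : quadBasis hL hind 1 = β := by simp [quadBasis]

include hL hind in
theorem exists_eq_smul_add (z : L) : ∃ x y : K, z = x • 1 + y • β := by
  have h := (quadBasis hL hind).sum_repr z
  rw [Fin.sum_univ_two, quadBasis_zero, quadBasis_one] at h
  exact ⟨_, _, h.symm⟩

include hL hβ hind in
theorem discr_one_beta : Algebra.discr K ![1, β] = a ^ 2 - 4 * b := by
  set B := quadBasis hL hind
  have h0 : B 0 = 1 := quadBasis_zero hL hind
  have h1 : B 1 = β := quadBasis_one hL hind
  have t1 : Algebra.trace K L 1 = 2 := by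
    have := Algebra.trace_algebraMap (S := L) (1 : K)
    rwa [map_one, hL, nsmul_eq_mul, mul_one] at this
  have tβ : Algebra.trace K L β = a := by
    rw [Algebra.trace_eq_matrix_trace B, Matrix.trace_fin_two, Algebra.leftMulMatrix_eq_repr_mul,
      Algebra.leftMulMatrix_eq_repr_mul, h0, h1, mul_one, hβ, ← h1, ← h0]
    simp
  have tββ : Algebra.trace K L (β * β) = a * a - b * 2 := by
    rw [hβ, map_sub, map_smul, map_smul, t1, tβ, smul_eq_mul, smul_eq_mul]
  rw [Algebra.discr_def, Matrix.det_fin_two]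
  simp only [Algebra.traceMatrix_apply, Algebra.traceForm_apply, Matrix.cons_val_zero,
    Matrix.cons_val_one, one_mul, mul_one, t1, tβ, tββ]
  ring

include hL hβ hind in
theorem discr_of_coords (f : Fin 2 → L) (x y : Fin 2 → K) (hf : ∀ i, f i = x i • 1 + y i • β) :
    Algebra.discr K f = (x 0 * y 1 - x 1 * y 0) ^ 2 * (a ^ 2 - 4 * b) := by
  have h := Algebra.discr_of_matrix_mulVec ![1, β] (!![x 0, y 0; x 1, y 1] : Matrix (Fin 2) (Fin 2) K)
  rw [discr_one_beta hL hβ hind, Matrix.det_fin_two_of] at h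
  rw [show x 0 * y 1 - x 1 * y 0 = x 0 * y 1 - y 0 * x 1 by ring, ← h]
  congr 1
  funext i
  fin_cases i
  · simp [Matrix.mulVec, dotProduct, hf, Algebra.smul_def]
  · simp [Matrix.mulVec, dotProduct, hf, Algebra.smul_def]

variable {D : Type*} [Ring D] [Algebra K D] {u : D} (hu : u * u = a • u - b • 1)

theorem quad_mul {w : D} (hw : w * w = a • w - b • 1) (x y x' y' : K) :
    (x • (1 : D) + y • w) * (x' • 1 + y' • w) =
      (x * x' - b * (y * y')) • 1 + (x * y' + y * x' + a * (y * y')) • w := by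
  simp only [add_mul, mul_add, smul_mul_assoc, mul_smul_comm, one_mul, mul_one, hw]
  module

theorem constr_quadBasis (x y : K) :
    (quadBasis hL hind).constr K ![1, u] (x • 1 + y • β) = x • 1 + y • u := by
  have h0 := (quadBasis hL hind).constr_basis K ![1, u] 0
  have h1 := (quadBasis hL hind).constr_basis K ![1, u] 1
  rw [quadBasis_zero] at h0
  rw [quadBasis_one] at h1
  rw [map_add, map_smul, map_smul, h0, h1]
  rfl

/-- The embedding that maps `β` to `u`. -/
def quadLift : L →ₐ[K] D :=
  AlgHom.ofLinearMap ((quadBasis hL hind).constr K ![1, u])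
    (by
      have h0 := (quadBasis hL hind).constr_basis K ![1, u] 0
      rw [quadBasis_zero] at h0
      exact h0) (by
      intro z z'
      obtain ⟨x, y, rfl⟩ := exists_eq_smul_add hL hind z
      obtain ⟨x', y', rfl⟩ := exists_eq_smul_add hL hind z'
      rw [quad_mul hβ, constr_quadBasis, constr_quadBasis, constr_quadBasis, quad_mul hu])

theorem quadLift_apply (x y : K) :
    quadLift hL hβ hind hu (x • 1 + y • β) = x • 1 + y • u := constr_quadBasis hL hind x y

end QuadraticField

/-! ### Quotients of the valuation ring -/

section Quotient

set_option linter.unusedSectionVars false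

variable {O K : Type*} [CommRing O] [IsDomain O] [IsDiscreteValuationRing O]
  [NontriviallyNormedField K]
  [IsUltrametricDist K] [ProperSpace K] [Algebra O K] {ϖ : K} {q : ℕ}
  (hO : IsNormalizedLocal O K ϖ q)

namespace IsNormalizedLocal

include hO

theorem dvd_iff (c d : O) : c ∣ d ↔ ‖algebraMap O K d‖ ≤ ‖algebraMap O K c‖ := by
  constructor
  · rintro ⟨e, rfl⟩
    rw [map_mul, norm_mul]
    exact mul_le_of_le_one_right (norm_nonneg _) ((hO.mem_range _).1 ⟨e, rfl⟩)
  · intro h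
    by_cases hc : algebraMap O K c = 0
    · rw [hc, norm_zero, norm_le_zero_iff] at h
      rw [hO.injective (h.trans (map_zero (algebraMap O K)).symm)]
      exact dvd_zero c
    obtain ⟨e, he⟩ := (hO.mem_range (algebraMap O K d / algebraMap O K c)).2 (by
      rw [norm_div]; exact div_le_one_of_le₀ h (norm_nonneg _))
    refine ⟨e, hO.injective ?_⟩
    rw [map_mul, he, mul_div_cancel₀ _ hc]

theorem maximalIdeal_eq_span {p : O} (hp : algebraMap O K p = ϖ) :
    IsLocalRing.maximalIdeal O = Ideal.span {p} := by
  ext a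
  rw [hO.mem_maximalIdeal_iff, Ideal.mem_span_singleton, hO.dvd_iff, hp]
  exact ⟨hO.norm_le_of_lt_one, fun h => h.trans_lt hO.norm_lt_one⟩

theorem exists_prime : ∃ p : O, algebraMap O K p = ϖ :=
  (hO.mem_range ϖ).2 hO.norm_lt_one.le

/-- The ideal is a power of the maximal ideal, and each step of the filtration contributes a factor
`q`. -/
theorem card_quotient_span {d : O} (hd : d ≠ 0) :
    (Nat.card (O ⧸ Ideal.span {d}) : ℝ) = ‖algebraMap O K d‖⁻¹ := by
  obtain ⟨p, hp⟩ := hO.exists_prime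
  have hd0 : algebraMap O K d ≠ 0 := fun h => hd (hO.injective (h.trans (map_zero _).symm))
  obtain ⟨n, hn⟩ := hO.exists_zpow _ hd0
  have hn0 : 0 ≤ n := by
    by_contra! h
    have h1 : ‖algebraMap O K d‖ ≤ 1 := (hO.mem_range _).1 ⟨d, rfl⟩
    rw [hn] at h1
    exact absurd h1 (not_le.2 (one_lt_zpow_of_neg₀ hO.norm_pos hO.norm_lt_one h))
  obtain ⟨m, rfl⟩ := Int.eq_ofNat_of_zero_le hn0
  rw [zpow_natCast] at hn
  have hspan : Ideal.span {d} = IsLocalRing.maximalIdeal O ^ m := by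
    rw [hO.maximalIdeal_eq_span hp, Ideal.span_singleton_pow]
    ext a
    rw [Ideal.mem_span_singleton, Ideal.mem_span_singleton, hO.dvd_iff, hO.dvd_iff, hn, map_pow,
      norm_pow, hp]
  have hcard := cardQuot_pow_of_prime (IsDiscreteValuationRing.not_a_field O) (i := m)
  rw [Submodule.cardQuot_apply, Submodule.cardQuot_apply, ← hspan] at hcard
  rw [hcard, show Nat.card (O ⧸ IsLocalRing.maximalIdeal O) = q from hO.card_residue, hn,
    hO.norm_eq, Nat.cast_pow, inv_pow, inv_inv]

end IsNormalizedLocal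

end Quotient

/-! ### Standard representatives -/

section Standard

set_option linter.unusedSectionVars false

variable {O K D : Type*} [CommRing O] [IsDomain O] [IsDiscreteValuationRing O]
  [NontriviallyNormedField K]
  [IsUltrametricDist K] [ProperSpace K] [CharZero K] [Algebra O K]
  {ϖ : K} {q : ℕ} (hO : IsNormalizedLocal O K ϖ q)
  [Ring D] [Nontrivial D] [NoZeroDivisors D] [Algebra K D] [FiniteDimensional K D]
  [TopologicalSpace D] [IsModuleTopology K D] [IsTopologicalRing D] [ContinuousSMul K D]
  [PolishSpace D] [LocallyCompactSpace D] [Algebra O D] [IsScalarTower O K D]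
  (Q : NormConj K D) {u : D} (hs : IsStandard O K u) (hc : IsSelfCentralizing K u)

include hO Q hs in
theorem IsStandard.norm_le : ‖reducedNorm K u‖ ≤ 1 := by
  have h : u ∈ {a : D | a ∈ Algebra.adjoin K ({u} : Set D) ∧ IsIntegral O a} := by
    rw [hs.generates]; exact Algebra.self_mem_adjoin_singleton O u
  exact (Q.isIntegral_iff hO).1 h.2

include hO Q hs hc in
-- Standardness puts an integral element of `K[u]` into `O[u]`, and `O[u] = O + O u` because the
-- trace and the norm of `u` are integral. Independence of `1, u` identifies the coordinates.
theorem IsStandard.coord_le {x y : K} (h : ‖reducedNorm K (x • (1 : D) + y • u)‖ ≤ 1) :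
    ‖x‖ ≤ 1 ∧ ‖y‖ ≤ 1 := by
  have hn := hs.norm_le hO Q
  have ht := Q.norm_tr_le_one hn
  have hmem : x • (1 : D) + y • u ∈ (Algebra.adjoin O ({u} : Set D) : Set D) := by
    rw [← hs.generates]
    exact ⟨add_mem (Subalgebra.smul_mem _ (one_mem _) _)
      (Subalgebra.smul_mem _ (Algebra.self_mem_adjoin_singleton K u) _), (Q.isIntegral_iff hO).2 h⟩
  have key : ∀ d ∈ Algebra.adjoin O ({u} : Set D),
      ∃ x y : K, ‖x‖ ≤ 1 ∧ ‖y‖ ≤ 1 ∧ d = x • 1 + y • u := by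
    have hadd : ∀ {x y : K}, ‖x‖ ≤ 1 → ‖y‖ ≤ 1 → ‖x + y‖ ≤ 1 := fun hx hy =>
      (IsUltrametricDist.norm_add_le_max _ _).trans (max_le hx hy)
    have hmul : ∀ {x y : K}, ‖x‖ ≤ 1 → ‖y‖ ≤ 1 → ‖x * y‖ ≤ 1 := fun hx hy => by
      rw [norm_mul]; exact mul_le_one₀ hx (norm_nonneg _) hy
    intro d hd
    refine Algebra.adjoin_induction
      (p := fun d _ => ∃ x y : K, ‖x‖ ≤ 1 ∧ ‖y‖ ≤ 1 ∧ d = x • 1 + y • u) ?_ ?_ ?_ ?_ hd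
    · rintro _ rfl
      exact ⟨0, 1, by simp, by simp, by simp⟩
    · intro r
      exact ⟨algebraMap O K r, 0, (hO.mem_range _).1 ⟨r, rfl⟩, by simp, by
        rw [zero_smul, add_zero, ← Algebra.algebraMap_eq_smul_one, ← IsScalarTower.algebraMap_apply]⟩
    · rintro _ _ _ _ ⟨x, y, hx, hy, rfl⟩ ⟨x', y', hx', hy', rfl⟩
      exact ⟨x + x', y + y', hadd hx hx', hadd hy hy', by module⟩
    · rintro _ _ _ _ ⟨x, y, hx, hy, rfl⟩ ⟨x', y', hx', hy', rfl⟩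
      refine ⟨_, _, ?_, ?_, quad_mul (Q.mul_self' (u := u)) x y x' y'⟩
      · rw [sub_eq_add_neg]
        exact hadd (hmul hx hx') (by rw [norm_neg]; exact hmul hn (hmul hy hy'))
      · exact hadd (hadd (hmul hx hy') (hmul hy hx')) (hmul ht (hmul hy hy'))
  obtain ⟨x', y', hx', hy', e⟩ := key _ hmem
  have h0 : (x - x') • (1 : D) + (y - y') • u = 0 := by
    rw [← sub_eq_zero] at e
    rw [← e]; module
  obtain ⟨h1, h2⟩ := hc.indep _ _ h0
  rw [sub_eq_zero] at h1 h2
  exact ⟨h1 ▸ hx', h2 ▸ hy'⟩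

variable (hfr : Module.finrank K (orbitField K (pairOf u)) = 2)

include hO Q hs hc hfr in
/-- The splitting field of the form attached to `u` is generated by a conjugate of `u`. -/
theorem exists_root_orbitField : ∃ β : orbitField K (pairOf u),
    β * β = Q.tr u • β - reducedNorm K u • 1 ∧
    ∀ c d : K, c • (1 : orbitField K (pairOf u)) + d • β = 0 → c = 0 ∧ d = 0 := by
  have hc0 : formCoeff K (pairOf u) 0 = 1 := NormConj.nrd_one
  have hc1 : formCoeff K (pairOf u) 1 = Q.tr u := by
    change reducedNorm K (1 + u) - reducedNorm K 1 - reducedNorm K u = _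
    rw [Q.nrd_one_add, NormConj.nrd_one]; ring
  have hc2 : formCoeff K (pairOf u) 2 = reducedNorm K u := rfl
  have hdeg : (formPoly K (pairOf u)).degree = 2 := by
    rw [formPoly, hc0]
    exact Polynomial.degree_quadratic one_ne_zero
  obtain ⟨θ, hθ⟩ := (Polynomial.SplittingField.splits (formPoly K (pairOf u))).exists_eval_eq_zero
    (by rw [Polynomial.degree_map, hdeg]; decide)
  have hev : ∀ (L : Type _) [Field L] [Algebra K L] (t : L),
      ((formPoly K (pairOf u)).map (algebraMap K L)).eval t =
        t ^ 2 + algebraMap K L (Q.tr u) * t + algebraMap K L (reducedNorm K u) := by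
    intro L _ _ t
    rw [formPoly, hc0, hc1, hc2]
    simp only [Polynomial.map_add, Polynomial.map_mul, Polynomial.map_C, Polynomial.map_pow,
    Polynomial.map_X, Polynomial.eval_add, Polynomial.eval_mul, Polynomial.eval_C,
    Polynomial.eval_pow, Polynomial.eval_X, map_one, one_mul]
  rw [hev] at hθ
  -- The polynomial of the form is `X² + tr(u) X + N(u)`, so the negative of a root satisfies the
  -- quadratic equation of `u`.
  have hβ : (-θ) * (-θ) = Q.tr u • (-θ) - reducedNorm K u • (1 : orbitField K (pairOf u)) := by
    rw [Algebra.smul_def, Algebra.smul_def]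
    linear_combination hθ
  refine ⟨-θ, hβ, fun c d h => ?_⟩
  by_cases hd : d = 0
  · rw [hd, zero_smul, add_zero, ← Algebra.algebraMap_eq_smul_one] at h
    exact ⟨(map_eq_zero _).1 h, hd⟩
  exfalso
  -- A relation with `d ≠ 0` would put the root in `K`; then some `u - e` with `e ∈ K` would have
  -- norm zero, although `u` is not a scalar.
  have hθ' : algebraMap K (orbitField K (pairOf u)) (-(d⁻¹ * c)) = -θ := by
    rw [Algebra.algebraMap_eq_smul_one, neg_smul, ← smul_smul, neg_eq_iff_eq_neg]
    rw [eq_neg_of_add_eq_zero_left h, smul_neg, inv_smul_smul₀ hd]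
  rw [← hθ', Algebra.smul_def, ← map_mul, ← map_mul, ← Algebra.algebraMap_eq_smul_one,
    ← map_sub] at hβ
  have he := (algebraMap K (orbitField K (pairOf u))).injective hβ
  set e := -(d⁻¹ * c)
  have hN : reducedNorm K ((-e) • (1 : D) + (1 : K) • u) = 0 := by
    rw [← Q.torusNorm_eq, torusNorm]
    linear_combination he
  obtain ⟨-, h1⟩ := hc.indep _ _ (Q.nrd_eq_zero.1 hN)
  exact one_ne_zero h1

include hO Q hs hc hfr in
-- The splitting field embeds into `D` with `β ↦ u`, so its integral elements are `O + O β`. An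
-- integral basis has discriminant `P(x)` times the square of an integral determinant, and `1, β`
-- attains `P(x)` itself.
theorem relDiscr_orbitField : (Nat.card (O ⧸ relDiscr O K (orbitField K (pairOf u))) : ℝ) =
    ‖disc K (pairOf u)‖⁻¹ := by
  obtain ⟨β, hβ, hind⟩ := exists_root_orbitField hO Q hs hc hfr
  have hmul := Q.mul_self' (u := u)
  let ψ := quadLift hfr hβ hind hmul
  have hint : ∀ z : orbitField K (pairOf u), IsIntegral O z ↔ ‖reducedNorm K (ψ z)‖ ≤ 1 := fun z => by
    rw [← Q.isIntegral_iff hO]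
    exact (isIntegral_algHom_iff (ψ.restrictScalars O) ψ.toRingHom.injective).symm
  have hdisc : disc K (pairOf u) = Q.tr u ^ 2 - 4 * reducedNorm K u := Q.disc_pairOf u
  have hle : ‖disc K (pairOf u)‖ ≤ 1 := by
    rw [← norm_nrd_conj_sub Q]
    exact Q.nrd_sub_le (hs.norm_le hO Q) (by rw [Q.nrd_conj]; exact hs.norm_le hO Q)
  obtain ⟨d₀, hd₀⟩ := (hO.mem_range _).2 hle
  have hspan : relDiscr O K (orbitField K (pairOf u)) = Ideal.span {d₀} := by
    refine le_antisymm (Ideal.span_le.2 ?_) (Ideal.span_le.2 ?_)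
    · rintro d ⟨B, hB, hd⟩
      rw [SetLike.mem_coe, Ideal.mem_span_singleton, hO.dvd_iff, hd₀, hd]
      have hB' : ∀ i, ∃ x y : K, ‖x‖ ≤ 1 ∧ ‖y‖ ≤ 1 ∧
          (B ∘ (finCongr hfr).symm) i = x • 1 + y • β := fun i => by
        obtain ⟨x, y, h⟩ := exists_eq_smul_add hfr hind ((B ∘ (finCongr hfr).symm) i)
        have h1 := (hint _).1 (hB ((finCongr hfr).symm i))
        change ‖reducedNorm K (ψ ((B ∘ (finCongr hfr).symm) i))‖ ≤ 1 at h1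
        rw [h, show ψ (x • 1 + y • β) = x • 1 + y • u from quadLift_apply hfr hβ hind hmul x y] at h1
        obtain ⟨h2, h3⟩ := hs.coord_le hO Q hc h1
        exact ⟨x, y, h2, h3, h⟩
      choose x y hx hy hxy using hB'
      rw [← Algebra.discr_reindex K B (finCongr hfr), discr_of_coords hfr hβ hind _ x y hxy, ← hdisc,
        norm_mul, norm_pow]
      refine mul_le_of_le_one_left (norm_nonneg _) (pow_le_one₀ (norm_nonneg _) ?_)
      rw [sub_eq_add_neg]
      refine (IsUltrametricDist.norm_add_le_max _ _).trans (max_le ?_ ?_)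
      · rw [norm_mul]; exact mul_le_one₀ (hx 0) (norm_nonneg _) (hy 1)
      · rw [norm_neg, norm_mul]; exact mul_le_one₀ (hx 1) (norm_nonneg _) (hy 0)
    · rw [Set.singleton_subset_iff]
      refine Ideal.subset_span ⟨(quadBasis hfr hind).reindex (finCongr hfr).symm, ?_, ?_⟩
      · have h : ∀ j : Fin 2, IsIntegral O (quadBasis hfr hind j) := by
          intro j
          fin_cases j
          · change IsIntegral O (quadBasis hfr hind 0)
            rw [quadBasis_zero]; exact isIntegral_one
          · change IsIntegral O (quadBasis hfr hind 1)
            have h1 := quadLift_apply hfr hβ hind hmul 0 1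
            rw [zero_smul, one_smul, zero_smul, one_smul, zero_add, zero_add] at h1
            rw [quadBasis_one, hint, show ψ β = u from h1]
            exact hs.norm_le hO Q
        intro i
        rw [Module.Basis.reindex_apply]
        exact h _
      · rw [hd₀, Module.Basis.coe_reindex, Algebra.discr_reindex]
        have h := discr_of_coords hfr hβ hind (quadBasis hfr hind) ![1, 0] ![0, 1] (fun i => by
          fin_cases i
          · change quadBasis hfr hind 0 = (1 : K) • 1 + (0 : K) • β
            rw [quadBasis_zero]; simp
          · change quadBasis hfr hind 1 = (0 : K) • 1 + (1 : K) • β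
            rw [quadBasis_one]; simp)
        rw [h, hdisc]
        simp
  have hd0 : d₀ ≠ 0 := fun h => hs.semistable (by rw [← hd₀, h, map_zero])
  rw [hspan, hO.card_quotient_span hd0, hd₀]

include hO Q hs hc in
-- If no element of `K[u]` had norm of the size of `ϖ`, every integral element would either have a
-- unit norm or be divisible by `ϖ`. Then `ϖ` would generate a prime ideal, contrary to
-- ramification.
theorem isRamifiedGenerator (hr : IsRamifiedQuadratic O K (orbitField K (pairOf u))) :
    IsRamifiedGenerator ϖ u := by
  refine ⟨hc, hs.semistable, hs.norm_le hO Q, fun x y h => hs.coord_le hO Q hc h, ?_⟩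
  by_contra! hno
  have hfr := hr.finrank_eq
  obtain ⟨β, hβ, hind⟩ := exists_root_orbitField hO Q hs hc hfr
  have hmul := Q.mul_self' (u := u)
  let ψ := quadLift hfr hβ hind hmul
  have hint : ∀ z : orbitField K (pairOf u), IsIntegral O z ↔ ‖reducedNorm K (ψ z)‖ ≤ 1 := fun z => by
    rw [← Q.isIntegral_iff hO]
    exact (isIntegral_algHom_iff (ψ.restrictScalars O) ψ.toRingHom.injective).symm
  have hne : ∀ z, ‖reducedNorm K (ψ z)‖ ≠ ‖ϖ‖ := by
    intro z hz
    have hz0 : ψ z ≠ 0 := fun h => by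
      rw [h, Q.nrd_zero, norm_zero] at hz
      exact hO.norm_pos.ne hz
    obtain ⟨h1, h2⟩ := Q.mul_inv_smul_conj hz0
    have hcomm : ψ z * u = u * ψ z := by
      obtain ⟨x, y, rfl⟩ := exists_eq_smul_add hfr hind z
      rw [show ψ (x • 1 + y • β) = x • 1 + y • u from quadLift_apply hfr hβ hind hmul x y]
      simp [add_mul, mul_add]
    obtain ⟨p, hp⟩ := exists_quadUnits hc h1 h2 hcomm
    exact hno p (by rw [hp, hz])
  obtain ⟨p, hp⟩ := hO.exists_prime
  refine hr.ramified ?_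
  rw [hO.maximalIdeal_eq_span hp, Ideal.map_span, Set.image_singleton]
  have hdvd : ∀ z : integralClosure O (orbitField K (pairOf u)),
      algebraMap O (integralClosure O (orbitField K (pairOf u))) p ∣ z ↔
        ‖reducedNorm K (ψ z)‖ ≤ ‖ϖ‖ ^ 2 := by
    have hϖ := hO.ne_zero
    have hpz : ∀ w : orbitField K (pairOf u), algebraMap O (orbitField K (pairOf u)) p * w = ϖ • w := by
      intro w
      rw [IsScalarTower.algebraMap_apply O K (orbitField K (pairOf u)), hp, ← Algebra.smul_def]
    intro z
    constructor
    · rintro ⟨w, rfl⟩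
      change ‖reducedNorm K (ψ (algebraMap O (orbitField K (pairOf u)) p * (w : _)))‖ ≤ _
      rw [hpz, map_smul, Q.nrd_smul, norm_mul, norm_pow]
      exact mul_le_of_le_one_right (by positivity) ((hint _).1 w.2)
    · intro h
      refine ⟨⟨ϖ⁻¹ • (z : orbitField K (pairOf u)), (hint _).2 ?_⟩, Subtype.ext ?_⟩
      · rw [map_smul, Q.nrd_smul, norm_mul, norm_pow, norm_inv, inv_pow,
          inv_mul_le_iff₀ (by have := hO.norm_pos; positivity), mul_one]
        exact h
      · change (z : orbitField K (pairOf u)) = algebraMap O (orbitField K (pairOf u)) p * _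
        rw [hpz, smul_inv_smul₀ hϖ]
  have hsplit : ∀ z : integralClosure O (orbitField K (pairOf u)),
      ‖reducedNorm K (ψ z)‖ ≤ ‖ϖ‖ ^ 2 ∨ ‖reducedNorm K (ψ z)‖ = 1 := by
    intro z
    rcases ((hint _).1 z.2).lt_or_eq with h | h
    · left
      have h1 := lt_of_le_of_ne (hO.norm_le_of_lt_one h) (hne _)
      have h2 : ‖ϖ⁻¹ * reducedNorm K (ψ z)‖ < 1 := by
        rwa [norm_mul, norm_inv, inv_mul_lt_iff₀ hO.norm_pos, mul_one]
      have h3 := hO.norm_le_of_lt_one h2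
      rwa [norm_mul, norm_inv, inv_mul_le_iff₀ hO.norm_pos, ← sq] at h3
    · exact Or.inr h
  have hlt : ‖ϖ‖ ^ 2 < 1 := pow_lt_one₀ (norm_nonneg _) hO.norm_lt_one two_ne_zero
  refine ⟨fun h => ?_, fun {z w} h => ?_⟩
  · have h1 := (hdvd 1).1 (Ideal.mem_span_singleton.1 (h ▸ Submodule.mem_top))
    rw [OneMemClass.coe_one, map_one, NormConj.nrd_one, norm_one] at h1
    exact absurd h1 (not_le.2 hlt)
  · rw [Ideal.mem_span_singleton, hdvd] at h
    rw [Ideal.mem_span_singleton, Ideal.mem_span_singleton, hdvd, hdvd]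
    rcases hsplit z with hz | hz
    · exact Or.inl hz
    rcases hsplit w with hw | hw
    · exact Or.inr hw
    rw [MulMemClass.coe_mul, map_mul, Q.nrd_mul, norm_mul, hz, hw, mul_one] at h
    exact absurd h (not_le.2 hlt)

end Standard

end PairQuat

namespace PairQuat

/-! ### The local density -/

/-- A central element commutes with `1 ⊗ B`, whose centralizer is `K` tensored with the centre of
`B`, that is, `K` itself. -/
theorem isCentral_baseChange (k K B : Type*) [Field k] [Field K] [Algebra k K] [Ring B]
    [Algebra k B] [Algebra.IsCentral k B] : Algebra.IsCentral K (K ⊗[k] B) := by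
  refine ⟨fun x hx => ?_⟩
  have h : x ∈ Subalgebra.centralizer k
      (Algebra.TensorProduct.includeRight : B →ₐ[k] K ⊗[k] B).range := by
    rw [Subalgebra.mem_centralizer_iff]
    exact fun b _ => Subalgebra.mem_center_iff.1 hx b
  rw [Subalgebra.centralizer_range_includeRight_eq_center_tensorProduct] at h
  obtain ⟨y, rfl⟩ := h
  clear hx
  induction y with
  | zero => rw [map_zero]; exact zero_mem _
  | tmul c b =>
    obtain ⟨r, hr⟩ := (Algebra.IsCentral.mem_center_iff k).1 b.2
    refine Algebra.mem_bot.2 ⟨r • c, ?_⟩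
    change (r • c) ⊗ₜ[k] (1 : B) = c ⊗ₜ[k] (b : B)
    rw [hr, Algebra.algebraMap_eq_smul_one, TensorProduct.smul_tmul]
  | add y z hy hz => rw [map_add]; exact add_mem hy hz

/-! ### The formula over a local field -/

section Density

set_option linter.unusedSectionVars false

variable {O K D : Type*} [CommRing O] [IsDomain O] [IsDiscreteValuationRing O]
  [NontriviallyNormedField K] [IsUltrametricDist K] [ProperSpace K] [CharZero K] [Algebra O K]
  [Ring D] [Algebra K D] [Algebra.IsCentral K D] [TopologicalSpace D] [IsModuleTopology K D]
  [Algebra O D] [IsScalarTower O K D]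

theorem NormConj.isSelfCentralizing [Nontrivial D] [NoZeroDivisors D] (Q : NormConj K D)
    (hfin : Module.finrank K D = 4) {u : D} (hu : disc K (pairOf u) ≠ 0) :
    IsSelfCentralizing K u := by
  have hr := Q.notMem_range_of_disc_ne_zero hu
  obtain ⟨τ, hτ, hτu⟩ := exists_conj_intertwiner hr (Q.mul_self u)
  exact ⟨fun c d => smul_one_add_smul_eq_zero hr, fun d => exists_centralizer hfin hr hτ hτu⟩

/-- The abstract local computation gives the density in terms of `|P(x)|`; the relative discriminant
enters only through the order of its quotient, which is `|P(x)|⁻¹`. -/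
theorem localDensity_eq {ϖ : K} {q : ℕ} (hO : IsNormalizedLocal O K ϖ q)
    (hfin : Module.finrank K D = 4) (hdiv : ∀ a : D, a ≠ 0 → IsUnit a) {u : D}
    (hs : IsStandard O K u) (hr : IsRamifiedQuadratic O K (orbitField K (pairOf u))) :
    (∃! b : ℝ, IsOrbitConstant O K u b) ∧ localDensity O K u =
      2⁻¹ * (Nat.card (O ⧸ relDiscr O K (orbitField K (pairOf u))) : ℝ)⁻¹ *
        (1 + (q : ℝ)⁻¹) * (1 - ((q : ℝ) ^ 2)⁻¹) ^ 2 := by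
  have : FiniteDimensional K D := Module.finite_of_finrank_pos (by omega)
  have : Nontrivial D := Module.nontrivial_of_finrank_pos (R := K) (by omega)
  have := noZeroDivisors_of_isUnit hdiv
  have : IsTopologicalRing D := IsModuleTopology.isTopologicalRing K D
  have : ContinuousSMul K D := IsModuleTopology.toContinuousSMul K D
  have := polishSpace_of_isModuleTopology K D
  have := locallyCompactSpace_of_isModuleTopology K D
  obtain ⟨Q⟩ := nonempty_normConj hfin hdiv
  have hc := Q.isSelfCentralizing hfin hs.semistable
  obtain ⟨h1, h2⟩ := existsUnique_isOrbitConstant hO Q (isRamifiedGenerator hO Q hs hc hr) hfin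
  refine ⟨h1, ?_⟩
  rw [h2, relDiscr_orbitField hO Q hs hc hr.finrank_eq, inv_inv, hO.norm_eq, inv_pow]

end Density

end PairQuat

end

theorem mainTheorem6 (k : Type*) [Field k] [NumberField k]
    (B : Type*) [Ring B] [Algebra k B] [Algebra.IsCentral k B] [IsSimpleRing B]
    (hB : Module.finrank k B = 4)
    (v : HeightOneSpectrum (𝓞 k))
    [TopologicalSpace (v.adicCompletion k ⊗[k] B)]
    [IsModuleTopology (v.adicCompletion k) (v.adicCompletion k ⊗[k] B)]
    (hdiv : ∀ a : v.adicCompletion k ⊗[k] B, a ≠ 0 → IsUnit a)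
    (u : v.adicCompletion k ⊗[k] B)
    (hu : PairQuat.IsStandard (v.adicCompletionIntegers k) (v.adicCompletion k) u)
    (hram : PairQuat.IsRamifiedQuadratic (v.adicCompletionIntegers k) (v.adicCompletion k)
      (PairQuat.orbitField (v.adicCompletion k) (PairQuat.pairOf u)))
    (q : ℝ) (hq : q = Nat.card (IsLocalRing.ResidueField (v.adicCompletionIntegers k))) :
    (∃! b : ℝ, PairQuat.IsOrbitConstant (v.adicCompletionIntegers k) (v.adicCompletion k) u b) ∧
    PairQuat.localDensity (v.adicCompletionIntegers k) (v.adicCompletion k) u =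
      2⁻¹ * (Nat.card (v.adicCompletionIntegers k ⧸
          PairQuat.relDiscr (v.adicCompletionIntegers k) (v.adicCompletion k)
            (PairQuat.orbitField (v.adicCompletion k) (PairQuat.pairOf u))) : ℝ)⁻¹ *
        (1 + q⁻¹) * (1 - (q ^ 2)⁻¹) ^ 2 := by
  subst hq
  obtain ⟨ϖ, hO⟩ := PairQuat.exists_isNormalizedLocal k v
  -- The normed structure of the completion is kept and only nontriviality is added, with `ϖ⁻¹` as
  -- the element of norm `q > 1`.
  let : NontriviallyNormedField (v.adicCompletion k) :=
    { (inferInstance : NormedField (v.adicCompletion k)) with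
      non_trivial := ⟨ϖ⁻¹, by
        rw [norm_inv, hO.norm_eq, inv_inv]; exact_mod_cast hO.one_lt⟩ }
  have := PairQuat.isCentral_baseChange k (v.adicCompletion k) B
  exact PairQuat.localDensity_eq hO (by rw [Module.finrank_baseChange, hB]) hdiv hu hram
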